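/- All graphs are finite, simple and undirected. Let $G$ be a graph. An assignment $L$ gives each vertex $v$ a finite set $L(v)$ of colours; it is a $k$-assignment if $|L(v)|=k$ for all $v$. A cover of $G$ (with respect to $L$) is a graph $H$ with vertex set $\{(v,c): v\in V(G),\ c\in L(v)\}$ such that each $\{v\}\times L(v)$ induces a complete graph, the edges of $H$ between $\{u\}\times L(u)$ and $\{v\}\times L(v)$ form a (possibly empty) matching if $uv\in E(G)$, and there are no such edges if $u\ne v$ and $uv\notin E(G)$. A representative set is a set $R\subseteq V(H)$ that contains exactly one element of each $\{v\}\times L(v)$. The graph $G$ is DP-$k$-colorable (respectively DP-vertex-$k$-arborable) if for every $k$-assignment $L$ and every cover $H$ there is a representative set $R$ such that $H[R]$ has no edges (respectively is a forest). For $s\ge 0$, an assignment $L$ with lists $L(v)\subseteq\{1,\dots,s\}$ and functions $f_1,\dots,f_s:V(G)\to\mathbb{Z}_{\ge 0}$ with $f_i(v)=0$ whenever $i\notin L(v)$, a DP-$F$-coloring of $(G,H)$, where $F=(f_1,\dots,f_s)$, is a representative set $R$ that can be linearly ordered so that each $(v,i)\in R$ has fewer than $f_i(v)$ $H$-neighbours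 of lower order in $R$. Write $|f(v)|=f_1(v)+\cdots+f_s(v)$. The graph $G$ is DPG-$[k,t]$-colorable if $(G,H)$ has a DP-$F$-coloring for all such $s$, $L$, all covers $H$ and all such $F$ with $|f(v)|\ge k$ and $f_i(v)\le t$ for all $v$ and $i$. An $L$-forested-coloring of $G$ is a choice of a colour $c(v)\in L(v)$ for each vertex $v$ such that each colour class $C(i)=\{v: c(v)=i\}$ induces a forest. The graph $G$ is $(f_1,\dots,f_s)$-partitionable if $V(G)$ can be partitioned into (possibly empty) sets $V_1,\dots,V_s$ such that for every $i$ each nonempty subgraph $G'$ of $G[V_i]$ has a vertex $v$ with $d_{G'}(v)<f_i(v)$. **Theorem.** Let $a$ and $b$ be distinct elements of $\{6,7,8\}$ and let $G$ be a planar graph without cycles of length $4$, $a$, $b$ or $9$. Then $G$ is DPG-$[3,2]$-colorable. Moreover: (1) $G$ is DP-$3$-colorable. (2) $G$ is DP-vertex-$2$-arborable. (3) If $L$ is a $2$-assignment of $G$ and $i$ is a colour, then $G$ has an $L$-forested-coloring in which $C(i)$ is an independent set. (4) If $f_1,\dots,f_s:V(G)\to\{0,1,2\}$ satisfy $|f(v)|\ge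 3$ for every vertex $v$, then $G$ is $(f_1,\dots,f_s)$-partitionable. -/

import Mathlib

universe u w

namespace DPG

/-! ### Planar graphs, through combinatorial embeddings -/

/-- A rotation system of `G` (a combinatorial embedding of `G` in closed orientable surfaces, one
for each connected component): a permutation `rot` of the darts (oriented edges) of `G` that maps
each dart to a dart with the same initial vertex and permutes the darts leaving any one vertex
cyclically. It records the cyclic order of the edges around each vertex. -/
structure RotationSystem {V : Type u} (G : SimpleGraph V) where
  rot : Equiv.Perm G.Dart
  fst_rot : ∀ d : G.Dart, (rot d).fst = d.fst
  cyclic : ∀ d e : G.Dart, d.fst = e.fst → rot.SameCycle d e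

/-- Reversal of darts, as a permutation. -/
def dartRev {V : Type u} (G : SimpleGraph V) : Equiv.Perm G.Dart where
  toFun := SimpleGraph.Dart.symm
  invFun := SimpleGraph.Dart.symm
  left_inv := SimpleGraph.Dart.symm_symm
  right_inv := SimpleGraph.Dart.symm_symm

namespace RotationSystem

variable {V : Type u} {G : SimpleGraph V}

/-- The face permutation: traverse a dart, then turn to the next dart at its terminal vertex. -/
def facePerm (E : RotationSystem G) : Equiv.Perm G.Dart :=
  E.rot * dartRev G

/-- The facial walks: the orbits of the face permutation. -/
def Face (E : RotationSystem G) : Type u :=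
  Quotient (Equiv.Perm.SameCycle.setoid E.facePerm)

/-- The number of faces, summed over the surfaces that carry the components. An isolated vertex has
no darts; the sphere that carries it has exactly one face. -/
noncomputable def numFaces (E : RotationSystem G) : ℕ :=
  Nat.card E.Face + Nat.card {v : V // ∀ w, ¬ G.Adj v w}

/-- Euler's formula `|V| - |E| + |F| = 2 c`, where `c` is the number of connected components:
every component is embedded in a sphere. -/
def IsPlane (E : RotationSystem G) : Prop :=
  Nat.card V + E.numFaces = Nat.card G.edgeSet + 2 * Nat.card G.ConnectedComponent

end RotationSystem

/-- A finite graph is planar if it has a combinatorial embedding of genus zero. -/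
def IsPlanar {V : Type u} (G : SimpleGraph V) : Prop :=
  ∃ E : RotationSystem G, E.IsPlane

/-- `G` has no cycle of length `n`. -/
def NoCycleOfLength {V : Type u} (G : SimpleGraph V) (n : ℕ) : Prop :=
  ∀ (v : V) (p : G.Walk v v), p.IsCycle → p.length ≠ n

/-! ### Covers and DP-colorings -/

/-- The pairs `(v, c)` with `v` a vertex and `c` a color in the list of `v`. -/
abbrev ListPair {V : Type u} {C : Type w} (L : V → Finset C) : Type (max u w) :=
  (v : V) × {c : C // c ∈ L v}

/-- A cover of `G` with respect to the list assignment `L`. -/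
structure Cover {V : Type u} (G : SimpleGraph V) {C : Type w} (L : V → Finset C) where
  graph : SimpleGraph (ListPair L)
  complete : ∀ (u : V) (c d : {c : C // c ∈ L u}), c ≠ d → graph.Adj ⟨u, c⟩ ⟨u, d⟩
  -- Used for `u, v` and for `v, u`, this says that the edges between the two lists are a matching.
  matching : ∀ u v : V, G.Adj u v →
    ∀ (c : {c : C // c ∈ L u}) (d d' : {c : C // c ∈ L v}),
      graph.Adj ⟨u, c⟩ ⟨v, d⟩ → graph.Adj ⟨u, c⟩ ⟨v, d'⟩ → d = d'
  not_adj : ∀ u v : V, u ≠ v → ¬ G.Adj u v →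
    ∀ (c : {c : C // c ∈ L u}) (d : {c : C // c ∈ L v}), ¬ graph.Adj ⟨u, c⟩ ⟨v, d⟩

namespace Cover

variable {V : Type u} {G : SimpleGraph V} {C : Type w} {L : V → Finset C}

/-- A representative set contains exactly one pair `(v, c)` for every vertex `v`. -/
def IsRepresentative (_H : Cover G L) (R : Set (ListPair L)) : Prop :=
  ∀ v : V, ∃! c : {c : C // c ∈ L v}, (⟨v, c⟩ : ListPair L) ∈ R

/-- A DP-coloring: a representative set that induces no edges. -/
def IsDPColoring (H : Cover G L) (R : Set (ListPair L)) : Prop :=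
  H.IsRepresentative R ∧ ∀ x ∈ R, ∀ y ∈ R, ¬ H.graph.Adj x y

/-- A DP-forested-coloring: a representative set that induces a forest. -/
def IsDPForestedColoring (H : Cover G L) (R : Set (ListPair L)) : Prop :=
  H.IsRepresentative R ∧ (H.graph.induce R).IsAcyclic

/-- A DP-`F`-coloring: a representative set with a linear order (given by injective ranks) in which
each `(v, i)` has fewer than `f i v` neighbors of lower order. -/
def IsDPFColoring (H : Cover G L) (f : C → V → ℕ) (R : Set (ListPair L)) : Prop :=
  H.IsRepresentative R ∧
    ∃ rank : ListPair L → ℕ, Set.InjOn rank R ∧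
      ∀ x ∈ R, {y ∈ R | H.graph.Adj x y ∧ rank y < rank x}.ncard < f x.2 x.1

end Cover

/-- `G` is DP-`k`-colorable. -/
def DPColorable {V : Type u} (G : SimpleGraph V) (k : ℕ) : Prop :=
  ∀ (C : Type w) (L : V → Finset C), (∀ v, (L v).card = k) →
    ∀ H : Cover G L, ∃ R, H.IsDPColoring R

/-- `G` is DP-vertex-`k`-arborable. -/
def DPVertexArborable {V : Type u} (G : SimpleGraph V) (k : ℕ) : Prop :=
  ∀ (C : Type w) (L : V → Finset C), (∀ v, (L v).card = k) →
    ∀ H : Cover G L, ∃ R, H.IsDPForestedColoring R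

/-- `G` is DPG-`[k,t]`-colorable. The lists are arbitrary subsets of the `s` colors; a color that
is not in the list of `v` has value `0` at `v`, so that it does not contribute to
`|f(v)| = f₁(v) + ⋯ + fₛ(v)`. -/
def DPGColorable {V : Type u} (G : SimpleGraph V) (k t : ℕ) : Prop :=
  ∀ (s : ℕ) (L : V → Finset (Fin s)) (H : Cover G L) (f : Fin s → V → ℕ),
    (∀ v i, i ∉ L v → f i v = 0) →
    (∀ v, k ≤ ∑ i, f i v) →
    (∀ v i, f i v ≤ t) →
    ∃ R, H.IsDPFColoring f R

/-! ### List-forested colorings and variable degeneracy -/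

/-- `c` is an `L`-forested-coloring of `G`. -/
def IsForestedColoring {V : Type u} (G : SimpleGraph V) {C : Type w} (L : V → Finset C)
    (c : V → C) : Prop :=
  (∀ v, c v ∈ L v) ∧ ∀ i : C, (G.induce {v | c v = i}).IsAcyclic

/-- `G` is strictly `f`-degenerate: every nonempty subgraph `G'` has a vertex `v` whose degree in
`G'` is less than `f v`. -/
def StrictlyDegenerate {V : Type u} (G : SimpleGraph V) (f : V → ℕ) : Prop :=
  ∀ G' : G.Subgraph, G'.verts.Nonempty → ∃ v ∈ G'.verts, (G'.neighborSet v).ncard < f v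

/-- `G` is `(f₁, …, fₛ)`-partitionable (parts of the partition may be empty). -/
def Partitionable {V : Type u} (G : SimpleGraph V) {s : ℕ} (f : Fin s → V → ℕ) : Prop :=
  ∃ P : Fin s → Set V, (∀ v, ∃! i, v ∈ P i) ∧
    ∀ i, StrictlyDegenerate (G.induce (P i)) (fun v => f i v)

end DPG

/-! All five conclusions are special cases of one statement, `AllColorable`. An instance `Inst`
gives each vertex a capacity at most 2 for every colour, with total at least 3, and a matching of
conflicts between the colours of adjacent vertices. Wanted are a colour for each vertex and an order
of the vertices in which every vertex has fewer earlier conflicting neighbours than the capacity of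
its colour. Three colours of capacity 1 give DP-3-colourings. Two colours of capacity 2 give
forests, because a graph in which every vertex has at most one earlier neighbour is acyclic. The
other conclusions come from other choices of conflicts and capacities.

The statement is strengthened for induction: a precoloured vertex or edge `C` extends to the whole
graph. In a smallest counterexample (`Critical`) the vertices outside `C` have degree at least 3,
neither a vertex nor the ends of an edge separate the graph (colourings can be glued there), and
there is no reducible set. A set `S` is reducible (`exists_good_of_reducible`) if it has adjacent
vertices `p` and `q`, all neighbours of `p` lie in `S`, `q` has degree at most 3 and a neighbour
outside, and the rest of `S` can be coloured greedily after `p` and before `q`. The freedom at `p`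
is used to save one unit at `q`. Two reducible configurations suffice: two adjacent faces with all
vertices of degree 3 (`not_allLight`), and a variant that allows two vertices of degree 4
(`not_exists_outside`).

Planarity enters through permutations of darts. `defect` is twice the genus; it is nonnegative and
does not increase when edges are deleted, since multiplying a permutation by a transposition splits
or merges cycles in a controlled way. Hence the class is hereditary. Splitting vertices shows in the
same way that in a critical graph every face is bounded by a cycle (`face_simple`), and that two
distinct faces cannot share certain pairs of vertices (`not_two_faces`). With the excluded cycle
lengths this restricts which short faces can share an edge: next to a triangle that avoids `C` there
are only pentagons and faces of length at least 10, a pentagon has at most one triangle next to it,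
and so on.

The contradiction comes from discharging. Give a vertex `2 * deg - 6` and a face `len - 6`; by
Euler's formula the total is at most -12. Only triangles and pentagons have negative charge among
faces, and among the vertices outside `C` none has. Heavy vertices (degree at least 4, outside `C`)
make gifts to adjacent triangles and pentagons. Faces of length at least 10 pay to triangles and to
pentagons next to triangles, in halves or quarters at light vertices; faces of length at least 7 pay
thirds or quarters to the remaining pentagons. A face of length 10 that pays at every vertex may
overspend; such a poor face is refunded in fifths by long neighbours (`sum_loss_poor`), and the
second reducible configuration ensures that the neighbours can afford it. The vertices of `C`
overspend by at most 11 altogether (`sum_gift_total`), while no face ends below zero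
(`sum_loss_le`). Thus the total would be at least -11 and at most -12. -/

namespace DPG

open Equiv Equiv.Perm

/-! ### Counting cycles of permutations -/

section Count

variable {D : Type u}

/-- The number of classes of an equivalence relation. -/
noncomputable def numClasses (r : Setoid D) : ℕ := Nat.card (Quotient r)

/-- The equivalence relation obtained by merging the classes of `x` and `y`. -/
def addLink (r : Setoid D) (x y : D) : Setoid D where
  r a b := r a b ∨ (r a x ∧ r y b) ∨ (r a y ∧ r x b)
  iseqv := by
    refine ⟨fun a => Or.inl (r.refl a), ?_, ?_⟩
    · rintro a b (h | ⟨h, h'⟩ | ⟨h, h'⟩)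
      · exact Or.inl (r.symm h)
      · exact Or.inr (Or.inr ⟨r.symm h', r.symm h⟩)
      · exact Or.inr (Or.inl ⟨r.symm h', r.symm h⟩)
    · rintro a b c (h | ⟨h, h'⟩ | ⟨h, h'⟩) (k | ⟨k, k'⟩ | ⟨k, k'⟩)
      · exact Or.inl (r.trans h k)
      · exact Or.inr (Or.inl ⟨r.trans h k, k'⟩)
      · exact Or.inr (Or.inr ⟨r.trans h k, k'⟩)
      · exact Or.inr (Or.inl ⟨h, r.trans h' k⟩)
      · exact Or.inr (Or.inl ⟨h, k'⟩)
      · exact Or.inl (r.trans h k')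
      · exact Or.inr (Or.inr ⟨h, r.trans h' k⟩)
      · exact Or.inl (r.trans h k')
      · exact Or.inr (Or.inr ⟨h, k'⟩)

theorem le_addLink (r : Setoid D) (x y : D) : r ≤ addLink r x y := fun _ _ h => Or.inl h

theorem addLink_rel (r : Setoid D) (x y : D) : addLink r x y x y :=
  Or.inr (Or.inl ⟨r.refl x, r.refl y⟩)

theorem addLink_le {r s : Setoid D} {x y : D} (h : r ≤ s) (hxy : s x y) : addLink r x y ≤ s := by
  rintro a b (k | ⟨k, k'⟩ | ⟨k, k'⟩)
  · exact h k
  · exact s.trans (h k) (s.trans hxy (h k'))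
  · exact s.trans (h k) (s.trans (s.symm hxy) (h k'))

theorem addLink_eq_self {r : Setoid D} {x y : D} (h : r x y) : addLink r x y = r :=
  le_antisymm (addLink_le le_rfl h) (le_addLink r x y)

/-- Every merged class contains exactly one old class different from that of `x`: the class of `y`
represents the merged one, and all other classes are unchanged. -/
theorem numClasses_addLink [Finite D] {r : Setoid D} {x y : D} (h : ¬ r x y) :
    numClasses r = numClasses (addLink r x y) + 1 := by
  classical
  let g : Quotient r → Quotient (addLink r x y) :=
    Quotient.map' id (fun a b hab => Or.inl hab)
  have hb : Function.Bijective (fun q : {q : Quotient r // q ≠ ⟦x⟧} => g q.1) := by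
    constructor
    · rintro ⟨p, hp⟩ ⟨q, hq⟩ hpq
      induction p using Quotient.inductionOn with | h a => ?_
      induction q using Quotient.inductionOn with | h b => ?_
      have hpq' : addLink r x y a b := Quotient.exact hpq
      have ha : ¬ r a x := fun h => hp (Quotient.sound h)
      have hb : ¬ r b x := fun h => hq (Quotient.sound h)
      refine Subtype.ext (Quotient.sound ?_)
      rcases hpq' with k | ⟨k, -⟩ | ⟨-, k⟩
      · exact k
      · exact absurd k ha
      · exact absurd (r.symm k) hb
    · intro q
      induction q using Quotient.inductionOn with | h a => ?_
      by_cases ha : r a x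
      · refine ⟨⟨⟦y⟧, fun h' => h (r.symm (Quotient.exact h'))⟩, Quotient.sound ?_⟩
        exact Or.inr (Or.inr ⟨r.refl y, r.symm ha⟩)
      · exact ⟨⟨⟦a⟧, fun h' => ha (Quotient.exact h')⟩, rfl⟩
  have h1 := Nat.card_congr (Equiv.ofBijective _ hb)
  unfold numClasses
  rw [← h1]
  have := Nat.card_congr (Equiv.optionSubtypeNe (⟦x⟧ : Quotient r)).symm
  rw [this, Finite.card_option]

theorem numClasses_mono [Finite D] {r s : Setoid D} (h : r ≤ s) : numClasses s ≤ numClasses r :=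
  Nat.card_le_card_of_surjective (Quotient.map' id (fun _ _ hab => h hab)) (by
    intro q
    induction q using Quotient.inductionOn with | h a => exact ⟨⟦a⟧, rfl⟩)

theorem numClasses_pos [Finite D] [h : Nonempty D] (r : Setoid D) : 0 < numClasses r := by
  have : Nonempty (Quotient r) := h.map (Quotient.mk r)
  exact Nat.card_pos

theorem numClasses_le_addLink [Finite D] (r : Setoid D) (x y : D) :
    numClasses r ≤ numClasses (addLink r x y) + 1 := by
  by_cases h : r x y
  · rw [addLink_eq_self h]; omega
  · exact (numClasses_addLink h).le

/-- The relation of lying on the same cycle. -/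
abbrev cyc (π : Perm D) : Setoid D := SameCycle.setoid π

/-- An equivalence relation that is closed under a single step of the permutation contains all its
cycles. Most comparisons of cycles below are made this way. -/
theorem cyc_le {π : Perm D} {s : Setoid D} (h : ∀ a, s a (π a)) : cyc π ≤ s := by
  rintro a b ⟨n, rfl⟩
  have hz : ∀ n : ℤ, s a ((π ^ n) a) := by
    intro n
    induction n using Int.induction_on with
    | zero => exact s.refl a
    | succ n ih =>
      have : (π ^ ((n : ℤ) + 1)) a = π ((π ^ (n : ℤ)) a) := by
        rw [add_comm, zpow_add, zpow_one, Perm.mul_apply]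
      rw [this]; exact s.trans ih (h _)
    | pred n ih =>
      have : (π ^ (-(n : ℤ))) a = π ((π ^ (-(n : ℤ) - 1)) a) := by
        rw [← Perm.mul_apply, ← zpow_one_add]; congr 2; ring
      rw [this] at ih
      exact s.trans ih (s.symm (h _))
  exact hz n

theorem cyc_apply (π : Perm D) (a : D) : cyc π a (π a) := SameCycle.refl π a |>.apply_right

/-- The number of cycles, fixed points included. -/
noncomputable def numCycles (π : Perm D) : ℕ := numClasses (cyc π)

/-- The number of orbits of the group generated by two permutations. -/
noncomputable def numOrbits (σ α : Perm D) : ℕ := numClasses (cyc σ ⊔ cyc α)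

/-- The defect in Euler's formula for the map with vertex permutation `σ`, edge permutation `α`
and face permutation `σ * α`; for a map with all edges of two darts it is twice the genus. -/
noncomputable def defect (σ α : Perm D) : ℤ :=
  Nat.card D + 2 * numOrbits σ α - numCycles σ - numCycles α - numCycles (σ * α)

theorem addLink_mono {r s : Setoid D} (h : r ≤ s) (x y : D) : addLink r x y ≤ addLink s x y :=
  addLink_le (h.trans (le_addLink _ _ _)) (addLink_rel _ _ _)

theorem mul_le_sup (σ α : Perm D) (a : D) : (cyc σ ⊔ cyc α) a ((σ * α) a) := by
  have h1 : (cyc σ ⊔ cyc α) a (α a) := (le_sup_right : cyc α ≤ _) (cyc_apply α a)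
  have h2 : (cyc σ ⊔ cyc α) (α a) (σ (α a)) := (le_sup_left : cyc σ ≤ _) (cyc_apply σ _)
  exact Setoid.trans' _ h1 h2

theorem cyc_mul_le_sup (σ α : Perm D) : cyc (σ * α) ≤ cyc σ ⊔ cyc α := cyc_le (mul_le_sup σ α)

theorem cyc_one : cyc (1 : Perm D) = ⊥ :=
  le_antisymm (cyc_le fun a => Setoid.refl' _ a) bot_le

theorem numClasses_bot : numClasses (⊥ : Setoid D) = Nat.card D :=
  Nat.card_congr (Equiv.ofBijective (Quotient.mk _)
    ⟨fun _ _ h => Quotient.exact h, Quotient.mk_surjective⟩).symm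

end Count

/-! ### Multiplication by a transposition, and the genus inequality. -/

section Swap

variable {D : Type u} [DecidableEq D]

theorem cyc_swap_mul_le (π : Perm D) (x y : D) : cyc (swap x y * π) ≤ addLink (cyc π) x y := by
  refine cyc_le fun a => ?_
  rw [Perm.mul_apply]
  by_cases hx : π a = x
  · rw [hx, swap_apply_left]
    exact Or.inr (Or.inl ⟨hx ▸ cyc_apply π a, (cyc π).refl y⟩)
  by_cases hy : π a = y
  · rw [hy, swap_apply_right]
    exact Or.inr (Or.inr ⟨hy ▸ cyc_apply π a, (cyc π).refl x⟩)
  rw [swap_apply_of_ne_of_ne hx hy]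
  exact Or.inl (cyc_apply π a)

/-- The two permutations differ only in jumps between `x` and `y`, so their cycles agree once these
two points are linked. It follows that a transposition can only split one cycle or merge two. -/
theorem addLink_cyc_swap_mul (π : Perm D) (x y : D) :
    addLink (cyc (swap x y * π)) x y = addLink (cyc π) x y := by
  refine le_antisymm (addLink_le (cyc_swap_mul_le π x y) (addLink_rel _ x y))
    (addLink_le ?_ (addLink_rel _ x y))
  have := cyc_swap_mul_le (swap x y * π) x y
  rwa [← mul_assoc, swap_mul_self, one_mul] at this

theorem cyc_le_addLink_swap_mul_apply (α : Perm D) (x : D) :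
    cyc α ≤ addLink (cyc (swap x (α x) * α)) x (α x) := by
  rw [addLink_cyc_swap_mul]; exact le_addLink _ _ _

/-- The new orbit of `x` is confined to the old arc from `x` up to just before `y`: where it would
step to `y`, the transposition returns it to `x`. -/
theorem not_sameCycle_swap_mul [Finite D] {π : Perm D} {x y : D} (hxy : x ≠ y)
    (h : SameCycle π x y) : ¬ SameCycle (swap x y * π) x y := by
  classical
  have hex : ∃ k : ℕ, (π ^ k) x = y := h.exists_nat_pow_eq
  set k := Nat.find hex with hk
  have hky : (π ^ k) x = y := Nat.find_spec hex
  have hmin : ∀ j < k, (π ^ j) x ≠ y := fun j hj => Nat.find_min hex hj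
  have hk0 : 0 < k := by
    rcases Nat.eq_zero_or_pos k with h0 | h0
    · rw [h0] at hky; exact absurd hky hxy
    · exact h0
  have hnx : ∀ j, 0 < j → j < k → (π ^ j) x ≠ x := by
    intro j hj hjk hx
    apply hmin (k - j) (by omega)
    rw [← hky]
    conv_rhs => rw [show k = (k - j) + j by omega, pow_add, Perm.mul_apply, hx]
  have hinv : ∀ n : ℕ, ∃ i < k, ((swap x y * π) ^ n) x = (π ^ i) x := by
    intro n
    induction n with
    | zero => exact ⟨0, hk0, by simp⟩
    | succ n ih =>
      obtain ⟨i, hi, h⟩ := ih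
      rw [pow_succ', Perm.mul_apply, h, Perm.mul_apply, ← Perm.mul_apply π, ← pow_succ']
      rcases Nat.lt_or_ge (i + 1) k with h' | h'
      · exact ⟨i + 1, h', swap_apply_of_ne_of_ne (hnx _ (by omega) h') (hmin _ h')⟩
      · have : i + 1 = k := by omega
        exact ⟨0, hk0, by rw [this, hky, swap_apply_right]; simp⟩
  intro hc
  obtain ⟨n, hn⟩ := hc.exists_nat_pow_eq
  obtain ⟨i, hi, h⟩ := hinv n
  exact hmin i hi (h.symm.trans hn)

/-- Follow the old cycle of `y`, which misses `x`. The transposition acts only at the return to `y`,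
and there it diverts the orbit to `x`. -/
theorem sameCycle_swap_mul [Finite D] {π : Perm D} {x y : D}
    (h : ¬ SameCycle π x y) : SameCycle (swap x y * π) x y := by
  classical
  have hex : ∃ k : ℕ, 0 < k ∧ (π ^ k) y = y := by
    obtain ⟨n, hn, h⟩ := isOfFinOrder_iff_pow_eq_one.1 (isOfFinOrder_of_finite π)
    exact ⟨n, hn, by rw [h]; rfl⟩
  set k := Nat.find hex with hk
  obtain ⟨hk0, hky⟩ := Nat.find_spec hex
  have hmin : ∀ j, 0 < j → j < k → (π ^ j) y ≠ y := fun j h0 hj h => Nat.find_min hex hj ⟨h0, h⟩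
  have hx : ∀ j : ℕ, (π ^ j) y ≠ x := fun j hj => h (SameCycle.symm ⟨j, by simpa using hj⟩)
  have hp : ∀ j < k, ((swap x y * π) ^ j) y = (π ^ j) y := by
    intro j
    induction j with
    | zero => intro _; rfl
    | succ j ih =>
      intro hj
      rw [pow_succ', Perm.mul_apply, ih (by omega), Perm.mul_apply, ← Perm.mul_apply π,
        ← pow_succ']
      exact swap_apply_of_ne_of_ne (hx _) (hmin _ (by omega) hj)
  refine SameCycle.symm ⟨k, ?_⟩
  rw [zpow_natCast]
  obtain ⟨j, hj⟩ : ∃ j, k = j + 1 := ⟨k - 1, by omega⟩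
  rw [hj, pow_succ', Perm.mul_apply, hp j (by omega), Perm.mul_apply, ← Perm.mul_apply π,
    ← pow_succ', ← hj, hky, swap_apply_right]

variable [Finite D]

theorem numCycles_swap_mul_of_sameCycle {π : Perm D} {x y : D} (hxy : x ≠ y)
    (h : SameCycle π x y) : numCycles (swap x y * π) = numCycles π + 1 := by
  unfold numCycles
  rw [numClasses_addLink (r := cyc (swap x y * π)) (not_sameCycle_swap_mul hxy h),
    addLink_cyc_swap_mul, addLink_eq_self h]

theorem numCycles_swap_mul_of_not_sameCycle {π : Perm D} {x y : D}
    (h : ¬ SameCycle π x y) : numCycles π = numCycles (swap x y * π) + 1 := by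
  unfold numCycles
  rw [numClasses_addLink (r := cyc π) h, ← addLink_cyc_swap_mul,
    addLink_eq_self (sameCycle_swap_mul h)]

/-- Cutting a dart out of a cycle of the edge permutation does not increase the defect. -/
theorem defect_swap_mul_right_le (σ α : Perm D) {x : D} (hx : α x ≠ x) :
    defect σ (swap x (α x) * α) ≤ defect σ α := by
  set α' := swap x (α x) * α with hα'
  have h1 : numCycles α' = numCycles α + 1 :=
    numCycles_swap_mul_of_sameCycle hx.symm (cyc_apply α x)
  have hmul : σ * α' = swap (σ x) (σ (α x)) * (σ * α) := by
    rw [hα', ← mul_assoc, Equiv.mul_swap_eq_swap_mul, mul_assoc]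
  have hne : σ x ≠ σ (α x) := fun h => hx (σ.injective h).symm
  have hc : numOrbits σ α' ≤ numOrbits σ α + 1 := by
    refine (numClasses_le_addLink _ x (α x)).trans (Nat.add_le_add_right (numClasses_mono ?_) 1)
    refine sup_le (le_sup_left.trans (le_addLink _ _ _)) ?_
    exact (cyc_le_addLink_swap_mul_apply α x).trans (addLink_mono le_sup_right _ _)
  unfold defect
  -- The edge permutation gains one cycle. If the face splits as well, these two units pay for an
  -- additional orbit. If two faces merge, the counts balance, and it must be shown that no orbit is
  -- lost.
  by_cases hs : SameCycle (σ * α) (σ x) (σ (α x))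
  · have h2 := numCycles_swap_mul_of_sameCycle hne hs
    rw [← hmul] at h2
    rw [h1, h2]; push_cast; omega
  · have h2 := numCycles_swap_mul_of_not_sameCycle hs
    have h3 := sameCycle_swap_mul hs
    rw [← hmul] at h2 h3
    -- The merged face still ties the two separated darts together, so the number of orbits does not
    -- grow.
    have h4 : (cyc σ ⊔ cyc α') x (α x) := by
      have e1 : (cyc σ ⊔ cyc α') x (σ x) := (le_sup_left : cyc σ ≤ _) (cyc_apply σ x)
      have e2 : (cyc σ ⊔ cyc α') (α x) (σ (α x)) := (le_sup_left : cyc σ ≤ _) (cyc_apply σ _)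
      have e3 : (cyc σ ⊔ cyc α') (σ x) (σ (α x)) := cyc_mul_le_sup σ α' h3
      exact Setoid.trans' _ e1 (Setoid.trans' _ e3 (Setoid.symm' _ e2))
    have hc' : numOrbits σ α' ≤ numOrbits σ α := by
      refine numClasses_mono (sup_le le_sup_left ?_)
      refine (cyc_le_addLink_swap_mul_apply α x).trans (addLink_le le_sup_right h4)
    rw [h1, h2]; push_cast; omega

/-- Cutting a dart that is fixed by the edge permutation out of its vertex does not increase the
defect. -/
theorem defect_swap_mul_left_le (σ α : Perm D) {x : D} (hα : α x = x) (hx : σ x ≠ x) :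
    defect (swap x (σ x) * σ) α ≤ defect σ α := by
  have h1 := numCycles_swap_mul_of_sameCycle hx.symm (cyc_apply σ x)
  have h2 : numCycles (swap x (σ x) * (σ * α)) = numCycles (σ * α) + 1 :=
    numCycles_swap_mul_of_sameCycle hx.symm (by
      have := cyc_apply (σ * α) x
      rwa [Perm.mul_apply, hα] at this)
  have hc : numOrbits (swap x (σ x) * σ) α ≤ numOrbits σ α + 1 := by
    refine (numClasses_le_addLink _ x (σ x)).trans (Nat.add_le_add_right (numClasses_mono ?_) 1)
    refine sup_le ?_ (le_sup_right.trans (le_addLink _ _ _))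
    exact (cyc_le_addLink_swap_mul_apply σ x).trans (addLink_mono le_sup_left _ _)
  unfold defect
  rw [mul_assoc, h1, h2]; push_cast; omega

/-- The genus inequality. -/
theorem defect_nonneg (σ α : Perm D) : 0 ≤ defect σ α := by
  have := Fintype.ofFinite D
  induction hn : α.support.card using Nat.strong_induction_on generalizing α with
  | _ n ih =>
    by_cases h : α = 1
    · subst h
      unfold defect numOrbits numCycles
      -- Without edges every orbit is a single vertex with a single face, and the defect is zero.
      rw [cyc_one, sup_bot_eq, mul_one, numClasses_bot]; omega
    · obtain ⟨x, hx⟩ : ∃ x, α x ≠ x := by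
        by_contra hc; push Not at hc; exact h (Equiv.ext hc)
      refine le_trans (ih _ ?_ (swap x (α x) * α) rfl) (defect_swap_mul_right_le σ α hx)
      rw [← hn]
      exact card_support_swap_mul hx

end Swap

end DPG

namespace DPG

open Equiv Equiv.Perm

/-! ### Restricting permutations -/

section Restrict

variable {D D' : Type u} {ι : D' → D}

/-- The equivalence relation on `D` that is transported along an injection `D' → D` and trivial
outside of its range. -/
def extendSetoid (hι : Function.Injective ι) (s : Setoid D') : Setoid D where
  r a b := a = b ∨ ∃ a' b', ι a' = a ∧ ι b' = b ∧ s a' b'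
  iseqv := by
    refine ⟨fun a => Or.inl rfl, ?_, ?_⟩
    · rintro a b (h | ⟨a', b', h1, h2, h3⟩)
      · exact Or.inl h.symm
      · exact Or.inr ⟨b', a', h2, h1, s.symm h3⟩
    · rintro a b c (rfl | ⟨a', b', h1, h2, h3⟩) (rfl | ⟨b'', c', h4, h5, h6⟩)
      · exact Or.inl rfl
      · exact Or.inr ⟨b'', c', h4, h5, h6⟩
      · exact Or.inr ⟨a', b', h1, h2, h3⟩
      · obtain rfl : b' = b'' := hι (h2.trans h4.symm)
        exact Or.inr ⟨a', c', h1, h5, s.trans h3 h6⟩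

theorem extendSetoid_le {hι : Function.Injective ι} {s : Setoid D'} {r : Setoid D}
    (h : ∀ a b, s a b → r (ι a) (ι b)) : extendSetoid hι s ≤ r := by
  rintro a b (rfl | ⟨a', b', rfl, rfl, h3⟩)
  · exact r.refl a
  · exact h _ _ h3

theorem extendSetoid_mono (hι : Function.Injective ι) {s t : Setoid D'} (h : s ≤ t) :
    extendSetoid hι s ≤ extendSetoid hι t :=
  extendSetoid_le fun a b hab => Or.inr ⟨a, b, rfl, rfl, h hab⟩

theorem numClasses_extendSetoid [Finite D] (hι : Function.Injective ι) (s : Setoid D') :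
    numClasses (extendSetoid hι s) = numClasses s + Nat.card {d : D // d ∉ Set.range ι} := by
  have : Finite D' := Finite.of_injective ι hι
  let g : Quotient s ⊕ {d : D // d ∉ Set.range ι} → Quotient (extendSetoid hι s) :=
    Sum.elim (Quotient.map' ι (fun a b h => Or.inr ⟨a, b, rfl, rfl, h⟩)) (fun d => ⟦d.1⟧)
  have hg : Function.Bijective g := by
    constructor
    · rintro (p | ⟨a, ha⟩) (q | ⟨b, hb⟩) h
      · induction p using Quotient.inductionOn with | h a => ?_
        induction q using Quotient.inductionOn with | h b => ?_
        have h' : extendSetoid hι s (ι a) (ι b) := Quotient.exact h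
        rcases h' with h' | ⟨a', b', h1, h2, h3⟩
        · rw [hι h']
        · rw [hι h1, hι h2] at h3
          exact congrArg _ (Quotient.sound h3)
      · induction p using Quotient.inductionOn with | h a => ?_
        have h' : extendSetoid hι s (ι a) b := Quotient.exact h
        rcases h' with h' | ⟨a', b', h1, h2, h3⟩
        · exact absurd ⟨a, h'⟩ hb
        · exact absurd ⟨b', h2⟩ hb
      · induction q using Quotient.inductionOn with | h b => ?_
        have h' : extendSetoid hι s a (ι b) := Quotient.exact h
        rcases h' with h' | ⟨a', b', h1, h2, h3⟩
        · exact absurd ⟨b, h'.symm⟩ ha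
        · exact absurd ⟨a', h1⟩ ha
      · have h' : extendSetoid hι s a b := Quotient.exact h
        rcases h' with h' | ⟨a', b', h1, h2, h3⟩
        · subst h'; rfl
        · exact absurd ⟨a', h1⟩ ha
    · intro q
      induction q using Quotient.inductionOn with | h a => ?_
      by_cases ha : a ∈ Set.range ι
      · obtain ⟨a', rfl⟩ := ha
        exact ⟨Sum.inl ⟦a'⟧, rfl⟩
      · exact ⟨Sum.inr ⟨a, ha⟩, rfl⟩
  unfold numClasses
  rw [← Nat.card_congr (Equiv.ofBijective g hg), Nat.card_sum]

theorem cyc_eq_extendSetoid (hι : Function.Injective ι) {π : Perm D} {π' : Perm D'}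
    (h : ∀ d, ι (π' d) = π (ι d)) (hfix : ∀ d, d ∉ Set.range ι → π d = d) :
    cyc π = extendSetoid hι (cyc π') := by
  apply le_antisymm
  · refine cyc_le fun a => ?_
    by_cases ha : a ∈ Set.range ι
    · obtain ⟨a, rfl⟩ := ha
      exact Or.inr ⟨a, π' a, rfl, h a, cyc_apply π' a⟩
    · exact Or.inl (hfix a ha).symm
  · refine extendSetoid_le fun a b hab => ?_
    have : cyc π' ≤ Setoid.comap ι (cyc π) := cyc_le fun a => by
      change cyc π (ι a) (ι (π' a))
      rw [h]; exact cyc_apply π _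
    exact this hab

theorem extendSetoid_sup (hι : Function.Injective ι) (s t : Setoid D') :
    extendSetoid hι (s ⊔ t) = extendSetoid hι s ⊔ extendSetoid hι t := by
  apply le_antisymm
  · refine extendSetoid_le fun a b hab => ?_
    have : s ⊔ t ≤ Setoid.comap ι (extendSetoid hι s ⊔ extendSetoid hι t) :=
      sup_le (fun a b h => (le_sup_left : extendSetoid hι s ≤ _) (Or.inr ⟨a, b, rfl, rfl, h⟩))
        (fun a b h => (le_sup_right : extendSetoid hι t ≤ _) (Or.inr ⟨a, b, rfl, rfl, h⟩))
    exact this hab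
  · exact sup_le (extendSetoid_mono hι le_sup_left) (extendSetoid_mono hι le_sup_right)

/-- Each of the `n` darts outside the range is fixed by all three permutations and forms an orbit by
itself. Together they contribute `n + 2 * n - n - n - n = 0`. -/
theorem defect_restrict [Finite D] (hι : Function.Injective ι) {σ α : Perm D} {σ' α' : Perm D'}
    (hσ : ∀ d, ι (σ' d) = σ (ι d)) (hα : ∀ d, ι (α' d) = α (ι d))
    (hfσ : ∀ d, d ∉ Set.range ι → σ d = d) (hfα : ∀ d, d ∉ Set.range ι → α d = d) :
    defect σ' α' = defect σ α := by
  have hσα : ∀ d, ι ((σ' * α') d) = (σ * α) (ι d) := fun d => by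
    rw [Perm.mul_apply, Perm.mul_apply, hσ, hα]
  have hfσα : ∀ d, d ∉ Set.range ι → (σ * α) d = d := fun d hd => by
    rw [Perm.mul_apply, hfα d hd, hfσ d hd]
  have hc : Nat.card D = Nat.card D' + Nat.card {d : D // d ∉ Set.range ι} := by
    have := Finite.of_injective ι hι
    rw [← Nat.card_range_of_injective hι, ← Nat.card_sum]
    classical
    exact Nat.card_congr (Equiv.sumCompl (fun d => d ∈ Set.range ι)).symm
  unfold defect numOrbits numCycles
  rw [cyc_eq_extendSetoid hι hσα hfσα, cyc_eq_extendSetoid hι hσ hfσ,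
    cyc_eq_extendSetoid hι hα hfα, ← extendSetoid_sup, numClasses_extendSetoid,
    numClasses_extendSetoid, numClasses_extendSetoid, numClasses_extendSetoid, hc]
  push_cast; ring

end Restrict

/-! ### Genus zero is hereditary -/

section Hereditary

variable {V : Type u} {G : SimpleGraph V}

/-- A rotation system of genus zero, with Euler's formula as an inequality on darts. -/
def RotationSystem.Spherical (E : RotationSystem G) : Prop := defect E.rot (dartRev G) ≤ 0

/-- The dart of `G` that underlies a dart of an induced subgraph. -/
def inducedDart (T : Set V) (d : (G.induce T).Dart) : G.Dart := ⟨(d.fst.1, d.snd.1), d.adj⟩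

theorem inducedDart_injective (T : Set V) :
    Function.Injective (inducedDart (G := G) T) := by
  intro d e h
  refine SimpleGraph.Dart.ext _ _ (Prod.ext (Subtype.ext ?_) (Subtype.ext ?_))
  · exact congrArg (fun d : G.Dart => d.fst) h
  · exact congrArg (fun d : G.Dart => d.snd) h

variable [Finite V]

instance : Finite G.Dart := Finite.of_injective _ SimpleGraph.Dart.toProd_injective

/-- Edges that are not kept are cut one at a time. Multiplying by the transposition of the two darts
of an edge fixes both, and the defect does not increase. -/
theorem exists_edgePerm (σ : Perm G.Dart) (T : G.Dart → Prop) (hT : ∀ d, T d → T d.symm) :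
    ∃ α : Perm G.Dart, defect σ α ≤ defect σ (dartRev G) ∧ (∀ d, T d → α d = d.symm) ∧
      ∀ d, ¬ T d → α d = d := by
  classical
  have := Fintype.ofFinite G.Dart
  have hT' : ∀ d, T d.symm → T d := fun d h => by simpa using hT _ h
  suffices H : ∀ n : ℕ, ∀ α : Perm G.Dart, α.support.card = n → (∀ d, α d = d ∨ α d = d.symm) →
      (∀ d, T d → α d = d.symm) → ∃ α' : Perm G.Dart, defect σ α' ≤ defect σ α ∧
      (∀ d, T d → α' d = d.symm) ∧ ∀ d, ¬ T d → α' d = d from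
    H _ (dartRev G) rfl (fun d => Or.inr rfl) (fun d _ => rfl)
  intro n
  induction n using Nat.strong_induction_on with
  | _ n ih =>
    intro α hn h1 h2
    by_cases h : ∀ d, ¬ T d → α d = d
    · exact ⟨α, le_rfl, h2, h⟩
    push Not at h
    obtain ⟨x, hxT, hx⟩ := h
    have hxs : α x = x.symm := (h1 x).resolve_left hx
    have hxs' : α x.symm = x := by
      rcases h1 x.symm with h | h
      · exact absurd (α.injective (h.trans hxs.symm)) x.symm_ne
      · simpa using h
    have key : ∀ d, (d = x ∨ d = x.symm) ∧ (swap x (α x) * α) d = d ∨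
        d ≠ x ∧ d ≠ x.symm ∧ (swap x (α x) * α) d = α d := by
      intro d
      rw [Perm.mul_apply, hxs]
      by_cases e1 : d = x
      · subst e1; left; exact ⟨Or.inl rfl, by rw [hxs, swap_apply_right]⟩
      by_cases e2 : d = x.symm
      · subst e2; left; exact ⟨Or.inr rfl, by rw [hxs', swap_apply_left]⟩
      right
      refine ⟨e1, e2, swap_apply_of_ne_of_ne ?_ ?_⟩
      · intro h; exact e2 (α.injective (h.trans hxs'.symm))
      · intro h; exact e1 (α.injective (h.trans hxs.symm))
    obtain ⟨α', hα', hb, hc⟩ := ih _ (hn ▸ card_support_swap_mul hx) (swap x (α x) * α) rfl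
      (fun d => by
        rcases key d with ⟨-, h⟩ | ⟨-, -, h⟩
        · exact Or.inl h
        · rw [h]; exact h1 d)
      (fun d hd => by
        rcases key d with ⟨rfl | rfl, -⟩ | ⟨-, -, h⟩
        · exact absurd hd hxT
        · exact absurd (hT' _ hd) hxT
        · rw [h]; exact h2 d hd)
    exact ⟨α', hα'.trans (defect_swap_mul_right_le σ α hx), hb, hc⟩

/-- Once the unwanted darts are fixed by the edge permutation, they can be bypassed in the rotation.
The cyclic order of the darts that remain is kept, so they still form one cycle at each vertex. -/
theorem exists_vertexPerm (α σ : Perm G.Dart) (T : G.Dart → Prop) (hα : ∀ d, ¬ T d → α d = d)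
    (h1 : ∀ d, (σ d).fst = d.fst)
    (h2 : ∀ d e, T d → T e → d.fst = e.fst → SameCycle σ d e) :
    ∃ σ' : Perm G.Dart, defect σ' α ≤ defect σ α ∧ (∀ d, (σ' d).fst = d.fst) ∧
      (∀ d e, T d → T e → d.fst = e.fst → SameCycle σ' d e) ∧ ∀ d, ¬ T d → σ' d = d := by
  classical
  have := Fintype.ofFinite G.Dart
  induction hn : σ.support.card using Nat.strong_induction_on generalizing σ with
  | _ n ih =>
    by_cases h : ∀ d, ¬ T d → σ d = d
    · exact ⟨σ, le_rfl, h1, h2, h⟩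
    push Not at h
    obtain ⟨x, hxT, hx⟩ := h
    have hfx : (swap x (σ x) * σ) x = x := by rw [Perm.mul_apply, swap_apply_right]
    obtain ⟨σ', hd, hb, hc, he⟩ := ih _ (hn ▸ card_support_swap_mul hx) (swap x (σ x) * σ)
      (fun d => by
        rw [Perm.mul_apply]
        by_cases e1 : σ d = x
        · rw [e1, swap_apply_left, h1, ← e1, h1]
        by_cases e2 : σ d = σ x
        · rw [e2, swap_apply_right, σ.injective e2]
        rw [swap_apply_of_ne_of_ne e1 e2, h1])
      (fun d e hd he hde => by
        rcases cyc_le_addLink_swap_mul_apply σ x (h2 d e hd he hde) with h | ⟨h, -⟩ | ⟨-, h⟩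
        · exact h
        · obtain ⟨n, hn⟩ := SameCycle.symm h
          rw [zpow_apply_eq_self_of_apply_eq_self hfx] at hn
          subst hn; exact absurd hd hxT
        · obtain ⟨n, hn⟩ := h
          rw [zpow_apply_eq_self_of_apply_eq_self hfx] at hn
          subst hn; exact absurd he hxT) rfl
    exact ⟨σ', hd.trans (defect_swap_mul_left_le σ α (hα x hxT) hx), hb, hc, he⟩

/-- Cut the edges that leave `T`, remove their darts from the rotation, and forget the darts that
are now isolated. None of these steps increases the defect. -/
theorem exists_spherical_induce (E : RotationSystem G) (hE : E.Spherical) (T : Set V) :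
    ∃ E' : RotationSystem (G.induce T), E'.Spherical := by
  classical
  let P : G.Dart → Prop := fun d => d.fst ∈ T ∧ d.snd ∈ T
  have hPs : ∀ d, P d → P d.symm := fun d h => ⟨h.2, h.1⟩
  obtain ⟨α, hα, hαT, hαf⟩ := exists_edgePerm E.rot P hPs
  obtain ⟨σ, hσ, hσ1, hσ2, hσf⟩ := exists_vertexPerm α E.rot P hαf E.fst_rot
    (fun d e _ _ h => E.cyclic d e h)
  have hι := inducedDart_injective (G := G) T
  have hrange : ∀ d, P d ↔ d ∈ Set.range (inducedDart (G := G) T) := by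
    intro d
    constructor
    · rintro ⟨h1, h2⟩
      exact ⟨⟨(⟨d.fst, h1⟩, ⟨d.snd, h2⟩), d.adj⟩, rfl⟩
    · rintro ⟨d, rfl⟩
      exact ⟨d.fst.2, d.snd.2⟩
  have hσP : ∀ d, P (σ d) ↔ P d := by
    intro d
    constructor
    · intro h
      by_contra hc
      rw [hσf d hc] at h
      exact hc h
    · intro h
      by_contra hc
      have := σ.injective (hσf _ hc)
      rw [this] at hc
      exact hc h
  let e : (G.induce T).Dart ≃ {d // P d} :=
    (Equiv.ofInjective _ hι).trans (Equiv.subtypeEquivRight fun d => (hrange d).symm)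
  have he : ∀ d, (e d).1 = inducedDart T d := fun d => rfl
  let σ' : Perm (G.induce T).Dart := e.symm.permCongr (σ.subtypePerm hσP)
  have hσ' : ∀ d, inducedDart T (σ' d) = σ (inducedDart T d) := by
    intro d
    rw [← he, ← he]
    simp [σ', Equiv.permCongr_apply]
  have hα' : ∀ d, inducedDart T (dartRev (G.induce T) d) = α (inducedDart T d) := by
    intro d
    rw [hαT _ ((hrange _).2 ⟨d, rfl⟩)]
    rfl
  have hσF : ∀ d, d ∉ Set.range (inducedDart (G := G) T) → σ d = d := fun d hd =>
    hσf d fun h => hd ((hrange d).1 h)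
  have hαF : ∀ d, d ∉ Set.range (inducedDart (G := G) T) → α d = d := fun d hd =>
    hαf d fun h => hd ((hrange d).1 h)
  refine ⟨⟨σ', ?_, ?_⟩, ?_⟩
  · intro d
    have := congrArg (fun d : G.Dart => d.fst) (hσ' d)
    simp only [hσ1] at this
    exact Subtype.ext this
  · intro d f hdf
    have h := hσ2 (inducedDart T d) (inducedDart T f) ((hrange _).2 ⟨d, rfl⟩)
      ((hrange _).2 ⟨f, rfl⟩) (congrArg Subtype.val hdf)
    have h' : cyc σ (inducedDart T d) (inducedDart T f) := h
    rw [cyc_eq_extendSetoid hι hσ' hσF] at h'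
    rcases h' with h' | ⟨a, b, h1, h2, h3⟩
    · rw [hι h']
    · rw [hι h1, hι h2] at h3; exact h3
  · unfold RotationSystem.Spherical
    rw [defect_restrict hι hσ' hα' hσF hαF]
    exact hσ.trans (hα.trans hE)

end Hereditary

/-! ### Euler's formula and facial cycles -/

section Euler

variable {V : Type u} {G : SimpleGraph V}

theorem RotationSystem.fst_eq_of_sameCycle (E : RotationSystem G) {d e : G.Dart}
    (h : SameCycle E.rot d e) : d.fst = e.fst := by
  have : cyc E.rot ≤ Setoid.ker (fun d : G.Dart => d.fst) :=
    cyc_le fun a => (E.fst_rot a).symm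
  exact this h

theorem cyc_dartRev_iff {d e : G.Dart} : cyc (dartRev G) d e ↔ d.edge = e.edge := by
  constructor
  · intro h
    have : cyc (dartRev G) ≤ Setoid.ker (fun d : G.Dart => d.edge) :=
      cyc_le fun a => (SimpleGraph.Dart.edge_symm a).symm
    exact this h
  · intro h
    rcases SimpleGraph.dart_edge_eq_iff d e |>.1 h with rfl | rfl
    · exact Setoid.refl' _ _
    · exact Setoid.symm' _ (cyc_apply (dartRev G) e)

theorem sup_cyc_of_reachable (E : RotationSystem G) {d e : G.Dart}
    (h : G.Reachable d.fst e.fst) : (cyc E.rot ⊔ cyc (dartRev G)) d e := by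
  obtain ⟨p⟩ := h
  generalize hu : d.fst = u at p
  generalize hv : e.fst = v at p
  induction p generalizing d with
  | nil => exact (le_sup_left : cyc E.rot ≤ _) (E.cyclic d e (hu.trans hv.symm))
  | @cons u x v hux p ih =>
    let d' : G.Dart := ⟨(u, x), hux⟩
    have h1 : (cyc E.rot ⊔ cyc (dartRev G)) d d' :=
      (le_sup_left : cyc E.rot ≤ _) (E.cyclic d d' hu)
    have h2 : (cyc E.rot ⊔ cyc (dartRev G)) d' d'.symm :=
      (le_sup_right : cyc (dartRev G) ≤ _) (cyc_apply (dartRev G) d')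
    exact Setoid.trans' _ h1 (Setoid.trans' _ h2 (ih (d := d'.symm) rfl hv))

theorem numCycles_dartRev : numCycles (dartRev G) = Nat.card G.edgeSet := by
  refine Nat.card_congr (Equiv.ofBijective
    (Quotient.lift (fun d : G.Dart => (⟨d.edge, d.edge_mem⟩ : G.edgeSet))
      fun a b h => Subtype.ext (cyc_dartRev_iff.1 h)) ⟨?_, ?_⟩)
  · intro p q h
    induction p using Quotient.inductionOn with | h a => ?_
    induction q using Quotient.inductionOn with | h b => ?_
    exact Quotient.sound (cyc_dartRev_iff.2 (congrArg Subtype.val h))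
  · rintro ⟨e, he⟩
    induction e using Sym2.inductionOn with
    | hf a b => exact ⟨⟦⟨(a, b), he⟩⟧, rfl⟩

variable [Finite V]

theorem card_dart : Nat.card G.Dart = 2 * Nat.card G.edgeSet := by
  classical
  have := Fintype.ofFinite V
  rw [Nat.card_eq_fintype_card, SimpleGraph.dart_card_eq_twice_card_edges,
    Nat.card_eq_fintype_card, SimpleGraph.edgeFinset_card]

theorem numCycles_rot_le (E : RotationSystem G) : numCycles E.rot ≤ Nat.card V :=
  Nat.card_le_card_of_injective
    (Quotient.lift (fun d : G.Dart => d.fst) fun a b h => E.fst_eq_of_sameCycle h) (by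
      intro p q h
      induction p using Quotient.inductionOn with | h a => ?_
      induction q using Quotient.inductionOn with | h b => ?_
      exact Quotient.sound (E.cyclic a b h))

theorem card_le_numCycles_rot_add (E : RotationSystem G) :
    Nat.card V ≤ numCycles E.rot + Nat.card {v : V // ∀ w, ¬ G.Adj v w} := by
  classical
  unfold numCycles numClasses
  rw [← Nat.card_sum]
  refine Nat.card_le_card_of_injective (fun v =>
    if h : ∃ w, G.Adj v w then Sum.inl ⟦⟨(v, h.choose), h.choose_spec⟩⟧
    else Sum.inr ⟨v, not_exists.1 h⟩) ?_
  intro v w h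
  by_cases hv : ∃ x, G.Adj v x <;> by_cases hw : ∃ x, G.Adj w x
  · simp only [hv, hw, dif_pos] at h
    exact E.fst_eq_of_sameCycle (Quotient.exact (Sum.inl.inj h))
  · simp only [hv, hw, dif_pos, dif_neg, not_false_eq_true, reduceCtorEq] at h
  · simp only [hv, hw, dif_pos, dif_neg, not_false_eq_true, reduceCtorEq] at h
  · simp only [hv, hw, dif_neg, not_false_eq_true] at h
    exact congrArg Subtype.val (Sum.inr.inj h)

/-- Isolated vertices carry no darts and hence no orbit, but each is a component. They have to be
counted separately to match Euler's formula. -/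
theorem numOrbits_add_le (E : RotationSystem G) :
    numOrbits E.rot (dartRev G) + Nat.card {v : V // ∀ w, ¬ G.Adj v w} ≤
      Nat.card G.ConnectedComponent := by
  unfold numOrbits numClasses
  rw [← Nat.card_sum]
  have hle : cyc E.rot ⊔ cyc (dartRev G) ≤
      Setoid.ker (fun d : G.Dart => G.connectedComponentMk d.fst) :=
    sup_le (cyc_le fun a => congrArg G.connectedComponentMk (E.fst_rot a).symm)
      (cyc_le fun a => SimpleGraph.ConnectedComponent.sound a.adj.reachable)
  refine Nat.card_le_card_of_injective (Sum.elim
    (Quotient.lift (fun d : G.Dart => G.connectedComponentMk d.fst) fun a b h => hle h)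
    fun v => G.connectedComponentMk v.1) ?_
  have hiso : ∀ v w, (∀ x, ¬ G.Adj v x) → G.Reachable v w → v = w := by
    rintro v w hv ⟨p⟩
    cases p with
    | nil => rfl
    | cons h _ => exact absurd h (hv _)
  rintro (p | ⟨v, hv⟩) (q | ⟨w, hw⟩) h
  · induction p using Quotient.inductionOn with | h a => ?_
    induction q using Quotient.inductionOn with | h b => ?_
    exact congrArg _ (Quotient.sound
      (sup_cyc_of_reachable E (SimpleGraph.ConnectedComponent.exact h)))
  · induction p using Quotient.inductionOn with | h a => ?_
    have := hiso _ _ hw (SimpleGraph.ConnectedComponent.exact h).symm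
    exact absurd (this ▸ a.adj) (hw _)
  · induction q using Quotient.inductionOn with | h a => ?_
    have := hiso _ _ hv (SimpleGraph.ConnectedComponent.exact h)
    exact absurd (this ▸ a.adj) (hv _)
  · have := hiso _ _ hv (SimpleGraph.ConnectedComponent.exact h)
    subst this; rfl

/-- From here on genus zero is used only in the form `defect ≤ 0`. Isolated vertices drop out: each
contributes one vertex, one face and one component. -/
theorem RotationSystem.IsPlane.spherical {E : RotationSystem G} (h : E.IsPlane) :
    E.Spherical := by
  have h1 := card_le_numCycles_rot_add E
  have h2 := numOrbits_add_le E
  have h3 : numCycles (E.rot * dartRev G) = Nat.card E.Face := rfl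
  have h4 := card_dart (G := G)
  have h5 := numCycles_dartRev (G := G)
  unfold RotationSystem.IsPlane RotationSystem.numFaces at h
  unfold RotationSystem.Spherical defect
  rw [h3, h4, h5]; push_cast; omega

theorem euler_le (E : RotationSystem G) (hE : E.Spherical) [Nonempty G.Dart] :
    Nat.card G.Dart + 4 ≤ 2 * (Nat.card V + numCycles E.facePerm) := by
  have h1 := numCycles_rot_le E
  have h4 := card_dart (G := G)
  have h5 := numCycles_dartRev (G := G)
  have h6 : 0 < numOrbits E.rot (dartRev G) := numClasses_pos _
  unfold RotationSystem.Spherical defect at hE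
  unfold RotationSystem.facePerm
  omega

/-- In a graph without cut vertices every facial walk of a plane embedding visits a vertex at most
once. -/
theorem face_simple (E : RotationSystem G) (hE : E.Spherical) {d₁ d₂ : G.Dart}
    (hcut : (G.induce {v | v ≠ d₁.fst}).Preconnected) (hv : d₁.fst = d₂.fst)
    (hf : SameCycle E.facePerm d₁ d₂) : d₁ = d₂ := by
  classical
  by_contra hne
  -- Split the vertex between the two darts. The face splits too, so the defect drops by 2 unless
  -- the map becomes disconnected; but the defect is never negative.
  have h1 := numCycles_swap_mul_of_sameCycle hne (E.cyclic _ _ hv)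
  have h2 := numCycles_swap_mul_of_sameCycle hne hf
  have h3 := defect_nonneg (swap d₁ d₂ * E.rot) (dartRev G)
  have : Nonempty G.Dart := ⟨d₁⟩
  have h6 : 0 < numOrbits E.rot (dartRev G) := numClasses_pos _
  -- Only the rotation at one vertex has changed. The other vertices stay connected because it is
  -- not a cut vertex, and each half of the split vertex is attached to them by its edges.
  have h7 : numOrbits (swap d₁ d₂ * E.rot) (dartRev G) ≤ 1 := by
    set σ := swap d₁ d₂ * E.rot with hσ
    set r := cyc σ ⊔ cyc (dartRev G) with hr
    have hrev : ∀ d : G.Dart, r d d.symm := fun d =>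
      (le_sup_right : cyc (dartRev G) ≤ _) (cyc_apply (dartRev G) d)
    have hrot : ∀ d e : G.Dart, d.fst = e.fst → d.fst ≠ d₁.fst → r d e := by
      intro d e hde hd
      refine (le_sup_left : cyc σ ≤ _) ?_
      have hs : ∀ n : ℕ, (σ ^ n) d = (E.rot ^ n) d ∧ ((E.rot ^ n) d).fst = d.fst := by
        intro n
        induction n with
        | zero => exact ⟨rfl, rfl⟩
        | succ n ih =>
          have h' : ((E.rot ^ (n + 1)) d).fst = d.fst := by
            rw [pow_succ', Perm.mul_apply, E.fst_rot, ih.2]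
          refine ⟨?_, h'⟩
          rw [pow_succ', Perm.mul_apply, ih.1, hσ, Perm.mul_apply, ← Perm.mul_apply E.rot,
            ← pow_succ']
          refine swap_apply_of_ne_of_ne ?_ ?_
          · intro h; rw [h] at h'; exact hd h'.symm
          · intro h; rw [h] at h'; exact hd (h'.symm.trans hv.symm)
      obtain ⟨n, hn⟩ := (E.cyclic d e hde).exists_nat_pow_eq
      exact ⟨n, by rw [zpow_natCast, (hs n).1, hn]⟩
    have hwalk : ∀ (u v : {v | v ≠ d₁.fst}), (G.induce {v | v ≠ d₁.fst}).Walk u v →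
        ∀ d e : G.Dart, d.fst = u.1 → e.fst = v.1 → r d e := by
      intro u v p
      induction p with
      | @nil u => exact fun d e hd he => hrot d e (hd.trans he.symm) (hd ▸ u.2)
      | @cons u x v hux p ih =>
        intro d e hd he
        let d' : G.Dart := ⟨(u.1, x.1), hux⟩
        exact Setoid.trans' _ (hrot d d' hd (hd ▸ u.2))
          (Setoid.trans' _ (hrev d') (ih d'.symm e rfl he))
    have hne' : ∀ d e : G.Dart, d.fst ≠ d₁.fst → e.fst ≠ d₁.fst → r d e := by
      intro d e hd he
      obtain ⟨p⟩ := hcut ⟨d.fst, hd⟩ ⟨e.fst, he⟩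
      exact hwalk _ _ p d e rfl rfl
    have hex : ∀ d : G.Dart, ∃ d', d'.fst ≠ d₁.fst ∧ r d d' := by
      intro d
      by_cases hd : d.fst = d₁.fst
      · exact ⟨d.symm, fun h => d.adj.ne (hd.trans h.symm), hrev d⟩
      · exact ⟨d, hd, Setoid.refl' _ _⟩
    have hsub : Subsingleton (Quotient r) := by
      constructor
      intro p q
      induction p using Quotient.inductionOn with | h a => ?_
      induction q using Quotient.inductionOn with | h b => ?_
      obtain ⟨a', ha, ha'⟩ := hex a
      obtain ⟨b', hb, hb'⟩ := hex b
      exact Quotient.sound (Setoid.trans' _ ha' (Setoid.trans' _ (hne' a' b' ha hb)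
        (Setoid.symm' _ hb')))
    exact Finite.card_le_one_iff_subsingleton.2 hsub
  unfold RotationSystem.Spherical at hE
  unfold defect at h3 hE
  unfold RotationSystem.facePerm at h2
  rw [mul_assoc, h1, h2] at h3
  push_cast at h3
  omega

-- A transposition of two darts at one vertex leaves the rotation at every other vertex intact.
omit [Finite V] in
theorem sameCycle_swap_mul_of_fst_ne {σ : Perm G.Dart} [DecidableEq G.Dart]
    (hσ : ∀ d, (σ d).fst = d.fst) {e₁ e₂ d e : G.Dart} (h12 : e₁.fst = e₂.fst)
    (hd : d.fst ≠ e₁.fst) (h : SameCycle σ d e) : SameCycle (swap e₁ e₂ * σ) d e := by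
  have hf : cyc (swap e₁ e₂ * σ) ≤ Setoid.ker (fun d : G.Dart => d.fst) := by
    refine cyc_le fun a => ?_
    change a.fst = ((swap e₁ e₂ * σ) a).fst
    rw [Perm.mul_apply]
    by_cases h1 : σ a = e₁
    · rw [h1, swap_apply_left, ← h12, ← h1, hσ]
    by_cases h2 : σ a = e₂
    · rw [h2, swap_apply_right, h12, ← h2, hσ]
    rw [swap_apply_of_ne_of_ne h1 h2, hσ]
  have h' : addLink (cyc (swap e₁ e₂ * σ)) e₁ e₂ d e := by
    rw [addLink_cyc_swap_mul]; exact Or.inl h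
  rcases h' with h' | ⟨h', -⟩ | ⟨h', -⟩
  · exact h'
  · exact absurd (hf h') hd
  · exact absurd ((hf h').trans h12.symm) hd

omit [Finite V] in
theorem fst_swap_mul {σ : Perm G.Dart} [DecidableEq G.Dart] (hσ : ∀ d, (σ d).fst = d.fst)
    {e₁ e₂ : G.Dart} (h12 : e₁.fst = e₂.fst) (a : G.Dart) :
    ((swap e₁ e₂ * σ) a).fst = a.fst := by
  rw [Perm.mul_apply]
  by_cases h1 : σ a = e₁
  · rw [h1, swap_apply_left, ← h12, ← h1, hσ]
  by_cases h2 : σ a = e₂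
  · rw [h2, swap_apply_right, h12, ← h2, hσ]
  rw [swap_apply_of_ne_of_ne h1 h2, hσ]

/-- Two faces of a plane embedding do not share two vertices `y` and `a` that do not separate the
graph, unless the edge between them is all that lies on one side. -/
theorem not_two_faces [DecidableEq G.Dart] (E : RotationSystem G) (hE : E.Spherical) {y a : V}
    (hya : y ≠ a) (hcut : (G.induce {v | v ≠ y ∧ v ≠ a}).Preconnected) {e₁ e₂ e₃ e₄ : G.Dart}
    (h1 : e₁.fst = y) (h2 : e₂.fst = y) (h3 : e₃.fst = a) (h4 : e₄.fst = a) (h12 : e₁ ≠ e₂)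
    (h34 : e₃ ≠ e₄) (h13 : SameCycle E.facePerm e₁ e₃) (h24 : SameCycle E.facePerm e₂ e₄)
    (hn : ¬ SameCycle E.facePerm e₁ e₂)
    (hm : ∀ m : G.Dart, m.fst = y → m.snd = a →
      ∃ g : G.Dart, g.fst = y ∧ g.snd ≠ a ∧ SameCycle (swap e₁ e₂ * E.rot) m g) : False := by
  have hf12 : e₁.fst = e₂.fst := h1.trans h2.symm
  have hf34 : e₃.fst = e₄.fst := h3.trans h4.symm
  -- Splitting `y` merges the two faces; splitting `a` then splits the merged face again. Altogether
  -- there are two more vertices and as many faces as before, so the defect would become negative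
  -- unless a piece falls off.
  set σ₁ := swap e₁ e₂ * E.rot with hσ₁
  set σ₂ := swap e₃ e₄ * σ₁ with hσ₂
  have hfst : ∀ d, (σ₁ d).fst = d.fst := fst_swap_mul E.fst_rot hf12
  have k1 : numCycles σ₁ = numCycles E.rot + 1 :=
    numCycles_swap_mul_of_sameCycle h12 (E.cyclic _ _ hf12)
  have k2 := numCycles_swap_mul_of_not_sameCycle hn
  have s1 := sameCycle_swap_mul hn
  have hle : cyc E.facePerm ≤ cyc (swap e₁ e₂ * E.facePerm) := by
    have := le_addLink (cyc E.facePerm) e₁ e₂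
    rwa [← addLink_cyc_swap_mul, addLink_eq_self s1] at this
  have s2 : SameCycle (swap e₁ e₂ * E.facePerm) e₃ e₄ :=
    (hle h13).symm.trans (SameCycle.trans s1 (hle h24))
  have k3 := numCycles_swap_mul_of_sameCycle h34 s2
  have s3 : SameCycle σ₁ e₃ e₄ :=
    sameCycle_swap_mul_of_fst_ne E.fst_rot hf12 (by rw [h3, h1]; exact hya.symm)
      (E.cyclic _ _ hf34)
  have k4 : numCycles σ₂ = numCycles σ₁ + 1 := numCycles_swap_mul_of_sameCycle h34 s3
  have hdef := defect_nonneg σ₂ (dartRev G)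
  have : Nonempty G.Dart := ⟨e₁⟩
  have h6 : 0 < numOrbits E.rot (dartRev G) := numClasses_pos _
  have h7 : numOrbits σ₂ (dartRev G) ≤ 1 := by
    set r := cyc σ₂ ⊔ cyc (dartRev G) with hr
    have hrev : ∀ d : G.Dart, r d d.symm := fun d =>
      (le_sup_right : cyc (dartRev G) ≤ _) (cyc_apply (dartRev G) d)
    have hσ2 : ∀ d e : G.Dart, d.fst ≠ a → SameCycle σ₁ d e → r d e := fun d e hd h =>
      (le_sup_left : cyc σ₂ ≤ _) (sameCycle_swap_mul_of_fst_ne hfst hf34 (by rwa [h3]) h)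
    have hrot : ∀ d e : G.Dart, d.fst = e.fst → d.fst ≠ y → d.fst ≠ a → r d e :=
      fun d e hde hdy hda => hσ2 d e hda
        (sameCycle_swap_mul_of_fst_ne E.fst_rot hf12 (by rwa [h1]) (E.cyclic _ _ hde))
    have hwalk : ∀ (u v : {v | v ≠ y ∧ v ≠ a}), (G.induce {v | v ≠ y ∧ v ≠ a}).Walk u v →
        ∀ d e : G.Dart, d.fst = u.1 → e.fst = v.1 → r d e := by
      intro u v p
      induction p with
      | @nil u => exact fun d e hd he => hrot d e (hd.trans he.symm) (hd ▸ u.2.1) (hd ▸ u.2.2)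
      | @cons u x v hux p ih =>
        intro d e hd he
        let d' : G.Dart := ⟨(u.1, x.1), hux⟩
        exact Setoid.trans' _ (hrot d d' hd (hd ▸ u.2.1) (hd ▸ u.2.2))
          (Setoid.trans' _ (hrev d') (ih d'.symm e rfl he))
    have hne' : ∀ d e : G.Dart, d.fst ≠ y → d.fst ≠ a → e.fst ≠ y → e.fst ≠ a → r d e := by
      intro d e hd hd' he he'
      obtain ⟨p⟩ := hcut ⟨d.fst, hd, hd'⟩ ⟨e.fst, he, he'⟩
      exact hwalk _ _ p d e rfl rfl
    -- A half of `y` whose edges all lead to `a` could be detached together with a half of `a`. The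
    -- hypothesis `hm` excludes exactly this.
    have hy : ∀ d : G.Dart, d.fst = y → ∃ d', d'.fst ≠ y ∧ d'.fst ≠ a ∧ r d d' := by
      intro d hd
      by_cases hda : d.snd = a
      · obtain ⟨g, g1, g2, g3⟩ := hm d hd hda
        refine ⟨g.symm, fun h => g.adj.ne (g1.trans h.symm), g2, ?_⟩
        exact Setoid.trans' _ (hσ2 d g (hd ▸ hya) g3) (hrev g)
      · exact ⟨d.symm, fun h => d.adj.ne (hd.trans h.symm), hda, hrev d⟩
    have hex : ∀ d : G.Dart, ∃ d', d'.fst ≠ y ∧ d'.fst ≠ a ∧ r d d' := by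
      intro d
      by_cases hd : d.fst = y
      · exact hy d hd
      by_cases hda : d.fst = a
      · by_cases hds : d.snd = y
        · obtain ⟨d', g1, g2, g3⟩ := hy d.symm hds
          exact ⟨d', g1, g2, Setoid.trans' _ (hrev d) g3⟩
        · exact ⟨d.symm, hds, fun h => d.adj.ne (hda.trans h.symm), hrev d⟩
      · exact ⟨d, hd, hda, Setoid.refl' _ _⟩
    have hsub : Subsingleton (Quotient r) := by
      constructor
      intro p q
      induction p using Quotient.inductionOn with | h a => ?_
      induction q using Quotient.inductionOn with | h b => ?_
      obtain ⟨a', ha, ha2, ha'⟩ := hex a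
      obtain ⟨b', hb, hb2, hb'⟩ := hex b
      exact Quotient.sound (Setoid.trans' _ ha' (Setoid.trans' _ (hne' a' b' ha ha2 hb hb2)
        (Setoid.symm' _ hb')))
    exact Finite.card_le_one_iff_subsingleton.2 hsub
  have hφ : σ₂ * dartRev G = swap e₃ e₄ * (swap e₁ e₂ * E.facePerm) := by
    rw [hσ₂, hσ₁, mul_assoc, mul_assoc]; rfl
  have hφ0 : E.rot * dartRev G = E.facePerm := rfl
  unfold RotationSystem.Spherical at hE
  unfold defect at hdef hE
  rw [hφ, k4, k1, k3] at hdef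
  rw [hφ0, k2] at hE
  push_cast at hdef hE
  omega

end Euler

end DPG

/-! ### Ordered colourings with capacities, and reducible sets. -/

namespace DPG

/-- A colouring instance: a matching of conflicts between the colours of adjacent vertices, and
for every vertex a capacity for each colour. -/
structure Inst {V : Type u} (G : SimpleGraph V) (s : ℕ) where
  conf : V → Fin s → V → Fin s → Prop
  conf_symm : ∀ {v i w j}, conf v i w j → conf w j v i
  adj : ∀ {v i w j}, conf v i w j → G.Adj v w
  unique : ∀ {v i w j j'}, conf v i w j → conf v i w j' → j = j'
  cap : V → Fin s → ℕ
  cap_le : ∀ v i, cap v i ≤ 2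
  le_sum : ∀ v, 3 ≤ ∑ i, cap v i

namespace Inst

variable {V : Type u} {G : SimpleGraph V} {s : ℕ} (I : Inst G s)

open Classical in
/-- The number of entries of a partial colouring that conflict with colour `i` at `v`. -/
noncomputable def cnt (v : V) (i : Fin s) : List (V × Fin s) → ℕ
  | [] => 0
  | x :: l => (if I.conf v i x.1 x.2 then 1 else 0) + cnt v i l

/-- Ordered partial colourings, last vertex first, that start with a precoloured list and respect
the capacities at all other vertices. -/
inductive Good (B : List (V × Fin s)) : List (V × Fin s) → Prop
  | base : Good B B
  | cons {x : V × Fin s} {l : List (V × Fin s)} : Good B l → x.1 ∉ l.map Prod.fst →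
      I.cnt x.1 x.2 l < I.cap x.1 x.2 → Good B (x :: l)

variable {I}

theorem Good.nodup {B l : List (V × Fin s)} (h : I.Good B l) (hB : (B.map Prod.fst).Nodup) :
    (l.map Prod.fst).Nodup := by
  induction h with
  | base => exact hB
  | cons _ h1 _ ih => simpa using ⟨by simpa using h1, ih⟩

theorem Good.base_subset {B l : List (V × Fin s)} (h : I.Good B l) : B ⊆ l := by
  induction h with
  | base => exact List.Subset.refl _
  | cons _ _ _ ih => exact List.subset_cons_of_subset _ ih

theorem Good.of_cons {B l : List (V × Fin s)} {x : V × Fin s} (h : I.Good B (x :: l))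
    (hx : x ∉ B) : I.Good B l ∧ x.1 ∉ l.map Prod.fst ∧ I.cnt x.1 x.2 l < I.cap x.1 x.2 := by
  generalize hl : x :: l = l' at h
  cases h with
  | base => subst hl; simp at hx
  | cons h1 h2 h3 => cases hl; exact ⟨h1, h2, h3⟩

theorem cnt_append (v : V) (i : Fin s) (l l' : List (V × Fin s)) :
    I.cnt v i (l ++ l') = I.cnt v i l + I.cnt v i l' := by
  induction l with
  | nil => simp [cnt]
  | cons x l ih => simp [cnt, ih, add_assoc]

theorem cnt_eq_zero {v : V} {i : Fin s} {l : List (V × Fin s)}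
    (h : ∀ x ∈ l, ¬ I.conf v i x.1 x.2) : I.cnt v i l = 0 := by
  induction l with
  | nil => rfl
  | cons x l ih =>
    have h1 := h x (by simp)
    have h2 := ih fun y hy => h y (by simp [hy])
    simp [cnt, h1, h2]

theorem not_conf_of_cnt_eq_zero {v : V} {i : Fin s} {l : List (V × Fin s)}
    (h : I.cnt v i l = 0) : ∀ x ∈ l, ¬ I.conf v i x.1 x.2 := by
  induction l with
  | nil => simp
  | cons x l ih =>
    simp only [cnt, Nat.add_eq_zero_iff] at h
    intro y hy
    rcases List.mem_cons.1 hy with rfl | hy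
    · intro hc; simp [hc] at h
    · exact ih h.2 y hy

/-- The conflicts of `v` with a set of coloured vertices take up at most one unit of capacity for
each coloured neighbour. -/
theorem sum_cnt_le [Finite V] (v : V) (l : List (V × Fin s)) (hl : (l.map Prod.fst).Nodup) :
    ∑ i, I.cnt v i l ≤ {w | G.Adj v w ∧ w ∈ l.map Prod.fst}.ncard := by
  classical
  induction l with
  | nil => simp [cnt]
  | cons x l ih =>
    simp only [List.map_cons, List.nodup_cons] at hl
    have h1 := ih hl.2
    simp only [cnt, Finset.sum_add_distrib]
    by_cases hx : G.Adj v x.1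
    · have h2 : ∑ i, (if I.conf v i x.1 x.2 then 1 else 0) ≤ 1 := by
        rw [← Finset.card_filter, Finset.card_le_one]
        intro i hi j hj
        simp only [Finset.mem_filter, Finset.mem_univ, true_and] at hi hj
        exact I.unique (I.conf_symm hi) (I.conf_symm hj)
      have h3 : {w | G.Adj v w ∧ w ∈ (x :: l).map Prod.fst} =
          insert x.1 {w | G.Adj v w ∧ w ∈ l.map Prod.fst} := by
        ext w
        simp only [List.map_cons, List.mem_cons, Set.mem_ofPred_eq, Set.mem_insert_iff]
        constructor
        · rintro ⟨h, rfl | h'⟩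
          · exact Or.inl rfl
          · exact Or.inr ⟨h, h'⟩
        · rintro (rfl | ⟨h, h'⟩)
          · exact ⟨hx, Or.inl rfl⟩
          · exact ⟨h, Or.inr h'⟩
      rw [h3, Set.ncard_insert_of_notMem (fun h => hl.1 h.2) (Set.toFinite _)]
      omega
    · have h2 : ∑ i, (if I.conf v i x.1 x.2 then 1 else 0) = 0 :=
        Finset.sum_eq_zero fun i _ => if_neg fun h => hx (I.adj h)
      rw [h2, zero_add]
      refine h1.trans (Set.ncard_le_ncard ?_ (Set.toFinite _))
      rintro w ⟨h, h'⟩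
      exact ⟨h, by simp [h']⟩

/-- A vertex with at most two coloured neighbours can be coloured. -/
theorem exists_cnt_lt [Finite V] (v : V) (l : List (V × Fin s)) (hl : (l.map Prod.fst).Nodup)
    (h : {w | G.Adj v w ∧ w ∈ l.map Prod.fst}.ncard ≤ 2) : ∃ i, I.cnt v i l < I.cap v i := by
  by_contra hc
  push Not at hc
  have h1 := Finset.sum_le_sum fun i (_ : i ∈ Finset.univ) => hc i
  have h2 := I.sum_cnt_le v l hl
  have h3 := I.le_sum v
  omega

/-- If every proper vertex subset is extendable, then a reducible set `S` extends a colouring of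
its complement. -/
theorem exists_good_of_reducible [Finite V] {B : List (V × Fin s)} (hB : (B.map Prod.fst).Nodup)
    {S : Set V} {p q : V}
    (hp : p ∈ S) (hq : q ∈ S) (hpq : G.Adj p q) (hNp : ∀ w, G.Adj p w → w ∈ S)
    (hdq : (G.neighborSet q).ncard ≤ 3) (hout : ∃ w, G.Adj q w ∧ w ∉ S)
    (hcl : ∀ Y ⊆ S, p ∉ Y → q ∈ Y → (∃ v ∈ S, v ≠ p ∧ v ∉ Y) →
      ∃ v ∈ S, v ≠ p ∧ v ∉ Y ∧ (G.neighborSet v).ncard ≤ 2 + {w | G.Adj v w ∧ w ∈ Y}.ncard)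
    {l₀ : List (V × Fin s)} (hl₀ : I.Good B l₀) (hv₀ : ∀ v, v ∈ l₀.map Prod.fst ↔ v ∉ S) :
    ∃ l, I.Good B l ∧ ∀ v, v ∈ l.map Prod.fst := by
  classical
  -- the vertices of `S` other than `q` can be coloured after any choice at `p`
  have main : ∀ α, 1 ≤ I.cap p α → ∀ X : Set V, X ⊆ S → p ∉ X → q ∉ X →
      ∃ l₁ : List (V × Fin s), I.Good B (l₁ ++ (p, α) :: l₀) ∧
        ∀ v, v ∈ l₁.map Prod.fst ↔ v ∈ X := by
    intro α hα X
    induction hn : X.ncard generalizing X with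
    | zero =>
      intro _ _ _
      rw [Set.ncard_eq_zero (Set.toFinite _)] at hn
      subst hn
      refine ⟨[], Good.cons hl₀ (fun h => (hv₀ p).1 h hp) ?_, by simp⟩
      rw [cnt_eq_zero]
      · exact hα
      · intro x hx hc
        exact (hv₀ x.1).1 (List.mem_map_of_mem hx) (hNp _ (I.adj hc))
    | succ n ih =>
      intro hXS hpX hqX
      have hne : X.Nonempty := by
        rw [Set.nonempty_iff_ne_empty]; rintro rfl; simp at hn
      obtain ⟨x₀, hx₀⟩ := hne
      -- The order is built from its end. The set passed to `hcl` consists of `q` and the vertices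
      -- that will be coloured later; the vertex `v` returned comes directly before them and has at
      -- most two neighbours that are already coloured.
      obtain ⟨v, hvS, hvp, hvY, hdeg⟩ := hcl {w | w ∈ S ∧ w ∉ X ∧ w ≠ p} (fun w hw => hw.1)
        (fun h => h.2.2 rfl) ⟨hq, hqX, fun h => hpq.ne h.symm⟩
        ⟨x₀, hXS hx₀, fun h => hpX (h ▸ hx₀), fun h => h.2.1 hx₀⟩
      have hvX : v ∈ X := by
        by_contra h; exact hvY ⟨hvS, h, hvp⟩
      obtain ⟨l₁, hg, hl₁⟩ := ih (X \ {v}) (by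
        rw [Set.ncard_sdiff_singleton_of_mem hvX, hn]; rfl) (fun w hw => hXS hw.1)
        (fun h => hpX h.1) (fun h => hqX h.1)
      have hmem : ∀ w, w ∈ (l₁ ++ (p, α) :: l₀).map Prod.fst → w ≠ v ∧ ¬ (w ∈ S ∧ w ∉ X ∧ w ≠ p) := by
        intro w hw
        rw [List.map_append, List.map_cons, List.mem_append, List.mem_cons, hl₁, hv₀] at hw
        rcases hw with ⟨hw, hw'⟩ | rfl | hw
        · exact ⟨hw', fun h => h.2.1 hw⟩
        · exact ⟨fun h => hvp h.symm, fun h => h.2.2 rfl⟩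
        · exact ⟨fun h => hw (h ▸ hvS), fun h => hw h.1⟩
      have h2 : {w | G.Adj v w ∧ w ∈ (l₁ ++ (p, α) :: l₀).map Prod.fst}.ncard ≤ 2 := by
        have hd : Disjoint {w | G.Adj v w ∧ w ∈ (l₁ ++ (p, α) :: l₀).map Prod.fst}
            {w | G.Adj v w ∧ w ∈ {w | w ∈ S ∧ w ∉ X ∧ w ≠ p}} := by
          rw [Set.disjoint_left]
          rintro w ⟨-, h⟩ ⟨-, h'⟩
          exact (hmem w h).2 h'
        have h3 := Set.ncard_union_eq hd (Set.toFinite _) (Set.toFinite _)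
        have h4 : _ ≤ (G.neighborSet v).ncard := Set.ncard_le_ncard (s :=
          {w | G.Adj v w ∧ w ∈ (l₁ ++ (p, α) :: l₀).map Prod.fst} ∪
            {w | G.Adj v w ∧ w ∈ {w | w ∈ S ∧ w ∉ X ∧ w ≠ p}})
          (by rintro w (h | h) <;> exact h.1) (Set.toFinite _)
        omega
      obtain ⟨i, hi⟩ := I.exists_cnt_lt v _ (hg.nodup hB) h2
      refine ⟨(v, i) :: l₁, Good.cons hg (fun h => (hmem _ h).1 rfl) hi, ?_⟩
      intro w
      rw [List.map_cons, List.mem_cons, hl₁]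
      constructor
      · rintro (rfl | h)
        · exact hvX
        · exact h.1
      · intro h
        by_cases hw : w = v
        · exact Or.inl hw
        · exact Or.inr ⟨h, hw⟩
  -- the residual capacities at `q`
  set R : Fin s → ℕ := fun β => I.cap q β - I.cnt q β l₀ with hR
  -- The decisive choice of the colour at `p`. If the residual capacities at `q` sum to less than 3,
  -- they cannot dominate the capacities at `p` along the matching of conflicts, so some colour of
  -- `p` has more capacity than its partner has left at `q`.
  have hα : ∃ α, 1 ≤ I.cap p α ∧ (3 ≤ ∑ β, R β ∨ ∀ β, I.conf q β p α → R β < I.cap p α) := by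
    by_cases h3 : 3 ≤ ∑ β, R β
    · by_contra hc
      push Not at hc
      have h0 : ∀ α, I.cap p α = 0 := by
        intro α
        by_contra h
        have := (hc α (by omega)).1
        omega
      have := I.le_sum p
      simp [h0] at this
    · by_contra hc
      push Not at hc
      have h1 : ∀ α, I.cap p α ≤ ∑ β, if I.conf q β p α then R β else 0 := by
        intro α
        rcases Nat.eq_zero_or_pos (I.cap p α) with h | h
        · omega
        · obtain ⟨-, β, hβ, hle⟩ := hc α h
          refine hle.trans ?_
          have := Finset.single_le_sum (f := fun β => if I.conf q β p α then R β else 0)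
            (fun _ _ => Nat.zero_le _) (Finset.mem_univ β)
          simpa [hβ] using this
      have h2 : ∑ α, I.cap p α ≤ ∑ β, R β := by
        refine (Finset.sum_le_sum fun α _ => h1 α).trans ?_
        rw [Finset.sum_comm]
        refine Finset.sum_le_sum fun β _ => ?_
        rw [← Finset.sum_filter, Finset.sum_const, smul_eq_mul]
        refine (Nat.mul_le_mul_right _ (Finset.card_le_one.2 ?_)).trans (one_mul _).le
        intro i hi j hj
        simp only [Finset.mem_filter, Finset.mem_univ, true_and] at hi hj
        exact I.unique hi hj
      have := I.le_sum p
      omega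
  obtain ⟨α, hα1, hα2⟩ := hα
  obtain ⟨l₁, hg, hl₁⟩ := main α hα1 {w | w ∈ S ∧ w ≠ p ∧ w ≠ q} (fun w h => h.1)
    (fun h => h.2.1 rfl) (fun h => h.2.2 rfl)
  have hmem : ∀ w, w ≠ q → w ∈ (l₁ ++ (p, α) :: l₀).map Prod.fst := by
    intro w hw
    rw [List.map_append, List.map_cons, List.mem_append, List.mem_cons, hl₁, hv₀]
    by_cases hS : w ∈ S
    · by_cases hwp : w = p
      · exact Or.inr (Or.inl hwp)
      · exact Or.inl ⟨hS, hwp, hw⟩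
    · exact Or.inr (Or.inr hS)
  have hqm : q ∉ (l₁ ++ (p, α) :: l₀).map Prod.fst := by
    rw [List.map_append, List.map_cons, List.mem_append, List.mem_cons, hl₁, hv₀]
    rintro (h | h | h)
    · exact h.2.2 rfl
    · exact hpq.ne h.symm
    · exact h hq
  -- it suffices to find a colour that leaves room for `q`
  by_cases hlast : ∃ β, I.cnt q β (l₁ ++ (p, α) :: l₀) < I.cap q β
  · obtain ⟨β, hβ⟩ := hlast
    refine ⟨(q, β) :: (l₁ ++ (p, α) :: l₀), Good.cons hg hqm hβ, fun v => ?_⟩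
    by_cases hv : v = q
    · simp [hv]
    · rw [List.map_cons]; exact List.mem_cons_of_mem _ (hmem v hv)
  push Not at hlast
  have hnd := (hg.nodup hB)
  have hnd1 : ((l₁ ++ [(p, α)]).map Prod.fst).Nodup := by
    have : l₁ ++ (p, α) :: l₀ = (l₁ ++ [(p, α)]) ++ l₀ := by simp
    rw [this, List.map_append] at hnd
    exact hnd.of_append_left
  have hnd2 : (l₁.map Prod.fst).Nodup := by
    rw [List.map_append] at hnd1; exact hnd1.of_append_left
  have hcntap : ∀ β, I.cnt q β (l₁ ++ (p, α) :: l₀) =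
      I.cnt q β (l₁ ++ [(p, α)]) + I.cnt q β l₀ := by
    intro β
    rw [← cnt_append]; simp
  have hin : {w | G.Adj q w ∧ w ∈ S}.ncard + {w | G.Adj q w ∧ w ∉ S}.ncard ≤ 3 := by
    rw [← Set.ncard_union_eq _ (Set.toFinite _) (Set.toFinite _)]
    · refine le_trans (Set.ncard_le_ncard ?_ (Set.toFinite _)) hdq
      rintro w (h | h) <;> exact h.1
    · rw [Set.disjoint_left]; rintro w ⟨-, h⟩ ⟨-, h'⟩; exact h' h
  obtain ⟨w₀, hw₀, hw₀S⟩ := hout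
  have hpos : 0 < {w | G.Adj q w ∧ w ∉ S}.ncard :=
    (Set.ncard_pos (Set.toFinite _)).2 ⟨w₀, hw₀, hw₀S⟩
  have hsum1 : ∑ β, I.cnt q β (l₁ ++ [(p, α)]) ≤ {w | G.Adj q w ∧ w ∈ S}.ncard := by
    refine (I.sum_cnt_le q _ hnd1).trans (Set.ncard_le_ncard ?_ (Set.toFinite _))
    rintro w ⟨h, h'⟩
    refine ⟨h, ?_⟩
    simp only [List.map_append, List.map_cons, List.map_nil, List.mem_append, List.mem_singleton,
      hl₁] at h'
    rcases h' with h' | rfl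
    · exact h'.1
    · exact hp
  -- With total residual capacity 3 the vertex `q` can come last, because it has at most two
  -- neighbours in `S`.
  rcases hα2 with hα2 | hα2
  · exfalso
    have : ∑ β, R β ≤ ∑ β, I.cnt q β (l₁ ++ [(p, α)]) := Finset.sum_le_sum fun β _ => by
      have := hlast β
      rw [hcntap] at this
      simp only [hR]; omega
    omega
  -- Leaving `p` aside, the neighbours of `q` in `S` take up fewer units than `q` has left.
  · have hex : ∃ β, I.cnt q β l₁ < R β := by
      by_contra hc
      push Not at hc
      have e1 : ∑ β, R β ≤ ∑ β, I.cnt q β l₁ := Finset.sum_le_sum fun β _ => hc β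
      have e2 : ∑ β, I.cap q β ≤ ∑ β, (R β + I.cnt q β l₀) := Finset.sum_le_sum fun β _ => by
        simp only [hR]; omega
      rw [Finset.sum_add_distrib] at e2
      have e3 := I.sum_cnt_le q l₀ (hl₀.nodup hB)
      simp only [hv₀] at e3
      have e4 := I.sum_cnt_le q l₁ hnd2
      have e5 : {w | G.Adj q w ∧ w ∈ l₁.map Prod.fst}.ncard < {w | G.Adj q w ∧ w ∈ S}.ncard := by
        refine Set.ncard_lt_ncard ⟨?_, ?_⟩ (Set.toFinite _)
        · rintro w ⟨h, h'⟩
          exact ⟨h, ((hl₁ w).1 h').1⟩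
        · intro h
          have := (h ⟨hpq.symm, hp⟩).2
          rw [hl₁] at this
          exact this.2.1 rfl
      have e6 := I.le_sum q
      omega
    obtain ⟨β, hβ⟩ := hex
    have hconf : I.conf q β p α := by
      by_contra hc
      have := hlast β
      rw [hcntap, cnt_append] at this
      simp only [cnt, hc, if_false] at this
      simp only [hR] at hβ
      omega
    -- Since capacities are at most 2, `β` has exactly one unit left, `α` has capacity 2 at `p`, and
    -- no vertex coloured after `p` conflicts with `β`. So `q` can move before `p`: then `p` bears
    -- the conflict as its only one, and nothing later is disturbed.
    have h1 := hα2 β hconf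
    have h2 := I.cap_le p α
    have h0 : I.cnt q β l₁ = 0 := by omega
    have hno := not_conf_of_cnt_eq_zero h0
    -- insert `q` directly before `p`
    have hins : ∀ l₂ : List (V × Fin s), (∀ x ∈ l₂, ¬ I.conf q β x.1 x.2) →
        q ∉ l₂.map Prod.fst → (∀ x ∈ l₂, x.1 ∈ S) → I.Good B (l₂ ++ (p, α) :: l₀) →
        I.Good B (l₂ ++ (p, α) :: (q, β) :: l₀) := by
      intro l₂
      induction l₂ with
      | nil =>
        intro _ _ _ hg
        have hq0 : q ∉ l₀.map Prod.fst := fun h => (hv₀ q).1 h hq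
        have hp0 : p ∉ l₀.map Prod.fst := fun h => (hv₀ p).1 h hp
        refine Good.cons (Good.cons hl₀ hq0 ?_) ?_ ?_
        · simp only [hR] at hβ; simp only; omega
        · simp only [List.map_cons, List.mem_cons, not_or]
          exact ⟨hpq.ne, hp0⟩
        · have h5 : I.cnt p α l₀ = 0 := cnt_eq_zero fun x hx hc =>
            (hv₀ x.1).1 (List.mem_map_of_mem hx) (hNp _ (I.adj hc))
          simp only [cnt, I.conf_symm hconf, if_true, h5]
          omega
      | cons x l₂ ih =>
        intro hn hq2 hS2 hg
        have hxq : x.1 ≠ q := by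
          intro h; apply hq2; simp [h]
        rw [List.cons_append] at hg ⊢
        obtain ⟨hg', hx, hlt⟩ := hg.of_cons fun h =>
          (hv₀ x.1).1 (List.mem_map_of_mem (hl₀.base_subset h)) (hS2 x (by simp))
        refine Good.cons (ih (fun y hy => hn y (List.mem_cons_of_mem _ hy))
          (fun h => hq2 (by rw [List.map_cons]; exact List.mem_cons_of_mem _ h))
          (fun y hy => hS2 y (List.mem_cons_of_mem _ hy)) hg') ?_ ?_
        · simp only [List.map_append, List.map_cons, List.mem_append, List.mem_cons] at hx ⊢
          tauto
        · rw [cnt_append] at hlt ⊢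
          have hxc : ¬ I.conf x.1 x.2 q β := fun h => hn x (by simp) (I.conf_symm h)
          simpa [cnt, hxc] using hlt
    refine ⟨_, hins l₁ hno (fun h => hqm ?_)
      (fun x hx => ((hl₁ x.1).1 (List.mem_map_of_mem hx)).1) hg, fun v => ?_⟩
    · rw [List.map_append]; exact List.mem_append_left _ h
    · by_cases hv : v = q
      · simp [hv]
      · have := hmem v hv
        simp only [List.map_append, List.map_cons, List.mem_append, List.mem_cons] at this ⊢
        tauto

end Inst

/-! ### Critical instances -/
/-- A precoloured clique with one or two vertices. -/
structure IsBase {V : Type u} (G : SimpleGraph V) {s : ℕ} (B : List (V × Fin s)) : Prop where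
  ne_nil : B ≠ []
  length_le : B.length ≤ 2
  adj : (B.map Prod.fst).Pairwise G.Adj

theorem IsBase.nodup {V : Type u} {G : SimpleGraph V} {s : ℕ} {B : List (V × Fin s)}
    (h : IsBase G B) : (B.map Prod.fst).Nodup :=
  h.adj.imp fun h => h.ne

theorem IsBase.adj_of_ne {V : Type u} {G : SimpleGraph V} {s : ℕ} {B : List (V × Fin s)}
    (h : IsBase G B) {u v : V} (hu : u ∈ B.map Prod.fst) (hv : v ∈ B.map Prod.fst) (huv : u ≠ v) :
    G.Adj u v :=
  have : Std.Symm G.Adj := ⟨fun _ _ h => h.symm⟩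
  h.adj.forall hu hv huv

/-- Every proper set of vertices has a good colouring that starts with any precoloured base in the
set. -/
def Inst.Extends {V : Type u} {G : SimpleGraph V} {s : ℕ} (I : Inst G s) : Prop :=
  ∀ T : Set V, T ≠ Set.univ → ∀ B : List (V × Fin s), IsBase G B → (∀ v ∈ B.map Prod.fst, v ∈ T) →
    ∃ l, I.Good B l ∧ ∀ v, v ∈ l.map Prod.fst ↔ v ∈ T

/-- The properties of a smallest graph with a precoloured clique `C` that does not extend. -/
structure Critical {V : Type u} (G : SimpleGraph V) (C : Set V) : Prop where
  nonempty : C.Nonempty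
  ncard_le : C.ncard ≤ 2
  clique : ∀ u ∈ C, ∀ v ∈ C, u ≠ v → G.Adj u v
  deg : ∀ v, v ∉ C → 3 ≤ (G.neighborSet v).ncard
  exists_notMem : ∃ v, v ∉ C
  cut : ∀ w, (G.induce {v | v ≠ w}).Preconnected
  edge_cut : ∀ w w', G.Adj w w' → (G.induce {v | v ≠ w ∧ v ≠ w'}).Preconnected
  irreducible : ∀ (S : Set V) (p q : V), (∀ v ∈ S, v ∉ C) → p ∈ S → q ∈ S → G.Adj p q →
    (∀ w, G.Adj p w → w ∈ S) → (G.neighborSet q).ncard ≤ 3 → (∃ w, G.Adj q w ∧ w ∉ S) →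
    ¬ ∀ Y ⊆ S, p ∉ Y → q ∈ Y → (∃ v ∈ S, v ≠ p ∧ v ∉ Y) →
      ∃ v ∈ S, v ≠ p ∧ v ∉ Y ∧ (G.neighborSet v).ncard ≤ 2 + {w | G.Adj v w ∧ w ∈ Y}.ncard

namespace Inst

variable {V : Type u} {G : SimpleGraph V} {s : ℕ} {I : Inst G s}

theorem cnt_le_cnt {v : V} {i : Fin s} {l l' : List (V × Fin s)} (hl : l.Nodup)
    (h : ∀ x ∈ l, I.conf v i x.1 x.2 → x ∈ l') : I.cnt v i l ≤ I.cnt v i l' := by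
  classical
  induction l generalizing l' with
  | nil => simp [cnt]
  | cons x l ih =>
    rw [List.nodup_cons] at hl
    by_cases hx : I.conf v i x.1 x.2
    · obtain ⟨s₁, s₂, rfl⟩ := List.append_of_mem (h x (by simp) hx)
      have := ih (l' := s₁ ++ s₂) hl.2 fun y hy hc => by
        have h1 := h y (by simp [hy]) hc
        have h2 : y ≠ x := fun e => hl.1 (e ▸ hy)
        simp only [List.mem_append, List.mem_cons] at h1 ⊢
        tauto
      rw [cnt_append] at this ⊢
      simp only [cnt, hx, if_true]
      omega
    · simp only [cnt, hx, if_false, zero_add]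
      exact ih hl.2 fun y hy => h y (by simp [hy])

/-- Gluing colourings along a clique with one or two vertices. -/
theorem exists_good_glue {B : List (V × Fin s)} {W : List V} (hB : IsBase G B) (hW0 : W ≠ [])
    (hW2 : W.length ≤ 2) (hW : W.Pairwise G.Adj) {K K' : Set V}
    (hK : ∀ v, v ∈ W ∨ v ∈ K ∨ v ∈ K') (hd : ∀ v ∈ K, v ∉ K') (hWK : ∀ w ∈ W, w ∉ K)
    (hWK' : ∀ w ∈ W, w ∉ K') (hno : ∀ x ∈ K, ∀ y ∈ K', ¬ G.Adj x y)
    (hne : K.Nonempty) (hne' : K'.Nonempty) (hBK : ∀ v ∈ B.map Prod.fst, v ∉ K')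
    (hI : I.Extends) : ∃ l, I.Good B l ∧ ∀ v, v ∈ l.map Prod.fst := by
  obtain ⟨x, hx⟩ := hne
  obtain ⟨y, hy⟩ := hne'
  -- Colour the side that holds the base. The colours that `W` receives form a new base for the
  -- other side; as `W` may have two vertices, bases with two vertices have to be admitted in the
  -- induction.
  obtain ⟨l₁, hg₁, hl₁⟩ := hI K'ᶜ (fun h => by
    have : y ∈ K'ᶜ := h ▸ Set.mem_univ y
    exact this hy) B hB hBK
  have hnd₁ := hg₁.nodup hB.nodup
  have hex : ∀ w ∈ W, ∃ j, (w, j) ∈ l₁ := by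
    intro w hw
    obtain ⟨⟨w', j⟩, h1, h2⟩ := List.mem_map.1 ((hl₁ w).2 (hWK' w hw))
    obtain rfl : w' = w := h2
    exact ⟨j, h1⟩
  have hexc : ∃ B' : List (V × Fin s), B'.map Prod.fst = W ∧ ∀ b ∈ B', b ∈ l₁ := by
    clear hK hWK hWK' hW hW0 hW2
    induction W with
    | nil => exact ⟨[], rfl, by simp⟩
    | cons w W ih =>
      obtain ⟨B', h1, h2⟩ := ih fun w hw => hex w (by simp [hw])
      obtain ⟨j, hj⟩ := hex w (by simp)
      refine ⟨(w, j) :: B', by simp [h1], ?_⟩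
      intro b hb
      rcases List.mem_cons.1 hb with rfl | hb
      · exact hj
      · exact h2 b hb
  obtain ⟨B', hB'W, hB'l⟩ := hexc
  have hB' : IsBase G B' := by
    refine ⟨fun h => hW0 (by rw [← hB'W, h]; rfl), ?_, hB'W ▸ hW⟩
    rw [← List.length_map (f := Prod.fst), hB'W]; exact hW2
  obtain ⟨l₂, hg₂, hl₂⟩ := hI Kᶜ (fun h => by
    have : x ∈ Kᶜ := h ▸ Set.mem_univ x
    exact this hx) B' hB' (by rw [hB'W]; exact hWK)
  have hc₁ : ∀ v ∈ K', ∀ i, I.cnt v i l₁ ≤ I.cnt v i B' := by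
    intro v hv i
    refine cnt_le_cnt (List.Nodup.of_map _ hnd₁) fun z hz hc => ?_
    have hzK' : z.1 ∉ K' := (hl₁ z.1).1 (List.mem_map_of_mem hz)
    have hzW : z.1 ∈ W := by
      rcases hK z.1 with h | h | h
      · exact h
      · exact absurd (I.adj hc).symm (hno z.1 h v hv)
      · exact absurd h hzK'
    rw [← hB'W] at hzW
    obtain ⟨z', hz', hzz⟩ := List.mem_map.1 hzW
    have : z' = z := List.inj_on_of_nodup_map hnd₁ (hB'l z' hz') hz hzz
    exact this ▸ hz'
  -- The second colouring is replayed on top of the first. Vertices of `K'` see the first colouring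
  -- only through `W`, so their numbers of conflicts do not grow.
  have key : ∀ l, I.Good B' l → (∀ v ∈ l.map Prod.fst, v ∉ K) →
      ∃ l', I.Good B l' ∧ (∀ v, v ∈ l'.map Prod.fst ↔ v ∈ l₁.map Prod.fst ∨ v ∈ l.map Prod.fst) ∧
        ∀ v ∈ K', ∀ i, I.cnt v i l' ≤ I.cnt v i l := by
    intro l hl
    induction hl with
    | base =>
      intro _
      refine ⟨l₁, hg₁, fun v => ⟨Or.inl, ?_⟩, hc₁⟩
      rintro (h | h)
      · exact h
      · obtain ⟨z, hz, rfl⟩ := List.mem_map.1 h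
        exact List.mem_map_of_mem (hB'l z hz)
    | @cons x l hl hx hlt ih =>
      intro hA
      obtain ⟨l', hg, hm, hc⟩ := ih fun v hv => hA v (List.mem_cons_of_mem _ hv)
      have hxA : x.1 ∉ K := hA _ (by simp)
      have hxw : x.1 ∉ W := fun h => hx (by
        rw [← hB'W] at h
        obtain ⟨z, hz, hzx⟩ := List.mem_map.1 h
        exact hzx ▸ List.mem_map_of_mem (hl.base_subset hz))
      have hxB : x.1 ∈ K' := by
        rcases hK x.1 with h | h | h
        · exact absurd h hxw
        · exact absurd h hxA
        · exact h
      refine ⟨x :: l', Good.cons hg ?_ ((hc _ hxB _).trans_lt hlt), ?_, ?_⟩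
      · rw [hm, hl₁]
        rintro (h | h)
        · exact h hxB
        · exact hx h
      · intro v
        rw [List.map_cons, List.map_cons, List.mem_cons, List.mem_cons, hm]; tauto
      · intro v hv i
        simp only [cnt]
        exact Nat.add_le_add_left (hc v hv i) _
  obtain ⟨l', hg, hm, -⟩ := key l₂ hg₂ fun v hv => (hl₂ v).1 hv
  refine ⟨l', hg, fun v => (hm v).2 ?_⟩
  rw [hl₁, hl₂]
  by_cases hv : v ∈ K'
  · exact Or.inr fun h => hd v h hv
  · exact Or.inl hv

/-- A graph with a base that does not extend is not separated by a small clique. -/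
theorem preconnected_of_not_good {B : List (V × Fin s)} (hI : I.Extends) (hB : IsBase G B)
    (hb : ¬ ∃ l, I.Good B l ∧ ∀ v, v ∈ l.map Prod.fst) {W : List V} (hW0 : W ≠ [])
    (hW2 : W.length ≤ 2) (hW : W.Pairwise G.Adj) : (G.induce {v | v ∉ W}).Preconnected := by
  by_contra hc
  simp only [SimpleGraph.Preconnected, not_forall] at hc
  obtain ⟨x, y, hxy⟩ := hc
  let H := G.induce {v | v ∉ W}
  let K : Set V := {v | ∃ h : v ∉ W, H.Reachable x ⟨v, h⟩}
  let K' : Set V := {v | ∃ h : v ∉ W, ¬ H.Reachable x ⟨v, h⟩}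
  have hK : ∀ v, v ∈ W ∨ v ∈ K ∨ v ∈ K' := by
    intro v
    by_cases h : v ∈ W
    · exact Or.inl h
    · by_cases h' : H.Reachable x ⟨v, h⟩
      · exact Or.inr (Or.inl ⟨h, h'⟩)
      · exact Or.inr (Or.inr ⟨h, h'⟩)
  have hd : ∀ v ∈ K, v ∉ K' := fun v ⟨_, h⟩ ⟨_, h'⟩ => h' h
  have hWK : ∀ w ∈ W, w ∉ K := fun w hw ⟨h, _⟩ => h hw
  have hWK' : ∀ w ∈ W, w ∉ K' := fun w hw ⟨h, _⟩ => h hw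
  have hno : ∀ x ∈ K, ∀ y ∈ K', ¬ G.Adj x y := by
    rintro a ⟨ha, ha'⟩ c ⟨hc, hc'⟩ hadj
    exact hc' (ha'.trans (SimpleGraph.Adj.reachable (G := H) (u := ⟨a, ha⟩) (v := ⟨c, hc⟩) hadj))
  have hne : K.Nonempty := ⟨x.1, x.2, SimpleGraph.Reachable.refl _⟩
  have hne' : K'.Nonempty := ⟨y.1, y.2, hxy⟩
  have hBadj : ∀ u ∈ B.map Prod.fst, ∀ v ∈ B.map Prod.fst, u ≠ v → G.Adj u v :=
    fun u hu v hv huv => hB.adj_of_ne hu hv huv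
  -- The base is a clique, so it cannot meet both sides of the separation; the two sides are
  -- exchanged if necessary.
  by_cases hBK : ∀ v ∈ B.map Prod.fst, v ∉ K'
  · exact hb (exists_good_glue hB hW0 hW2 hW hK hd hWK hWK' hno hne hne' hBK hI)
  · push Not at hBK
    obtain ⟨u, hu, huK'⟩ := hBK
    refine hb (exists_good_glue (K := K') (K' := K) hB hW0 hW2 hW
      (fun v => by have := hK v; tauto) (fun v h h' => hd v h' h) hWK' hWK
      (fun x hx y hy h => hno y hy x hx h.symm) hne' hne (fun v hv hvK => ?_) hI)
    exact hno v hvK u huK' (hBadj v hv u hu fun h => hd v hvK (h ▸ huK'))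

/-- Each property states that some proper vertex set would otherwise extend to everything: delete a
vertex of small degree, glue along a small clique, or delete a reducible set. Entries of the base
need not respect capacities, which is why `C` is exempt from the degree condition. -/
theorem critical_of_not_good [Finite V] {B : List (V × Fin s)} (hI : I.Extends) (hB : IsBase G B)
    (hb : ¬ ∃ l, I.Good B l ∧ ∀ v, v ∈ l.map Prod.fst) : Critical G {v | v ∈ B.map Prod.fst} where
  nonempty := by
    obtain ⟨b, hb⟩ := List.exists_mem_of_ne_nil B hB.ne_nil
    exact ⟨b.1, List.mem_map_of_mem hb⟩
  ncard_le := by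
    classical
    have : {v | v ∈ B.map Prod.fst} = ((B.map Prod.fst).toFinset : Set V) := by ext; simp
    rw [this, Set.ncard_coe_finset]
    refine (List.toFinset_card_le _).trans ?_
    rw [List.length_map]; exact hB.length_le
  clique u hu v hv huv := hB.adj_of_ne hu hv huv
  deg v hv := by
    by_contra hlt
    push Not at hlt
    apply hb
    obtain ⟨l, hg, hl⟩ := hI {v}ᶜ (fun h => by
      have : v ∈ ({v}ᶜ : Set V) := h ▸ Set.mem_univ v
      exact this rfl) B hB (fun w hw h => by
        rw [Set.mem_singleton_iff] at h; subst h; exact hv hw)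
    have hvl : v ∉ l.map Prod.fst := fun h => (hl v).1 h rfl
    obtain ⟨i, hi⟩ := I.exists_cnt_lt v l (hg.nodup hB.nodup) (by
      refine (Set.ncard_le_ncard (t := G.neighborSet v) ?_ (Set.toFinite _)).trans (by omega)
      rintro w ⟨h, -⟩; exact h)
    refine ⟨(v, i) :: l, Good.cons hg hvl hi, fun w => ?_⟩
    by_cases hw : w = v
    · simp [hw]
    · rw [List.map_cons]; exact List.mem_cons_of_mem _ ((hl w).2 hw)
  exists_notMem := by
    by_contra hc
    push Not at hc
    exact hb ⟨B, Good.base, hc⟩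
  cut w := by
    have := preconnected_of_not_good hI hB hb (W := [w]) (by simp) (by simp) (by simp)
    have e : {v | v ∉ [w]} = {v | v ≠ w} := by ext; simp
    rwa [e] at this
  edge_cut w w' h := by
    have := preconnected_of_not_good hI hB hb (W := [w, w']) (by simp) (by simp) (by simpa using h)
    have e : {v | v ∉ [w, w']} = {v | v ≠ w ∧ v ≠ w'} := by ext; simp
    rwa [e] at this
  irreducible S p q h1 h2 h3 h4 h5 h6 h7 h8 := by
    obtain ⟨l₀, hg, hl⟩ := hI Sᶜ (fun h => by
      have : p ∈ Sᶜ := h ▸ Set.mem_univ p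
      exact this h2) B hB (fun v hv hS => h1 v hS hv)
    exact hb (exists_good_of_reducible hB.nodup h2 h3 h4 h5 h6 h7 h8 hg hl)

/-- The restriction of an instance to a set of vertices. -/
def restrict (I : Inst G s) (T : Set V) : Inst (G.induce T) s where
  conf v i w j := I.conf v i w j
  conf_symm h := I.conf_symm h
  adj h := I.adj h
  unique h h' := I.unique h h'
  cap v i := I.cap v i
  cap_le v i := I.cap_le v i
  le_sum v := I.le_sum v

theorem cnt_restrict (T : Set V) (v : T) (i : Fin s) (l : List (T × Fin s)) :
    (I.restrict T).cnt v i l = I.cnt v i (l.map fun x => (x.1.1, x.2)) := by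
  induction l with
  | nil => rfl
  | cons x l ih => simp only [cnt, List.map_cons, ih]; rfl

theorem Good.of_restrict {T : Set V} {B : List (T × Fin s)} {l : List (T × Fin s)}
    (h : (I.restrict T).Good B l) :
    I.Good (B.map fun x => (x.1.1, x.2)) (l.map fun x => (x.1.1, x.2)) := by
  induction h with
  | base => exact Good.base
  | @cons x l _ hx hlt ih =>
    refine Good.cons ih ?_ ?_
    · intro hm
      apply hx
      simp only [List.map_map, List.mem_map, Function.comp] at hm ⊢
      obtain ⟨a, ha, hax⟩ := hm
      exact ⟨a, ha, Subtype.ext hax⟩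
    · rw [cnt_restrict] at hlt; exact hlt

end Inst

/-- A hereditary class without critical graphs consists of graphs in which every precoloured base
extends. -/
theorem exists_good_of_hereditary (P : ∀ {V : Type u}, SimpleGraph V → Prop)
    (hP : ∀ {V : Type u} [Finite V] (G : SimpleGraph V) (T : Set V), P G → P (G.induce T))
    (hcrit : ∀ {V : Type u} [Finite V] (G : SimpleGraph V) (C : Set V), P G → ¬ Critical G C)
    {s : ℕ} (n : ℕ) : ∀ {V : Type u} [Finite V] (G : SimpleGraph V), Nat.card V = n → P G →
    ∀ (I : Inst G s) (B : List (V × Fin s)), IsBase G B →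
      ∃ l, I.Good B l ∧ ∀ v, v ∈ l.map Prod.fst := by
  induction n using Nat.strong_induction_on with
  | _ n ih =>
    intro V _ G hn hG I B hB
    by_contra hb
    refine hcrit G _ hG (I.critical_of_not_good ?_ hB hb)
    intro T hT B' hB' hBT
    have hlt : Nat.card T < n := by
      rw [← hn]
      obtain ⟨x, hx⟩ := (Set.ne_univ_iff_exists_notMem T).1 hT
      exact Finite.card_subtype_lt hx
    -- The induction hypothesis applies to the induced subgraph on `T`, so the base is moved there
    -- and the colouring obtained is moved back.
    let B'' : List (T × Fin s) := B'.attach.map fun x =>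
      (⟨x.1.1, hBT _ (List.mem_map_of_mem x.2)⟩, x.1.2)
    have hmap : (B''.map fun x => (x.1.1, x.2)) = B' := by
      simp only [B'', List.map_map]
      exact List.attach_map_subtype_val B'
    have hB'' : IsBase (G.induce T) B'' := by
      refine ⟨fun h => hB'.ne_nil ?_, ?_, ?_⟩
      · rw [← hmap, h]; rfl
      · simpa [B''] using hB'.length_le
      · have h1 := hB'.adj
        rw [← hmap, List.map_map, List.pairwise_map] at h1
        rw [List.pairwise_map]
        exact h1
    obtain ⟨l, hg, hl⟩ := ih _ hlt (G.induce T) rfl (hP G T hG) (I.restrict T) B'' hB''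
    refine ⟨_, hmap ▸ hg.of_restrict, fun v => ?_⟩
    simp only [List.map_map, List.mem_map, Function.comp]
    constructor
    · rintro ⟨a, -, rfl⟩; exact a.1.2
    · intro hv
      obtain ⟨a, ha, hav⟩ := List.mem_map.1 (hl ⟨v, hv⟩)
      exact ⟨a, ha, congrArg Subtype.val hav⟩

end DPG

namespace DPG

/-! ### From good colourings to the colouring properties -/

/-- The rank of a vertex is the number of entries present when it is added, so the precoloured
vertex has rank 0 and earlier entries are exactly those of lower rank. -/
theorem Inst.Good.exists_rank {V : Type u} [Finite V] {G : SimpleGraph V} {s : ℕ} {I : Inst G s}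
    {b : V × Fin s} {l : List (V × Fin s)} (h : I.Good [b] l) :
    ∃ (c : V → Fin s) (rank : V → ℕ), (∀ x ∈ l, c x.1 = x.2) ∧
      (∀ v ∈ l.map Prod.fst, rank v < l.length) ∧ Set.InjOn rank {v | v ∈ l.map Prod.fst} ∧
      rank b.1 = 0 ∧ ∀ v ∈ l.map Prod.fst, v ≠ b.1 →
        {w | w ∈ l.map Prod.fst ∧ I.conf v (c v) w (c w) ∧ rank w < rank v}.ncard <
          I.cap v (c v) := by
  classical
  induction h with
  | base =>
    refine ⟨fun _ => b.2, fun _ => 0, by simp, by simp, ?_, rfl, ?_⟩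
    · intro v hv w hw _
      simp only [List.map_cons, List.map_nil, List.mem_singleton, Set.mem_ofPred_eq] at hv hw
      rw [hv, hw]
    · intro v hv hvb
      simp only [List.map_cons, List.map_nil, List.mem_singleton] at hv
      exact absurd hv hvb
  | @cons x l hl hx hlt ih =>
    obtain ⟨c, rank, h1, h2, h3, h4, h5⟩ := ih
    have hbx : b.1 ≠ x.1 := fun h => hx (h ▸ List.mem_map_of_mem (hl.base_subset (by simp)))
    have hne : ∀ v ∈ l.map Prod.fst, v ≠ x.1 := fun v hv h => hx (h ▸ hv)
    have hcl : ∀ v ∈ l.map Prod.fst, Function.update c x.1 x.2 v = c v :=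
      fun v hv => Function.update_of_ne (hne v hv) _ _
    have hrl : ∀ v ∈ l.map Prod.fst, Function.update rank x.1 l.length v = rank v :=
      fun v hv => Function.update_of_ne (hne v hv) _ _
    refine ⟨Function.update c x.1 x.2, Function.update rank x.1 l.length, ?_, ?_, ?_, ?_, ?_⟩
    · intro y hy
      rcases List.mem_cons.1 hy with rfl | hy
      · simp
      · rw [hcl _ (List.mem_map_of_mem hy), h1 y hy]
    · intro v hv
      rw [List.map_cons, List.mem_cons] at hv
      rcases hv with rfl | hv
      · simp
      · rw [hrl v hv, List.length_cons]; have := h2 v hv; omega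
    · intro v hv w hw hvw
      simp only [List.map_cons, List.mem_cons, Set.mem_ofPred_eq] at hv hw
      rcases hv with rfl | hv <;> rcases hw with rfl | hw
      · rfl
      · rw [hrl w hw, Function.update_self] at hvw
        have := h2 w hw; omega
      · rw [hrl v hv, Function.update_self] at hvw
        have := h2 v hv; omega
      · rw [hrl w hw, hrl v hv] at hvw
        exact h3 hv hw hvw
    · rw [Function.update_of_ne hbx, h4]
    · intro v hv hvb
      rw [List.map_cons, List.mem_cons] at hv
      rcases hv with rfl | hv
      · rw [Function.update_self]
        refine lt_of_le_of_lt ?_ hlt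
        have key : ∀ l' : List (V × Fin s), (∀ y ∈ l', y ∈ l) →
            {w | w ∈ l'.map Prod.fst ∧ I.conf x.1 x.2 w (c w)}.ncard ≤ I.cnt x.1 x.2 l' := by
          intro l'
          induction l' with
          | nil => intro _; simp
          | cons y l' ih' =>
            intro hy
            have e1 := ih' fun z hz => hy z (List.mem_cons_of_mem _ hz)
            have e2 := h1 y (hy y (by simp))
            simp only [cnt]
            by_cases hc : I.conf x.1 x.2 y.1 y.2
            · rw [if_pos hc]
              refine (Set.ncard_le_ncard (t := insert y.1
                {w | w ∈ l'.map Prod.fst ∧ I.conf x.1 x.2 w (c w)}) ?_ (Set.toFinite _)).trans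
                ((Set.ncard_insert_le _ _).trans (by omega))
              rintro w ⟨h, h'⟩
              rw [List.map_cons, List.mem_cons] at h
              rcases h with rfl | h
              · exact Or.inl rfl
              · exact Or.inr ⟨h, h'⟩
            · rw [if_neg hc, zero_add]
              refine (Set.ncard_le_ncard ?_ (Set.toFinite _)).trans e1
              rintro w ⟨h, h'⟩
              rw [List.map_cons, List.mem_cons] at h
              rcases h with rfl | h
              · rw [e2] at h'; exact absurd h' hc
              · exact ⟨h, h'⟩
        refine (Set.ncard_le_ncard ?_ (Set.toFinite _)).trans (key l fun _ h => h)
        rintro w ⟨hw, hc, hr⟩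
        rw [List.map_cons, List.mem_cons] at hw
        rcases hw with rfl | hw
        · exact absurd hr (lt_irrefl _)
        · rw [hcl w hw] at hc; exact ⟨hw, hc⟩
      · rw [hcl v hv]
        refine lt_of_le_of_lt (Set.ncard_le_ncard ?_ (Set.toFinite _)) (h5 v hv hvb)
        rintro w ⟨hw, hc, hr⟩
        rw [hrl v hv] at hr
        rw [List.map_cons, List.mem_cons] at hw
        rcases hw with rfl | hw
        · rw [Function.update_self] at hr
          have := h2 v hv; omega
        · rw [hcl w hw] at hc
          rw [hrl w hw] at hr
          exact ⟨hw, hc, hr⟩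

/-- Every instance has an ordered colouring that respects the capacities. -/
def AllColorable {V : Type u} (G : SimpleGraph V) : Prop :=
  ∀ (s : ℕ) (I : Inst G s), ∃ (c : V → Fin s) (rank : V → ℕ), Function.Injective rank ∧
    ∀ v, {w | I.conf v (c v) w (c w) ∧ rank w < rank v}.ncard < I.cap v (c v)

/-- The precoloured vertex is not bound by its capacity. It is given a colour of capacity at least
1, which suffices because it is first in the order. -/
theorem allColorable_of_good {V : Type u} [Finite V] {G : SimpleGraph V}
    (h : ∀ (s : ℕ) (I : Inst G s) (b : V × Fin s), ∃ l, I.Good [b] l ∧ ∀ v, v ∈ l.map Prod.fst) :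
    AllColorable G := by
  intro s I
  rcases isEmpty_or_nonempty V with hV | ⟨⟨u₀⟩⟩
  · exact ⟨hV.elim, hV.elim, fun v => hV.elim v, fun v => hV.elim v⟩
  obtain ⟨i, hi⟩ : ∃ i, 1 ≤ I.cap u₀ i := by
    by_contra hc
    push Not at hc
    have h0 : ∀ i, I.cap u₀ i = 0 := fun i => by have := hc i; omega
    have := I.le_sum u₀
    simp [h0] at this
  obtain ⟨l, hl, hv⟩ := h s I (u₀, i)
  obtain ⟨c, rank, h1, -, h3, h4, h5⟩ := hl.exists_rank
  refine ⟨c, rank, fun v w hvw => h3 (hv v) (hv w) hvw, fun v => ?_⟩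
  by_cases hvu : v = u₀
  · subst hvu
    have hcu : c v = i := h1 (v, i) (hl.base_subset (by simp))
    have : {w | I.conf v (c v) w (c w) ∧ rank w < rank v} = ∅ := by
      ext w; simp only [Set.mem_ofPred_eq, Set.mem_empty_iff_false, iff_false]
      rintro ⟨-, h⟩; simp only at h4; omega
    rw [this, Set.ncard_empty, hcu]; exact hi
  · refine lt_of_le_of_lt (Set.ncard_le_ncard ?_ (Set.toFinite _)) (h5 v (hv v) hvu)
    rintro w ⟨h, h'⟩; exact ⟨hv w, h, h'⟩

/-- The highest vertex of a cycle would have two distinct lower neighbours. -/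
theorem isAcyclic_of_rank {W : Type*} (H : SimpleGraph W) (rank : W → ℕ)
    (hinj : Function.Injective rank)
    (h : ∀ v x y, H.Adj v x → H.Adj v y → rank x < rank v → rank y < rank v → x = y) :
    H.IsAcyclic := by
  classical
  intro v p hp
  obtain ⟨x, hx, hmax⟩ := p.support.toFinset.exists_max_image rank ⟨v, by simp⟩
  rw [List.mem_toFinset] at hx
  set q := p.rotate x hx with hq
  have hqc : q.IsCycle := hp.rotate hx
  have hmem : ∀ y ∈ q.support, y ≠ x → rank y < rank x := by
    intro y hy hyx
    have hy' : y ∈ p.support := (p.mem_support_rotate_iff x hx).1 hy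
    have := hmax y (List.mem_toFinset.2 hy')
    exact lt_of_le_of_ne this fun h => hyx (hinj h)
  have hnil : ¬ q.Nil := hqc.not_nil
  have a1 := q.adj_snd hnil
  have a2 := q.adj_penultimate hnil
  refine hqc.snd_ne_penultimate (h x _ _ a1 a2.symm ?_ ?_)
  · exact hmem _ (q.getVert_mem_support _) a1.ne'
  · exact hmem _ (q.getVert_mem_support _) a2.ne

section Consequences

variable {V : Type u} [Finite V] {G : SimpleGraph V}

/-- The functions `f` serve as capacities. A colour outside the list has capacity 0 and therefore is
never chosen, so the colouring really is a representative set. -/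
theorem AllColorable.dpg (h : AllColorable G) : DPGColorable G 3 2 := by
  intro s L H f hf0 hf3 hf2
  let I : Inst G s :=
    { conf := fun v i w j => v ≠ w ∧ ∃ (hi : i ∈ L v) (hj : j ∈ L w),
        H.graph.Adj ⟨v, i, hi⟩ ⟨w, j, hj⟩
      conf_symm := fun ⟨h, hi, hj, ha⟩ => ⟨h.symm, hj, hi, ha.symm⟩
      adj := fun {v i w j} ⟨h, hi, hj, ha⟩ => by
        by_contra hc; exact H.not_adj v w h hc _ _ ha
      unique := fun {v i w j j'} ⟨h, hi, hj, ha⟩ ⟨_, _, hj', ha'⟩ => by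
        have hadj : G.Adj v w := by
          by_contra hc; exact H.not_adj v w h hc _ _ ha
        exact congrArg Subtype.val (H.matching v w hadj _ _ _ ha ha')
      cap := fun v i => f i v
      cap_le := fun v i => hf2 v i
      le_sum := hf3 }
  obtain ⟨c, rank, hinj, hc⟩ := h s I
  have hcL : ∀ v, c v ∈ L v := by
    intro v
    by_contra hcv
    have h1 := hc v
    have h2 : I.cap v (c v) = 0 := hf0 v _ hcv
    omega
  have heq : ∀ x y : ListPair L, x.2.1 = c x.1 → y.2.1 = c y.1 → x.1 = y.1 → x = y := by
    rintro ⟨v, i, hi⟩ ⟨w, j, hj⟩ h1 h2 h3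
    simp only at h1 h2 h3
    subst h3 h1 h2; rfl
  refine ⟨{x | x.2.1 = c x.1}, fun v => ⟨⟨c v, hcL v⟩, rfl, fun y hy => Subtype.ext hy⟩,
    fun x => rank x.1, fun x hx y hy hxy => heq x y hx hy (hinj hxy), ?_⟩
  intro x hx
  have hx' : x.2.1 = c x.1 := hx
  rw [hx']
  refine lt_of_le_of_lt ?_ (hc x.1)
  refine Set.ncard_le_ncard_of_injOn (fun y : ListPair L => y.1) ?_ ?_ (Set.toFinite _)
  · rintro y ⟨hy, hadj, hr⟩
    have hy' : y.2.1 = c y.1 := hy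
    refine ⟨⟨fun h => hadj.ne (heq x y hx hy h), hcL _, hcL _, ?_⟩, hr⟩
    have e1 : (⟨x.1, c x.1, hcL _⟩ : ListPair L) = x := heq _ _ rfl hx rfl
    have e2 : (⟨y.1, c y.1, hcL _⟩ : ListPair L) = y := heq _ _ rfl hy rfl
    rw [e1, e2]; exact hadj
  · rintro y ⟨hy, -, -⟩ z ⟨hz, -, -⟩ hyz
    exact heq y z hy hz hyz

/-- Ordered colourings of a cover with lists of size `k`. -/
theorem AllColorable.exists_representative (h : AllColorable G) {C : Type w} {k t : ℕ}
    (L : V → Finset C) (hL : ∀ v, (L v).card = k) (H : Cover G L) (ht : t ≤ 2) (hkt : 3 ≤ k * t) :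
    ∃ (R : Set (ListPair L)) (rank : ListPair L → ℕ), H.IsRepresentative R ∧ Set.InjOn rank R ∧
      ∀ x ∈ R, {y ∈ R | H.graph.Adj x y ∧ rank y < rank x}.ncard < t := by
  have e : ∀ v, Fin k ≃ {c // c ∈ L v} := fun v => ((L v).equivFinOfCardEq (hL v)).symm
  let I : Inst G k :=
    { conf := fun v i w j => v ≠ w ∧ H.graph.Adj ⟨v, e v i⟩ ⟨w, e w j⟩
      conf_symm := fun ⟨h, ha⟩ => ⟨h.symm, ha.symm⟩
      adj := fun {v i w j} ⟨h, ha⟩ => by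
        by_contra hc; exact H.not_adj v w h hc _ _ ha
      unique := fun {v i w j j'} ⟨h, ha⟩ ⟨_, ha'⟩ => by
        have hadj : G.Adj v w := by
          by_contra hc; exact H.not_adj v w h hc _ _ ha
        exact (e w).injective (H.matching v w hadj _ _ _ ha ha')
      cap := fun _ _ => t
      cap_le := fun _ _ => ht
      le_sum := fun v => by simpa using hkt }
  obtain ⟨c, rank, hinj, hc⟩ := h k I
  have heq : ∀ x y : ListPair L, x.2 = e x.1 (c x.1) → y.2 = e y.1 (c y.1) → x.1 = y.1 → x = y := by
    rintro ⟨v, i⟩ ⟨w, j⟩ h1 h2 h3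
    simp only at h1 h2 h3
    subst h3; rw [h1, h2]
  refine ⟨{x | x.2 = e x.1 (c x.1)}, fun x => rank x.1,
    fun v => ⟨e v (c v), rfl, fun y hy => hy⟩,
    fun x hx y hy hxy => heq x y hx hy (hinj hxy), ?_⟩
  intro x hx
  refine lt_of_le_of_lt ?_ (hc x.1)
  refine Set.ncard_le_ncard_of_injOn (fun y : ListPair L => y.1) ?_ ?_ (Set.toFinite _)
  · rintro y ⟨hy, hadj, hr⟩
    refine ⟨⟨fun h => hadj.ne (heq x y hx hy h), ?_⟩, hr⟩
    have e1 : (⟨x.1, e x.1 (c x.1)⟩ : ListPair L) = x := heq _ _ rfl hx rfl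
    have e2 : (⟨y.1, e y.1 (c y.1)⟩ : ListPair L) = y := heq _ _ rfl hy rfl
    rw [e1, e2]; exact hadj
  · rintro y ⟨hy, -, -⟩ z ⟨hz, -, -⟩ hyz
    exact heq y z hy hz hyz

instance {C : Type w} (L : V → Finset C) : Finite (ListPair L) :=
  inferInstanceAs (Finite ((v : V) × {c : C // c ∈ L v}))

/-- Three colours of capacity 1: no vertex has an earlier neighbour in the representative set. -/
theorem AllColorable.dpColorable (h : AllColorable G) : DPColorable.{u, w} G 3 := by
  intro C L hL H
  obtain ⟨R, rank, hR, hinj, hc⟩ := h.exists_representative L hL H (t := 1) (by omega) (by omega)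
  refine ⟨R, hR, ?_⟩
  have key : ∀ x ∈ R, ∀ y ∈ R, rank y < rank x → ¬ H.graph.Adj x y := by
    intro x hx y hy hr hadj
    have h1 := hc x hx
    have h2 : 0 < {y ∈ R | H.graph.Adj x y ∧ rank y < rank x}.ncard :=
      (Set.ncard_pos (Set.toFinite _)).2 ⟨y, hy, hadj, hr⟩
    omega
  intro x hx y hy hadj
  rcases lt_trichotomy (rank x) (rank y) with hr | hr | hr
  · exact key y hy x hx hr hadj.symm
  · exact hadj.ne (hinj hx hy hr)
  · exact key x hx y hy hr hadj

/-- Two colours of capacity 2: every vertex has at most one earlier neighbour, so the representative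
set induces a forest. -/
theorem AllColorable.dpVertexArborable (h : AllColorable G) : DPVertexArborable.{u, w} G 2 := by
  intro C L hL H
  obtain ⟨R, rank, hR, hinj, hc⟩ := h.exists_representative L hL H (t := 2) le_rfl (by omega)
  refine ⟨R, hR, isAcyclic_of_rank _ (fun x => rank x.1)
    (fun x y hxy => Subtype.ext (hinj x.2 y.2 hxy)) ?_⟩
  rintro ⟨v, hv⟩ ⟨x, hx⟩ ⟨y, hy⟩ hvx hvy hrx hry
  have h1 := hc v hv
  exact Subtype.ext ((Set.ncard_le_one (Set.toFinite _)).1 (Nat.le_of_lt_succ h1)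
    x ⟨hx, hvx, hrx⟩ y ⟨hy, hvy, hry⟩)

/-- The distinguished colour `i` gets capacity 1 and every other colour capacity 2. A list of two
colours contains `i` at most once, so the total is at least 3. -/
theorem AllColorable.forested (h : AllColorable G) {C : Type w} (L : V → Finset C)
    (hL : ∀ v, (L v).card = 2) (i : C) :
    ∃ c : V → C, IsForestedColoring G L c ∧ G.IsIndepSet {v | c v = i} := by
  classical
  have e : ∀ v, Fin 2 ≃ {c // c ∈ L v} := fun v => ((L v).equivFinOfCardEq (hL v)).symm
  let I : Inst G 2 :=
    { conf := fun v j w k => G.Adj v w ∧ (e v j).1 = (e w k).1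
      conf_symm := fun ⟨h, ha⟩ => ⟨h.symm, ha.symm⟩
      adj := fun h => h.1
      unique := fun {v i w j j'} ⟨h, ha⟩ ⟨_, ha'⟩ =>
        (e w).injective (Subtype.ext (ha.symm.trans ha'))
      cap := fun v j => if (e v j).1 = i then 1 else 2
      cap_le := fun v j => by split_ifs <;> omega
      le_sum := fun v => by
        rw [Fin.sum_univ_two]
        have : ¬ ((e v 0).1 = i ∧ (e v 1).1 = i) := fun ⟨h1, h2⟩ => by
          have := (e v).injective (Subtype.ext (h1.trans h2.symm))
          exact absurd this (by decide)
        split_ifs <;> first | omega | (exfalso; tauto) }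
  obtain ⟨c, rank, hinj, hc⟩ := h 2 I
  refine ⟨fun v => (e v (c v)).1, ⟨fun v => (e v (c v)).2, fun k => ?_⟩, ?_⟩
  · refine isAcyclic_of_rank _ (fun x => rank x.1) (fun x y hxy => Subtype.ext (hinj hxy)) ?_
    rintro ⟨v, hv⟩ ⟨x, hx⟩ ⟨y, hy⟩ hvx hvy hrx hry
    simp only [Set.mem_ofPred_eq] at hv hx hy
    have h1 := hc v
    have h2 := I.cap_le v (c v)
    have h3 : {w | I.conf v (c v) w (c w) ∧ rank w < rank v}.ncard ≤ 1 := by omega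
    exact Subtype.ext ((Set.ncard_le_one (Set.toFinite _)).1 h3
      x ⟨⟨hvx, hv.trans hx.symm⟩, hrx⟩ y ⟨⟨hvy, hv.trans hy.symm⟩, hry⟩)
  · have key : ∀ v w, (e v (c v)).1 = i → (e w (c w)).1 = i → rank w < rank v → ¬ G.Adj v w := by
      intro v w hv hw hr hadj
      have h1 := hc v
      have h2 : I.cap v (c v) = 1 := if_pos hv
      have h3 : 0 < {w | I.conf v (c v) w (c w) ∧ rank w < rank v}.ncard :=
        (Set.ncard_pos (Set.toFinite _)).2 ⟨w, ⟨hadj, hv.trans hw.symm⟩, hr⟩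
      omega
    intro v hv w hw hvw hadj
    rcases lt_trichotomy (rank v) (rank w) with hr | hr | hr
    · exact key w v hw hv hr hadj.symm
    · exact hvw (hinj hr)
    · exact key v w hv hw hr hadj

/-- Conflicts join equal colours. In a subgraph of one class, the vertex of highest rank has only
earlier neighbours, and these are fewer than its capacity. -/
theorem AllColorable.partitionable (h : AllColorable G) {s : ℕ} (f : Fin s → V → ℕ)
    (hf3 : ∀ v, 3 ≤ ∑ i, f i v) (hf : ∀ v i, f i v ∈ ({0, 1, 2} : Set ℕ)) :
    Partitionable G f := by
  let I : Inst G s :=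
    { conf := fun v i w j => G.Adj v w ∧ i = j
      conf_symm := fun ⟨h, ha⟩ => ⟨h.symm, ha.symm⟩
      adj := fun h => h.1
      unique := fun h h' => h.2.symm.trans h'.2
      cap := fun v i => f i v
      cap_le := fun v i => by
        rcases hf v i with h | h | h <;> rw [h] <;> omega
      le_sum := hf3 }
  obtain ⟨c, rank, hinj, hc⟩ := h s I
  refine ⟨fun i => {v | c v = i}, fun v => ⟨c v, rfl, fun j hj => hj.symm⟩, fun i => ?_⟩
  intro G' hne
  obtain ⟨v, hv, hmax⟩ := Set.exists_max_image G'.verts (fun v => rank v.1) (Set.toFinite _) hne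
  refine ⟨v, hv, ?_⟩
  have hvi : c v.1 = i := v.2
  have h1 := hc v.1
  rw [hvi] at h1
  refine lt_of_le_of_lt ?_ h1
  refine Set.ncard_le_ncard_of_injOn Subtype.val ?_ Subtype.val_injective.injOn (Set.toFinite _)
  intro x hx
  have hadj : G'.Adj v x := hx
  have hxi : c x.1 = i := x.2
  have hG : G.Adj v.1 x.1 := hadj.adj_sub
  refine ⟨⟨hG, hxi.symm⟩, lt_of_le_of_ne (hmax x hadj.snd_mem) fun h => ?_⟩
  exact hG.ne (hinj h).symm

end Consequences

end DPG

namespace DPG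

open Equiv Equiv.Perm

/-! ### Orbits of a permutation as lists of iterates -/

section Orbit

variable {D : Type u}

theorem minimalPeriod_pos_perm [Finite D] (π : Perm D) (d : D) : 0 < Function.minimalPeriod π d := by
  apply Function.minimalPeriod_pos_of_mem_periodicPts
  obtain ⟨n, hn, h⟩ := isOfFinOrder_iff_pow_eq_one.1 (isOfFinOrder_of_finite π)
  refine ⟨n, hn, ?_⟩
  change π^[n] d = d
  rw [iterate_eq_pow, h]; rfl

theorem iterate_minimalPeriod_perm (π : Perm D) (d : D) : π^[Function.minimalPeriod π d] d = d :=
  Function.iterate_minimalPeriod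

theorem sameCycle_iff_exists_lt [Finite D] (π : Perm D) (d e : D) :
    SameCycle π d e ↔ ∃ i < Function.minimalPeriod π d, π^[i] d = e := by
  constructor
  · intro h
    obtain ⟨n, hn⟩ := h.exists_nat_pow_eq
    refine ⟨n % Function.minimalPeriod π d, Nat.mod_lt _ (minimalPeriod_pos_perm π d), ?_⟩
    rw [Function.iterate_mod_minimalPeriod_eq, iterate_eq_pow, hn]
  · rintro ⟨i, -, h⟩
    exact ⟨i, by rw [zpow_natCast, ← iterate_eq_pow, h]⟩

theorem sameCycle_iterate (π : Perm D) (d : D) (i : ℕ) : SameCycle π d (π^[i] d) :=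
  ⟨i, by rw [zpow_natCast, ← iterate_eq_pow]⟩

theorem iterate_inj_of_lt (π : Perm D) (d : D) {i j : ℕ} (hi : i < Function.minimalPeriod π d)
    (hj : j < Function.minimalPeriod π d) (h : π^[i] d = π^[j] d) : i = j :=
  Function.iterate_injOn_Iio_minimalPeriod hi hj h

theorem minimalPeriod_iterate_perm [Finite D] (π : Perm D) (d : D) (i : ℕ) :
    Function.minimalPeriod π (π^[i] d) = Function.minimalPeriod π d := by
  induction i with
  | zero => rfl
  | succ i ih =>
    rw [Function.iterate_succ_apply', Function.minimalPeriod_apply, ih]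
    exact Function.minimalPeriod_pos_iff_mem_periodicPts.1 (minimalPeriod_pos_perm π _)

theorem minimalPeriod_eq_of_sameCycle [Finite D] {π : Perm D} {d e : D} (h : SameCycle π d e) :
    Function.minimalPeriod π d = Function.minimalPeriod π e := by
  obtain ⟨i, -, rfl⟩ := (sameCycle_iff_exists_lt π d e).1 h
  exact (minimalPeriod_iterate_perm π d i).symm

open Classical in
theorem sum_sameCycle [Fintype D] {M : Type*} [AddCommMonoid M] (π : Perm D) (d : D) (X : D → M) :
    ∑ e with SameCycle π d e, X e = ∑ i ∈ Finset.range (Function.minimalPeriod π d), X (π^[i] d) := by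
  symm
  refine Finset.sum_bij (fun i _ => π^[i] d) ?_ ?_ ?_ ?_
  · intro i _
    simpa using sameCycle_iterate π d i
  · intro i hi j hj h
    exact iterate_inj_of_lt π d (Finset.mem_range.1 hi) (Finset.mem_range.1 hj) h
  · intro e he
    obtain ⟨i, hi, h⟩ := (sameCycle_iff_exists_lt π d e).1 (by simpa using he)
    exact ⟨i, Finset.mem_range.2 hi, h⟩
  · intros; rfl

/-- If on every cycle the sum of `X` is at most the length of the cycle minus `k`, then in total it
is at most the number of elements minus `k` times the number of cycles. -/
theorem sum_le_of_cycles [Fintype D] (π : Perm D) (X : D → ℚ) (k : ℚ)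
    (h : ∀ d, ∑ i ∈ Finset.range (Function.minimalPeriod π d), X (π^[i] d) ≤
      Function.minimalPeriod π d - k) :
    ∑ d, X d ≤ Nat.card D - k * numCycles π := by
  classical
  have : Fintype (Quotient (cyc π)) := Fintype.ofFinite _
  have key : ∀ Y : D → ℚ, ∑ d, Y d = ∑ q : Quotient (cyc π),
      ∑ i ∈ Finset.range (Function.minimalPeriod π q.out), Y (π^[i] q.out) := by
    intro Y
    rw [← Finset.sum_fiberwise Finset.univ (fun d => (⟦d⟧ : Quotient (cyc π))) Y]
    refine Finset.sum_congr rfl fun q _ => ?_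
    rw [← sum_sameCycle π q.out Y]
    refine Finset.sum_congr ?_ fun _ _ => rfl
    ext d
    simp only [Finset.mem_filter, Finset.mem_univ, true_and]
    constructor
    · rintro rfl
      exact Quotient.mk_out (s := cyc π) d
    · intro hd
      rw [← Quotient.out_eq q]
      exact Quotient.sound (Setoid.symm' _ hd)
  have h1 : ∑ d : D, (1 : ℚ) = ∑ q : Quotient (cyc π), (Function.minimalPeriod π q.out : ℚ) := by
    rw [key]; simp
  have h2 : (Nat.card D : ℚ) = ∑ q : Quotient (cyc π), (Function.minimalPeriod π q.out : ℚ) := by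
    rw [← h1]; simp [Nat.card_eq_fintype_card]
  have h3 : (numCycles π : ℚ) = ∑ q : Quotient (cyc π), (1 : ℚ) := by
    simp [numCycles, numClasses, Nat.card_eq_fintype_card]
  rw [key, h2, h3, Finset.mul_sum, ← Finset.sum_sub_distrib]
  exact Finset.sum_le_sum fun q _ => by simpa using h q.out

end Orbit

/-! ### Rotations and faces -/

section Faces

variable {V : Type u} {G : SimpleGraph V} (E : RotationSystem G)

/-- The degree of a vertex. -/
noncomputable def deg (G : SimpleGraph V) (v : V) : ℕ := (G.neighborSet v).ncard

theorem dart_ext {d e : G.Dart} (h1 : d.fst = e.fst) (h2 : d.snd = e.snd) : d = e :=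
  SimpleGraph.Dart.ext _ _ (Prod.ext h1 h2)

namespace RotationSystem

theorem facePerm_apply (d : G.Dart) : E.facePerm d = E.rot d.symm := rfl

theorem fst_facePerm (d : G.Dart) : (E.facePerm d).fst = d.snd := E.fst_rot d.symm

theorem facePerm_inv_apply (d : G.Dart) : E.facePerm.symm d = (E.rot.symm d).symm := by
  rw [Equiv.symm_apply_eq, facePerm_apply]; simp

theorem snd_facePerm_inv (d : G.Dart) : (E.facePerm.symm d).snd = d.fst := by
  rw [← E.fst_facePerm, Equiv.apply_symm_apply]

theorem fst_rot_inv (d : G.Dart) : (E.rot.symm d).fst = d.fst := by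
  rw [← E.fst_rot, Equiv.apply_symm_apply]

theorem fst_rot_iterate (d : G.Dart) (n : ℕ) : (E.rot^[n] d).fst = d.fst := by
  induction n with
  | zero => rfl
  | succ n ih => rw [Function.iterate_succ_apply', E.fst_rot, ih]

theorem rot_eq (d : G.Dart) : E.rot d = E.facePerm d.symm := by
  rw [facePerm_apply, SimpleGraph.Dart.symm_symm]

theorem symm_facePerm_inv (d : G.Dart) : (E.facePerm.symm d).symm = E.rot.symm d := by
  rw [facePerm_inv_apply, SimpleGraph.Dart.symm_symm]

/-- The length of the facial walk through a dart. -/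
noncomputable def len (d : G.Dart) : ℕ := Function.minimalPeriod E.facePerm d

theorem iterate_len (d : G.Dart) : E.facePerm^[E.len d] d = d :=
  iterate_minimalPeriod_perm _ _

theorem iterate_eq_inv {d : G.Dart} {n : ℕ} (h : E.len d = n + 1) :
    E.facePerm^[n] d = E.facePerm.symm d := by
  have := E.iterate_len d
  rw [h, Function.iterate_succ_apply'] at this
  rw [Equiv.eq_symm_apply, this]

variable [Finite V]

theorem len_facePerm (d : G.Dart) : E.len (E.facePerm d) = E.len d :=
  minimalPeriod_iterate_perm E.facePerm d 1

theorem len_facePerm_inv (d : G.Dart) : E.len (E.facePerm.symm d) = E.len d := by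
  rw [← E.len_facePerm, Equiv.apply_symm_apply]

theorem len_iterate (d : G.Dart) (i : ℕ) : E.len (E.facePerm^[i] d) = E.len d :=
  minimalPeriod_iterate_perm E.facePerm d i

theorem minimalPeriod_rot (d : G.Dart) : Function.minimalPeriod E.rot d = deg G d.fst := by
  classical
  have := Fintype.ofFinite G.Dart
  have h1 := sum_sameCycle E.rot d (fun _ => 1)
  simp only [Finset.sum_const, Finset.card_range, smul_eq_mul, mul_one] at h1
  rw [← h1, deg, ← Set.ncard_coe_finset]
  refine Set.ncard_congr (fun e _ => e.snd) ?_ ?_ ?_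
  · intro e he
    have he' : SameCycle E.rot d e := by simpa using he
    rw [E.fst_eq_of_sameCycle he']; exact e.adj
  · intro e f he hf hef
    have he' : SameCycle E.rot d e := by simpa using he
    have hf' : SameCycle E.rot d f := by simpa using hf
    exact dart_ext ((E.fst_eq_of_sameCycle he').symm.trans (E.fst_eq_of_sameCycle hf')) hef
  · intro x hx
    exact ⟨⟨(d.fst, x), hx⟩, by simpa using E.cyclic d ⟨(d.fst, x), hx⟩ rfl, rfl⟩

theorem exists_rot_iterate {d : G.Dart} {x : V} (h : G.Adj d.fst x) :
    ∃ i < deg G d.fst, (E.rot^[i] d).snd = x := by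
  obtain ⟨i, hi, h'⟩ := (sameCycle_iff_exists_lt E.rot d ⟨(d.fst, x), h⟩).1 (E.cyclic _ _ rfl)
  exact ⟨i, by rwa [← E.minimalPeriod_rot], by rw [h']⟩

theorem rot_iterate_deg (d : G.Dart) : E.rot^[deg G d.fst] d = d := by
  rw [← E.minimalPeriod_rot]; exact iterate_minimalPeriod_perm _ _

theorem rot_iterate_ne {d : G.Dart} {i : ℕ} (h0 : 0 < i) (h : i < deg G d.fst) :
    E.rot^[i] d ≠ d := by
  intro hc
  rw [← E.minimalPeriod_rot] at h
  have := iterate_inj_of_lt E.rot d h (by omega) (j := 0) hc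
  omega

/-- At a vertex of degree at least three the two edges next to a given one are distinct. -/
theorem rot_ne_rot_inv {d : G.Dart} (h : 3 ≤ deg G d.fst) : (E.rot d).snd ≠ (E.rot.symm d).snd := by
  intro hc
  have h1 : E.rot d = E.rot.symm d := dart_ext ((E.fst_rot d).trans (E.fst_rot_inv d).symm) hc
  refine E.rot_iterate_ne (d := d) (i := 2) (by omega) (by omega) ?_
  change E.rot (E.rot d) = d
  rw [h1, Equiv.apply_symm_apply]

theorem rot_inv_eq_of_deg_three {d : G.Dart} (h : deg G d.fst = 3) :
    E.rot.symm d = E.rot (E.rot d) := by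
  have := E.rot_iterate_deg d
  rw [h] at this
  rw [Equiv.symm_apply_eq]; exact this.symm

theorem adj_iff_of_deg_three {d : G.Dart} (h : deg G d.fst = 3) (x : V) :
    G.Adj d.fst x ↔ x = d.snd ∨ x = (E.rot d).snd ∨ x = (E.rot.symm d).snd := by
  rw [E.rot_inv_eq_of_deg_three h]
  constructor
  · intro hx
    obtain ⟨i, hi, h'⟩ := E.exists_rot_iterate hx
    rw [h] at hi
    interval_cases i
    · exact Or.inl h'.symm
    · exact Or.inr (Or.inl h'.symm)
    · exact Or.inr (Or.inr h'.symm)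
  · rintro (rfl | rfl | rfl)
    · exact d.adj
    · rw [← E.fst_rot d]; exact (E.rot d).adj
    · rw [← E.fst_rot d, ← E.fst_rot (E.rot d)]; exact (E.rot (E.rot d)).adj

end RotationSystem

end Faces

/-! ### Cycles given by lists of vertices -/

theorem NoCycleOfLength.of_list {V : Type u} {G : SimpleGraph V} {n : ℕ} (h : NoCycleOfLength G n)
    {a b c : V} {l : List V} (hl : (l.length + 3) = n) (hnd : (a :: b :: c :: l).Nodup)
    (hch : (a :: b :: c :: l).IsChain G.Adj)
    (hlast : G.Adj ((a :: b :: c :: l).getLast (by simp)) a) : False := by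
  have hw : ∀ (l : List V) (x : V), (x :: l).IsChain G.Adj →
      ∃ p : G.Walk x ((x :: l).getLast (by simp)), p.support = x :: l := by
    intro l
    induction l with
    | nil => intro x _; exact ⟨SimpleGraph.Walk.nil, rfl⟩
    | cons y l ih =>
      intro x hx
      rw [List.isChain_cons_cons] at hx
      obtain ⟨p, hp⟩ := ih y hx.2
      refine ⟨(SimpleGraph.Walk.cons hx.1 p).copy rfl (by simp), ?_⟩
      rw [SimpleGraph.Walk.support_copy, SimpleGraph.Walk.support_cons, hp]
  obtain ⟨p, hp⟩ := hw (b :: c :: l) a hch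
  have hpath : p.IsPath := by rw [SimpleGraph.Walk.isPath_def, hp]; exact hnd
  have hlen : p.length + 1 = l.length + 3 := by
    have := congrArg List.length hp
    rw [SimpleGraph.Walk.length_support] at this
    simpa using this
  refine h _ (SimpleGraph.Walk.cons hlast p) ?_ (by
    rw [SimpleGraph.Walk.length_cons]; omega)
  rw [SimpleGraph.Walk.cons_isCycle_iff]
  refine ⟨hpath, ?_⟩
  intro he
  have hsnd : p.snd = b := by
    have h1 : p.getVert 1 = p.support[1]'(by rw [hp]; simp) := by
      rw [SimpleGraph.Walk.support_getElem_eq_getVert]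
    rw [SimpleGraph.Walk.snd, h1]
    simp only [hp]; rfl
  have := hpath.eq_snd_of_mem_edges (by rw [Sym2.eq_swap]; exact he)
  rw [hsnd] at this
  have hmem : (a :: b :: c :: l).getLast (by simp) ∈ c :: l := by
    simp only [List.getLast_cons_cons]; exact List.getLast_mem _
  rw [this] at hmem
  simp only [List.nodup_cons] at hnd
  exact hnd.2.1 hmem

end DPG

/-! ### First properties of plane critical graphs. -/

namespace DPG

open Equiv Equiv.Perm

/-- A plane critical graph without the forbidden cycles. -/
structure Setting {V : Type u} {G : SimpleGraph V} (E : RotationSystem G) (C : Set V) : Prop where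
  sph : E.Spherical
  crit : Critical G C
  c4 : NoCycleOfLength G 4
  c9 : NoCycleOfLength G 9
  cases : (NoCycleOfLength G 7 ∧ NoCycleOfLength G 8) ∨
    (NoCycleOfLength G 6 ∧ NoCycleOfLength G 8) ∨ (NoCycleOfLength G 6 ∧ NoCycleOfLength G 7)

namespace Setting

variable {V : Type u} {G : SimpleGraph V} {E : RotationSystem G} {C : Set V}

theorem three_le_deg (X : Setting E C) {v : V} (hv : v ∉ C) : 3 ≤ deg G v := X.crit.deg v hv

theorem exists_three_adj (X : Setting E C) {v : V} (hv : v ∉ C) :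
    ∃ x y z, G.Adj v x ∧ G.Adj v y ∧ G.Adj v z ∧ x ≠ y ∧ x ≠ z ∧ y ≠ z := by
  have h := X.three_le_deg hv
  obtain ⟨t, ht, hc⟩ := Set.exists_subset_card_eq h
  obtain ⟨x, y, z, h1, h2, h3, rfl⟩ := Set.ncard_eq_three.1 hc
  exact ⟨x, y, z, ht (by simp), ht (by simp), ht (by simp), h1, h2, h3⟩

theorem exists_ne_ne (X : Setting E C) (x y : V) : ∃ w, w ≠ x ∧ w ≠ y := by
  obtain ⟨v, hv⟩ := X.crit.exists_notMem
  obtain ⟨a, b, c, ha, hb, hc, h1, h2, h3⟩ := X.exists_three_adj hv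
  by_contra hcon
  push Not at hcon
  have e := ha.ne; have e1 := hb.ne; have e2 := hc.ne
  have hor : ∀ w, w = x ∨ w = y := fun w => or_iff_not_imp_left.2 (hcon w)
  have k1 := hor v; have k2 := hor a; have k3 := hor b
  clear hor hcon
  grind

theorem reachable (X : Setting E C) (x y : V) : G.Reachable x y := by
  obtain ⟨w, hx, hy⟩ := X.exists_ne_ne x y
  obtain ⟨p⟩ := X.crit.cut w ⟨x, hx.symm⟩ ⟨y, hy.symm⟩
  exact ⟨p.map (SimpleGraph.Embedding.induce _).toHom⟩

variable [Finite V]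

/-- Vertices of `C` are not covered by the degree condition, but a vertex with a single neighbour
would be separated from the rest by that neighbour. -/
theorem two_le_deg (X : Setting E C) (v : V) : 2 ≤ deg G v := by
  obtain ⟨x, hx, -⟩ := X.exists_ne_ne v v
  obtain ⟨p⟩ := X.reachable v x
  cases p with
  | nil => exact absurd rfl hx
  | @cons _ a _ ha p =>
    obtain ⟨y, hya, hyv⟩ := X.exists_ne_ne a v
    obtain ⟨q⟩ := X.crit.cut a ⟨v, ha.ne⟩ ⟨y, hya⟩
    have hb : ∃ b, G.Adj v b ∧ b ≠ a := by
      cases q with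
      | nil => exact absurd rfl hyv
      | @cons _ b _ hb q => exact ⟨b.1, hb, b.2⟩
    obtain ⟨b, hb, hba⟩ := hb
    have : 1 < (G.neighborSet v).ncard :=
      (Set.one_lt_ncard (Set.toFinite _)).2 ⟨a, ha, b, hb, hba.symm⟩
    exact this

theorem dart_eq_of_sameCycle (X : Setting E C) {d e : G.Dart} (hf : SameCycle E.facePerm d e)
    (h : d.fst = e.fst) : d = e :=
  face_simple E X.sph (X.crit.cut _) h hf

/-- Vertices of a face are distinct. -/
theorem fst_iterate_inj (X : Setting E C) (d : G.Dart) {i j : ℕ} (hi : i < E.len d)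
    (hj : j < E.len d) (h : (E.facePerm^[i] d).fst = (E.facePerm^[j] d).fst) : i = j := by
  refine iterate_inj_of_lt E.facePerm d hi hj (X.dart_eq_of_sameCycle ?_ h)
  exact (sameCycle_iterate _ d i).symm.trans (sameCycle_iterate _ d j)

/-- Length 1 would be a loop, and in a face of length 2 the rotation would fix a dart, that is, its
vertex would have degree 1. -/
theorem three_le_len (X : Setting E C) (d : G.Dart) : 3 ≤ E.len d := by
  have h0 : 0 < E.len d := minimalPeriod_pos_perm _ _
  have h := E.iterate_len d
  by_contra hc
  push Not at hc
  have hl : E.len d = 1 ∨ E.len d = 2 := by omega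
  rcases hl with hl | hl <;> rw [hl] at h
  · have h1 := E.fst_facePerm d
    have h2 : E.facePerm d = d := h
    rw [h2] at h1
    exact d.adj.ne h1
  · have h2 : E.facePerm (E.facePerm d) = d := h
    have h1 : E.facePerm d = d.symm := by
      refine dart_ext (E.fst_facePerm d) ?_
      rw [← E.fst_facePerm, h2]; rfl
    rw [E.facePerm_apply] at h1
    exact E.rot_iterate_ne (d := d.symm) (i := 1) (by omega) (X.two_le_deg _) h1

end Setting

end DPG

/-! ### Short cycles that share edges. -/

namespace DPG

/-- The vertices of the list form a cycle, in this order. -/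
structure IsRing {V : Type u} (G : SimpleGraph V) (l : List V) : Prop where
  nodup : l.Nodup
  chain : l.IsChain G.Adj
  last : ∀ h : l ≠ [], G.Adj (l.getLast h) (l.head h)

theorem NoCycleOfLength.not_isRing {V : Type u} {G : SimpleGraph V} {n : ℕ}
    (h : NoCycleOfLength G n) {l : List V} (hn : 3 ≤ n) (hl : l.length = n) : ¬ IsRing G l := by
  intro hr
  match l, hl, hr with
  | a :: b :: c :: l, hl, hr => exact h.of_list (by simpa using hl) hr.1 hr.2 (hr.3 (by simp))
  | [a, b], hl, hr => simp at hl; omega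
  | [a], hl, hr => simp at hl; omega
  | [], hl, hr => simp at hl; omega

theorem isRing_iff {V : Type u} {G : SimpleGraph V} {a : V} {l : List V} :
    IsRing G (a :: l) ↔ (a :: l).Nodup ∧ (a :: l).IsChain G.Adj ∧
      G.Adj ((a :: l).getLast (by simp)) a :=
  ⟨fun h => ⟨h.1, h.2, h.3 (by simp)⟩, fun h => ⟨h.1, h.2.1, fun _ => h.2.2⟩⟩

section Rings

variable {V : Type u} {G : SimpleGraph V}

theorem isRing_3 {a b c : V} : IsRing G [a, b, c] ↔
    (a ≠ b ∧ a ≠ c ∧ b ≠ c) ∧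
    G.Adj a b ∧ G.Adj b c ∧ G.Adj c a := by
  simp [isRing_iff, and_assoc]

theorem isRing_4 {a b c d : V} : IsRing G [a, b, c, d] ↔
    (a ≠ b ∧ a ≠ c ∧ a ≠ d ∧ b ≠ c ∧ b ≠ d ∧ c ≠ d) ∧
    G.Adj a b ∧ G.Adj b c ∧ G.Adj c d ∧ G.Adj d a := by
  simp [isRing_iff, and_assoc]

theorem isRing_5 {a b c d e : V} : IsRing G [a, b, c, d, e] ↔
    (a ≠ b ∧ a ≠ c ∧ a ≠ d ∧ a ≠ e ∧ b ≠ c ∧ b ≠ d ∧ b ≠ e ∧ c ≠ d ∧ c ≠ e ∧ d ≠ e) ∧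
    G.Adj a b ∧ G.Adj b c ∧ G.Adj c d ∧ G.Adj d e ∧ G.Adj e a := by
  simp [isRing_iff, and_assoc]

theorem isRing_6 {a b c d e f : V} : IsRing G [a, b, c, d, e, f] ↔
    (a ≠ b ∧ a ≠ c ∧ a ≠ d ∧ a ≠ e ∧ a ≠ f ∧ b ≠ c ∧ b ≠ d ∧ b ≠ e ∧ b ≠ f ∧ c ≠ d ∧ c ≠ e ∧ c ≠ f ∧ d ≠ e ∧ d ≠ f ∧ e ≠ f) ∧
    G.Adj a b ∧ G.Adj b c ∧ G.Adj c d ∧ G.Adj d e ∧ G.Adj e f ∧ G.Adj f a := by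
  simp [isRing_iff, and_assoc]

theorem isRing_7 {a b c d e f g : V} : IsRing G [a, b, c, d, e, f, g] ↔
    (a ≠ b ∧ a ≠ c ∧ a ≠ d ∧ a ≠ e ∧ a ≠ f ∧ a ≠ g ∧ b ≠ c ∧ b ≠ d ∧ b ≠ e ∧ b ≠ f ∧ b ≠ g ∧ c ≠ d ∧ c ≠ e ∧ c ≠ f ∧ c ≠ g ∧ d ≠ e ∧ d ≠ f ∧ d ≠ g ∧ e ≠ f ∧ e ≠ g ∧ f ≠ g) ∧
    G.Adj a b ∧ G.Adj b c ∧ G.Adj c d ∧ G.Adj d e ∧ G.Adj e f ∧ G.Adj f g ∧ G.Adj g a := by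
  simp [isRing_iff, and_assoc]

theorem isRing_8 {a b c d e f g h : V} : IsRing G [a, b, c, d, e, f, g, h] ↔
    (a ≠ b ∧ a ≠ c ∧ a ≠ d ∧ a ≠ e ∧ a ≠ f ∧ a ≠ g ∧ a ≠ h ∧ b ≠ c ∧ b ≠ d ∧ b ≠ e ∧ b ≠ f ∧ b ≠ g ∧ b ≠ h ∧ c ≠ d ∧ c ≠ e ∧ c ≠ f ∧ c ≠ g ∧ c ≠ h ∧ d ≠ e ∧ d ≠ f ∧ d ≠ g ∧ d ≠ h ∧ e ≠ f ∧ e ≠ g ∧ e ≠ h ∧ f ≠ g ∧ f ≠ h ∧ g ≠ h) ∧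
    G.Adj a b ∧ G.Adj b c ∧ G.Adj c d ∧ G.Adj d e ∧ G.Adj e f ∧ G.Adj f g ∧ G.Adj g h ∧ G.Adj h a := by
  simp [isRing_iff, and_assoc]

theorem isRing_9 {a b c d e f g h i : V} : IsRing G [a, b, c, d, e, f, g, h, i] ↔
    (a ≠ b ∧ a ≠ c ∧ a ≠ d ∧ a ≠ e ∧ a ≠ f ∧ a ≠ g ∧ a ≠ h ∧ a ≠ i ∧ b ≠ c ∧ b ≠ d ∧ b ≠ e ∧ b ≠ f ∧ b ≠ g ∧ b ≠ h ∧ b ≠ i ∧ c ≠ d ∧ c ≠ e ∧ c ≠ f ∧ c ≠ g ∧ c ≠ h ∧ c ≠ i ∧ d ≠ e ∧ d ≠ f ∧ d ≠ g ∧ d ≠ h ∧ d ≠ i ∧ e ≠ f ∧ e ≠ g ∧ e ≠ h ∧ e ≠ i ∧ f ≠ g ∧ f ≠ h ∧ f ≠ i ∧ g ≠ h ∧ g ≠ i ∧ h ≠ i) ∧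
    G.Adj a b ∧ G.Adj b c ∧ G.Adj c d ∧ G.Adj d e ∧ G.Adj e f ∧ G.Adj f g ∧ G.Adj g h ∧ G.Adj h i ∧ G.Adj i a := by
  simp [isRing_iff, and_assoc]

/-- The pattern of all results of this kind: if the cycles meet only along the common edges, their
outer boundary is a cycle of forbidden length, here 6; if they meet elsewhere, a chord closes a
shorter forbidden cycle, here of length 4. The list of rings names the outer boundary and those
shorter cycles. -/
theorem not_isRing_three_five (h4 : NoCycleOfLength G 4) (h6 : NoCycleOfLength G 6)
    {a b c x y z : V} (r1 : IsRing G [x, y, z])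
    (r2 : IsRing G [x, y, a, b, c]) : False := by
  have k1 := h4.not_isRing (l := [a, b, c, x]) (by omega) rfl
  have k2 := h4.not_isRing (l := [a, b, c, y]) (by omega) rfl
  have k3 := h4.not_isRing (l := [a, b, x, y]) (by omega) rfl
  have k4 := h6.not_isRing (l := [a, b, c, x, z, y]) (by omega) rfl
  grind (splits := 40) [isRing_3, isRing_4, isRing_5, isRing_6, SimpleGraph.Adj.symm]

theorem not_isRing_three_three (h4 : NoCycleOfLength G 4)
    {w x y z : V} (r1 : IsRing G [x, y, z])
    (r2 : IsRing G [x, y, w])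
    (n1 : z ≠ w) : False := by
  have k1 := h4.not_isRing (l := [w, x, z, y]) (by omega) rfl
  grind (splits := 40) [isRing_3, isRing_4, SimpleGraph.Adj.symm]

/-- The outer boundary has length 7. The two inequalities are needed because the triangle could
otherwise be made of two consecutive edges of the hexagon and a chord. -/
theorem not_isRing_three_six (h4 : NoCycleOfLength G 4) (h7 : NoCycleOfLength G 7)
    {a b c d x y z : V} (r1 : IsRing G [x, y, z])
    (r2 : IsRing G [x, y, a, b, c, d])
    (n1 : z ≠ a) (n2 : z ≠ d) : False := by
  have k1 := h4.not_isRing (l := [a, b, c, y]) (by omega) rfl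
  have k2 := h4.not_isRing (l := [a, b, x, y]) (by omega) rfl
  have k3 := h7.not_isRing (l := [a, b, c, d, x, z, y]) (by omega) rfl
  grind (splits := 40) [isRing_3, isRing_4, isRing_6, isRing_7, SimpleGraph.Adj.symm]

theorem not_isRing_three_seven (h4 : NoCycleOfLength G 4) (h6 : NoCycleOfLength G 6) (h8 : NoCycleOfLength G 8)
    {a b c d e x y z : V} (r1 : IsRing G [x, y, z])
    (r2 : IsRing G [x, y, a, b, c, d, e]) : False := by
  have k1 := h4.not_isRing (l := [a, b, c, y]) (by omega) rfl
  have k2 := h4.not_isRing (l := [a, b, x, y]) (by omega) rfl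
  have k3 := h4.not_isRing (l := [d, e, x, y]) (by omega) rfl
  have k4 := h6.not_isRing (l := [a, b, c, d, e, x]) (by omega) rfl
  have k5 := h6.not_isRing (l := [a, b, c, d, e, y]) (by omega) rfl
  have k6 := h8.not_isRing (l := [a, b, c, d, e, x, z, y]) (by omega) rfl
  grind (splits := 40) [isRing_3, isRing_4, isRing_6, isRing_7, isRing_8, SimpleGraph.Adj.symm]

theorem not_isRing_three_eight (h4 : NoCycleOfLength G 4) (h7 : NoCycleOfLength G 7) (h9 : NoCycleOfLength G 9)
    {a b c d e f x y z : V} (r1 : IsRing G [x, y, z])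
    (r2 : IsRing G [x, y, a, b, c, d, e, f]) : False := by
  have k1 := h4.not_isRing (l := [a, b, c, y]) (by omega) rfl
  have k2 := h4.not_isRing (l := [a, b, x, y]) (by omega) rfl
  have k3 := h4.not_isRing (l := [d, e, f, x]) (by omega) rfl
  have k4 := h4.not_isRing (l := [e, f, x, y]) (by omega) rfl
  have k5 := h7.not_isRing (l := [a, b, c, d, e, f, x]) (by omega) rfl
  have k6 := h7.not_isRing (l := [a, b, c, d, e, f, y]) (by omega) rfl
  have k7 := h9.not_isRing (l := [a, b, c, d, e, f, x, z, y]) (by omega) rfl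
  grind (splits := 40) [isRing_3, isRing_4, isRing_7, isRing_8, isRing_9, SimpleGraph.Adj.symm]

/-- Pentagons on two sides of a triangle, with `a` and `r` their neighbours of the common vertex
`y`. If these differ, the outer boundary, which passes through `y`, has length 9. -/
theorem not_isRing_five_three_five (h4 : NoCycleOfLength G 4) (h9 : NoCycleOfLength G 9)
    {a b c p q r x y z : V} (r1 : IsRing G [x, y, z])
    (r2 : IsRing G [x, y, a, b, c])
    (r3 : IsRing G [y, z, p, q, r])
    (n1 : z ≠ a) (n2 : z ≠ c) (n3 : x ≠ r) (n4 : x ≠ p) (n5 : a ≠ r) : False := by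
  have k1 := h4.not_isRing (l := [a, b, c, y]) (by omega) rfl
  have k2 := h4.not_isRing (l := [a, b, r, y]) (by omega) rfl
  have k3 := h4.not_isRing (l := [a, b, x, y]) (by omega) rfl
  have k4 := h4.not_isRing (l := [a, b, z, y]) (by omega) rfl
  have k5 := h4.not_isRing (l := [a, p, z, y]) (by omega) rfl
  have k6 := h4.not_isRing (l := [a, q, r, y]) (by omega) rfl
  have k7 := h4.not_isRing (l := [b, c, x, y]) (by omega) rfl
  have k8 := h4.not_isRing (l := [c, p, z, x]) (by omega) rfl
  have k9 := h4.not_isRing (l := [c, x, y, z]) (by omega) rfl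
  have k10 := h4.not_isRing (l := [p, x, y, z]) (by omega) rfl
  have k11 := h9.not_isRing (l := [a, b, c, x, z, p, q, r, y]) (by omega) rfl
  grind (splits := 40) [isRing_3, isRing_4, isRing_5, isRing_9, SimpleGraph.Adj.symm]

/-- Here `a = r` is allowed. In that case `y` is enclosed and the boundary that skips it has length
7, provided the next vertices `b` and `q` differ. -/
theorem not_isRing_five_three_five_of_ne (h4 : NoCycleOfLength G 4) (h7 : NoCycleOfLength G 7) (h9 : NoCycleOfLength G 9)
    {a b c p q r x y z : V} (r1 : IsRing G [x, y, z])
    (r2 : IsRing G [x, y, a, b, c])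
    (r3 : IsRing G [y, z, p, q, r])
    (n1 : z ≠ a) (n2 : z ≠ c) (n3 : x ≠ r) (n4 : x ≠ p) (n5 : b ≠ q) : False := by
  have k1 := h4.not_isRing (l := [a, b, c, q]) (by omega) rfl
  have k2 := h4.not_isRing (l := [a, b, c, x]) (by omega) rfl
  have k3 := h4.not_isRing (l := [a, b, c, y]) (by omega) rfl
  have k4 := h4.not_isRing (l := [a, b, p, q]) (by omega) rfl
  have k5 := h4.not_isRing (l := [a, b, x, y]) (by omega) rfl
  have k6 := h4.not_isRing (l := [a, b, z, y]) (by omega) rfl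
  have k7 := h4.not_isRing (l := [a, c, x, y]) (by omega) rfl
  have k8 := h4.not_isRing (l := [a, p, z, y]) (by omega) rfl
  have k9 := h4.not_isRing (l := [a, q, r, y]) (by omega) rfl
  have k10 := h4.not_isRing (l := [b, c, x, y]) (by omega) rfl
  have k11 := h4.not_isRing (l := [c, p, z, x]) (by omega) rfl
  have k12 := h4.not_isRing (l := [c, x, y, z]) (by omega) rfl
  have k13 := h4.not_isRing (l := [p, x, y, z]) (by omega) rfl
  have k14 := h7.not_isRing (l := [a, b, c, x, z, p, q]) (by omega) rfl
  have k15 := h9.not_isRing (l := [a, b, c, x, z, p, q, r, y]) (by omega) rfl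
  grind (splits := 40) [isRing_3, isRing_4, isRing_5, isRing_7, isRing_9, SimpleGraph.Adj.symm]

/-- Each triangle lengthens the boundary of the pentagon by one, which gives a cycle of length 7. -/
theorem not_isRing_three_five_three (h4 : NoCycleOfLength G 4) (h7 : NoCycleOfLength G 7)
    {a b c w x y z : V} (r1 : IsRing G [x, y, a, b, c])
    (r2 : IsRing G [x, y, z])
    (r3 : IsRing G [y, a, w]) : False := by
  have k1 := h4.not_isRing (l := [a, b, c, x]) (by omega) rfl
  have k2 := h4.not_isRing (l := [a, b, c, y]) (by omega) rfl
  have k3 := h4.not_isRing (l := [a, b, x, y]) (by omega) rfl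
  have k4 := h4.not_isRing (l := [a, y, x, z]) (by omega) rfl
  have k5 := h4.not_isRing (l := [b, c, x, y]) (by omega) rfl
  have k6 := h7.not_isRing (l := [a, b, c, x, z, y, w]) (by omega) rfl
  grind (splits := 40) [isRing_3, isRing_4, isRing_5, isRing_7, SimpleGraph.Adj.symm]

theorem not_isRing_three_five_three_of_apart (h4 : NoCycleOfLength G 4) (h7 : NoCycleOfLength G 7)
    {a b c w x y z : V} (r1 : IsRing G [x, y, a, b, c])
    (r2 : IsRing G [x, y, z])
    (r3 : IsRing G [a, b, w]) : False := by
  have k1 := h4.not_isRing (l := [a, b, c, w]) (by omega) rfl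
  have k2 := h4.not_isRing (l := [a, b, c, x]) (by omega) rfl
  have k3 := h4.not_isRing (l := [a, b, c, y]) (by omega) rfl
  have k4 := h4.not_isRing (l := [a, b, w, y]) (by omega) rfl
  have k5 := h4.not_isRing (l := [a, b, x, y]) (by omega) rfl
  have k6 := h4.not_isRing (l := [a, w, x, y]) (by omega) rfl
  have k7 := h4.not_isRing (l := [b, c, x, w]) (by omega) rfl
  have k8 := h7.not_isRing (l := [a, w, b, c, x, z, y]) (by omega) rfl
  grind (splits := 40) [isRing_3, isRing_4, isRing_5, isRing_7, SimpleGraph.Adj.symm]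

theorem not_isRing_five_five (h4 : NoCycleOfLength G 4) (h8 : NoCycleOfLength G 8)
    {a b c p q r x y : V} (r1 : IsRing G [x, y, a, b, c])
    (r2 : IsRing G [x, y, p, q, r])
    (n1 : a ≠ p) (n2 : c ≠ r) : False := by
  have k1 := h4.not_isRing (l := [a, b, c, x]) (by omega) rfl
  have k2 := h4.not_isRing (l := [a, b, c, y]) (by omega) rfl
  have k3 := h4.not_isRing (l := [a, b, p, y]) (by omega) rfl
  have k4 := h4.not_isRing (l := [a, b, x, y]) (by omega) rfl
  have k5 := h4.not_isRing (l := [a, r, x, y]) (by omega) rfl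
  have k6 := h4.not_isRing (l := [b, c, x, y]) (by omega) rfl
  have k7 := h4.not_isRing (l := [c, p, y, x]) (by omega) rfl
  have k8 := h8.not_isRing (l := [a, b, c, x, r, q, p, y]) (by omega) rfl
  grind (splits := 40) [isRing_4, isRing_5, isRing_8, SimpleGraph.Adj.symm]

theorem not_isRing_five_six (h4 : NoCycleOfLength G 4) (h9 : NoCycleOfLength G 9)
    {a b c p q r s x y : V} (r1 : IsRing G [x, y, a, b, c])
    (r2 : IsRing G [x, y, p, q, r, s])
    (n1 : a ≠ p) (n2 : c ≠ s) (n3 : a ≠ q) (n4 : c ≠ r) : False := by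
  have k1 := h4.not_isRing (l := [a, b, c, x]) (by omega) rfl
  have k2 := h4.not_isRing (l := [a, b, c, y]) (by omega) rfl
  have k3 := h4.not_isRing (l := [a, b, p, y]) (by omega) rfl
  have k4 := h4.not_isRing (l := [a, b, x, y]) (by omega) rfl
  have k5 := h4.not_isRing (l := [a, q, p, y]) (by omega) rfl
  have k6 := h4.not_isRing (l := [b, c, x, s]) (by omega) rfl
  have k7 := h4.not_isRing (l := [b, c, x, y]) (by omega) rfl
  have k8 := h4.not_isRing (l := [c, p, y, x]) (by omega) rfl
  have k9 := h9.not_isRing (l := [a, b, c, x, s, r, q, p, y]) (by omega) rfl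
  grind (splits := 40) [isRing_4, isRing_5, isRing_6, isRing_9, SimpleGraph.Adj.symm]

/-- Three pentagons around `o` have an outer boundary of length 9; coincidences on it close cycles
of length 4 or 6. -/
theorem not_isRing_five_five_five (h4 : NoCycleOfLength G 4) (h6 : NoCycleOfLength G 6) (h9 : NoCycleOfLength G 9)
    {a b o p q r s x y z : V} (r1 : IsRing G [o, x, a, b, y])
    (r2 : IsRing G [o, y, p, q, z])
    (r3 : IsRing G [o, z, r, s, x]) : False := by
  have k1 := h4.not_isRing (l := [a, b, o, x]) (by omega) rfl
  have k2 := h4.not_isRing (l := [a, b, s, x]) (by omega) rfl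
  have k3 := h4.not_isRing (l := [a, b, y, o]) (by omega) rfl
  have k4 := h4.not_isRing (l := [a, b, y, p]) (by omega) rfl
  have k5 := h4.not_isRing (l := [a, b, y, x]) (by omega) rfl
  have k6 := h4.not_isRing (l := [a, x, o, y]) (by omega) rfl
  have k7 := h4.not_isRing (l := [a, x, o, z]) (by omega) rfl
  have k8 := h4.not_isRing (l := [b, q, o, y]) (by omega) rfl
  have k9 := h4.not_isRing (l := [b, x, o, y]) (by omega) rfl
  have k10 := h4.not_isRing (l := [b, y, o, z]) (by omega) rfl
  have k11 := h4.not_isRing (l := [o, q, p, y]) (by omega) rfl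
  have k12 := h4.not_isRing (l := [o, x, p, y]) (by omega) rfl
  have k13 := h4.not_isRing (l := [o, x, q, z]) (by omega) rfl
  have k14 := h4.not_isRing (l := [o, x, s, y]) (by omega) rfl
  have k15 := h4.not_isRing (l := [o, y, p, z]) (by omega) rfl
  have k16 := h6.not_isRing (l := [a, b, q, z, o, x]) (by omega) rfl
  have k17 := h6.not_isRing (l := [a, b, y, o, z, r]) (by omega) rfl
  have k18 := h6.not_isRing (l := [o, x, s, q, p, y]) (by omega) rfl
  have k19 := h9.not_isRing (l := [a, b, y, p, q, z, r, s, x]) (by omega) rfl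
  grind (splits := 40) [isRing_4, isRing_5, isRing_6, isRing_9, SimpleGraph.Adj.symm]

end Rings

end DPG

/-! ### Facial walks as cycles. -/

namespace DPG

open Equiv Equiv.Perm

section Rings

variable {V : Type u} {G : SimpleGraph V}

theorem IsRing.reverse {l : List V} (h : IsRing G l) : IsRing G l.reverse where
  nodup := List.nodup_reverse.2 h.nodup
  chain := by
    rw [List.isChain_reverse]
    exact h.chain.imp fun _ _ h => h.symm
  last hl := by
    have hl' : l ≠ [] := by simpa using hl
    rw [List.getLast_reverse, List.head_reverse]
    exact (h.last hl').symm

theorem IsRing.rotate {a : V} {l : List V} (h : IsRing G (a :: l)) : IsRing G (l ++ [a]) := by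
  cases l with
  | nil => exact h
  | cons b l =>
    have h1 := h.chain
    have h2 := h.last (by simp)
    have h3 := h.nodup
    refine ⟨?_, ?_, ?_⟩
    · exact (List.perm_append_singleton a (b :: l)).nodup_iff.2 h3
    · rw [List.isChain_cons_cons] at h1
      rw [List.isChain_append]
      refine ⟨h1.2, by simp, ?_⟩
      intro x hx y hy
      simp only [List.head?_cons, Option.mem_def, Option.some.injEq] at hy
      subst hy
      rw [List.getLast?_eq_some_getLast (by simp), Option.mem_def, Option.some.injEq] at hx
      subst hx
      simpa using h2
    · intro _
      rw [List.isChain_cons_cons] at h1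
      simpa using h1.1

end Rings

namespace RotationSystem

variable {V : Type u} {G : SimpleGraph V} (E : RotationSystem G)

/-- The vertices of the facial walk through a dart. -/
def vx (d : G.Dart) (i : ℕ) : V := (E.facePerm^[i] d).fst

theorem vx_zero (d : G.Dart) : E.vx d 0 = d.fst := rfl

theorem vx_one (d : G.Dart) : E.vx d 1 = d.snd := E.fst_facePerm d

theorem adj_vx (d : G.Dart) (i : ℕ) : G.Adj (E.vx d i) (E.vx d (i + 1)) := by
  unfold vx
  rw [Function.iterate_succ_apply', E.fst_facePerm]
  exact (E.facePerm^[i] d).adj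

end RotationSystem

namespace Setting

variable {V : Type u} [Finite V] {G : SimpleGraph V} {E : RotationSystem G} {C : Set V}

theorem isRing_face (X : Setting E C) (d : G.Dart) :
    IsRing G ((List.range (E.len d)).map (E.vx d)) where
  nodup := by
    refine List.Nodup.map_on ?_ List.nodup_range
    intro i hi j hj hij
    rw [List.mem_range] at hi hj
    exact X.fst_iterate_inj d hi hj hij
  chain := by
    rw [List.isChain_iff_getElem]
    intro i hi
    simp only [List.getElem_map, List.getElem_range]
    exact E.adj_vx d i
  last hne := by
    rw [List.getLast_eq_getElem, List.head_eq_getElem]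
    simp only [List.getElem_map, List.getElem_range, List.length_map, List.length_range]
    have h3 := X.three_le_len d
    have := E.adj_vx d (E.len d - 1)
    have e : E.vx d (E.len d - 1 + 1) = E.vx d 0 := by
      unfold RotationSystem.vx
      rw [show E.len d - 1 + 1 = E.len d by omega, E.iterate_len]; rfl
    rwa [e] at this

theorem len_ne (X : Setting E C) {n : ℕ} (h : NoCycleOfLength G n) (d : G.Dart) :
    E.len d ≠ n := by
  intro hn
  have h3 := X.three_le_len d
  exact h.not_isRing (by omega) (by simpa using hn) (X.isRing_face d)

/-- Where two faces meet at an edge, their next vertices beyond a common end of degree at least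
three are distinct. -/
theorem vx_two_ne (d : G.Dart) (h : 3 ≤ deg G d.snd) {n : ℕ} (hn : E.len d.symm = n + 1) :
    E.vx d 2 ≠ E.vx d.symm n := by
  have h1 := E.rot_ne_rot_inv (d := d.symm) h
  have h2 : E.vx d 2 = (E.rot d.symm).snd := (E.vx_one (E.facePerm d))
  have h3 : E.vx d.symm n = (E.rot.symm d.symm).snd := by
    rw [RotationSystem.vx, E.iterate_eq_inv hn, ← E.symm_facePerm_inv]; rfl
  rwa [h2, h3]

end Setting

end DPG

/-! ### Short faces that share an edge. -/

namespace DPG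

open Equiv Equiv.Perm

section Rings

variable {V : Type u} {G : SimpleGraph V}

theorem IsRing.append_comm {l l' : List V} (h : IsRing G (l ++ l')) : IsRing G (l' ++ l) := by
  induction l generalizing l' with
  | nil => simpa using h
  | cons a l ih =>
    have := ih (l' := l' ++ [a]) (by simpa using h.rotate)
    simpa using this

theorem IsRing.flip {x y : V} {l : List V} (h : IsRing G (y :: x :: l)) :
    IsRing G (x :: y :: l.reverse) := by
  have := h.reverse
  rw [List.reverse_cons, List.reverse_cons, List.append_assoc] at this
  exact this.append_comm

end Rings

namespace Setting

variable {V : Type u} [Finite V] {G : SimpleGraph V} {E : RotationSystem G} {C : Set V}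

theorem ring (X : Setting E C) {d : G.Dart} {n : ℕ} (h : E.len d = n) :
    IsRing G ((List.range n).map (E.vx d)) := h ▸ X.isRing_face d

/-- The face on the other side of a dart, traversed backwards. -/
theorem ring_symm (X : Setting E C) {d : G.Dart} {n : ℕ} (h : E.len d.symm = n + 2) :
    IsRing G (E.vx d 0 :: E.vx d 1 :: ((List.range n).map fun i => E.vx d.symm (i + 2)).reverse) := by
  have h1 := X.ring h
  have h2 : (List.range (n + 2)).map (E.vx d.symm) = E.vx d 1 :: E.vx d 0 ::
      (List.range n).map fun i => E.vx d.symm (i + 2) := by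
    simp only [List.range_succ_eq_map, List.map_cons, List.map_map]
    rw [E.vx_one d, E.vx_zero d, E.vx_zero, E.vx_one]
    rfl
  rw [h2] at h1
  exact h1.flip

omit [Finite V] in
theorem vx_len (d : G.Dart) {n : ℕ} (h : E.len d = n) (i : ℕ) : E.vx d (n + i) = E.vx d i := by
  unfold RotationSystem.vx
  rw [add_comm, Function.iterate_add_apply, ← h, E.iterate_len]

theorem not_three_three (X : Setting E C) {d : G.Dart} (hy : 3 ≤ deg G d.snd) (h1 : E.len d = 3)
    (h2 : E.len d.symm = 3) : False :=
  not_isRing_three_three X.c4 (X.ring h1) (X.ring_symm h2) (vx_two_ne d hy h2)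

theorem not_three_five (X : Setting E C) (h6 : NoCycleOfLength G 6) {d : G.Dart}
    (h1 : E.len d = 3) (h2 : E.len d.symm = 5) : False :=
  not_isRing_three_five X.c4 h6 (X.ring h1) (X.ring_symm h2)

theorem not_three_six (X : Setting E C) (h7 : NoCycleOfLength G 7) {d : G.Dart}
    (hx : 3 ≤ deg G d.fst) (hy : 3 ≤ deg G d.snd) (h1 : E.len d = 3) (h2 : E.len d.symm = 6) :
    False :=
  not_isRing_three_six X.c4 h7 (X.ring h1) (X.ring_symm h2) (vx_two_ne d hy h2)
    (vx_two_ne d.symm hx h1).symm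

theorem not_three_seven (X : Setting E C) (h6 : NoCycleOfLength G 6) (h8 : NoCycleOfLength G 8)
    {d : G.Dart} (h1 : E.len d = 3) (h2 : E.len d.symm = 7) : False :=
  not_isRing_three_seven X.c4 h6 h8 (X.ring h1) (X.ring_symm h2)

theorem not_three_eight (X : Setting E C) (h7 : NoCycleOfLength G 7)
    {d : G.Dart} (h1 : E.len d = 3) (h2 : E.len d.symm = 8) : False :=
  not_isRing_three_eight X.c4 h7 X.c9 (X.ring h1) (X.ring_symm h2)

theorem not_five_five (X : Setting E C) (h8 : NoCycleOfLength G 8) {d : G.Dart}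
    (hx : 3 ≤ deg G d.fst) (hy : 3 ≤ deg G d.snd) (h1 : E.len d = 5) (h2 : E.len d.symm = 5) :
    False :=
  not_isRing_five_five X.c4 h8 (X.ring h1) (X.ring_symm h2) (vx_two_ne d hy h2)
    (vx_two_ne d.symm hx h1).symm

theorem ring_symm_iterate (X : Setting E C) {d : G.Dart} {i n : ℕ}
    (h : E.len (E.facePerm^[i] d).symm = n + 2) :
    IsRing G (E.vx d i :: E.vx d (i + 1) ::
      ((List.range n).map fun j => E.vx (E.facePerm^[i] d).symm (j + 2)).reverse) := by
  have := X.ring_symm h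
  have e : E.vx (E.facePerm^[i] d) 1 = E.vx d (i + 1) := by
    unfold RotationSystem.vx
    rw [← Function.iterate_add_apply, add_comm]
  rwa [e] at this

/-- A face of length five is adjacent to at most one triangle. -/
theorem not_three_five_three (X : Setting E C) (h7 : NoCycleOfLength G 7) {d : G.Dart}
    (h1 : E.len d = 5) (h2 : E.len d.symm = 3) {i : ℕ} (hi0 : 0 < i) (hi : i < 5)
    (h3 : E.len (E.facePerm^[i] d).symm = 3) : False := by
  have key1 : ∀ e : G.Dart, E.len e = 5 → E.len e.symm = 3 →
      E.len (E.facePerm^[1] e).symm = 3 → False := fun e e1 e2 e3 =>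
    not_isRing_three_five_three X.c4 h7 (X.ring e1) (X.ring_symm e2) (X.ring_symm_iterate e3)
  have key2 : ∀ e : G.Dart, E.len e = 5 → E.len e.symm = 3 →
      E.len (E.facePerm^[2] e).symm = 3 → False := fun e e1 e2 e3 =>
    not_isRing_three_five_three_of_apart X.c4 h7 (X.ring e1) (X.ring_symm e2)
      (X.ring_symm_iterate e3)
  have hback : ∀ j, i + j = 5 → E.facePerm^[j] (E.facePerm^[i] d) = d := by
    intro j hj
    rw [← Function.iterate_add_apply, show j + i = 5 by omega, ← h1, E.iterate_len]
  have hl : E.len (E.facePerm^[i] d) = 5 := by rw [E.len_iterate, h1]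
  interval_cases i
  · exact key1 d h1 h2 h3
  · exact key2 d h1 h2 h3
  · exact key2 _ hl h3 (by rw [hback 2 rfl]; exact h2)
  · exact key1 _ hl h3 (by rw [hback 1 rfl]; exact h2)

/-- A triangle with two adjacent faces of length five. -/
theorem not_five_three_five (X : Setting E C) (h7 : NoCycleOfLength G 7) {d : G.Dart}
    (hx : 3 ≤ deg G d.fst) (hy : 3 ≤ deg G d.snd) (hz : 3 ≤ deg G (E.facePerm d).snd)
    (h1 : E.len d = 3) (h2 : E.len d.symm = 5) (h3 : E.len (E.facePerm d).symm = 5)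
    (hne : E.vx d.symm 4 ≠ E.vx (E.facePerm d).symm 2 ∨
      E.vx d.symm 3 ≠ E.vx (E.facePerm d).symm 3) : False := by
  have hl : E.len (E.facePerm d) = 3 := by rw [E.len_facePerm, h1]
  have e0 : E.vx (E.facePerm d) 2 = E.vx d 0 := vx_len d h1 0
  have n1 := vx_two_ne d hy h2
  have n2 := (vx_two_ne d.symm hx h1).symm
  have n3 : E.vx d 0 ≠ E.vx (E.facePerm d).symm 2 := by
    rw [← e0]
    exact (vx_two_ne (E.facePerm d).symm
      (by change 3 ≤ deg G (E.facePerm d).fst; rw [E.fst_facePerm]; exact hy) hl).symm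
  have n4 : E.vx d 0 ≠ E.vx (E.facePerm d).symm 4 := by
    rw [← e0]
    exact vx_two_ne (E.facePerm d) hz h3
  have r3 := X.ring_symm_iterate (d := d) (i := 1) h3
  rcases hne with hne | hne
  · exact not_isRing_five_three_five X.c4 X.c9 (X.ring h1) (X.ring_symm h2) r3 n1 n2 n3 n4 hne
  · exact not_isRing_five_three_five_of_ne X.c4 h7 X.c9 (X.ring h1) (X.ring_symm h2) r3 n1 n2 n3 n4
      hne

/-- If the pentagons had the same neighbour at the common vertex, the rotation there would close
after three steps, which a degree of at least 4 forbids. -/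
theorem not_five_three_five_of_four_le_deg (X : Setting E C) (h7 : NoCycleOfLength G 7)
    {d : G.Dart} (hx : 3 ≤ deg G d.fst) (hy : 4 ≤ deg G d.snd)
    (hz : 3 ≤ deg G (E.facePerm d).snd)
    (h1 : E.len d = 3) (h2 : E.len d.symm = 5) (h3 : E.len (E.facePerm d).symm = 5) : False := by
  refine X.not_five_three_five h7 hx (by omega) hz h1 h2 h3 (Or.inl fun h => ?_)
  have e1 : E.vx d.symm 4 = (E.rot.symm d.symm).snd := by
    rw [RotationSystem.vx, E.iterate_eq_inv h2, ← E.symm_facePerm_inv]; rfl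
  have e2 : E.vx (E.facePerm d).symm 2 = (E.rot (E.rot d.symm)).snd := by
    rw [E.rot_eq (E.rot d.symm), ← E.facePerm_apply, ← E.vx_one]; rfl
  rw [e1, e2] at h
  have h' := dart_ext (by rw [E.fst_rot_inv, E.fst_rot, E.fst_rot]) h
  refine E.rot_iterate_ne (d := d.symm) (i := 3) (by omega) hy ?_
  change E.rot (E.rot (E.rot d.symm)) = d.symm
  rw [← h', Equiv.apply_symm_apply]

/-- The remaining case has `a = r` and `b = q`: the two pentagons then share two consecutive edges,
whose middle vertex would have degree 2. -/
theorem not_five_three_five_of_deg (X : Setting E C) (h7 : NoCycleOfLength G 7)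
    {d : G.Dart} (hx : 3 ≤ deg G d.fst) (hy : 3 ≤ deg G d.snd)
    (hz : 3 ≤ deg G (E.facePerm d).snd)
    (ha : 3 ≤ deg G (E.vx d.symm 4) ∨ 3 ≤ deg G (E.vx (E.facePerm d).symm 2))
    (h1 : E.len d = 3) (h2 : E.len d.symm = 5) (h3 : E.len (E.facePerm d).symm = 5) : False := by
  refine X.not_five_three_five h7 hx hy hz h1 h2 h3 ?_
  by_contra hc
  push Not at hc
  obtain ⟨hc1, hc2⟩ := hc
  rw [← hc1, or_self] at ha
  set e := E.facePerm.symm d.symm with he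
  have e0 : E.facePerm^[4] d.symm = e := E.iterate_eq_inv h2
  have e1 : e.fst = E.vx d.symm 4 := by rw [← e0]; rfl
  have e2 : e.symm = E.facePerm (E.facePerm d).symm := by
    refine dart_ext ?_ ?_
    · change e.snd = _
      rw [he, E.snd_facePerm_inv, E.fst_facePerm]
      exact (E.fst_facePerm d).symm
    · change e.fst = _
      rw [e1, hc1, ← E.vx_one]; rfl
  have hle : E.len e = 4 + 1 := by rw [he, E.len_facePerm_inv, h2]
  have h4 : E.vx e 4 = E.vx d.symm 3 := by
    rw [← e0]
    exact vx_len d.symm h2 3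
  have := vx_two_ne e.symm (by change 3 ≤ deg G e.fst; rw [e1]; exact ha) (n := 4) hle
  apply this
  change _ = E.vx e 4
  rw [h4, e2, hc2]
  rfl

theorem not_five_five_five (X : Setting E C) (h6 : NoCycleOfLength G 6)
    {d : G.Dart} (hd : deg G d.fst = 3) (h1 : E.len d = 5) (h2 : E.len (E.rot d) = 5)
    (h3 : E.len (E.rot (E.rot d)) = 5) : False := by
  have hlast : ∀ e : G.Dart, E.len e = 5 → E.vx e 4 = (E.rot.symm e).snd := by
    intro e he
    rw [RotationSystem.vx, E.iterate_eq_inv he, ← E.symm_facePerm_inv]; rfl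
  have hinv := E.rot_inv_eq_of_deg_three hd
  have r1 := X.ring h1
  have r2 := X.ring h2
  have r3 := X.ring h3
  have a1 : E.vx d 4 = E.vx (E.rot (E.rot d)) 1 := by
    rw [hlast d h1, hinv, E.vx_one]
  have a2 : E.vx (E.rot (E.rot d)) 4 = E.vx (E.rot d) 1 := by
    rw [hlast _ h3, Equiv.symm_apply_apply, E.vx_one]
  have a3 : E.vx (E.rot d) 4 = E.vx d 1 := by
    rw [hlast _ h2, Equiv.symm_apply_apply, E.vx_one]
  have b1 : E.vx (E.rot (E.rot d)) 0 = E.vx d 0 := by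
    rw [E.vx_zero, E.fst_rot, E.fst_rot]; rfl
  have b2 : E.vx (E.rot d) 0 = E.vx d 0 := E.fst_rot d
  simp only [List.range_succ_eq_map, List.map_cons, List.map_nil, List.range_zero,
    Nat.succ_eq_add_one, zero_add] at r1 r2 r3
  rw [a1] at r1
  rw [a2, b1] at r3
  rw [a3, b2] at r2
  exact not_isRing_five_five_five X.c4 h6 X.c9 r1 r3 r2

end Setting

end DPG

/-! ### Coincidences between faces of different lengths. -/

namespace DPG

open Equiv Equiv.Perm

namespace Setting

variable {V : Type u} [Finite V] {G : SimpleGraph V} {E : RotationSystem G} {C : Set V}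

omit [Finite V] in
theorem vx_last (d : G.Dart) {n : ℕ} (h : E.len d = n + 1) : E.vx d n = (E.rot.symm d).snd := by
  rw [RotationSystem.vx, E.iterate_eq_inv h, ← E.symm_facePerm_inv]; rfl

/-- Two faces that share an edge do not meet again next to this edge. -/
theorem vx_two_ne_of_len_ne (X : Setting E C) {d : G.Dart} (hl : E.len d.symm ≠ E.len d) {n : ℕ}
    (hn : E.len d.symm = n + 2) (hy : 3 ≤ deg G d.snd) :
    E.vx d 2 ≠ E.vx d.symm n := by
  classical
  intro h
  have hn' : ¬ SameCycle E.facePerm d.symm (E.facePerm d) := fun hc => by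
    have := minimalPeriod_eq_of_sameCycle hc
    exact hl (this.trans (E.len_facePerm d))
  have hadj : G.Adj d.snd (E.vx d 2) := by
    have := E.adj_vx d 1
    rwa [E.vx_one] at this
  -- If the vertices coincided, the two faces would share both ends of an edge from `d.snd`. The
  -- different lengths make the faces distinct, and the ends of an edge do not separate a critical
  -- graph.
  refine not_two_faces E X.sph (y := d.snd) (a := E.vx d 2) hadj.ne (X.crit.edge_cut _ _ hadj)
    (e₁ := d.symm) (e₂ := E.facePerm d) (e₃ := E.facePerm^[n] d.symm) (e₄ := E.facePerm^[2] d)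
    rfl (E.fst_facePerm d) h.symm rfl ?_ ?_ (sameCycle_iterate _ _ _)
    (sameCycle_iterate _ (E.facePerm d) 1) hn' ?_
  · intro hc; exact hn' (hc ▸ SameCycle.refl _ _)
  · intro hc
    apply hn'
    refine (sameCycle_iterate _ _ n).trans ?_
    rw [hc]
    exact (sameCycle_iterate _ (E.facePerm d) 1).symm
  · intro m hm1 hm2
    have hm : m = E.facePerm d := by
      refine dart_ext (hm1.trans (E.fst_facePerm d).symm) ?_
      rw [hm2, ← E.vx_one]; rfl
    refine ⟨E.rot.symm d.symm, E.fst_rot_inv _, ?_, ?_⟩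
    · rw [← vx_last d.symm hn]
      exact (vx_two_ne d hy hn).symm
    · refine SameCycle.symm ⟨1, ?_⟩
      rw [zpow_one, Perm.mul_apply, Equiv.apply_symm_apply, swap_apply_left, hm]

/-- The mirror image of `vx_two_ne_of_len_ne`, at the other end of the common edge. -/
theorem vx_three_ne_of_len_ne (X : Setting E C) {d : G.Dart} (hl : E.len d.symm ≠ E.len d) {n : ℕ}
    (hn : E.len d = n + 1) (hx : 3 ≤ deg G d.fst) : E.vx d.symm 3 ≠ E.vx d n := by
  classical
  intro h
  have hn' : ¬ SameCycle E.facePerm d (E.facePerm d.symm) := fun hc => by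
    have := minimalPeriod_eq_of_sameCycle hc
    exact hl ((E.len_facePerm d.symm).symm.trans this.symm)
  have e : E.vx d n = (E.rot.symm d).snd := vx_last d hn
  have hadj : G.Adj d.fst (E.vx d n) := by
    rw [e, ← E.fst_rot_inv d]; exact (E.rot.symm d).adj
  refine not_two_faces E X.sph (y := d.fst) (a := E.vx d n) hadj.ne (X.crit.edge_cut _ _ hadj)
    (e₁ := d) (e₂ := E.facePerm d.symm) (e₃ := E.facePerm^[n] d) (e₄ := E.facePerm^[3] d.symm)
    rfl (E.fst_facePerm d.symm) rfl h ?_ ?_ (sameCycle_iterate _ _ _)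
    (sameCycle_iterate _ (E.facePerm d.symm) 2) hn' ?_
  · intro hc; exact hn' (hc ▸ SameCycle.refl _ _)
  · intro hc
    apply hn'
    refine (sameCycle_iterate _ _ n).trans ?_
    rw [hc]
    exact (sameCycle_iterate _ (E.facePerm d.symm) 2).symm
  · intro m hm1 hm2
    have hm : m = E.rot.symm d := dart_ext (hm1.trans (E.fst_rot_inv d).symm) (hm2.trans e)
    refine ⟨E.facePerm d.symm, E.fst_facePerm _, ?_, ?_⟩
    · rw [← E.vx_one (E.facePerm d.symm)]
      exact vx_two_ne d.symm hx hn
    · refine ⟨1, ?_⟩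
      rw [zpow_one, Perm.mul_apply, hm, Equiv.apply_symm_apply, swap_apply_left]

/-- A face of length five is not adjacent to a face of length six. -/
theorem not_five_six (X : Setting E C) {d : G.Dart}
    (hx : 3 ≤ deg G d.fst) (hy : 3 ≤ deg G d.snd) (h1 : E.len d = 5) (h2 : E.len d.symm = 6) :
    False := by
  refine not_isRing_five_six X.c4 X.c9 (X.ring h1) (X.ring_symm h2) (vx_two_ne d hy h2)
    (vx_two_ne d.symm hx h1).symm
    (X.vx_two_ne_of_len_ne (by omega) (n := 4) h2 hy)
    (X.vx_three_ne_of_len_ne (by omega) (n := 4) h1 hx).symm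

end Setting

end DPG

/-! ### Types of vertices and faces, and which faces can be neighbours. -/

namespace DPG

open Equiv Equiv.Perm

section Predicates

variable {V : Type u} {G : SimpleGraph V}

/-- A vertex of degree three outside `C`. -/
def Light (G : SimpleGraph V) (C : Set V) (v : V) : Prop := v ∉ C ∧ deg G v = 3

/-- A vertex of degree at least four outside `C`. -/
def Heavy (G : SimpleGraph V) (C : Set V) (v : V) : Prop := v ∉ C ∧ 4 ≤ deg G v

theorem Light.not_heavy {C : Set V} {v : V} (h : Light G C v) : ¬ Heavy G C v := fun h' => by
  have := h.2; have := h'.2; omega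

namespace RotationSystem

variable (E : RotationSystem G) (C : Set V)

/-- The face through a dart avoids `C`. -/
def Act (d : G.Dart) : Prop := ∀ e, SameCycle E.facePerm d e → e.fst ∉ C

/-- The face through a dart is a triangle that avoids `C`. -/
def IsT (d : G.Dart) : Prop := E.len d = 3 ∧ E.Act C d

/-- The face through a dart is a pentagon that avoids `C`. -/
def IsQ (d : G.Dart) : Prop := E.len d = 5 ∧ E.Act C d

/-- The face through a dart is adjacent to a triangle that avoids `C`. -/
def NearT (d : G.Dart) : Prop := ∃ e, SameCycle E.facePerm d e ∧ E.IsT C e.symm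

/-- Pentagons adjacent to a triangle, both avoiding `C`. -/
def IsCQ (d : G.Dart) : Prop := E.IsQ C d ∧ E.NearT C d

/-- The other pentagons that avoid `C`. -/
def IsUQ (d : G.Dart) : Prop := E.IsQ C d ∧ ¬ E.NearT C d

/-- The faces that have to be paid for with more than one unit of charge. -/
def Needy (d : G.Dart) : Prop := E.IsT C d ∨ E.IsCQ C d

/-- Triangles and pentagons that avoid `C`. -/
def Small (d : G.Dart) : Prop := E.IsT C d ∨ E.IsQ C d

/-- All vertices of the face are light. -/
def AllLight (d : G.Dart) : Prop := ∀ e, SameCycle E.facePerm d e → Light G C e.fst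

/-- The vertex of this corner has degree more than four, or the opposite face is not small. -/
def Str (d : G.Dart) : Prop := ¬ (deg G d.fst = 4 ∧ E.Small C (E.rot (E.rot d)))

variable {E C}

theorem act_congr {d e : G.Dart} (h : SameCycle E.facePerm d e) : E.Act C d ↔ E.Act C e :=
  ⟨fun k a ha => k a (h.trans ha), fun k a ha => k a (h.symm.trans ha)⟩

theorem allLight_congr {d e : G.Dart} (h : SameCycle E.facePerm d e) :
    E.AllLight C d ↔ E.AllLight C e :=
  ⟨fun k a ha => k a (h.trans ha), fun k a ha => k a (h.symm.trans ha)⟩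

theorem nearT_congr {d e : G.Dart} (h : SameCycle E.facePerm d e) :
    E.NearT C d ↔ E.NearT C e :=
  ⟨fun ⟨a, h1, h2⟩ => ⟨a, h.symm.trans h1, h2⟩, fun ⟨a, h1, h2⟩ => ⟨a, h.trans h1, h2⟩⟩

theorem sameCycle_facePerm (d : G.Dart) : SameCycle E.facePerm (E.facePerm d) d :=
  (sameCycle_iterate E.facePerm d 1).symm

theorem sameCycle_facePerm_inv (d : G.Dart) : SameCycle E.facePerm (E.facePerm.symm d) d := by
  have := sameCycle_facePerm (E := E) (E.facePerm.symm d)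
  rw [Equiv.apply_symm_apply] at this
  exact this.symm

theorem Act.fst_notMem {d : G.Dart} (h : E.Act C d) : d.fst ∉ C := h d (SameCycle.refl _ _)

theorem Act.snd_notMem {d : G.Dart} (h : E.Act C d) : d.snd ∉ C := by
  rw [← E.fst_facePerm]; exact h _ (sameCycle_iterate _ d 1)

theorem Act.vx_notMem {d : G.Dart} (h : E.Act C d) (i : ℕ) : E.vx d i ∉ C :=
  h _ (sameCycle_iterate _ d i)

theorem Needy.act {d : G.Dart} (h : E.Needy C d) : E.Act C d := h.elim (·.2) (·.1.2)

theorem IsCQ.needy {d : G.Dart} (h : E.IsCQ C d) : E.Needy C d := Or.inr h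

theorem IsT.needy {d : G.Dart} (h : E.IsT C d) : E.Needy C d := Or.inl h

theorem Needy.small {d : G.Dart} (h : E.Needy C d) : E.Small C d :=
  h.elim Or.inl fun h => Or.inr h.1

theorem small_iff {d : G.Dart} : E.Small C d ↔ E.Needy C d ∨ E.IsUQ C d := by
  unfold Small Needy IsCQ IsUQ
  tauto

theorem IsUQ.not_needy {d : G.Dart} (h : E.IsUQ C d) : ¬ E.Needy C d := by
  rintro (h' | h')
  · have := h.1.1; have := h'.1; omega
  · exact h.2 h'.2

variable [Finite V]

theorem len_congr {d e : G.Dart} (h : SameCycle E.facePerm d e) : E.len d = E.len e :=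
  minimalPeriod_eq_of_sameCycle h

theorem isT_congr {d e : G.Dart} (h : SameCycle E.facePerm d e) : E.IsT C d ↔ E.IsT C e := by
  unfold IsT; rw [len_congr h, act_congr h]

theorem isQ_congr {d e : G.Dart} (h : SameCycle E.facePerm d e) : E.IsQ C d ↔ E.IsQ C e := by
  unfold IsQ; rw [len_congr h, act_congr h]

theorem isCQ_congr {d e : G.Dart} (h : SameCycle E.facePerm d e) : E.IsCQ C d ↔ E.IsCQ C e := by
  unfold IsCQ; rw [isQ_congr h, nearT_congr h]

theorem isUQ_congr {d e : G.Dart} (h : SameCycle E.facePerm d e) : E.IsUQ C d ↔ E.IsUQ C e := by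
  unfold IsUQ; rw [isQ_congr h, nearT_congr h]

theorem needy_congr {d e : G.Dart} (h : SameCycle E.facePerm d e) :
    E.Needy C d ↔ E.Needy C e := by
  unfold Needy; rw [isT_congr h, isCQ_congr h]

theorem small_congr {d e : G.Dart} (h : SameCycle E.facePerm d e) :
    E.Small C d ↔ E.Small C e := by
  unfold Small; rw [isT_congr h, isQ_congr h]

omit [Finite V] in
theorem sameCycle_rot (d : G.Dart) : SameCycle E.facePerm (E.rot d) d.symm := by
  rw [E.rot_eq]; exact sameCycle_facePerm _

omit [Finite V] in
theorem sameCycle_rot_inv (d : G.Dart) :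
    SameCycle E.facePerm (E.rot.symm d) (E.facePerm.symm d).symm := by
  rw [E.symm_facePerm_inv]

/-- Around a vertex of degree three. -/
theorem sameCycle_rot_symm {d : G.Dart} (h : deg G d.fst = 3) :
    SameCycle E.facePerm (E.rot d).symm (E.facePerm.symm d).symm := by
  rw [E.symm_facePerm_inv, E.rot_inv_eq_of_deg_three h]
  exact (sameCycle_rot _).symm

omit [Finite V] in
theorem IsCQ.not_isT {d : G.Dart} (h : E.IsCQ C d) : ¬ E.IsT C d := fun h' => by
  have := h.1.1; have := h'.1; omega

end RotationSystem

end Predicates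

namespace Setting

open RotationSystem

variable {V : Type u} [Finite V] {G : SimpleGraph V} {E : RotationSystem G} {C : Set V}

omit [Finite V] in
theorem light_or_heavy (X : Setting E C) {v : V} (hv : v ∉ C) : Light G C v ∨ Heavy G C v := by
  have := X.three_le_deg hv
  by_cases h : deg G v = 3
  · exact Or.inl ⟨hv, h⟩
  · exact Or.inr ⟨hv, by omega⟩

theorem len_cases (X : Setting E C) (d : G.Dart) : E.len d = 3 ∨ E.len d = 5 ∨ E.len d = 6 ∨
    E.len d = 7 ∨ E.len d = 8 ∨ 10 ≤ E.len d := by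
  have := X.three_le_len d
  have := X.len_ne X.c4 d
  have := X.len_ne X.c9 d
  omega

/-- Next to a triangle that avoids `C`. -/
theorem len_symm_of_isT (X : Setting E C) {d : G.Dart} (h : E.IsT C d) :
    E.len d.symm = 5 ∨ 10 ≤ E.len d.symm := by
  have hx := X.three_le_deg h.2.fst_notMem
  have hy := X.three_le_deg h.2.snd_notMem
  have k3 := X.not_three_three hy h.1
  have hl := X.len_cases d.symm
  rcases X.cases with ⟨h7, h8⟩ | ⟨h6, h8⟩ | ⟨h6, h7⟩
  · have k6 := X.not_three_six h7 hx hy h.1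
    have := X.len_ne h7 d.symm
    have := X.len_ne h8 d.symm
    grind
  · have k7 := X.not_three_seven h6 h8 h.1
    have := X.len_ne h6 d.symm
    have := X.len_ne h8 d.symm
    grind
  · have k8 := X.not_three_eight h7 h.1
    have := X.len_ne h6 d.symm
    have := X.len_ne h7 d.symm
    grind

/-- A triangle and a pentagon at a common edge give a cycle of length 6. So of the three cases of
the theorem only the one that permits this length remains. -/
theorem no_seven_eight_of_three_five (X : Setting E C) {d : G.Dart} (h3 : E.len d = 3)
    (h5 : E.len d.symm = 5) : NoCycleOfLength G 7 ∧ NoCycleOfLength G 8 := by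
  rcases X.cases with h | ⟨h6, -⟩ | ⟨h6, -⟩
  · exact h
  · exact (X.not_three_five h6 h3 h5).elim
  · exact (X.not_three_five h6 h3 h5).elim

/-- Two pentagons at a common edge give a cycle of length 8, which leaves only the case that
excludes 6 and 7. Hence this situation and a pentagon next to a triangle never occur in the same
graph. -/
theorem no_six_seven_of_five_five (X : Setting E C) {d : G.Dart} (hx : 3 ≤ deg G d.fst)
    (hy : 3 ≤ deg G d.snd) (h5 : E.len d = 5) (h5' : E.len d.symm = 5) :
    NoCycleOfLength G 6 ∧ NoCycleOfLength G 7 := by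
  rcases X.cases with ⟨-, h8⟩ | ⟨-, h8⟩ | h
  · exact (X.not_five_five h8 hx hy h5 h5').elim
  · exact (X.not_five_five h8 hx hy h5 h5').elim
  · exact h

theorem not_three_five_and_five_five (X : Setting E C) {d e : G.Dart} (h3 : E.len d = 3)
    (h5 : E.len d.symm = 5) (hx : 3 ≤ deg G e.fst)
    (hy : 3 ≤ deg G e.snd) (h : E.len e = 5) (h' : E.len e.symm = 5) : False :=
  X.not_five_five (X.no_seven_eight_of_three_five h3 h5).2 hx hy h h'

/-- A pentagon is adjacent to at most one triangle. -/
theorem eq_of_five_three (X : Setting E C) {d e : G.Dart} (h5 : E.len d = 5)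
    (hde : SameCycle E.facePerm d e) (h : E.len d.symm = 3) (h' : E.len e.symm = 3) : d = e := by
  obtain ⟨i, hi, rfl⟩ := (sameCycle_iff_exists_lt _ _ _).1 hde
  have hi' : i < 5 := by rw [← h5]; exact hi
  rcases Nat.eq_zero_or_pos i with rfl | h0
  · rfl
  · have h7 := (X.no_seven_eight_of_three_five (d := d.symm) h (by simpa using h5)).1
    exact (X.not_three_five_three h7 h5 h h0 hi' h').elim

/-- A triangle adjacent to a pentagon that avoids `C` is adjacent to no other pentagon. -/
theorem eq_of_three_five (X : Setting E C) {d e : G.Dart} (h3 : E.IsT C d)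
    (hde : SameCycle E.facePerm d e) (h : E.IsQ C d.symm) (h' : E.len e.symm = 5) : d = e := by
  have h7 := (X.no_seven_eight_of_three_five h3.1 h.1).1
  have key : ∀ d : G.Dart, E.IsT C d → E.len d.symm = 5 → E.len (E.facePerm d).symm = 5 →
      (E.Act C d.symm ∨ E.Act C (E.facePerm d).symm) → False := by
    intro d hd h1 h2 h4
    refine X.not_five_three_five_of_deg h7 (X.three_le_deg hd.2.fst_notMem)
      (X.three_le_deg hd.2.snd_notMem) (X.three_le_deg ?_) ?_ hd.1 h1 h2
    · exact ((isT_congr (sameCycle_facePerm d)).2 hd).2.snd_notMem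
    · exact h4.imp (fun h => X.three_le_deg (h.vx_notMem 4)) (fun h => X.three_le_deg (h.vx_notMem 2))
  obtain ⟨i, hi, rfl⟩ := (sameCycle_iff_exists_lt _ _ _).1 hde
  have hi' : i < 3 := by rw [← h3.1]; exact hi
  interval_cases i
  · rfl
  · exact (key d h3 h.1 h' (Or.inl h.2)).elim
  · have e0 : E.facePerm (E.facePerm^[2] d) = d := by
      have := E.iterate_len d; rw [h3.1] at this; exact this
    refine (key (E.facePerm^[2] d) ((isT_congr hde).1 h3) h' (by rw [e0]; exact h.1) ?_).elim
    rw [e0]; exact Or.inr h.2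

/-- The triangle next to the pentagon forces the case without cycles of lengths 7 and 8. Then no
pentagon, hexagon or second triangle fits beside this pentagon. -/
theorem len_symm_of_isCQ (X : Setting E C) {d : G.Dart} (h : E.IsCQ C d) :
    E.IsT C d.symm ∨ 10 ≤ E.len d.symm := by
  obtain ⟨⟨h5, ha⟩, t, ht, hT⟩ := h
  have ht5 : E.len t = 5 := by rw [← len_congr ht, h5]
  obtain ⟨h7, h8⟩ := X.no_seven_eight_of_three_five (d := t.symm) hT.1 ht5
  have hx := X.three_le_deg ha.fst_notMem
  have hy := X.three_le_deg ha.snd_notMem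
  have k5 := X.not_five_five h8 hx hy h5
  have k6 := X.not_five_six hx hy h5
  have k3 : E.len d.symm = 3 → E.IsT C d.symm := fun h => by
    rw [X.eq_of_five_three h5 ht h hT.1]; exact hT
  have := X.len_ne h7 d.symm
  have := X.len_ne h8 d.symm
  have hl := X.len_cases d.symm
  grind

theorem not_isUQ_symm_of_needy (X : Setting E C) {d : G.Dart} (h : E.Needy C d) :
    ¬ E.IsUQ C d.symm := by
  intro h'
  rcases h with h | h
  · exact h'.2 ⟨d.symm, SameCycle.refl _ _, h⟩
  · rcases X.len_symm_of_isCQ h with k | k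
    · have := k.1; have := h'.1.1; omega
    · have := h'.1.1; omega

/-- Next to a pentagon that avoids `C` and has no triangle next to it. -/
theorem len_symm_of_isUQ (X : Setting E C) {d : G.Dart} (h : E.IsUQ C d) :
    E.len d.symm = 3 ∨ E.len d.symm = 5 ∨ E.len d.symm = 7 ∨ E.len d.symm = 8 ∨
      10 ≤ E.len d.symm := by
  have hx := X.three_le_deg h.1.2.fst_notMem
  have hy := X.three_le_deg h.1.2.snd_notMem
  have k6 := X.not_five_six hx hy h.1.1
  have hl := X.len_cases d.symm
  grind

/-- The two other faces at a light vertex of a face are adjacent. -/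
theorem not_needy_isUQ (X : Setting E C) {d : G.Dart} (h : Light G C d.fst)
    (h1 : E.Needy C d.symm) (h2 : E.IsUQ C (E.facePerm.symm d).symm) : False := by
  refine X.not_isUQ_symm_of_needy (d := E.rot d) ((needy_congr (sameCycle_rot d)).2 h1) ?_
  exact (isUQ_congr (sameCycle_rot_symm h.2)).2 h2

theorem not_isUQ_needy (X : Setting E C) {d : G.Dart} (h : Light G C d.fst)
    (h1 : E.IsUQ C d.symm) (h2 : E.Needy C (E.facePerm.symm d).symm) : False := by
  refine X.not_isUQ_symm_of_needy (d := (E.rot d).symm)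
    ((needy_congr (sameCycle_rot_symm h.2)).2 h2) ?_
  rw [SimpleGraph.Dart.symm_symm]
  exact (isUQ_congr (sameCycle_rot d)).2 h1

end Setting

end DPG

/-! ### Adjacent faces with only light vertices are reducible. -/

namespace DPG

open Equiv Equiv.Perm

namespace Setting

open RotationSystem

variable {V : Type u} [Finite V] {G : SimpleGraph V} {E : RotationSystem G} {C : Set V}

/-- A set that grows along a facial cycle, except into `p`, contains the cycle except `p`. -/
theorem mem_of_cycle_closed (X : Setting E C) {d : G.Dart} {p : V} {Z : Set V}
    (hf : ∀ e, SameCycle E.facePerm d e → e.fst ∈ Z → e.snd ≠ p → e.snd ∈ Z)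
    (hb : ∀ e, SameCycle E.facePerm d e → e.snd ∈ Z → e.fst ≠ p → e.fst ∈ Z) (hd : d.fst ∈ Z)
    {e : G.Dart} (he : SameCycle E.facePerm d e) (hp : e.fst ≠ p) : e.fst ∈ Z := by
  obtain ⟨m, hm, rfl⟩ := (sameCycle_iff_exists_lt _ _ _).1 he
  change m < E.len d at hm
  have hs : ∀ i, (E.facePerm^[i] d).snd = (E.facePerm^[i + 1] d).fst := fun i => by
    rw [Function.iterate_succ_apply', E.fst_facePerm]
  by_cases hk : ∃ k < m, (E.facePerm^[k + 1] d).fst = p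
  · obtain ⟨k, hkm, hkp⟩ := hk
    have key : ∀ j, j ≤ E.len d - m → (E.facePerm^[E.len d - j] d).fst ∈ Z := by
      intro j
      induction j with
      | zero => intro _; rw [Nat.sub_zero, E.iterate_len]; exact hd
      | succ j ih =>
        intro hj
        have h1 := ih (by omega)
        rw [show E.len d - j = E.len d - (j + 1) + 1 by omega, ← hs] at h1
        refine hb _ (sameCycle_iterate _ _ _) h1 fun h => ?_
        have := X.fst_iterate_inj d (by omega) (by omega) (h.trans hkp.symm)
        have : k + 1 ≠ m := by rintro rfl; exact hp hkp
        omega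
    have := key (E.len d - m) le_rfl
    rwa [show E.len d - (E.len d - m) = m by omega] at this
  · push Not at hk
    have key : ∀ j, j ≤ m → (E.facePerm^[j] d).fst ∈ Z := by
      intro j
      induction j with
      | zero => intro _; exact hd
      | succ j ih =>
        intro hj
        rw [← hs]
        exact hf _ (sameCycle_iterate _ _ _) (ih (by omega)) (by rw [hs]; exact hk j (by omega))
    exact key m le_rfl

/-- Irreducibility in positive form: some set `Y` that contains `q` resists the greedy order. A
vertex of degree 3 with one neighbour in `Y`, or of degree 4 with two, must itself lie in `Y`. Each
application shows that `Y` is then all of `S` except `p`. -/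
theorem exists_closure (X : Setting E C) {S : Set V} {p q : V} (hS : ∀ v ∈ S, v ∉ C)
    (hp : p ∈ S) (hq : q ∈ S) (hpq : G.Adj p q) (hN : ∀ w, G.Adj p w → w ∈ S) (hq3 : deg G q ≤ 3)
    (ho : ∃ w, G.Adj q w ∧ w ∉ S) :
    ∃ Y ⊆ S, p ∉ Y ∧ q ∈ Y ∧ (∃ v ∈ S, v ≠ p ∧ v ∉ Y) ∧
      (∀ v ∈ S, v ≠ p → deg G v = 3 → ∀ y ∈ Y, G.Adj v y → v ∈ Y) ∧
      ∀ v ∈ S, v ≠ p → deg G v = 4 → ∀ y ∈ Y, ∀ z ∈ Y, y ≠ z → G.Adj v y → G.Adj v z → v ∈ Y := by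
  have h := X.crit.irreducible S p q hS hp hq hpq hN hq3 ho
  push Not at h
  obtain ⟨Y, hY, hpY, hqY, hv, hcl⟩ := h
  refine ⟨Y, hY, hpY, hqY, hv, ?_, ?_⟩
  · intro v hv hvp hd y hy hvy
    by_contra hvY
    have h1 := hcl v hv hvp hvY
    have h2 : 0 < {w | G.Adj v w ∧ w ∈ Y}.ncard := (Set.ncard_pos (Set.toFinite _)).2 ⟨y, hvy, hy⟩
    change _ < deg G v at h1
    omega
  · intro v hv hvp hd y hy z hz hyz hvy hvz
    by_contra hvY
    have h1 := hcl v hv hvp hvY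
    have h2 : 1 < {w | G.Adj v w ∧ w ∈ Y}.ncard :=
      (Set.one_lt_ncard (Set.toFinite _)).2 ⟨y, ⟨hvy, hy⟩, z, ⟨hvz, hz⟩, hyz⟩
    change _ < deg G v at h1
    omega

/-- Two adjacent faces do not both consist of light vertices. -/
theorem not_allLight (X : Setting E C) {d : G.Dart} (h1 : E.AllLight C d)
    (h2 : E.AllLight C d.symm) : False := by
  set S : Set V := {v | ∃ e, (SameCycle E.facePerm d e ∨ SameCycle E.facePerm d.symm e) ∧ e.fst = v}
    with hSdef
  have hl : ∀ v ∈ S, Light G C v := by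
    rintro v ⟨e, h | h, rfl⟩
    · exact h1 e h
    · exact h2 e h
  have hm1 : ∀ e, SameCycle E.facePerm d e → e.fst ∈ S := fun e h => ⟨e, Or.inl h, rfl⟩
  have hm2 : ∀ e, SameCycle E.facePerm d.symm e → e.fst ∈ S := fun e h => ⟨e, Or.inr h, rfl⟩
  have hs1 : ∀ e, SameCycle E.facePerm d e → e.snd ∈ S := fun e h => by
    rw [← E.fst_facePerm]; exact hm1 _ (h.trans (sameCycle_facePerm _).symm)
  have hs2 : ∀ e, SameCycle E.facePerm d.symm e → e.snd ∈ S := fun e h => by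
    rw [← E.fst_facePerm]; exact hm2 _ (h.trans (sameCycle_facePerm _).symm)
  have hd : d.fst ∈ S := hm1 d (SameCycle.refl _ _)
  -- An end of the common edge has degree 3, and its three edges all lie on the two faces.
  have hNd : ∀ w, G.Adj d.fst w → w ∈ S := by
    intro w hw
    rcases (E.adj_iff_of_deg_three (hl _ hd).2 w).1 hw with rfl | rfl | rfl
    · exact hs1 d (SameCycle.refl _ _)
    · exact hs2 _ (sameCycle_rot d).symm
    · rw [← E.symm_facePerm_inv]
      exact hm1 _ (sameCycle_facePerm_inv d).symm
  -- On a walk from the common edge to `C`, which is disjoint from `S`, some vertex with all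
  -- neighbours in `S` is followed by one with a neighbour outside.
  obtain ⟨p, q, hp, hpq, hN, hq⟩ : ∃ p q, p ∈ S ∧ G.Adj p q ∧ (∀ w, G.Adj p w → w ∈ S) ∧
      ∃ w, G.Adj q w ∧ w ∉ S := by
    by_contra hcon
    push Not at hcon
    obtain ⟨c, hc⟩ := X.crit.nonempty
    obtain ⟨W⟩ := X.reachable d.fst c
    have : ∀ (u v : V) (W : G.Walk u v), u ∈ S → (∀ w, G.Adj u w → w ∈ S) → v ∈ S := by
      intro u v W
      induction W with
      | nil => exact fun h _ => h
      | @cons u x v hux W ih =>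
        intro hu hNu
        exact ih (hNu x hux) (hcon u x hu hux hNu)
    exact (hl c (this _ _ W hd hNd)).1 hc
  obtain ⟨Y, -, -, hqY, ⟨v, hvS, hvp, hvY⟩, hcl, -⟩ := X.exists_closure (fun v hv => (hl v hv).1) hp
    (hN q hpq) hpq hN (hl q (hN q hpq)).2.le hq
  have cl : ∀ a ∈ S, a ≠ p → ∀ y ∈ Y, G.Adj a y → a ∈ Y := fun a ha hap =>
    hcl a ha hap (hl a ha).2
  have c1 : ∀ e₀, SameCycle E.facePerm d e₀ → e₀.fst ∈ Y →
      ∀ e, SameCycle E.facePerm d e → e.fst ≠ p → e.fst ∈ Y := by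
    intro e₀ h₀ hY e he
    refine X.mem_of_cycle_closed (d := e₀) (fun a ha h h' => ?_) (fun a ha h h' => ?_) hY
      (h₀.symm.trans he)
    · exact cl _ (hs1 a (h₀.trans ha)) h' _ h a.adj.symm
    · exact cl _ (hm1 a (h₀.trans ha)) h' _ h a.adj
  have c2 : ∀ e₀, SameCycle E.facePerm d.symm e₀ → e₀.fst ∈ Y →
      ∀ e, SameCycle E.facePerm d.symm e → e.fst ≠ p → e.fst ∈ Y := by
    intro e₀ h₀ hY e he
    refine X.mem_of_cycle_closed (d := e₀) (fun a ha h h' => ?_) (fun a ha h h' => ?_) hY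
      (h₀.symm.trans he)
    · exact cl _ (hs2 a (h₀.trans ha)) h' _ h a.adj.symm
    · exact cl _ (hm2 a (h₀.trans ha)) h' _ h a.adj
  -- At least one end of the common edge is not `p`; there the closure passes from one face to the
  -- other.
  have t1 : ∀ e₀, SameCycle E.facePerm d e₀ → e₀.fst ∈ Y → ∃ e₁, SameCycle E.facePerm d.symm e₁ ∧
      e₁.fst ∈ Y := by
    intro e₀ h h'
    by_cases hdp : d.fst = p
    · refine ⟨d.symm, SameCycle.refl _ _, ?_⟩
      have := c1 e₀ h h' (E.facePerm d) (sameCycle_facePerm d).symm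
        (by rw [E.fst_facePerm, ← hdp]; exact d.adj.ne')
      rwa [E.fst_facePerm] at this
    · exact ⟨E.facePerm d.symm, (sameCycle_facePerm _).symm, by
        rw [E.fst_facePerm]; exact c1 e₀ h h' d (SameCycle.refl _ _) hdp⟩
  have t2 : ∀ e₀, SameCycle E.facePerm d.symm e₀ → e₀.fst ∈ Y → ∃ e₁, SameCycle E.facePerm d e₁ ∧
      e₁.fst ∈ Y := by
    intro e₀ h h'
    by_cases hdp : d.fst = p
    · refine ⟨E.facePerm d, (sameCycle_facePerm _).symm, ?_⟩
      rw [E.fst_facePerm]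
      exact c2 e₀ h h' d.symm (SameCycle.refl _ _) (by rw [← hdp]; exact d.adj.ne')
    · refine ⟨d, SameCycle.refl _ _, ?_⟩
      have := c2 e₀ h h' (E.facePerm d.symm) (sameCycle_facePerm _).symm
        (by rw [E.fst_facePerm]; exact hdp)
      rwa [E.fst_facePerm] at this
  obtain ⟨e₀, h₀ | h₀, rfl⟩ := hN q hpq
  · obtain ⟨e₁, h₁, h₁'⟩ := t1 e₀ h₀ hqY
    obtain ⟨e, he | he, rfl⟩ := hvS
    · exact hvY (c1 e₀ h₀ hqY e he hvp)
    · exact hvY (c2 e₁ h₁ h₁' e he hvp)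
  · obtain ⟨e₁, h₁, h₁'⟩ := t2 e₀ h₀ hqY
    obtain ⟨e, he | he, rfl⟩ := hvS
    · exact hvY (c1 e₁ h₁ h₁' e he hvp)
    · exact hvY (c2 e₀ h₀ hqY e he hvp)

end Setting

end DPG

/-! ### A reducible pair of faces with two exceptional vertices. -/

namespace DPG

open Equiv Equiv.Perm

/-- Ways in which a vertex `y` outside a set `F` is tied to `F` at a vertex `b`, possibly through
a path of two more vertices that form the set `A`. -/
def Tied {V : Type u} (G : SimpleGraph V) (C F : Set V) (b y : V) (A : Set V) : Prop :=
  (A = ∅ ∧ deg G y = 3) ∨ (A = ∅ ∧ deg G y = 4 ∧ G.Adj y b) ∨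
    (deg G y = 4 ∧ ∃ r s, A = {r, s} ∧ Light G C r ∧ Light G C s ∧ r ∉ F ∧ s ∉ F ∧
      G.Adj b r ∧ G.Adj r s ∧ G.Adj s y)

namespace Setting

open RotationSystem

variable {V : Type u} [Finite V] {G : SimpleGraph V} {E : RotationSystem G} {C : Set V}

theorem third_adj {d : G.Dart} {F : Set V} {y : V} (hF : ∀ e, SameCycle E.facePerm d e → e.fst ∈ F)
    (h3 : deg G d.fst = 3) (hy : y ∉ F) (hdy : G.Adj d.fst y) {w : V} (hw : G.Adj d.fst w) :
    w ∈ F ∨ w = y := by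
  have h1 : d.snd ∈ F := by rw [← E.fst_facePerm]; exact hF _ (sameCycle_facePerm d).symm
  have h2 : (E.rot.symm d).snd ∈ F := by
    rw [← E.symm_facePerm_inv]; exact hF _ (sameCycle_facePerm_inv d).symm
  rw [E.adj_iff_of_deg_three h3] at hdy hw
  rcases hdy with rfl | rfl | rfl
  · exact absurd h1 hy
  · rcases hw with rfl | rfl | rfl
    · exact Or.inl h1
    · exact Or.inr rfl
    · exact Or.inl h2
  · exact absurd h2 hy

/-- Reducibility of two adjacent faces whose vertices are light except for the second neighbours,
on one of the faces, of the common edge. -/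
theorem not_exists_outside (X : Setting E C) {d : G.Dart} {F K A₁ A₂ : Set V} {y₁ y₂ : V}
    (hF : F = {v | ∃ e, SameCycle E.facePerm d e ∧ e.fst = v})
    (hK : K = {v | ∃ e, SameCycle E.facePerm d.symm e ∧ e.fst = v})
    (hf : E.AllLight C d) (hy₁ : (E.facePerm (E.facePerm d.symm)).fst = y₁)
    (hy₂ : (E.facePerm.symm d.symm).fst = y₂) (h4 : 4 ≤ E.len d)
    (hg : ∀ v ∈ K, v = y₁ ∨ v = y₂ ∨ Light G C v)
    (h1C : y₁ ∉ C) (h2C : y₂ ∉ C) (h1F : y₁ ∉ F) (h2F : y₂ ∉ F)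
    (t₁ : Tied G C F (E.facePerm.symm d).fst y₁ A₁)
    (t₂ : Tied G C F (E.facePerm (E.facePerm d)).fst y₂ A₂)
    (hK₂ : deg G y₂ = 4 → (E.facePerm (E.facePerm d)).fst ∉ K)
    (ho : ∃ v ∈ F, ∃ z, G.Adj v z ∧ z ∉ F ∪ K ∪ A₁ ∪ A₂) : False := by
  set φ := E.facePerm with hφ
  set S := F ∪ K ∪ A₁ ∪ A₂ with hS
  have mF : ∀ e, SameCycle φ d e → e.fst ∈ F := fun e h => by rw [hF]; exact ⟨e, h, rfl⟩
  have mK : ∀ e, SameCycle φ d.symm e → e.fst ∈ K := fun e h => by rw [hK]; exact ⟨e, h, rfl⟩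
  have FS : ∀ v ∈ F, v ∈ S := fun v h => Or.inl (Or.inl (Or.inl h))
  have KS : ∀ v ∈ K, v ∈ S := fun v h => Or.inl (Or.inl (Or.inr h))
  have lF : ∀ v ∈ F, Light G C v := by
    rw [hF]; rintro v ⟨e, he, rfl⟩; exact hf e he
  have sc : ∀ i, SameCycle φ d (φ^[i] d) := sameCycle_iterate φ d
  have hsnd : ∀ e : G.Dart, (φ e).fst = e.snd := E.fst_facePerm
  have y1K : y₁ ∈ K := by rw [← hy₁]; exact mK _ (sameCycle_iterate φ d.symm 2)
  have y2K : y₂ ∈ K := by rw [← hy₂]; exact mK _ (sameCycle_facePerm_inv _).symm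
  have v0F : d.fst ∈ F := mF d (sc 0)
  have v1F : d.snd ∈ F := by rw [← hsnd]; exact mF _ (sc 1)
  have v2F : (φ (φ d)).fst ∈ F := mF _ (sc 2)
  have v9F : (φ.symm d).fst ∈ F := mF _ (sameCycle_facePerm_inv d).symm
  have a01 : G.Adj d.fst y₁ := by
    have := (φ d.symm).adj
    rwa [hsnd d.symm, ← hsnd (φ d.symm), hy₁] at this
  have a12 : G.Adj d.snd y₂ := by
    have := (φ.symm d.symm).adj.symm
    rwa [hy₂, E.snd_facePerm_inv] at this
  have N0 : ∀ w, G.Adj d.fst w → w ∈ S := fun w hw => by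
    rcases third_adj mF (hf d (sc 0)).2 h1F a01 hw with h | rfl
    · exact FS _ h
    · exact KS _ y1K
  have N1 : ∀ w, G.Adj (φ d).fst w → w ∈ S := fun w hw => by
    rcases third_adj (d := φ d) (fun e he => mF e ((sc 1).trans he)) (hf _ (sc 1)).2 h2F
      (by rw [hsnd]; exact a12) hw with h | rfl
    · exact FS _ h
    · exact KS _ y2K
  have AS : ∀ {b y A}, Tied G C F b y A → ∀ v ∈ A, Light G C v := by
    rintro b y A (⟨rfl, -⟩ | ⟨rfl, -⟩ | ⟨-, r, s, rfl, hr, hs, -⟩) v hv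
    · exact absurd hv (by simp)
    · exact absurd hv (by simp)
    · rcases hv with rfl | rfl
      · exact hr
      · exact hs
  have SC : ∀ v ∈ S, v ∉ C := by
    rintro v (((h | h) | h) | h)
    · exact (lF v h).1
    · rcases hg v h with rfl | rfl | h
      · exact h1C
      · exact h2C
      · exact h.1
    · exact (AS t₁ v h).1
    · exact (AS t₂ v h).1
  -- the last vertex before the first one with a neighbour outside
  obtain ⟨i, hi1, hi2, hiN, hiO⟩ : ∃ i, 1 ≤ i ∧ i + 1 < E.len d ∧
      (∀ w, G.Adj (φ^[i] d).fst w → w ∈ S) ∧ ∃ w, G.Adj (φ^[i + 1] d).fst w ∧ w ∉ S := by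
    classical
    obtain ⟨v, hv, z, hvz, hz⟩ := ho
    rw [hF] at hv
    obtain ⟨e, he, rfl⟩ := hv
    obtain ⟨m, hm, rfl⟩ := (sameCycle_iff_exists_lt _ _ _).1 he
    have hex : ∃ m, ∃ w, G.Adj (φ^[m] d).fst w ∧ w ∉ S := ⟨m, z, hvz, hz⟩
    have hle := Nat.find_min' hex ⟨z, hvz, hz⟩
    have h0 : Nat.find hex ≠ 0 := fun h => by
      obtain ⟨w, hw, hw'⟩ := Nat.find_spec hex
      rw [h] at hw
      exact hw' (N0 w hw)
    have h1 : Nat.find hex ≠ 1 := fun h => by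
      obtain ⟨w, hw, hw'⟩ := Nat.find_spec hex
      rw [h] at hw
      exact hw' (N1 w hw)
    have hm' : m < E.len d := hm
    refine ⟨Nat.find hex - 1, by omega, by omega, ?_, ?_⟩
    · have := Nat.find_min hex (m := Nat.find hex - 1) (by omega)
      push Not at this
      exact this
    · rw [show Nat.find hex - 1 + 1 = Nat.find hex by omega]
      exact Nat.find_spec hex
  set p := (φ^[i] d).fst with hp
  have pF : p ∈ F := mF _ (sc i)
  have hpq : G.Adj p (φ^[i + 1] d).fst := E.adj_vx d i
  obtain ⟨Y, -, -, hqY, ⟨v, hvS, hvp, hvY⟩, cl3, cl4⟩ := X.exists_closure SC (FS _ pF)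
    (FS _ (mF _ (sc (i + 1)))) hpq hiN (hf _ (sc (i + 1))).2.le hiO
  have cF : ∀ v ∈ F, v ≠ p → v ∈ Y := by
    rw [hF]
    rintro v ⟨e, he, rfl⟩ hvp
    refine X.mem_of_cycle_closed (d := φ^[i + 1] d) (p := p) (fun a ha h h' => ?_)
      (fun a ha h h' => ?_) hqY ((sc (i + 1)).symm.trans he) hvp
    · have haF : a.snd ∈ F := by
        rw [← hsnd]; exact mF _ (((sc (i + 1)).trans ha).trans (sameCycle_facePerm a).symm)
      exact cl3 _ (FS _ haF) h' (lF _ haF).2 _ h a.adj.symm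
    · have haF : a.fst ∈ F := mF _ ((sc (i + 1)).trans ha)
      exact cl3 _ (FS _ haF) h' (lF _ haF).2 _ h a.adj
  have v0p : d.fst ≠ p := fun h => by
    have := X.fst_iterate_inj d (i := 0) (j := i) (by omega) (by omega) h
    omega
  have v9p : (φ.symm d).fst ≠ p := fun h => by
    rw [← E.iterate_eq_inv (n := E.len d - 1) (by omega)] at h
    have := X.fst_iterate_inj d (by omega) (by omega) h
    omega
  have v0Y := cF _ v0F v0p
  have v9Y := cF _ v9F v9p
  -- What being tied is for: with both anchors `a` and `b` in `Y`, the vertex `y` has enough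
  -- neighbours in `Y` to be forced into it, through the path `A` if there is one.
  have ext : ∀ {a b y A}, Tied G C F b y A → y ∈ S → A ⊆ S → y ∉ F → G.Adj a y → a ∈ F → a ∈ Y →
      b ∈ Y → a ≠ b → y ∈ Y ∧ A ⊆ Y := by
    rintro a b y A ht hyS hAS hyF hay haF haY hbY hab
    have hyp : y ≠ p := fun h => hyF (h ▸ pF)
    rcases ht with ⟨rfl, h3⟩ | ⟨rfl, h4, hyb⟩ | ⟨h4, r, s, rfl, hr, hs, hrF, hsF, hbr, hrs, hsy⟩
    · exact ⟨cl3 y hyS hyp h3 a haY hay.symm, by simp⟩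
    · exact ⟨cl4 y hyS hyp h4 a haY b hbY hab hay.symm hyb, by simp⟩
    · have hrY : r ∈ Y := cl3 r (hAS (by simp)) (fun h => hrF (h ▸ pF)) hr.2 b hbY hbr.symm
      have hsY : s ∈ Y := cl3 s (hAS (by simp)) (fun h => hsF (h ▸ pF)) hs.2 r hrY hrs.symm
      refine ⟨cl4 y hyS hyp h4 a haY s hsY (fun h => hsF (h ▸ haF)) hay.symm hsy.symm, ?_⟩
      rintro x (rfl | rfl)
      · exact hrY
      · exact hsY
  have A1S : A₁ ⊆ S := fun v h => Or.inl (Or.inr h)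
  have A2S : A₂ ⊆ S := fun v h => Or.inr h
  obtain ⟨y1Y, A1Y⟩ := ext t₁ (KS _ y1K) A1S h1F a01 v0F v0Y v9Y (fun h => by
    rw [← E.snd_facePerm_inv d] at h
    exact (φ.symm d).adj.ne h.symm)
  -- the other face, once its vertices of larger degree are known to be in `Y`
  have cK : ∀ r, (∀ v ∈ K, v ≠ r → v ≠ p ∧ (v = y₂ → y₂ ∈ Y ∨ deg G y₂ = 3)) →
      d.fst ≠ r → ∀ v ∈ K, v ≠ r → v ∈ Y := by
    intro r hr h0r v hv hvr
    rw [hK] at hv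
    obtain ⟨e, he, rfl⟩ := hv
    have hstep : ∀ v ∈ K, v ≠ r → ∀ y ∈ Y, G.Adj v y → v ∈ Y := by
      intro v hv hvr y hy hvy
      obtain ⟨hvp, h2⟩ := hr v hv hvr
      rcases hg v hv with rfl | rfl | h
      · exact y1Y
      · rcases h2 rfl with h | h
        · exact h
        · exact cl3 _ (KS _ hv) hvp h y hy hvy
      · exact cl3 v (KS _ hv) hvp h.2 y hy hvy
    have s0 : SameCycle φ d.symm (φ d.symm) := sameCycle_iterate φ d.symm 1
    refine X.mem_of_cycle_closed (d := φ d.symm) (p := r) (fun a ha h h' => ?_)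
      (fun a ha h h' => ?_) ?_ (s0.symm.trans he) hvr
    · refine hstep _ ?_ h' _ h a.adj.symm
      rw [← hsnd]; exact mK _ ((s0.trans ha).trans (sameCycle_facePerm a).symm)
    · exact hstep _ (mK _ (s0.trans ha)) h' _ h a.adj
    · rw [hsnd]; exact v0Y
  have y2p : y₂ ≠ p := fun h => h2F (h ▸ pF)
  have fin : y₂ ∈ Y ∧ A₂ ⊆ Y ∧ ∀ v ∈ K, v ≠ p → v ∈ Y := by
    have general : y₂ ∈ Y → A₂ ⊆ Y → y₂ ∈ Y ∧ A₂ ⊆ Y ∧ ∀ v ∈ K, v ≠ p → v ∈ Y := fun h h' =>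
      ⟨h, h', cK p (fun v _ hvp => ⟨hvp, fun _ => Or.inl h⟩) v0p⟩
    have h12 : d.snd ≠ (φ (φ d)).fst := by rw [hsnd, ← hsnd d]; exact (φ d).adj.ne
    by_cases c1 : d.snd = p
    -- Here `q` is the vertex after `p = d.snd` on the first face. Its only neighbour off that face
    -- lies outside `S`, so it is neither `y₂` nor on the path `A₂`; hence `y₂` has degree 3.
    · have hi : i = 1 := by
        have h : (φ^[1] d).fst = (φ^[i] d).fst := (hsnd d).trans c1
        exact (X.fst_iterate_inj d (by omega) (by omega) h).symm
      have hout : ∃ w, G.Adj (φ (φ d)).fst w ∧ w ∉ S := by rw [hi] at hiO; exact hiO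
      obtain ⟨w, hw, hwS⟩ := hout
      have third : ∀ y, y ∉ F → y ∈ S → ¬ G.Adj (φ (φ d)).fst y := fun y hyF hyS hy => by
        rcases third_adj (d := φ (φ d)) (fun e he => mF e ((sc 2).trans he)) (hf _ (sc 2)).2 hyF
          hy hw with h | rfl
        · exact hwS (FS _ h)
        · exact hwS hyS
      have t3 : A₂ = ∅ ∧ deg G y₂ = 3 := by
        rcases t₂ with h | ⟨-, -, h⟩ | ⟨-, r, s, rfl, -, -, hrF, -, hbr, -⟩
        · exact h
        · exact (third y₂ h2F (KS _ y2K) h.symm).elim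
        · exact (third r hrF (A2S (by simp)) hbr).elim
      have := cK p (fun v _ hvp => ⟨hvp, fun _ => Or.inr t3.2⟩) v0p
      exact ⟨this _ y2K y2p, by rw [t3.1]; simp, this⟩
    have v1Y := cF _ v1F c1
    by_cases c2 : (φ (φ d)).fst = p
    · by_cases h3 : deg G y₂ = 3
      · refine general (cl3 _ (KS _ y2K) y2p h3 _ v1Y a12.symm) ?_
        rcases t₂ with ⟨rfl, -⟩ | ⟨-, h, -⟩ | ⟨h, -⟩
        · simp
        · omega
        · omega
      · have h4 : deg G y₂ = 4 := by
          rcases t₂ with ⟨-, h⟩ | ⟨-, h, -⟩ | ⟨h, -⟩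
          · exact absurd h h3
          · exact h
          · exact h
        have pK : p ∉ K := c2 ▸ hK₂ h4
        -- Now `p` is the anchor of `y₂` and cannot be used. The closure goes around the second face
        -- from the other side instead and reaches the neighbour of `y₂` there. With `d.snd` this
        -- makes two neighbours in `Y`.
        have h := cK y₂ (fun v hv hv2 => ⟨fun h => pK (h ▸ hv), fun h => absurd h hv2⟩)
          (fun h => h2F (h ▸ v0F))
        set b := φ.symm (φ.symm d.symm) with hb
        have hbs : b.snd = y₂ := by rw [hb, E.snd_facePerm_inv, hy₂]
        have bK : b.fst ∈ K :=
          mK _ ((sameCycle_facePerm_inv _).trans (sameCycle_facePerm_inv _)).symm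
        have bY : b.fst ∈ Y := h _ bK (by rw [← hbs]; exact b.adj.ne)
        have hb1 : b.fst ≠ d.snd := fun hc => by
          have : b = d.symm := X.dart_eq_of_sameCycle
            ((sameCycle_facePerm_inv _).trans (sameCycle_facePerm_inv _)) hc
          have k0 : φ (φ d.symm) = d.symm := by
            nth_rw 1 [← this]
            rw [hb, Equiv.apply_symm_apply, Equiv.apply_symm_apply]
          have k1 := X.fst_iterate_inj d.symm (i := 0) (j := 2) (by have := X.three_le_len d.symm; omega)
            (by have := X.three_le_len d.symm; omega) (congrArg (fun e : G.Dart => e.fst) k0.symm)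
          omega
        have y2Y : y₂ ∈ Y := cl4 _ (KS _ y2K) y2p h4 _ bY _ v1Y hb1 (hbs ▸ b.adj.symm) a12.symm
        refine general y2Y ?_
        rcases t₂ with ⟨rfl, -⟩ | ⟨rfl, -⟩ | ⟨h4, r, s, rfl, hr, hs, hrF, hsF, hbr, hrs, hsy⟩
        · simp
        · simp
        -- The path is now traversed from `y₂` back towards `p`.
        · have hsY : s ∈ Y := cl3 s (A2S (by simp)) (fun h => hsF (h ▸ pF)) hs.2 _ y2Y hsy
          have hrY : r ∈ Y := cl3 r (A2S (by simp)) (fun h => hrF (h ▸ pF)) hr.2 s hsY hrs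
          rintro x (rfl | rfl)
          · exact hrY
          · exact hsY
    · obtain ⟨h, h'⟩ := ext t₂ (KS _ y2K) A2S h2F a12 v1F v1Y (cF _ v2F c2) h12
      exact general h h'
  rcases hvS with ((h | h) | h) | h
  · exact hvY (cF v h hvp)
  · exact hvY (fin.2.2 v h hvp)
  · exact hvY (A1Y h)
  · exact hvY (fin.2.1 h)

end Setting

end DPG

/-! ### Places of payment, special edges and poor faces. -/

namespace DPG

open Equiv Equiv.Perm

namespace RotationSystem

variable {V : Type u} {G : SimpleGraph V} (E : RotationSystem G) (C : Set V)

/-- The face across a dart is needy. -/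
def ND (d : G.Dart) : Prop := E.Needy C d.symm

/-- The light vertex at which a dart starts pays across this dart. -/
def Eo (d : G.Dart) : Prop := Light G C d.fst ∧ E.ND C d ∧ ¬ E.ND C (E.facePerm.symm d) ∧
  ¬ (Heavy G C d.snd ∧ E.Str C d.symm)

/-- The light vertex at which a dart starts pays across the previous dart of the face. -/
def Ei (d : G.Dart) : Prop := Light G C d.fst ∧ E.ND C (E.facePerm.symm d) ∧ ¬ E.ND C d ∧
  ¬ (Heavy G C (E.facePerm.symm d).fst ∧ E.Str C (E.rot (E.facePerm.symm d)))

/-- The positions on a face at which the face pays to a needy face. -/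
def Ee (d : G.Dart) : Prop := E.Eo C d ∨ E.Ei C d

/-- An edge of a pentagon that is opposite to a common vertex with its triangle, when the edge of
the triangle has a heavy end. -/
def Spec (d : G.Dart) : Prop := E.IsCQ C d ∧
  ((E.IsT C (E.facePerm^[2] d).symm ∧ (Heavy G C (E.vx d 2) ∨ Heavy G C (E.vx d 3))) ∨
    (E.IsT C (E.facePerm^[3] d).symm ∧ (Heavy G C (E.vx d 3) ∨ Heavy G C (E.vx d 4))))

/-- The faces of length ten that pay at all their vertices. -/
def Poor (d : G.Dart) : Prop := E.len d = 10 ∧ ∀ e, SameCycle E.facePerm d e → E.Ee C e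

/-- The darts across which a face pays to a pentagon without triangle. -/
def Qe (d : G.Dart) : Prop := E.IsUQ C d.symm ∧ (E.AllLight C d.symm ∨
  (Light G C d.fst ∧ Light G C d.snd ∧
    (E.len (E.facePerm d).symm = 5 ∨ E.len (E.facePerm.symm d).symm = 5)))

/-- The darts across which a face pays to a poor face. -/
def Pe (h : G.Dart) : Prop := E.Poor C h.symm ∧ ¬ E.ND C h.symm ∧
  ¬ E.Ee C (E.facePerm (E.facePerm h)) ∧ ¬ E.Ee C (E.facePerm.symm h) ∧
  ¬ E.Spec C (E.facePerm h.symm).symm ∧ ¬ E.Spec C (E.facePerm.symm h.symm).symm ∧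
  ¬ (E.Spec C (E.facePerm^[3] h.symm).symm ∧ E.Spec C (E.facePerm^[7] h.symm).symm)

variable {E C}

theorem Ee.light {d : G.Dart} (h : E.Ee C d) : Light G C d.fst := h.elim (·.1) (·.1)

theorem Ee.nd_iff {d : G.Dart} (h : E.Ee C d) : E.ND C d ↔ ¬ E.ND C (E.facePerm.symm d) := by
  rcases h with ⟨-, h1, h2, -⟩ | ⟨-, h1, h2, -⟩ <;> simp [h1, h2]

theorem Poor.allLight {d : G.Dart} (h : E.Poor C d) : E.AllLight C d := fun e he => (h.2 e he).light

theorem Poor.nd_facePerm {d e : G.Dart} (h : E.Poor C d) (he : SameCycle E.facePerm d e) :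
    E.ND C (E.facePerm e) ↔ ¬ E.ND C e := by
  have := (h.2 (E.facePerm e) (he.trans (sameCycle_facePerm e).symm)).nd_iff
  rwa [Equiv.symm_apply_apply] at this

variable [Finite V]

/-- Around the initial vertex of a dart. -/
theorem sameCycle_symm_of_fst {d : G.Dart} (h : deg G d.fst = 3) :
    SameCycle E.facePerm (E.facePerm d.symm).symm (E.facePerm.symm d).symm := by
  rw [← E.rot_eq]; exact sameCycle_rot_symm h

/-- Around the final vertex of a dart. -/
theorem sameCycle_symm_of_snd {d : G.Dart} (h : deg G d.snd = 3) :
    SameCycle E.facePerm (E.facePerm.symm d.symm).symm (E.facePerm d).symm := by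
  have := (sameCycle_symm_of_fst (E := E) (d := d.symm) h).symm
  rwa [SimpleGraph.Dart.symm_symm] at this

theorem exists_rot_of_light {d e : G.Dart} (h : deg G d.fst = 3) (he : e.fst = d.fst) :
    e = d ∨ e = E.rot d ∨ e = E.rot.symm d := by
  have hadj : G.Adj d.fst e.snd := he ▸ e.adj
  rcases (E.adj_iff_of_deg_three h _).1 hadj with h | h | h
  · exact Or.inl (dart_ext he h)
  · exact Or.inr (Or.inl (dart_ext (he.trans (E.fst_rot d).symm) h))
  · exact Or.inr (Or.inr (dart_ext (he.trans (E.fst_rot_inv d).symm) h))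

omit [Finite V] in
theorem Needy.len_le {d : G.Dart} (h : E.Needy C d) : E.len d ≤ 5 := by
  rcases h with h | h
  · have := h.1; omega
  · exact h.1.1.le

/-- No face pays at a light vertex that lies on two needy faces. -/
theorem not_ee_of_needy_needy {k e : G.Dart} (hk : Light G C k.fst) (h1 : E.Needy C k)
    (h2 : E.Needy C k.symm) (he : e.fst = k.fst) (hl : 10 ≤ E.len e) : ¬ E.Ee C e := by
  intro hE
  rcases exists_rot_of_light (E := E) hk.2 he with rfl | rfl | rfl
  · have := h1.len_le; omega
  · have := h2.len_le
    rw [len_congr (sameCycle_rot k)] at hl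
    omega
  · have a1 : E.ND C (E.rot.symm k) := by
      unfold ND
      rw [← E.facePerm_inv_apply]
      exact (needy_congr (sameCycle_facePerm_inv k)).2 h1
    refine hE.nd_iff.1 a1 ?_
    unfold ND
    rw [E.symm_facePerm_inv, E.rot_inv_eq_of_deg_three hk.2, Equiv.symm_apply_apply]
    exact (needy_congr (sameCycle_rot k)).2 h2

/-- Facial walks of a neighbour at a light vertex. -/
theorem facePerm_inv_facePerm_inv_symm {d : G.Dart} (h : deg G d.fst = 3) :
    (E.facePerm.symm (E.facePerm.symm d).symm).symm = E.facePerm d.symm := by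
  rw [E.symm_facePerm_inv, E.symm_facePerm_inv, ← E.rot_eq]
  rw [Equiv.symm_apply_eq]
  exact E.rot_inv_eq_of_deg_three h

theorem facePerm_facePerm_symm {d : G.Dart} (h : deg G d.snd = 3) :
    E.facePerm (E.facePerm d).symm = (E.facePerm.symm d.symm).symm := by
  rw [E.symm_facePerm_inv, ← E.rot_eq, E.facePerm_apply]
  exact (E.rot_inv_eq_of_deg_three (d := d.symm) h).symm

end RotationSystem

namespace Setting

open RotationSystem

variable {V : Type u} [Finite V] {G : SimpleGraph V} {E : RotationSystem G} {C : Set V}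

omit [Finite V] in
theorem vx_facePerm_iterate (d : G.Dart) (i j : ℕ) : E.vx (E.facePerm^[i] d) j = E.vx d (i + j) := by
  unfold RotationSystem.vx
  rw [← Function.iterate_add_apply, add_comm]

/-- The shape of a needy face next to a face of light vertices. -/
theorem side_cases (X : Setting E C) {n : G.Dart} (hn : E.Needy C n) (h1 : ¬ E.Needy C n.symm)
    (h2 : ¬ E.Needy C (E.facePerm n).symm) (h3 : ¬ E.Needy C (E.facePerm.symm n).symm)
    (hl : E.AllLight C n.symm) (hs : ¬ E.Spec C n) :
    (E.IsT C n ∧ Heavy G C (E.vx n 2)) ∨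
    (E.IsCQ C n ∧ E.IsT C (E.facePerm^[2] n).symm ∧ Light G C (E.vx n 2) ∧ Light G C (E.vx n 3) ∧
      Heavy G C (E.vx n 4)) ∨
    (E.IsCQ C n ∧ E.IsT C (E.facePerm^[3] n).symm ∧ Light G C (E.vx n 3) ∧ Light G C (E.vx n 4) ∧
      Heavy G C (E.vx n 2)) := by
  have l0 : Light G C (E.vx n 0) := by
    have := hl (E.facePerm n.symm) (sameCycle_facePerm _).symm
    rwa [E.fst_facePerm] at this
  have l1 : Light G C (E.vx n 1) := by
    rw [E.vx_one]; exact hl n.symm (SameCycle.refl _ _)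
  have lh : ∀ i, Light G C (E.vx n i) ∨ Heavy G C (E.vx n i) := fun i =>
    X.light_or_heavy (hn.act.vx_notMem i)
  -- The adjacent face has only light vertices, so the needy face has a heavy vertex by
  -- `not_allLight`. It remains to locate it.
  have hne : ¬ E.AllLight C n := fun h => X.not_allLight h hl
  have hall : (∀ i < E.len n, Light G C (E.vx n i)) → False := fun h => hne fun e he => by
    obtain ⟨i, hi, rfl⟩ := (sameCycle_iff_exists_lt _ _ _).1 he
    exact h i hi
  rcases hn with hT | hQ
  · refine Or.inl ⟨hT, ?_⟩
    rcases lh 2 with h | h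
    · refine (hall fun i hi => ?_).elim
      rw [hT.1] at hi
      interval_cases i <;> assumption
    · exact h
  · refine Or.inr ?_
    obtain ⟨⟨h5, ha⟩, t, ht, hT⟩ := id hQ
    obtain ⟨i, hi, rfl⟩ := (sameCycle_iff_exists_lt _ _ _).1 ht
    change i < E.len n at hi
    rw [h5] at hi
    interval_cases i
    · exact (h1 hT.needy).elim
    · exact (h2 hT.needy).elim
    -- The edge is not special, so both ends of the edge shared with the triangle are light and the
    -- heavy vertex must be the one remaining vertex.
    · have n2 : ¬ Heavy G C (E.vx n 2) := fun h => hs ⟨hQ, Or.inl ⟨hT, Or.inl h⟩⟩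
      have n3 : ¬ Heavy G C (E.vx n 3) := fun h => hs ⟨hQ, Or.inl ⟨hT, Or.inr h⟩⟩
      have l2 := (lh 2).resolve_right n2
      have l3 := (lh 3).resolve_right n3
      refine Or.inl ⟨hQ, hT, l2, l3, (lh 4).resolve_left fun l4 => hall fun i hi => ?_⟩
      rw [h5] at hi
      interval_cases i <;> assumption
    · have n2 : ¬ Heavy G C (E.vx n 3) := fun h => hs ⟨hQ, Or.inr ⟨hT, Or.inl h⟩⟩
      have n3 : ¬ Heavy G C (E.vx n 4) := fun h => hs ⟨hQ, Or.inr ⟨hT, Or.inr h⟩⟩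
      have l3 := (lh 3).resolve_right n2
      have l4 := (lh 4).resolve_right n3
      refine Or.inr ⟨hQ, hT, l3, l4, (lh 2).resolve_left fun l2 => hall fun i hi => ?_⟩
      rw [h5] at hi
      interval_cases i <;> assumption
    · rw [E.iterate_eq_inv h5] at hT
      exact (h3 hT.needy).elim

/-- A vertex off a face is not adjacent to two of its vertices if this gives a forbidden cycle. -/
theorem not_adj_adj (X : Setting E C) {d : G.Dart} {y : V} {i k n : ℕ}
    (hy : ∀ e, SameCycle E.facePerm d e → e.fst ≠ y) (hk : k < E.len d) (hk1 : 1 ≤ k)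
    (hn : NoCycleOfLength G n) (hkn : k + 2 = n) (h1 : G.Adj y (E.vx d i))
    (h2 : G.Adj y (E.vx d (i + k))) : False := by
  refine hn.not_isRing (l := y :: (List.range (k + 1)).map fun t => E.vx d (i + t)) (by omega)
    (by simp; omega) ⟨?_, ?_, ?_⟩
  · rw [List.nodup_cons]
    constructor
    · simp only [List.mem_map, not_exists, not_and]
      intro t _ h
      exact hy _ (sameCycle_iterate _ d (i + t)) h
    · refine List.Nodup.map_on ?_ List.nodup_range
      intro a ha b hb hab
      rw [List.mem_range] at ha hb
      rw [← vx_facePerm_iterate, ← vx_facePerm_iterate] at hab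
      have hl := E.len_iterate d i
      exact X.fst_iterate_inj (E.facePerm^[i] d) (by omega) (by omega) hab
  · rw [List.isChain_cons]
    constructor
    · intro z hz
      simp only [List.range_succ_eq_map, List.map_cons, List.head?_cons, Option.mem_def,
        Option.some.injEq] at hz
      rw [← hz]; exact h1
    · rw [List.isChain_iff_getElem]
      intro t ht
      simp only [List.getElem_map, List.getElem_range]
      exact E.adj_vx d (i + t)
  · intro _
    simp only [List.head_cons]
    rw [List.getLast_cons (by simp)]
    simp only [List.range_succ, List.map_append, List.map_cons, List.map_nil, List.getLast_append_singleton]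
    exact h2.symm

end Setting

end DPG

/-! ### A long face that refunds a poor one has vertices to spare. -/

namespace DPG

open Equiv Equiv.Perm

namespace Setting

open RotationSystem

variable {V : Type u} [Finite V] {G : SimpleGraph V} {E : RotationSystem G} {C : Set V}

/-- The sides of a poor face. -/
theorem poor_side (X : Setting E C) {d : G.Dart} (hp : E.Poor C d) (hd : E.ND C d)
    (hs : ¬ E.Spec C d.symm) :
    (E.IsT C d.symm ∧ Heavy G C (E.vx d.symm 2)) ∨
    (E.IsCQ C d.symm ∧ E.IsT C (E.facePerm^[2] d.symm).symm ∧ Light G C (E.vx d.symm 2) ∧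
      Light G C (E.vx d.symm 3) ∧ Heavy G C (E.vx d.symm 4)) ∨
    (E.IsCQ C d.symm ∧ E.IsT C (E.facePerm^[3] d.symm).symm ∧ Light G C (E.vx d.symm 3) ∧
      Light G C (E.vx d.symm 4) ∧ Heavy G C (E.vx d.symm 2)) := by
  have hl := hp.allLight
  have k0 : ¬ E.Needy C d.symm.symm := fun h => by
    have h1 := h.len_le
    have h2 := hp.1
    rw [SimpleGraph.Dart.symm_symm] at h1
    omega
  have k1 : ¬ E.Needy C (E.facePerm d.symm).symm := by
    rw [needy_congr (sameCycle_symm_of_fst (hl d (SameCycle.refl _ _)).2)]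
    exact (hp.2 d (SameCycle.refl _ _)).nd_iff.1 hd
  have ls : Light G C d.snd := by
    rw [← E.fst_facePerm]; exact hl _ (sameCycle_facePerm d).symm
  have k2 : ¬ E.Needy C (E.facePerm.symm d.symm).symm := by
    rw [needy_congr (sameCycle_symm_of_snd ls.2)]
    exact fun h => (hp.nd_facePerm (SameCycle.refl _ _)).1 h hd
  exact X.side_cases hd k0 k1 k2 (by rwa [SimpleGraph.Dart.symm_symm]) hs

theorem poor_congr {d e : G.Dart} (h : SameCycle E.facePerm d e) : E.Poor C d ↔ E.Poor C e := by
  unfold RotationSystem.Poor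
  rw [len_congr h]
  exact and_congr_right fun _ => ⟨fun k a ha => k a (h.trans ha), fun k a ha => k a (h.symm.trans ha)⟩

/-- Otherwise the face would visit `d.fst` by two darts. These would be equal by `face_simple`, and
the vertex would have degree 1. -/
theorem not_sameCycle_symm (X : Setting E C) (d : G.Dart) : ¬ SameCycle E.facePerm d d.symm := by
  intro h
  have := X.dart_eq_of_sameCycle (h.trans (sameCycle_facePerm d.symm).symm)
    (E.fst_facePerm d.symm).symm
  rw [← E.rot_eq] at this
  exact E.rot_iterate_ne (d := d) (i := 1) (by omega) (X.two_le_deg _) this.symm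

/-- Two faces of length ten, one of which pays to the other poor one, have a third vertex at which
the first does not pay. -/
theorem exists_not_ee_of_pe (X : Setting E C) {h : G.Dart} (hpe : E.Pe C h) (hl : E.len h = 10) :
    ∃ e, SameCycle E.facePerm h e ∧ e ≠ E.facePerm (E.facePerm h) ∧ e ≠ E.facePerm.symm h ∧
      ¬ E.Ee C e := by
  by_contra hcon
  push Not at hcon
  obtain ⟨d, rfl⟩ : ∃ d : G.Dart, h = d.symm := ⟨h.symm, by simp⟩
  obtain ⟨hp, hnd, -, -, hs2, hs1, hs37⟩ := hpe
  rw [SimpleGraph.Dart.symm_symm] at hp hnd hs2 hs1 hs37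
  set φ := E.facePerm with hφ
  have hlight := hp.allLight
  have sc : ∀ i, SameCycle φ d (φ^[i] d) := sameCycle_iterate φ d
  have sk : ∀ i, SameCycle φ d.symm (φ^[i] d.symm) := sameCycle_iterate φ d.symm
  have hsnd : ∀ e : G.Dart, (φ e).fst = e.snd := E.fst_facePerm
  have hadjd : ∀ e : G.Dart, G.Adj e.fst e.snd := fun e => e.adj
  set F : Set V := {v | ∃ e, SameCycle φ d e ∧ e.fst = v} with hF
  set K : Set V := {v | ∃ e, SameCycle φ d.symm e ∧ e.fst = v} with hK
  set y₁ := (φ (φ d.symm)).fst with hy₁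
  set y₂ := (φ.symm d.symm).fst with hy₂
  have l10 : E.len d = 10 := hp.1
  have lF : ∀ v ∈ F, Light G C v := by
    rintro v ⟨e, he, rfl⟩; exact hlight e he
  have lv0 : deg G d.fst = 3 := (hlight d (sc 0)).2
  have lv1 : deg G d.snd = 3 := by rw [← hsnd]; exact (hlight _ (sc 1)).2
  have inj : ∀ {i j : ℕ}, i < 10 → j < 10 → φ^[i] d.symm = φ^[j] d.symm → i = j := by
    intro i j hi hj hij
    exact X.fst_iterate_inj d.symm (by omega) (by omega) (congrArg (fun e : G.Dart => e.fst) hij)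
  have hinv : φ.symm d.symm = φ^[9] d.symm := (E.iterate_eq_inv hl).symm
  -- Suppose that the only vertices at which the refunding face may fail to pay are `y₁` and `y₂`,
  -- the ones next to the common edge. All its other vertices pay, so they are light, and the two
  -- faces have the shape of `not_exists_outside`.
  have E0 : E.Ee C d.symm := hcon _ (sk 0) (fun h => by have := inj (i := 0) (j := 2) (by omega) (by omega) h; omega)
    (fun h => by rw [hinv] at h; have := inj (i := 0) (j := 9) (by omega) (by omega) h; omega)
  have E1 : E.Ee C (φ d.symm) := hcon _ (sk 1)
    (fun h => by have := inj (i := 1) (j := 2) (by omega) (by omega) h; omega)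
    (fun h => by rw [hinv] at h; have := inj (i := 1) (j := 9) (by omega) (by omega) h; omega)
  -- the two neighbouring sides
  set n₁ := (φ.symm d).symm with hn₁
  set n₂ := (φ d).symm with hn₂
  have sd1 : SameCycle φ d (φ.symm d) := (sameCycle_facePerm_inv d).symm
  have hd1 : E.ND C (φ.symm d) := not_not.1 fun h => hnd ((hp.2 d (sc 0)).nd_iff.2 h)
  have hd2 : E.ND C (φ d) := (hp.nd_facePerm (sc 0)).2 hnd
  have s1 := X.poor_side ((poor_congr sd1).1 hp) hd1 hs1
  have s2 := X.poor_side (d := φ d) ((poor_congr (sc 1)).1 hp) hd2 hs2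
  rw [← hn₁] at s1
  rw [← hn₂] at s2
  have hn1N : E.Needy C n₁ := hd1
  have hn2N : E.Needy C n₂ := hd2
  have n1f : n₁.fst = d.fst := E.snd_facePerm_inv d
  have n2f : n₂.fst = (φ (φ d)).fst := (hsnd (φ d)).symm
  have n2s : n₂.snd = d.snd := hsnd d
  have r1 : (φ.symm n₁).symm = φ d.symm := facePerm_inv_facePerm_inv_symm lv0
  have r2 : φ n₂ = (φ.symm d.symm).symm := facePerm_facePerm_symm lv1
  have y1n : (φ.symm n₁).fst = y₁ := by
    rw [hy₁, hsnd, ← r1]; rfl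
  have y2n : E.vx n₂ 2 = y₂ := by
    change (φ (φ n₂)).fst = y₂
    rw [hsnd, r2]; rfl
  have a01 : G.Adj d.fst y₁ := by
    have := hadjd (φ d.symm)
    rw [hsnd d.symm, ← hsnd (φ d.symm)] at this
    exact this
  have a12 : G.Adj d.snd y₂ := by
    have := (hadjd (φ.symm d.symm)).symm
    rwa [E.snd_facePerm_inv] at this
  -- Its neighbour on the face pays across the edge between them although `y₁` is heavy. So the
  -- corner is not strong, and the degree is exactly 4.
  have d1 : Heavy G C y₁ → deg G y₁ = 4 := by
    intro hh
    have hnd1 : E.ND C (φ d.symm) := by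
      change E.Needy C (φ d.symm).symm
      rw [← r1, SimpleGraph.Dart.symm_symm, needy_congr (sameCycle_facePerm_inv _)]
      exact hn1N
    rcases E1 with ⟨-, -, -, h⟩ | ⟨-, -, h, -⟩
    · have h' : ¬ E.Str C (φ d.symm).symm := fun h' => h ⟨by rw [← hsnd]; exact hh, h'⟩
      have := (not_not.1 h').1
      rw [hy₁, hsnd]; exact this
    · exact absurd hnd1 h
  have d2 : Heavy G C y₂ → deg G y₂ = 4 := by
    intro hh
    have hnd2 : E.ND C (φ.symm d.symm) := by
      change E.Needy C (φ.symm d.symm).symm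
      rw [← r2, needy_congr (sameCycle_facePerm _)]
      exact hn2N
    rcases E0 with ⟨-, -, h, -⟩ | ⟨-, -, -, h⟩
    · exact absurd hnd2 h
    · have h' : ¬ E.Str C (E.rot (φ.symm d.symm)) := fun h' => h ⟨hh, h'⟩
      have := (not_not.1 h').1
      rwa [E.fst_rot] at this
  have offF : ∀ k : G.Dart, Light G C k.fst → E.Needy C k → E.Needy C k.symm → k.fst ∉ F := by
    rintro k hk h1 h2 ⟨e, he, hek⟩
    exact not_ee_of_needy_needy hk h1 h2 hek (by rw [← len_congr he, l10]) (hp.2 e he)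
  have heavyF : ∀ v, Heavy G C v → v ∉ F := fun v hv h => (lF v h).not_heavy hv
  have itn : ∀ (n : G.Dart) (i : ℕ), E.Needy C n → E.Needy C (φ^[i] n) := fun n i h =>
    (needy_congr (sameCycle_iterate φ n i)).1 h
  have offF2 : ∀ (n : G.Dart) (i : ℕ), E.Needy C n → E.IsT C (φ^[i] n).symm →
      Light G C (E.vx n i) → Light G C (E.vx n (i + 1)) → E.vx n i ∉ F ∧ E.vx n (i + 1) ∉ F := by
    intro n i hn hT h1 h2
    refine ⟨offF (φ^[i] n) h1 (itn n i hn) hT.needy, ?_⟩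
    have e1 : E.vx n (i + 1) = (φ^[i] n).snd := by
      unfold RotationSystem.vx
      rw [Function.iterate_succ_apply', E.fst_facePerm]
    rw [e1] at h2 ⊢
    exact offF (φ^[i] n).symm h2 hT.needy (by rw [SimpleGraph.Dart.symm_symm]; exact itn n i hn)
  -- The needy side before the common edge supplies the tie: a triangle makes `y₁` adjacent to the
  -- anchor, and a pentagon gives either degree 3 or a path along its edge shared with the triangle.
  have T1 : ∃ A₁, Tied G C F (φ.symm d).fst y₁ A₁ ∧ y₁ ∉ C ∧ y₁ ∉ F ∧ ∀ v ∈ A₁, Light G C v := by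
    have v9 : (φ.symm d).fst = E.vx n₁ 1 := (E.vx_one n₁).symm
    rcases s1 with ⟨hT, hh⟩ | ⟨hQ, hT, l2, l3, hh⟩ | ⟨hQ, hT, l3, l4, -⟩
    · have e : E.vx n₁ 2 = y₁ := by
        unfold RotationSystem.vx
        rw [E.iterate_eq_inv hT.1, ← y1n]
      rw [e] at hh
      refine ⟨∅, Or.inr (Or.inl ⟨rfl, d1 hh, ?_⟩), hh.1, heavyF _ hh, by simp⟩
      rw [v9, ← e]; exact (E.adj_vx n₁ 1).symm
    · have e : E.vx n₁ 4 = y₁ := by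
        unfold RotationSystem.vx
        rw [E.iterate_eq_inv hQ.1.1, ← y1n]
      rw [e] at hh
      obtain ⟨f2, f3⟩ := offF2 n₁ 2 hn1N hT l2 l3
      refine ⟨{E.vx n₁ 2, E.vx n₁ 3}, Or.inr (Or.inr ⟨d1 hh, _, _, rfl, l2, l3, f2, f3, ?_,
        E.adj_vx n₁ 2, ?_⟩), hh.1, heavyF _ hh, ?_⟩
      · rw [v9]; exact E.adj_vx n₁ 1
      · rw [← e]; exact E.adj_vx n₁ 3
      · rintro v (rfl | rfl)
        · exact l2
        · exact l3
    · have e : E.vx n₁ 4 = y₁ := by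
        unfold RotationSystem.vx
        rw [E.iterate_eq_inv hQ.1.1, ← y1n]
      obtain ⟨f3, f4⟩ := offF2 n₁ 3 hn1N hT l3 l4
      rw [e] at l4 f4
      exact ⟨∅, Or.inl ⟨rfl, l4.2⟩, l4.1, f4, by simp⟩
  obtain ⟨A₁, t₁, h1C, h1F, lA1⟩ := T1
  have offF' : ∀ {y}, y ∉ F → ∀ e, SameCycle φ d e → e.fst ≠ y := fun hy e he h => hy ⟨e, he, h⟩
  have T2 : ∃ A₂, Tied G C F (φ (φ d)).fst y₂ A₂ ∧ y₂ ∉ C ∧ y₂ ∉ F ∧ (∀ v ∈ A₂, Light G C v) ∧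
      (deg G y₂ = 4 → (φ (φ d)).fst ∉ K) := by
    -- where the second face could meet the side again
    have back : Heavy G C y₂ → (φ (φ d)).fst ∈ K → SameCycle φ d.symm (φ.symm n₂).symm := by
      rintro hh ⟨e, he, hev⟩
      have l2 : deg G (φ (φ d)).fst = 3 := (hlight _ (sc 2)).2
      have r3 : E.rot.symm (φ (φ d)) = n₂ := by
        rw [← E.symm_facePerm_inv, Equiv.symm_apply_apply]
      rcases exists_rot_of_light (E := E) (d := φ (φ d)) l2 hev with rfl | rfl | rfl
      · exact (X.not_sameCycle_symm d ((sc 2).trans he.symm)).elim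
      · rw [E.symm_facePerm_inv, ← r3, E.rot_inv_eq_of_deg_three l2, Equiv.symm_apply_apply]
        exact he
      · have h1 := hn2N.len_le
        rw [r3] at he
        rw [← len_congr he] at h1
        omega
    rcases s2 with ⟨hT, hh⟩ | ⟨hQ, hT, l2, l3, -⟩ | ⟨hQ, hT, l3, l4, hh⟩
    · rw [y2n] at hh
      refine ⟨∅, Or.inr (Or.inl ⟨rfl, d2 hh, ?_⟩), hh.1, heavyF _ hh, by simp, fun _ hK2 => ?_⟩
      · have := E.adj_vx n₂ 2
        rwa [y2n, show (2 + 1 : ℕ) = 3 + 0 from rfl, vx_len n₂ hT.1, E.vx_zero, n2f] at this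
      -- If the second face met the first one again at this vertex, the rotation at `y₂` would close
      -- after two steps.
      · have he := back hh hK2
        have i2 : φ.symm n₂ = φ (φ n₂) := (E.iterate_eq_inv hT.1).symm
        have q1 : φ.symm n₂ = E.rot (φ.symm d.symm) := by
          rw [i2, r2]; exact (E.rot_eq _).symm
        have q2 : φ (φ.symm n₂).symm = φ.symm d.symm := by
          refine X.dart_eq_of_sameCycle
            ((sameCycle_facePerm _).trans (he.symm.trans (sameCycle_facePerm_inv _).symm)) ?_
          rw [hsnd]
          change (φ.symm n₂).fst = _
          rw [q1, E.fst_rot]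
        rw [← E.rot_eq, q1] at q2
        have h4 : 4 ≤ deg G (φ.symm d.symm).fst := hh.2
        exact E.rot_iterate_ne (d := φ.symm d.symm) (i := 2) (by omega) (by omega) q2
    · obtain ⟨f2, f3⟩ := offF2 n₂ 2 hn2N hT l2 l3
      rw [y2n] at l2 f2
      exact ⟨∅, Or.inl ⟨rfl, l2.2⟩, l2.1, f2, by simp, fun h => by have := l2.2; omega⟩
    · have h5 := hQ.1.1
      rw [y2n] at hh
      obtain ⟨f3, f4⟩ := offF2 n₂ 3 hn2N hT l3 l4
      have a4 : G.Adj (φ (φ d)).fst (E.vx n₂ 4) := by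
        have := (E.adj_vx n₂ 4).symm
        rwa [show (4 + 1 : ℕ) = 5 + 0 from rfl, vx_len n₂ h5, E.vx_zero, n2f] at this
      refine ⟨{E.vx n₂ 4, E.vx n₂ 3}, Or.inr (Or.inr ⟨d2 hh, _, _, rfl, l4, l3, f4, f3, a4,
        (E.adj_vx n₂ 3).symm, ?_⟩), hh.1, heavyF _ hh, ?_, fun _ hK2 => ?_⟩
      · rw [← y2n]; exact (E.adj_vx n₂ 2).symm
      · rintro v (rfl | rfl)
        · exact l4
        · exact l3
      · have he := back hh hK2
        have hq : (φ (φ.symm n₂).symm).fst = E.vx n₂ 4 := by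
          rw [hsnd]
          change (φ.symm n₂).fst = _
          rw [← E.iterate_eq_inv h5]; rfl
        have hq' := he.trans (sameCycle_facePerm (φ.symm n₂).symm).symm
        have e4 : E.vx n₂ 4 = (φ^[3] n₂).snd := by
          unfold RotationSystem.vx
          rw [Function.iterate_succ_apply', E.fst_facePerm]
        have hnE : ¬ E.Ee C (φ (φ.symm n₂).symm) :=
          not_ee_of_needy_needy (k := (φ^[3] n₂).symm) (by rw [e4] at l4; exact l4) hT.needy
            (by rw [SimpleGraph.Dart.symm_symm]; exact itn n₂ 3 hn2N) (by rw [hq, e4]; rfl)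
            (by rw [← len_congr hq', hl])
        -- This vertex lies on two needy faces, so the long face does not pay there and it must be
        -- one of the two exceptions. Being `y₁` would close a cycle of length 4; being `y₂` would
        -- make a heavy vertex light.
        have hor : φ (φ.symm n₂).symm = φ (φ d.symm) ∨ φ (φ.symm n₂).symm = φ.symm d.symm := by
          by_contra hc
          push Not at hc
          exact hnE (hcon _ hq' hc.1 hc.2)
        rcases hor with h | h
        · rw [h] at hq
          refine X.not_adj_adj (d := d) (y := y₁) (i := 0) (k := 2) (n := 4) (offF' h1F) (by omega)
            (by omega) X.c4 (by omega) a01.symm ?_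
          rw [hy₁, hq]; exact a4.symm
        · rw [h] at hq
          rw [← hq] at l4
          exact l4.not_heavy hh
  obtain ⟨A₂, t₂, h2C, h2F, lA2, hK₂⟩ := T2
  refine X.not_exists_outside hF hK hlight hy₁.symm hy₂.symm (by omega) ?_ h1C h2C h1F h2F t₁ t₂ hK₂ ?_
  · rintro v ⟨e, he, rfl⟩
    by_cases c1 : e = φ (φ d.symm)
    · exact Or.inl (by rw [c1])
    by_cases c2 : e = φ.symm d.symm
    · exact Or.inr (Or.inl (by rw [c2]))
    exact Or.inr (Or.inr (hcon e he c1 c2).light)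
  -- It remains to find a vertex of the poor face with a neighbour outside the configuration. Any
  -- heavy neighbour other than `y₁` and `y₂` will do.
  · have out : ∀ z, Heavy G C z → z ≠ y₁ → z ≠ y₂ → z ∉ F ∪ K ∪ A₁ ∪ A₂ := by
      rintro z hz h1 h2 (((h | ⟨e, he, rfl⟩) | h) | h)
      · exact (lF z h).not_heavy hz
      · by_cases c1 : e = φ (φ d.symm)
        · exact h1 (by rw [c1])
        by_cases c2 : e = φ.symm d.symm
        · exact h2 (by rw [c2])
        exact (hcon e he c1 c2).light.not_heavy hz
      · exact (lA1 z h).not_heavy hz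
      · exact (lA2 z h).not_heavy hz
    have o1 := offF' h1F
    have o2 := offF' h2F
    have per : ∀ i, E.vx d (10 + i) = E.vx d i := vx_len d l10
    have a01' : G.Adj y₁ (E.vx d 0) := a01.symm
    have a01'' : G.Adj y₁ (E.vx d 10) := by rw [show 10 = 10 + 0 from rfl, per]; exact a01'
    have a12' : G.Adj y₂ (E.vx d 1) := by rw [E.vx_one]; exact a12.symm
    have a12'' : G.Adj y₂ (E.vx d 11) := by rw [show 11 = 10 + 1 from rfl, per]; exact a12'
    -- A second adjacency of `y₁` or `y₂` to the poor face would close a cycle of length 4, 8 or 9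
    -- with an arc of it. Length 8 is available only if there is a pentagon next to a triangle.
    have n13 : ¬ G.Adj y₁ (E.vx d 3) := fun h =>
      X.not_adj_adj (i := 3) (k := 7) o1 (by omega) (by omega) X.c9 (by omega) h a01''
    have n17 : ¬ G.Adj y₁ (E.vx d 7) := fun h =>
      X.not_adj_adj (i := 0) (k := 7) o1 (by omega) (by omega) X.c9 (by omega) a01' h
    have n18 : ¬ G.Adj y₁ (E.vx d 8) := fun h =>
      X.not_adj_adj (i := 8) (k := 2) o1 (by omega) (by omega) X.c4 (by omega) h a01''
    have n14 : NoCycleOfLength G 8 → ¬ G.Adj y₁ (E.vx d 4) := fun h8 h =>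
      X.not_adj_adj (i := 4) (k := 6) o1 (by omega) (by omega) h8 (by omega) h a01''
    have n23 : ¬ G.Adj y₂ (E.vx d 3) := fun h =>
      X.not_adj_adj (i := 1) (k := 2) o2 (by omega) (by omega) X.c4 (by omega) a12' h
    have n24 : ¬ G.Adj y₂ (E.vx d 4) := fun h =>
      X.not_adj_adj (i := 4) (k := 7) o2 (by omega) (by omega) X.c9 (by omega) h a12''
    have n28 : ¬ G.Adj y₂ (E.vx d 8) := fun h =>
      X.not_adj_adj (i := 1) (k := 7) o2 (by omega) (by omega) X.c9 (by omega) a12' h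
    have n27 : NoCycleOfLength G 8 → ¬ G.Adj y₂ (E.vx d 7) := fun h8 h =>
      X.not_adj_adj (i := 1) (k := 6) o2 (by omega) (by omega) h8 (by omega) a12' h
    have fin : ∀ (i : ℕ) (z : V), Heavy G C z → G.Adj z (E.vx d i) →
        ¬ G.Adj y₁ (E.vx d i) → ¬ G.Adj y₂ (E.vx d i) →
        ∃ v ∈ F, ∃ z, G.Adj v z ∧ z ∉ F ∪ K ∪ A₁ ∪ A₂ := fun i z hz ha h1 h2 =>
      ⟨E.vx d i, ⟨_, sc i, rfl⟩, z, ha.symm, out z hz (fun h => h1 (h ▸ ha)) (fun h => h2 (h ▸ ha))⟩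
    have h8 : ∀ n, E.IsCQ C n → NoCycleOfLength G 8 := by
      rintro n ⟨⟨h5, -⟩, t, ht, hT⟩
      exact (X.no_seven_eight_of_three_five (d := t.symm) hT.1
        (by rw [SimpleGraph.Dart.symm_symm, ← len_congr ht, h5])).2
    have odd : ∀ i, E.ND C (φ^[2 * i + 1] d) := by
      intro i
      induction i with
      | zero => exact hd2
      | succ i ih =>
        rw [show 2 * (i + 1) + 1 = 2 * i + 1 + 1 + 1 by ring, Function.iterate_succ_apply',
          hp.nd_facePerm (sc _), Function.iterate_succ_apply', hp.nd_facePerm (sc _), not_not]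
        exact ih
    have sf : ∀ i, (φ^[i] d).symm.fst = E.vx d (i + 1) := fun i => by
      unfold RotationSystem.vx
      rw [Function.iterate_succ_apply', E.fst_facePerm]; rfl
    -- neighbours on the side
    have q0 : ∀ i m, E.len (φ^[i] d).symm = m + 1 →
        G.Adj (E.vx (φ^[i] d).symm m) (E.vx d (i + 1)) := fun i m hm => by
      have := E.adj_vx (φ^[i] d).symm m
      rwa [show m + 1 = (m + 1) + 0 from rfl, vx_len _ hm, E.vx_zero, sf] at this
    have q1 : ∀ i, G.Adj (E.vx (φ^[i] d).symm 2) (E.vx d i) := fun i => by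
      have := (E.adj_vx (φ^[i] d).symm 1).symm
      rwa [E.vx_one] at this
    -- The last condition in `Pe` is made for this place: one of the sides at positions 3 and 7 is
    -- not special, so it has a heavy vertex adjacent to the poor face, far enough from the common
    -- edge.
    rw [not_and_or] at hs37
    rcases hs37 with hs | hs
    · rcases X.poor_side ((poor_congr (sc 3)).1 hp) (odd 1) hs with
        ⟨hT, hh⟩ | ⟨hQ, -, -, -, hh⟩ | ⟨-, -, -, -, hh⟩
      · exact fin 3 _ hh (q1 3) n13 n23
      · exact fin 4 _ hh (q0 3 4 hQ.1.1) (n14 (h8 _ hQ)) n24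
      · exact fin 3 _ hh (q1 3) n13 n23
    · rcases X.poor_side ((poor_congr (sc 7)).1 hp) (odd 3) hs with
        ⟨hT, hh⟩ | ⟨hQ, -, -, -, hh⟩ | ⟨hQ, -, -, -, hh⟩
      · exact fin 8 _ hh (q0 7 2 hT.1) n18 n28
      · exact fin 8 _ hh (q0 7 4 hQ.1.1) n18 n28
      · exact fin 7 _ hh (q1 7) n17 (n27 (h8 _ hQ))

end Setting

end DPG

/-! ### The gifts of the vertices. -/

namespace DPG

open Equiv Equiv.Perm

namespace RotationSystem

variable {V : Type u} {G : SimpleGraph V} (E : RotationSystem G) (C : Set V)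

open Classical in
/-- The charge that the vertex of a corner gives to the face of the corner. -/
noncomputable def gift (d : G.Dart) : ℚ :=
  if d.fst ∈ C then (if d.snd ∈ C then 0 else if E.len d = 3 then 3 else if E.len d = 5 then 2 else 0)
  else if deg G d.fst ≤ 3 then 0
  else if E.Needy C d then
    (if ¬ E.Str C d ∨ E.Small C (E.rot d) ∨ E.Small C (E.rot.symm d) then 1 else 2)
  else if E.IsUQ C d then
    1 - (if E.len (E.rot d) = 5 then 1 / 4 else 0) - (if E.len (E.rot.symm d) = 5 then 1 / 4 else 0)
  else 0

variable {E C}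

theorem gift_nonneg (d : G.Dart) : 0 ≤ E.gift C d := by
  unfold gift; split_ifs <;> norm_num

theorem gift_light {d : G.Dart} (h : Light G C d.fst) : E.gift C d = 0 := by
  unfold gift; rw [if_neg h.1, if_pos h.2.le]

open Classical in
theorem gift_heavy {d : G.Dart} (h : Heavy G C d.fst) : E.gift C d =
    if E.Needy C d then
      (if ¬ E.Str C d ∨ E.Small C (E.rot d) ∨ E.Small C (E.rot.symm d) then 1 else 2)
    else if E.IsUQ C d then 1 - (if E.len (E.rot d) = 5 then 1 / 4 else 0) -
        (if E.len (E.rot.symm d) = 5 then 1 / 4 else 0)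
    else 0 := by
  have := h.2
  unfold gift; rw [if_neg h.1, if_neg (by omega)]

theorem gift_le_two {d : G.Dart} (h : Heavy G C d.fst) : E.gift C d ≤ 2 := by
  rw [gift_heavy h]; split_ifs <;> norm_num

theorem gift_of_not_small {d : G.Dart} (h : Heavy G C d.fst) (hs : ¬ E.Small C d) :
    E.gift C d = 0 := by
  rw [small_iff, not_or] at hs
  rw [gift_heavy h, if_neg hs.1, if_neg hs.2]

theorem gift_le_one {d : G.Dart} (h : Heavy G C d.fst)
    (hs : ¬ E.Str C d ∨ E.Small C (E.rot d) ∨ E.Small C (E.rot.symm d)) : E.gift C d ≤ 1 := by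
  rw [gift_heavy h, if_pos hs]; split_ifs <;> norm_num

theorem gift_add_gift_rot_le {d : G.Dart} (h : Heavy G C d.fst) :
    E.gift C d + E.gift C (E.rot d) ≤ 2 := by
  have h' : Heavy G C (E.rot d).fst := by rwa [E.fst_rot]
  by_cases s1 : E.Small C d
  · by_cases s2 : E.Small C (E.rot d)
    · have h1 := gift_le_one h (Or.inr (Or.inl s2))
      have h2 := gift_le_one h' (Or.inr (Or.inr (by rwa [Equiv.symm_apply_apply])))
      linarith
    · have h1 := gift_le_two (E := E) h
      rw [gift_of_not_small h' s2]; linarith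
  · have h1 := gift_le_two (E := E) h'
    rw [gift_of_not_small h s1]; linarith

end RotationSystem

namespace Setting

open RotationSystem

variable {V : Type u} [Finite V] {G : SimpleGraph V} {E : RotationSystem G} {C : Set V}

omit [Finite V] in
theorem symm_ne_rot (d : G.Dart) : d.symm ≠ E.rot d := fun h => by
  have := congrArg (fun e : G.Dart => e.fst) h
  rw [E.fst_rot] at this
  exact d.adj.ne this.symm

theorem len_rot (d : G.Dart) : E.len (E.rot d) = E.len d.symm := len_congr (sameCycle_rot d)

/-- A triangle in the middle would lie between two pentagons, and a pentagon in the middle between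
two triangles or between a triangle and a pentagon; all are impossible. So there are three
pentagons, and adjacent pentagons exclude a triangle next to a pentagon anywhere. -/
theorem isUQ_of_small (X : Setting E C) {d : G.Dart} (hv : d.fst ∉ C) (h0 : E.Small C d)
    (h1 : E.Small C (E.rot d)) (h2 : E.Small C (E.rot (E.rot d))) :
    E.IsUQ C d ∧ E.IsUQ C (E.rot d) ∧ E.IsUQ C (E.rot (E.rot d)) := by
  have s1 := sameCycle_rot (E := E) d
  have s2 := sameCycle_rot (E := E) (E.rot d)
  have hrv : (E.rot d).fst ∉ C := by rwa [E.fst_rot]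
  have act : ∀ {e : G.Dart}, E.Small C e → E.Act C e := fun h => h.elim (·.2) (·.2)
  have d0 := X.three_le_deg hv
  have d0' := X.three_le_deg hrv
  have ds := X.three_le_deg (act h0).snd_notMem
  have dr := X.three_le_deg (act h1).snd_notMem
  rw [small_congr s1] at h1
  have h1' : E.Small C (E.rot d) := (small_congr s1).2 h1
  rw [small_congr s2] at h2
  have key : E.IsQ C d ∧ E.IsQ C d.symm ∧ E.IsQ C (E.rot d).symm := by
    rcases h1 with h1 | h1
    · have h5 : ∀ {e : G.Dart}, E.IsT C e → E.Small C e.symm → E.IsQ C e.symm := by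
        intro e he hs
        rcases hs with hs | hs
        · exact (X.not_three_three (X.three_le_deg he.2.snd_notMem) he.1 hs.1).elim
        · exact hs
      have q0 : E.IsQ C d.symm.symm := h5 h1 (by rwa [SimpleGraph.Dart.symm_symm])
      have h1r : E.IsT C (E.rot d) := (isT_congr s1).2 h1
      have q2 := h5 h1r h2
      exact (symm_ne_rot d (X.eq_of_three_five h1 s1.symm q0 q2.1)).elim
    · have h1r : E.len (E.rot d) = 5 := ((isQ_congr s1).2 h1).1
      rcases h0 with h0 | h0
      · rcases h2 with h2 | h2
        · exact (symm_ne_rot d (X.eq_of_five_three h1.1 s1.symm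
            (by rw [SimpleGraph.Dart.symm_symm]; exact h0.1) h2.1)).elim
        · exact (X.not_three_five_and_five_five h0.1 h1.1 d0' dr h1r h2.1).elim
      · rcases h2 with h2 | h2
        · exact (X.not_three_five_and_five_five (d := (E.rot d).symm) h2.1
            (by rwa [SimpleGraph.Dart.symm_symm]) d0 ds h0.1 h1.1).elim
        · exact ⟨h0, h1, h2⟩
  obtain ⟨q0, q1, q2⟩ := key
  have nn : ∀ e, E.len e = 5 → ¬ E.NearT C e := by
    rintro e he ⟨t, ht, hT⟩
    exact X.not_three_five_and_five_five (d := t.symm) hT.1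
      (by rw [SimpleGraph.Dart.symm_symm, ← len_congr ht, he]) d0 ds q0.1 q1.1
  refine ⟨⟨q0, nn _ q0.1⟩, (isUQ_congr s1).2 ⟨q1, nn _ q1.1⟩, (isUQ_congr s2).2 ⟨q2, nn _ q2.1⟩⟩

/-- The middle pentagon has pentagons on both sides at this vertex and loses two quarters; each
outer one loses at least one. -/
theorem gift_triple (X : Setting E C) {d : G.Dart} (hv : Heavy G C d.fst) (h0 : E.Small C d)
    (h1 : E.Small C (E.rot d)) (h2 : E.Small C (E.rot (E.rot d))) :
    E.gift C d ≤ 3 / 4 ∧ E.gift C (E.rot d) = 1 / 2 ∧ E.gift C (E.rot (E.rot d)) ≤ 3 / 4 := by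
  obtain ⟨q0, q1, q2⟩ := X.isUQ_of_small hv.1 h0 h1 h2
  have hv1 : Heavy G C (E.rot d).fst := by rwa [E.fst_rot]
  have hv2 : Heavy G C (E.rot (E.rot d)).fst := by rwa [E.fst_rot]
  rw [gift_heavy hv, gift_heavy hv1, gift_heavy hv2, if_neg q0.not_needy, if_neg q1.not_needy,
    if_neg q2.not_needy, if_pos q0, if_pos q1, if_pos q2, Equiv.symm_apply_apply,
    Equiv.symm_apply_apply, if_pos q1.1.1, if_pos q0.1.1, if_pos q2.1.1]
  refine ⟨?_, ?_, ?_⟩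
  · split_ifs <;> norm_num
  · norm_num
  · split_ifs <;> norm_num

open Classical in
theorem sum_fst_eq [Fintype G.Dart] (d : G.Dart) (g : G.Dart → ℚ) :
    ∑ e with e.fst = d.fst, g e = ∑ i ∈ Finset.range (deg G d.fst), g (E.rot^[i] d) := by
  rw [← E.minimalPeriod_rot, ← sum_sameCycle]
  refine Finset.sum_congr ?_ fun _ _ => rfl
  ext e
  simp only [Finset.mem_filter, Finset.mem_univ, true_and]
  exact ⟨fun h => E.cyclic _ _ h.symm, fun h => (E.fst_eq_of_sameCycle h).symm⟩

/-- What a vertex outside `C` gives. -/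
theorem sum_gift_le (X : Setting E C) {d : G.Dart} (hd : d.fst ∉ C) :
    ∑ i ∈ Finset.range (deg G d.fst), E.gift C (E.rot^[i] d) ≤ 2 * (deg G d.fst : ℚ) - 6 := by
  rcases X.light_or_heavy hd with hl | hh
  · have : ∀ i ∈ Finset.range (deg G d.fst), E.gift C (E.rot^[i] d) = 0 := fun i _ =>
      gift_light (by rwa [E.fst_rot_iterate])
    rw [Finset.sum_eq_zero this, hl.2]; norm_num
  · have hv : ∀ i, Heavy G C (E.rot^[i] d).fst := fun i => by rwa [E.fst_rot_iterate]
    have b2 : ∀ i, E.gift C (E.rot^[i] d) ≤ 2 := fun i => gift_le_two (hv i)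
    have pr : ∀ i, E.gift C (E.rot^[i] d) + E.gift C (E.rot^[i + 1] d) ≤ 2 := fun i => by
      rw [Function.iterate_succ_apply']; exact gift_add_gift_rot_le (hv i)
    have tr : ∀ i, E.Small C (E.rot^[i] d) → E.Small C (E.rot^[i + 1] d) →
        E.Small C (E.rot^[i + 2] d) → E.gift C (E.rot^[i] d) ≤ 3 / 4 ∧
          E.gift C (E.rot^[i + 1] d) = 1 / 2 ∧ E.gift C (E.rot^[i + 2] d) ≤ 3 / 4 := by
      intro i h0 h1 h2
      rw [Function.iterate_succ_apply'] at h1 ⊢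
      rw [Function.iterate_succ_apply', Function.iterate_succ_apply'] at h2 ⊢
      exact X.gift_triple (hv i) h0 h1 h2
    have ze : ∀ i, ¬ E.Small C (E.rot^[i] d) → E.gift C (E.rot^[i] d) = 0 := fun i =>
      gift_of_not_small (hv i)
    have per : ∀ i, E.rot^[i + deg G d.fst] d = E.rot^[i] d := fun i => by
      rw [Function.iterate_add_apply, E.rot_iterate_deg]
    have h4 := hh.2
    rcases (show deg G d.fst = 4 ∨ deg G d.fst = 5 ∨ 6 ≤ deg G d.fst by omega) with h | h | h
    -- Degree 4 has 2 units to give. With two opposite small faces both corners are not strong and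
    -- get at most 1 each; three or four small faces fall under `gift_triple`.
    · have op : ∀ i, E.Small C (E.rot^[i + 2] d) → E.gift C (E.rot^[i] d) ≤ 1 := by
        intro i hs
        refine gift_le_one (hv i) (Or.inl fun hst => hst ⟨by rw [E.fst_rot_iterate, h], ?_⟩)
        rwa [Function.iterate_succ_apply', Function.iterate_succ_apply'] at hs
      rw [h] at per ⊢
      have e4 := per 0
      have z0 := ze 0; have z1 := ze 1; have z2 := ze 2; have z3 := ze 3
      have p0 := pr 0; have p1 := pr 1; have p2 := pr 2; have p3 := pr 3
      have o0 := op 0; have o1 := op 1; have o2 := op 2; have o3 := op 3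
      have t0 := tr 0; have t1 := tr 1; have t2 := tr 2; have t3 := tr 3
      norm_num [Finset.sum_range_succ] at *
      rw [e4] at p3 t2 o2 t3 o3
      clear tr pr ze op b2 per hv e4
      by_cases s0 : E.Small C d <;> by_cases s1 : E.Small C (E.rot d) <;>
        by_cases s2 : E.Small C (E.rot (E.rot d)) <;>
        by_cases s3 : E.Small C (E.rot (E.rot (E.rot d))) <;>
        simp only [s0, s1, s2, s3, not_true_eq_false, not_false_eq_true, false_implies,
          true_implies, implies_true] at * <;> linarith
    -- Degree 5 has 4 units. A face that is not small leaves two disjoint pairs of at most 2 each;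
    -- if all five are small, each gets one half.
    · rw [h] at per ⊢
      have e4 := per 0
      have z0 := ze 0; have z1 := ze 1; have z2 := ze 2; have z3 := ze 3; have z4 := ze 4
      have p0 := pr 0; have p1 := pr 1; have p2 := pr 2; have p3 := pr 3; have p4 := pr 4
      have t0 := tr 0; have t1 := tr 1; have t2 := tr 2; have t3 := tr 3; have t4 := tr 4
      norm_num [Finset.sum_range_succ] at *
      rw [e4] at p4 t3 t4
      clear tr pr ze b2 per hv e4
      by_cases s0 : E.Small C d
      · by_cases s1 : E.Small C (E.rot d)
        · by_cases s2 : E.Small C (E.rot (E.rot d))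
          · by_cases s3 : E.Small C (E.rot (E.rot (E.rot d)))
            · by_cases s4 : E.Small C (E.rot (E.rot (E.rot (E.rot d))))
              · simp only [s0, s1, s2, s3, s4, true_implies] at t0 t1 t2 t3 t4
                linarith
              · have := z4 s4; linarith
            · have := z3 s3; linarith
          · have := z2 s2; linarith
        · have := z1 s1; linarith
      · have := z0 s0; linarith
    -- Adding the pair bounds around the vertex counts every gift twice. The sum of the gifts is
    -- thus at most the degree, which is at most `2 * deg - 6` from degree 6 on.
    · have hs : ∑ i ∈ Finset.range (deg G d.fst), E.gift C (E.rot^[i + 1] d) =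
          ∑ i ∈ Finset.range (deg G d.fst), E.gift C (E.rot^[i] d) := by
        have h1 := Finset.sum_range_succ (fun i => E.gift C (E.rot^[i] d)) (deg G d.fst)
        have h2 := Finset.sum_range_succ' (fun i => E.gift C (E.rot^[i] d)) (deg G d.fst)
        rw [E.rot_iterate_deg] at h1
        simp only [Function.iterate_zero, id] at h2
        linarith
      have h1 : ∑ i ∈ Finset.range (deg G d.fst),
          (E.gift C (E.rot^[i] d) + E.gift C (E.rot^[i + 1] d)) ≤ (deg G d.fst) * 2 := by
        have := Finset.sum_le_card_nsmul (Finset.range (deg G d.fst)) _ 2 fun i _ => pr i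
        simpa using this
      rw [Finset.sum_add_distrib, hs] at h1
      have h6 : (6 : ℚ) ≤ deg G d.fst := by exact_mod_cast h
      linarith

/-- A bound for sums of numbers whose consecutive partial sums are small. -/
theorem sum_le_of_triples (a : ℕ → ℚ) (m : ℕ) (h1 : ∀ i < m, a i ≤ 3)
    (h2 : ∀ i, i + 1 < m → a i + a (i + 1) ≤ 5)
    (h3 : ∀ i, i + 2 < m → a i + a (i + 1) + a (i + 2) ≤ 6) :
    ∑ i ∈ Finset.range m, a i ≤ 2 * m + 1 := by
  induction m using Nat.strong_induction_on with
  | _ m ih =>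
    match m with
    | 0 => simp
    | 1 => have := h1 0 (by omega); simp; linarith
    | 2 =>
      have := h2 0 (by omega)
      simp only [Finset.sum_range_succ, Finset.range_zero, Finset.sum_empty]
      push_cast
      linarith
    | k + 3 =>
      have h := ih k (by omega) (fun i hi => h1 i (by omega)) (fun i hi => h2 i (by omega))
        (fun i hi => h3 i (by omega))
      have := h3 k (by omega)
      rw [Finset.sum_range_succ, Finset.sum_range_succ, Finset.sum_range_succ]
      push_cast
      linarith

omit [Finite V] in
theorem gift_mem {d : G.Dart} (h : d.fst ∈ C) (h' : d.snd ∉ C) : E.gift C d =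
    if E.len d = 3 then 3 else if E.len d = 5 then 2 else 0 := by
  unfold RotationSystem.gift
  rw [if_pos h, if_neg h']

omit [Finite V] in
theorem gift_mem_le {d : G.Dart} (h : d.fst ∈ C) : E.gift C d ≤ 3 := by
  unfold RotationSystem.gift
  rw [if_pos h]
  split_ifs <;> norm_num

/-- Two triangles cannot be consecutive, so the best pair is a triangle with a pentagon. -/
theorem gift_mem_pair (X : Setting E C) {d : G.Dart} (h : d.fst ∈ C) (h0 : d.snd ∉ C)
    (h1 : (E.rot d).snd ∉ C) : E.gift C d + E.gift C (E.rot d) ≤ 5 := by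
  have := X.not_three_three (X.three_le_deg h0)
  rw [gift_mem h h0, gift_mem (by rwa [E.fst_rot]) h1, len_rot]
  split_ifs with h1 h2 <;> norm_num
  exact this h1 h2

/-- More than 6 would need adjacent triangles or one of the length patterns 3-5-3, 5-3-5, 3-5-5 and
5-5-3. Only 5-3-5 needs the degree: around a vertex of degree 3 the two pentagons could share an
edge. -/
theorem gift_mem_triple (X : Setting E C) {d : G.Dart} (h : d.fst ∈ C) (h0 : d.snd ∉ C)
    (h1 : (E.rot d).snd ∉ C) (h2 : (E.rot (E.rot d)).snd ∉ C) (h4 : 4 ≤ deg G d.fst) :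
    E.gift C d + E.gift C (E.rot d) + E.gift C (E.rot (E.rot d)) ≤ 6 := by
  have d0 := X.three_le_deg h0
  have d1 := X.three_le_deg h1
  have hd : 3 ≤ deg G d.fst := by omega
  have hd' : 3 ≤ deg G (E.rot d).fst := by rwa [E.fst_rot]
  have lr := len_rot (E := E) d
  have lr2 := len_rot (E := E) (E.rot d)
  have k1 := X.not_three_three d0
  have k2 := X.not_three_three d1
  have k3 : E.len d = 3 → E.len d.symm = 5 → E.len (E.rot d).symm = 3 → False := fun a b c =>
    symm_ne_rot d (X.eq_of_five_three b (sameCycle_rot d).symm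
      (by rwa [SimpleGraph.Dart.symm_symm]) c)
  have k4 : E.len d = 5 → E.len d.symm = 3 → E.len (E.rot d).symm = 5 → False := fun a b c => by
    have h7 := (X.no_seven_eight_of_three_five b (by rwa [SimpleGraph.Dart.symm_symm])).1
    refine X.not_five_three_five_of_four_le_deg h7 (d := d.symm) d0 h4 ?_ b
      (by rwa [SimpleGraph.Dart.symm_symm]) ?_ <;> rw [← E.rot_eq]
    · exact d1
    · exact c
  have k5 : E.len d = 3 → E.len d.symm = 5 → E.len (E.rot d).symm = 5 → False := fun a b c =>
    X.not_three_five_and_five_five a b hd' d1 (lr.trans b) c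
  have k6 : E.len d = 5 → E.len d.symm = 5 → E.len (E.rot d).symm = 3 → False := fun a b c =>
    X.not_three_five_and_five_five (d := (E.rot d).symm) c
      (by rw [SimpleGraph.Dart.symm_symm]; exact lr.trans b) hd d0 a b
  rw [gift_mem h h0, gift_mem (by rwa [E.fst_rot]) h1,
    gift_mem (by rwa [E.fst_rot, E.fst_rot]) h2, lr, lr2]
  rw [lr] at k2
  split_ifs <;> norm_num <;> grind

/-- What the only vertex of `C` gives. -/
theorem sum_gift_le_of_singleton (X : Setting E C) {d : G.Dart} (hd : d.fst ∈ C)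
    (hC : ∀ v ∈ C, v = d.fst) :
    ∑ i ∈ Finset.range (deg G d.fst), E.gift C (E.rot^[i] d) ≤ 2 * (deg G d.fst : ℚ) + 5 := by
  have hf : ∀ i, (E.rot^[i] d).fst ∈ C := fun i => by rwa [E.fst_rot_iterate]
  have hs : ∀ i, (E.rot^[i] d).snd ∉ C := fun i hi => by
    have h1 := hC _ hi
    rw [← E.fst_rot_iterate d i] at h1
    exact (E.rot^[i] d).adj.ne h1.symm
  by_cases h4 : 4 ≤ deg G d.fst
  · refine (sum_le_of_triples _ _ (fun i _ => gift_mem_le (hf i)) (fun i _ => ?_)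
      (fun i _ => ?_)).trans (by linarith)
    · have := X.gift_mem_pair (hf i) (hs i) (by rw [← Function.iterate_succ_apply' E.rot]; exact hs _)
      rwa [Function.iterate_succ_apply']
    · have := X.gift_mem_triple (hf i) (hs i) (by rw [← Function.iterate_succ_apply' E.rot]; exact hs _)
        (by rw [← Function.iterate_succ_apply' E.rot, ← Function.iterate_succ_apply' E.rot]; exact hs _)
        (by rwa [E.fst_rot_iterate])
      rwa [Function.iterate_succ_apply' E.rot (i + 1), Function.iterate_succ_apply' E.rot i]
  -- In degree at most 3 the trivial bound of 3 per corner suffices.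
  · have h := Finset.sum_le_card_nsmul (Finset.range (deg G d.fst))
      (fun i => E.gift C (E.rot^[i] d)) 3 fun i _ => gift_mem_le (hf i)
    simp only [Finset.card_range, nsmul_eq_mul] at h
    have : (deg G d.fst : ℚ) ≤ 3 := by exact_mod_cast (by omega : deg G d.fst ≤ 3)
    linarith

/-- What a vertex of `C` gives if `C` is the pair of ends of an edge. -/
theorem sum_gift_le_of_pair (X : Setting E C) {d : G.Dart} (hd : d.fst ∈ C) (hd' : d.snd ∈ C)
    (hC : ∀ v ∈ C, v = d.fst ∨ v = d.snd) :
    ∑ i ∈ Finset.range (deg G d.fst), E.gift C (E.rot^[i] d) ≤ 2 * (deg G d.fst : ℚ) - 1 := by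
  have h2 := X.two_le_deg d.fst
  obtain ⟨m, hm⟩ : ∃ m, deg G d.fst = m + 1 := ⟨deg G d.fst - 1, by omega⟩
  have hf : ∀ i, (E.rot^[i] d).fst ∈ C := fun i => by rwa [E.fst_rot_iterate]
  have hs : ∀ i < m, (E.rot^[i + 1] d).snd ∉ C := fun i him hi => by
    rcases hC _ hi with h1 | h1
    · rw [← E.fst_rot_iterate d (i + 1)] at h1
      exact (E.rot^[i + 1] d).adj.ne h1.symm
    · exact E.rot_iterate_ne (d := d) (i := i + 1) (by omega) (by omega)
        (dart_ext (E.fst_rot_iterate d _) h1)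
  -- Nothing is given along the edge inside `C`. This leaves a linear row of `deg - 1` corners, to
  -- which the bound for consecutive triples applies.
  have h0 : E.gift C d = 0 := by
    unfold RotationSystem.gift
    rw [if_pos hd, if_pos hd']
  rw [hm, Finset.sum_range_succ', Function.iterate_zero, id, h0, add_zero]
  have key : ∀ i, i + 1 < m → E.gift C (E.rot^[i + 1] d) + E.gift C (E.rot^[i + 1 + 1] d) ≤ 5 := by
    intro i hi
    have := X.gift_mem_pair (hf (i + 1)) (hs i (by omega))
      (by rw [← Function.iterate_succ_apply' E.rot]; exact hs (i + 1) hi)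
    rwa [Function.iterate_succ_apply' E.rot (i + 1)]
  have : ∑ i ∈ Finset.range m, E.gift C (E.rot^[i + 1] d) ≤ 2 * m + 1 := by
    refine sum_le_of_triples _ _ (fun i _ => gift_mem_le (hf (i + 1))) key (fun i hi => ?_)
    have := X.gift_mem_triple (hf (i + 1)) (hs i (by omega))
      (by rw [← Function.iterate_succ_apply' E.rot]; exact hs (i + 1) (by omega))
      (by rw [← Function.iterate_succ_apply' E.rot, ← Function.iterate_succ_apply' E.rot]
          exact hs (i + 2) (by omega))
      (by rw [E.fst_rot_iterate]; omega)
    rwa [Function.iterate_succ_apply' E.rot (i + 2), Function.iterate_succ_apply' E.rot (i + 1)]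
  push_cast
  linarith

end Setting

end DPG

/-! ### The payments across edges. -/

namespace DPG

open Equiv Equiv.Perm

namespace RotationSystem

variable {V : Type u} {G : SimpleGraph V} (E : RotationSystem G) (C : Set V)

open Classical in
/-- The charge that a large face pays to a needy face. -/
noncomputable def payN (d : G.Dart) : ℚ :=
  if 10 ≤ E.len d then
    (if E.Spec C d.symm then 1 / 4 else 1 / 2) *
      ((if E.Eo C d then 1 else 0) + (if E.Ei C (E.facePerm d) then 1 else 0))
  else 0

open Classical in
/-- The charge that a face pays to a pentagon without triangle. -/
noncomputable def payQ (d : G.Dart) : ℚ :=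
  if 7 ≤ E.len d ∧ E.Qe C d then (if E.AllLight C d.symm then 1 / 3 else 1 / 4) else 0

open Classical in
/-- The charge that a face pays to a poor face. -/
noncomputable def payP (d : G.Dart) : ℚ := if 10 ≤ E.len d ∧ E.Pe C d then 1 / 5 else 0

open Classical in
/-- The charge that a pentagon through `C` pays to a triangle. -/
noncomputable def payF (d : G.Dart) : ℚ :=
  if E.len d = 5 ∧ ¬ E.Act C d ∧ E.IsT C d.symm then 1 else 0

/-- The charge that passes across a dart, except from triangles. -/
noncomputable def pay (d : G.Dart) : ℚ := E.payN C d + E.payQ C d + E.payP C d + E.payF C d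

open Classical in
/-- The surplus that a triangle passes on to the pentagon next to it. -/
noncomputable def payT (d : G.Dart) : ℚ :=
  if E.IsT C d ∧ E.IsQ C d.symm then
    (∑ i ∈ Finset.range 3, (E.gift C (E.facePerm^[i] d) + E.pay C (E.facePerm^[i] d).symm)) - 3
  else 0

/-- The charge that leaves the face at a dart and its corner. -/
noncomputable def loss (d : G.Dart) : ℚ :=
  E.pay C d - E.pay C d.symm + E.payT C d - E.payT C d.symm - E.gift C d

variable {E C}

theorem payN_nonneg (d : G.Dart) : 0 ≤ E.payN C d := by
  unfold payN; split_ifs <;> norm_num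

theorem payQ_nonneg (d : G.Dart) : 0 ≤ E.payQ C d := by
  unfold payQ; split_ifs <;> norm_num

theorem payP_nonneg (d : G.Dart) : 0 ≤ E.payP C d := by
  unfold payP; split_ifs <;> norm_num

theorem payF_nonneg (d : G.Dart) : 0 ≤ E.payF C d := by
  unfold payF; split_ifs <;> norm_num

theorem pay_nonneg (d : G.Dart) : 0 ≤ E.pay C d := by
  have h1 := payN_nonneg (E := E) (C := C) d
  have h2 := payQ_nonneg (E := E) (C := C) d
  have h3 := payP_nonneg (E := E) (C := C) d
  have h4 := payF_nonneg (E := E) (C := C) d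
  unfold pay; linarith

theorem pay_of_len_lt {d : G.Dart} (h : E.len d < 7) : E.pay C d = E.payF C d := by
  unfold pay payN payQ payP
  rw [if_neg (by omega), if_neg (by omega), if_neg (by omega)]; ring

theorem pay_of_act {d : G.Dart} (h : E.len d < 7) (ha : E.Act C d) : E.pay C d = 0 := by
  rw [pay_of_len_lt h, payF, if_neg (fun h => h.2.1 ha)]

theorem payT_of_not_isT {d : G.Dart} (h : ¬ E.IsT C d) : E.payT C d = 0 := by
  unfold payT; rw [if_neg (fun h' => h h'.1)]

theorem payT_of_not_isQ {d : G.Dart} (h : ¬ E.IsQ C d.symm) : E.payT C d = 0 := by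
  unfold payT; rw [if_neg (fun h' => h h'.2)]

theorem loss_le {d : G.Dart} (h : ¬ E.Small C d) : E.loss C d ≤ E.pay C d - E.pay C d.symm - E.gift C d := by
  unfold loss
  rw [payT_of_not_isT (fun h' => h (Or.inl h')),
    payT_of_not_isQ (d := d.symm) (fun h' => h (Or.inr (by rwa [SimpleGraph.Dart.symm_symm] at h')))]
  linarith

variable [Finite V]

/-- The payment across a dart of a needy face from the final vertex of the dart. -/
theorem eo_symm_iff {d : G.Dart} (hd : E.Needy C d) : E.Eo C d.symm ↔
    Light G C d.snd ∧ ¬ E.Needy C (E.facePerm d).symm ∧ ¬ (Heavy G C d.fst ∧ E.Str C d) := by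
  unfold Eo ND
  constructor
  · rintro ⟨h1, -, h3, h4⟩
    refine ⟨h1, ?_, by simpa using h4⟩
    rwa [← needy_congr (sameCycle_symm_of_snd (d := d) h1.2)]
  · rintro ⟨h1, h3, h4⟩
    refine ⟨h1, by simpa using hd, ?_, by simpa using h4⟩
    rwa [needy_congr (sameCycle_symm_of_snd (d := d) h1.2)]

/-- The payment across a dart of a needy face from the initial vertex of the dart. -/
theorem ei_symm_iff {d : G.Dart} (hd : E.Needy C d) : E.Ei C (E.facePerm d.symm) ↔
    Light G C d.fst ∧ ¬ E.Needy C (E.facePerm.symm d).symm ∧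
      ¬ (Heavy G C d.snd ∧ E.Str C (E.facePerm d)) := by
  unfold Ei ND
  rw [Equiv.symm_apply_apply, SimpleGraph.Dart.symm_symm, E.fst_facePerm, ← E.facePerm_apply]
  constructor
  · rintro ⟨h1, -, h3, h4⟩
    refine ⟨h1, ?_, h4⟩
    rwa [← needy_congr (sameCycle_symm_of_fst (d := d) h1.2)]
  · rintro ⟨h1, h3, h4⟩
    refine ⟨h1, hd, ?_, h4⟩
    rwa [needy_congr (sameCycle_symm_of_fst (d := d) h1.2)]

open Classical in
/-- The charge a corner of a needy face asks for, twice. -/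
noncomputable def ask (E : RotationSystem G) (C : Set V) (d : G.Dart) : ℚ :=
  if Light G C d.fst then 0 else if E.Str C d then 2 else 1

end RotationSystem

namespace Setting

open RotationSystem

variable {V : Type u} [Finite V] {G : SimpleGraph V} {E : RotationSystem G} {C : Set V}

omit [Finite V] in
theorem ask_nonneg (d : G.Dart) : 0 ≤ E.ask C d := by
  unfold RotationSystem.ask; split_ifs <;> norm_num

-- If neither face next to it at the vertex is small, a needy face receives the full amount: 2 from
-- a strong corner, 1 from any other heavy one, and nothing from a light one.
omit [Finite V] in
theorem ask_eq_gift {d : G.Dart} (X : Setting E C) (hd : E.Needy C d) (h1 : ¬ E.Small C (E.rot d))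
    (h2 : ¬ E.Small C (E.rot.symm d)) : E.gift C d = E.ask C d := by
  unfold RotationSystem.ask
  rcases X.light_or_heavy hd.act.fst_notMem with hl | hh
  · rw [if_pos hl, gift_light hl]
  · rw [if_neg (fun h => h.not_heavy hh), gift_heavy hh, if_pos hd]
    by_cases hs : E.Str C d
    · rw [if_pos hs, if_neg (by tauto)]
    · rw [if_neg hs, if_pos (Or.inl hs)]

open Classical in
/-- The payment across an edge of a needy face with no needy faces at the adjacent edges. -/
theorem payN_ge (X : Setting E C) {d : G.Dart} (hd : E.Needy C d) (hl : 10 ≤ E.len d.symm)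
    (h1 : ¬ E.Needy C (E.facePerm d).symm) (h2 : ¬ E.Needy C (E.facePerm.symm d).symm) {w : ℚ}
    (hw : 0 ≤ w) (hw' : w = 1 / 4 ∨ (w = 1 / 2 ∧ ¬ E.Spec C d)) :
    w * (2 - E.ask C d - E.ask C (E.facePerm d)) ≤ E.payN C d.symm := by
  have hs : ∀ e : G.Dart, E.Needy C e → (¬ Light G C e.fst ↔ Heavy G C e.fst) := fun e he =>
    ⟨fun h => (X.light_or_heavy he.act.fst_notMem).resolve_left h, fun h h' => h'.not_heavy h⟩
  have k1 := hs d hd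
  have k2 := hs (E.facePerm d) ((needy_congr (sameCycle_facePerm d)).2 hd)
  rw [E.fst_facePerm] at k2
  -- The number of ends that pay across the edge is at least 2 minus what the two corners ask for. A
  -- strong heavy corner stops the payment at the other end, and a weak one stops only its own.
  have key : 2 - E.ask C d - E.ask C (E.facePerm d) ≤
      (if E.Eo C d.symm then 1 else 0) +
        (if E.Ei C (E.facePerm d.symm) then 1 else 0) := by
    simp only [eo_symm_iff hd, ei_symm_iff hd, h1, h2, not_false_eq_true, true_and, ← k1, ← k2]
    unfold RotationSystem.ask
    rw [E.fst_facePerm]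
    by_cases a : Light G C d.fst <;> by_cases b : Light G C d.snd <;>
      by_cases s : E.Str C d <;> by_cases t : E.Str C (E.facePerm d) <;> simp [a, b, s, t] <;>
      norm_num
  unfold RotationSystem.payN
  rw [if_pos hl, SimpleGraph.Dart.symm_symm]
  have hnn : (0 : ℚ) ≤ (if E.Eo C d.symm then 1 else 0) +
      (if E.Ei C (E.facePerm d.symm) then 1 else 0) := by split_ifs <;> norm_num
  refine (mul_le_mul_of_nonneg_left key hw).trans ?_
  rcases hw' with rfl | ⟨rfl, hsp⟩
  · split_ifs <;> norm_num
  · rw [if_neg hsp]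

end Setting

end DPG

/-! ### Final charge of triangles, and of pentagons next to triangles. -/

namespace DPG

open Equiv Equiv.Perm

namespace Setting

open RotationSystem

variable {V : Type u} [Finite V] {G : SimpleGraph V} {E : RotationSystem G} {C : Set V}

theorem sum_face_congr {d e : G.Dart} (h : SameCycle E.facePerm d e) (g : G.Dart → ℚ) :
    ∑ i ∈ Finset.range (E.len d), g (E.facePerm^[i] d) =
      ∑ i ∈ Finset.range (E.len e), g (E.facePerm^[i] e) := by
  classical
  have := Fintype.ofFinite G.Dart
  unfold RotationSystem.len
  rw [← sum_sameCycle, ← sum_sameCycle]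
  refine Finset.sum_congr ?_ fun _ _ => rfl
  ext a
  simp only [Finset.mem_filter, Finset.mem_univ, true_and]
  exact ⟨fun k => h.symm.trans k, fun k => h.trans k⟩

omit [Finite V] in
theorem not_small_of_len {d : G.Dart} (h : 10 ≤ E.len d) : ¬ E.Small C d := by
  rintro (h' | h') <;> (have := h'.1; omega)

omit [Finite V] in
theorem not_needy_of_len {d : G.Dart} (h : 10 ≤ E.len d) : ¬ E.Needy C d := fun h' =>
  not_small_of_len h h'.small

omit [Finite V] in
/-- In a small face the payments go to the face. -/
theorem loss_eq_of_small {d : G.Dart} (h : E.Small C d) :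
    E.loss C d = - E.pay C d.symm + E.payT C d - E.payT C d.symm - E.gift C d := by
  unfold RotationSystem.loss
  rw [pay_of_act (d := d) (by rcases h with h | h <;> (have := h.1; omega)) (h.elim (·.2) (·.2))]
  ring

omit [Finite V] in
theorem payT_symm_of_isT {d : G.Dart} (h : E.IsT C d) : E.payT C d.symm = 0 :=
  payT_of_not_isQ fun h' => by
    have h1 := h'.1
    have h2 := h.1
    rw [SimpleGraph.Dart.symm_symm] at h1
    omega

/-- Triangles without a pentagon next to them. -/
theorem sum_loss_plain (X : Setting E C) {d : G.Dart} (hT : E.IsT C d)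
    (hQ : ∀ e, SameCycle E.facePerm d e → ¬ E.IsQ C e.symm) :
    ∑ i ∈ Finset.range (E.len d), E.loss C (E.facePerm^[i] d) ≤ E.len d - 6 := by
  -- The gift of a corner and the payment across the following edge add up to 1 plus a difference of
  -- half-asks, which telescopes around the triangle. A pentagon through `C` pays 1 across the edge
  -- directly.
  have key : ∀ e, SameCycle E.facePerm d e →
      E.loss C e ≤ -1 - (1 / 2) * E.ask C e + (1 / 2) * E.ask C (E.facePerm e) := by
    intro e he
    have heT : E.IsT C e := (isT_congr he).1 hT
    have ns : ∀ e, SameCycle E.facePerm d e → ¬ E.Small C e.symm := by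
      rintro e he (h | h)
      · have h1 := X.len_symm_of_isT ((isT_congr he).1 hT)
        have := h.1; omega
      · exact hQ e he h
    have hp := he.trans (sameCycle_facePerm_inv e).symm
    have hn := he.trans (sameCycle_facePerm e).symm
    rw [loss_eq_of_small (Or.inl heT), payT_of_not_isQ (hQ e he), payT_symm_of_isT heT,
      X.ask_eq_gift heT.needy (by rw [small_congr (sameCycle_rot e)]; exact ns e he)
      (by rw [small_congr (sameCycle_rot_inv e)]; exact ns _ hp)]
    have a1 := ask_nonneg (E := E) (C := C) e
    have a2 := ask_nonneg (E := E) (C := C) (E.facePerm e)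
    have n1 := payN_nonneg (E := E) (C := C) e.symm
    have n2 := payQ_nonneg (E := E) (C := C) e.symm
    have n3 := payP_nonneg (E := E) (C := C) e.symm
    have n4 := payF_nonneg (E := E) (C := C) e.symm
    rcases X.len_symm_of_isT heT with h | h
    · have h5 : E.payF C e.symm = 1 := by
        unfold RotationSystem.payF
        rw [if_pos ⟨h, fun ha => hQ e he ⟨h, ha⟩, by rwa [SimpleGraph.Dart.symm_symm]⟩]
      unfold RotationSystem.pay
      linarith
    · have := X.payN_ge heT.needy h (fun h' => ns _ hn h'.small) (fun h' => ns _ hp h'.small)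
        (w := 1 / 2) (by norm_num) (Or.inr ⟨rfl, fun h' => h'.1.not_isT heT⟩)
      unfold RotationSystem.pay
      linarith
  rw [hT.1]
  have h0 := key _ (sameCycle_iterate _ d 0)
  have h1 := key _ (sameCycle_iterate _ d 1)
  have h2 := key _ (sameCycle_iterate _ d 2)
  have h3 := E.iterate_len d
  rw [hT.1] at h3
  simp only [Function.iterate_succ_apply', Function.iterate_zero, id] at h0 h1 h2 h3
  rw [h3] at h2
  simp only [Finset.sum_range_succ, Finset.range_zero, Finset.sum_empty,
    Function.iterate_succ_apply', Function.iterate_zero, id]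
  push_cast
  linarith

/-- Triangles with a pentagon next to them. -/
theorem sum_loss_isT_isQ (X : Setting E C) {d : G.Dart} (hT : E.IsT C d) (hQ : E.IsQ C d.symm) :
    ∑ i ∈ Finset.range (E.len d), E.loss C (E.facePerm^[i] d) ≤ E.len d - 6 := by
  have key : ∀ e, SameCycle E.facePerm d e →
      E.loss C e = E.payT C e - (E.gift C e + E.pay C e.symm) := by
    intro e he
    have heT : E.IsT C e := (isT_congr he).1 hT
    rw [loss_eq_of_small (Or.inl heT), payT_symm_of_isT heT]; ring
  have hz : ∀ i, 0 < i → i < 3 → E.payT C (E.facePerm^[i] d) = 0 := by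
    intro i hi0 hi
    refine payT_of_not_isQ fun h => ?_
    have := X.eq_of_three_five hT (sameCycle_iterate _ d i) hQ h.1
    have := iterate_inj_of_lt E.facePerm d (i := 0) (j := i) (by
      change 0 < E.len d; rw [hT.1]; omega) (by change i < E.len d; rw [hT.1]; omega) this
    omega
  rw [Finset.sum_congr rfl fun i _ => key _ (sameCycle_iterate _ d i), Finset.sum_sub_distrib, hT.1]
  have h1 : ∑ i ∈ Finset.range 3, E.payT C (E.facePerm^[i] d) = E.payT C d := by
    rw [Finset.sum_range_succ, Finset.sum_range_succ, Finset.sum_range_one, hz 1 (by omega) (by omega),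
      hz 2 (by omega) (by omega)]
    simp
  -- The triangle hands on whatever it has beyond 3, a deficit included, and so ends at exactly
  -- zero. The pentagon settles for both, and the pair needs 4 in total.
  rw [h1, payT, if_pos ⟨hT, hQ⟩]
  push_cast
  linarith

omit [Finite V] in
theorem gift_ge_of_heavy {d : G.Dart} (hn : E.Needy C d) (h : Heavy G C d.fst) :
    1 ≤ E.gift C d := by
  rw [gift_heavy h, if_pos hn]; split_ifs <;> norm_num

omit [Finite V] in
theorem ask_ge_of_heavy {d : G.Dart} (h : Heavy G C d.fst) : 1 ≤ E.ask C d := by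
  unfold RotationSystem.ask
  rw [if_neg fun h' => h'.not_heavy h]; split_ifs <;> norm_num

/-- For an edge beside the edge shared by triangle and pentagon the face across that neighbouring
edge is needy, so `payN_ge` does not apply; the far end still pays one half. -/
theorem payN_ge_snd {d : G.Dart} (hd : E.Needy C d) (hl : 10 ≤ E.len d.symm)
    (h1 : ¬ E.Needy C (E.facePerm d).symm) (hs : ¬ E.Spec C d) (hx : ¬ Heavy G C d.fst)
    (hy : Light G C d.snd) : 1 / 2 ≤ E.payN C d.symm := by
  unfold RotationSystem.payN
  rw [if_pos hl, SimpleGraph.Dart.symm_symm, if_neg hs,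
    if_pos ((eo_symm_iff hd).2 ⟨hy, h1, fun h => hx h.1⟩)]
  split_ifs <;> norm_num

theorem payN_ge_fst {d : G.Dart} (hd : E.Needy C d) (hl : 10 ≤ E.len d.symm)
    (h1 : ¬ E.Needy C (E.facePerm.symm d).symm) (hs : ¬ E.Spec C d) (hx : Light G C d.fst)
    (hy : ¬ Heavy G C d.snd) : 1 / 2 ≤ E.payN C d.symm := by
  unfold RotationSystem.payN
  rw [if_pos hl, SimpleGraph.Dart.symm_symm, if_neg hs,
    if_pos ((ei_symm_iff hd).2 ⟨hx, h1, fun h => hy h.1⟩)]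
  split_ifs <;> norm_num

omit [Finite V] in
theorem payN_le_pay (d : G.Dart) : E.payN C d ≤ E.pay C d := by
  have n2 := payQ_nonneg (E := E) (C := C) d
  have n3 := payP_nonneg (E := E) (C := C) d
  have n4 := payF_nonneg (E := E) (C := C) d
  unfold RotationSystem.pay
  linarith

omit [Finite V] in
theorem payQ_le_pay (d : G.Dart) : E.payQ C d ≤ E.pay C d := by
  have n2 := payN_nonneg (E := E) (C := C) d
  have n3 := payP_nonneg (E := E) (C := C) d
  have n4 := payF_nonneg (E := E) (C := C) d
  unfold RotationSystem.pay
  linarith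

/-- Pentagons with a triangle next to them. -/
theorem sum_loss_isCQ (X : Setting E C) {d : G.Dart} (hQ : E.IsQ C d) (hT : E.IsT C d.symm) :
    ∑ i ∈ Finset.range (E.len d), E.loss C (E.facePerm^[i] d) ≤ E.len d - 6 := by
  classical
  set φ := E.facePerm with hφ
  have h5 := hQ.1
  have sc : ∀ i, SameCycle φ d (φ^[i] d) := sameCycle_iterate φ d
  have hCQ : E.IsCQ C d := ⟨hQ, d, SameCycle.refl _ _, hT⟩
  have cq : ∀ i, E.IsCQ C (φ^[i] d) := fun i => (isCQ_congr (sc i)).1 hCQ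
  have nd : ∀ i, E.Needy C (φ^[i] d) := fun i => (cq i).needy
  have nT : ∀ i, 0 < i → i < 5 → ¬ E.IsT C (φ^[i] d).symm := by
    intro i h0 hi h
    have := X.eq_of_five_three h5 (sc i) hT.1 h.1
    have := iterate_inj_of_lt φ d (i := 0) (j := i) (by change 0 < E.len d; omega)
      (by change i < E.len d; omega) this
    omega
  have big : ∀ i, 0 < i → i < 5 → 10 ≤ E.len (φ^[i] d).symm := fun i h0 hi =>
    (X.len_symm_of_isCQ (cq i)).resolve_left (nT i h0 hi)
  -- the triangle
  set τ := d.symm with hτ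
  have τd : τ.symm = d := by rw [hτ, SimpleGraph.Dart.symm_symm]
  have st : ∀ i, SameCycle φ τ (φ^[i] τ) := sameCycle_iterate φ τ
  have tt : ∀ i, E.IsT C (φ^[i] τ) := fun i => (isT_congr (st i)).1 hT
  have tbig : ∀ i, 0 < i → i < 3 → 10 ≤ E.len (φ^[i] τ).symm := by
    intro i h0 hi
    refine (X.len_symm_of_isT (tt i)).resolve_left fun h => ?_
    have := X.eq_of_three_five hT (st i) (by rwa [τd]) h
    have := iterate_inj_of_lt φ τ (i := 0) (j := i) (by change 0 < E.len τ; rw [hT.1]; omega)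
      (by change i < E.len τ; rw [hT.1]; omega) this
    omega
  have τ3 : φ (φ (φ τ)) = τ := by have := E.iterate_len τ; rw [hT.1] at this; exact this
  have d5 : φ (φ (φ (φ (φ d)))) = d := by have := E.iterate_len d; rw [h5] at this; exact this
  have b1 : 10 ≤ E.len (φ d).symm := big 1 (by omega) (by omega)
  have b2 : 10 ≤ E.len (φ (φ d)).symm := big 2 (by omega) (by omega)
  have b3 : 10 ≤ E.len (φ (φ (φ d))).symm := big 3 (by omega) (by omega)
  have b4 : 10 ≤ E.len (φ (φ (φ (φ d)))).symm := big 4 (by omega) (by omega)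
  have c1 : 10 ≤ E.len (φ τ).symm := tbig 1 (by omega) (by omega)
  have c2 : 10 ≤ E.len (φ (φ τ)).symm := tbig 2 (by omega) (by omega)
  have m0 : E.Needy C d := nd 0
  have m1 : E.Needy C (φ d) := nd 1
  have m2 : E.Needy C (φ (φ d)) := nd 2
  have m3 : E.Needy C (φ (φ (φ d))) := nd 3
  have m4 : E.Needy C (φ (φ (φ (φ d)))) := nd 4
  have k0 : E.Needy C τ := hT.needy
  have k1 : E.Needy C (φ τ) := (tt 1).needy
  have k2 : E.Needy C (φ (φ τ)) := (tt 2).needy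
  have hsnd : ∀ e : G.Dart, (φ e).fst = e.snd := E.fst_facePerm
  have inv : ∀ e, φ.symm (φ e) = e := fun e => Equiv.symm_apply_apply φ e
  have lh : ∀ e, E.Needy C e → Light G C e.fst ∨ Heavy G C e.fst := fun e he =>
    X.light_or_heavy he.act.fst_notMem
  have not_small_rot : ∀ e, 10 ≤ E.len e.symm → ¬ E.Small C (E.rot e) := fun e h => by
    rw [small_congr (sameCycle_rot e)]; exact not_small_of_len h
  have not_small_rot_inv : ∀ e, 10 ≤ E.len (φ.symm e).symm → ¬ E.Small C (E.rot.symm e) :=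
    fun e h => by rw [small_congr (sameCycle_rot_inv e)]; exact not_small_of_len h
  -- gifts
  have gx := X.ask_eq_gift k2 (not_small_rot _ c2) (not_small_rot_inv _ (by rw [inv]; exact c1))
  have gc := X.ask_eq_gift m2 (not_small_rot _ b2) (not_small_rot_inv _ (by rw [inv]; exact b1))
  have gd := X.ask_eq_gift m3 (not_small_rot _ b3) (not_small_rot_inv _ (by rw [inv]; exact b2))
  have ge := X.ask_eq_gift m4 (not_small_rot _ b4) (not_small_rot_inv _ (by rw [inv]; exact b3))
  have ax := ask_nonneg (E := E) (C := C) (φ (φ τ))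
  have ac := ask_nonneg (E := E) (C := C) (φ (φ d))
  have ad := ask_nonneg (E := E) (C := C) (φ (φ (φ d)))
  have ae := ask_nonneg (E := E) (C := C) (φ (φ (φ (φ d))))
  -- special edges
  have hspec : ∀ i, 0 < i → i < 5 → E.Spec C (φ^[i] d) →
      (i = 2 ∨ i = 3) ∧ (Heavy G C d.fst ∨ Heavy G C d.snd) := by
    rintro i h0 hi ⟨-, ⟨h, hh⟩ | ⟨h, hh⟩⟩
    · rw [← hφ, ← Function.iterate_add_apply] at h
      rw [vx_facePerm_iterate, vx_facePerm_iterate] at hh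
      interval_cases i
      · exact (nT 3 (by omega) (by omega) h).elim
      · exact (nT 4 (by omega) (by omega) h).elim
      · have e0 : E.vx d (3 + 2) = d.fst := vx_len d h5 0
        have e1 : E.vx d (3 + 3) = d.snd := (vx_len d h5 1).trans (E.vx_one d)
        rw [e0, e1] at hh
        exact ⟨Or.inr rfl, hh⟩
      · have e1 : φ^[2 + 4] d = φ d := by
          change φ (φ (φ (φ (φ (φ d))))) = φ d
          rw [d5]
        rw [e1] at h
        exact (nT 1 (by omega) (by omega) h).elim
    · rw [← hφ, ← Function.iterate_add_apply] at h
      rw [vx_facePerm_iterate, vx_facePerm_iterate] at hh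
      interval_cases i
      · exact (nT 4 (by omega) (by omega) h).elim
      · have e0 : E.vx d (2 + 3) = d.fst := vx_len d h5 0
        have e1 : E.vx d (2 + 4) = d.snd := (vx_len d h5 1).trans (E.vx_one d)
        rw [e0, e1] at hh
        exact ⟨Or.inl rfl, hh⟩
      · have e1 : φ^[3 + 3] d = φ d := by
          change φ (φ (φ (φ (φ (φ d))))) = φ d
          rw [d5]
        rw [e1] at h
        exact (nT 1 (by omega) (by omega) h).elim
      · have e1 : φ^[3 + 4] d = φ (φ d) := by
          change φ (φ (φ (φ (φ (φ (φ d)))))) = φ (φ d)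
          rw [d5]
        rw [e1] at h
        exact (nT 2 (by omega) (by omega) h).elim
  have s1 : ¬ E.Spec C (φ d) := fun h => by
    have := (hspec 1 (by omega) (by omega) h).1; omega
  have s4 : ¬ E.Spec C (φ (φ (φ (φ d)))) := fun h => by
    have := (hspec 4 (by omega) (by omega) h).1; omega
  have st1 : ¬ E.Spec C (φ τ) := fun h => h.1.not_isT (tt 1)
  have st2 : ¬ E.Spec C (φ (φ τ)) := fun h => h.1.not_isT (tt 2)
  -- sum of the losses
  have l0 : ∀ i, E.loss C (φ^[i] d) =
      - E.pay C (φ^[i] d).symm - E.payT C (φ^[i] d).symm - E.gift C (φ^[i] d) := by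
    intro i
    rw [loss_eq_of_small (nd i).small, payT_of_not_isT (cq i).not_isT]; ring
  have pz : ∀ i, 0 < i → i < 5 → E.payT C (φ^[i] d).symm = 0 := fun i h0 hi =>
    payT_of_not_isT (nT i h0 hi)
  have pt : E.payT C τ = E.gift C τ + E.gift C (φ τ) + E.pay C (φ τ).symm +
      E.gift C (φ (φ τ)) + E.pay C (φ (φ τ)).symm - 3 := by
    unfold RotationSystem.payT
    rw [if_pos ⟨hT, by rwa [τd]⟩]
    simp only [Finset.sum_range_succ, Finset.range_zero, Finset.sum_empty, ← hφ,
      Function.iterate_succ_apply', Function.iterate_zero, id]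
    rw [τd, pay_of_act (d := d) (by omega) hQ.2]; ring
  rw [h5]
  simp only [Finset.sum_range_succ, Finset.range_zero, Finset.sum_empty]
  rw [l0 0, l0 1, l0 2, l0 3, l0 4, pz 1 (by omega) (by omega), pz 2 (by omega) (by omega),
    pz 3 (by omega) (by omega), pz 4 (by omega) (by omega)]
  simp only [Function.iterate_succ_apply', Function.iterate_zero, id]
  rw [← hτ, pt, gx, gc, gd, ge]
  have u0 := pay_nonneg (E := E) (C := C) τ
  have w2 : ∀ {w : ℚ}, 0 ≤ w → (w = 1 / 4 ∨ (w = 1 / 2 ∧ ¬ E.Spec C (φ (φ d)))) →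
      w * (2 - E.ask C (φ (φ d)) - E.ask C (φ (φ (φ d)))) ≤ E.payN C (φ (φ d)).symm := fun hw =>
    X.payN_ge m2 b2 (not_needy_of_len b3) (by rw [← hφ, inv]; exact not_needy_of_len b1) hw
  have w3 : ∀ {w : ℚ}, 0 ≤ w → (w = 1 / 4 ∨ (w = 1 / 2 ∧ ¬ E.Spec C (φ (φ (φ d))))) →
      w * (2 - E.ask C (φ (φ (φ d))) - E.ask C (φ (φ (φ (φ d))))) ≤ E.payN C (φ (φ (φ d))).symm :=
    fun hw =>
    X.payN_ge m3 b3 (not_needy_of_len b4) (by rw [← hφ, inv]; exact not_needy_of_len b2) hw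
  have v1 := payN_le_pay (E := E) (C := C) (φ d).symm
  have v2 := payN_le_pay (E := E) (C := C) (φ (φ d)).symm
  have v3 := payN_le_pay (E := E) (C := C) (φ (φ (φ d))).symm
  have v4 := payN_le_pay (E := E) (C := C) (φ (φ (φ (φ d)))).symm
  have vt1 := payN_le_pay (E := E) (C := C) (φ τ).symm
  have vt2 := payN_le_pay (E := E) (C := C) (φ (φ τ)).symm
  have z1 := payN_nonneg (E := E) (C := C) (φ d).symm
  have z2 := payN_nonneg (E := E) (C := C) (φ (φ d)).symm
  have z3 := payN_nonneg (E := E) (C := C) (φ (φ (φ d))).symm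
  have z4 := payN_nonneg (E := E) (C := C) (φ (φ (φ (φ d)))).symm
  have zt1 := payN_nonneg (E := E) (C := C) (φ τ).symm
  have zt2 := payN_nonneg (E := E) (C := C) (φ (φ τ)).symm
  have y0 := gift_nonneg (E := E) (C := C) d
  have y1 := gift_nonneg (E := E) (C := C) (φ d)
  have yt0 := gift_nonneg (E := E) (C := C) τ
  have yt1 := gift_nonneg (E := E) (C := C) (φ τ)
  -- names for the vertices
  have eb : (φ d).fst = d.snd := hsnd d
  have eb' : τ.fst = d.snd := rfl
  have ea : (φ τ).fst = d.fst := hsnd τ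
  have ec : (φ d).snd = (φ (φ d)).fst := (hsnd _).symm
  have ex : (φ τ).snd = (φ (φ τ)).fst := (hsnd _).symm
  have exb : (φ (φ τ)).snd = d.snd := by rw [← hsnd, τ3]; exact eb'
  have eea : (φ (φ (φ (φ d)))).snd = d.fst := by rw [← hsnd, d5]
  -- the payments across the edges next to the common edge
  have P1 : ¬ Heavy G C d.snd → Light G C (φ (φ d)).fst → 1 / 2 ≤ E.payN C (φ d).symm := fun h h' =>
    payN_ge_snd m1 b1 (not_needy_of_len b2) s1 (by rwa [eb]) (by rwa [ec])
  have P4 : Light G C (φ (φ (φ (φ d)))).fst → ¬ Heavy G C d.fst →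
      1 / 2 ≤ E.payN C (φ (φ (φ (φ d)))).symm := fun h h' =>
    payN_ge_fst m4 b4 (by rw [← hφ, inv]; exact not_needy_of_len b3) s4 h (by rwa [eea])
  have Pt1 : ¬ Heavy G C d.fst → Light G C (φ (φ τ)).fst → 1 / 2 ≤ E.payN C (φ τ).symm :=
    fun h h' => payN_ge_snd k1 c1 (not_needy_of_len c2) st1 (by rwa [ea]) (by rwa [ex])
  have Pt2 : Light G C (φ (φ τ)).fst → ¬ Heavy G C d.snd → 1 / 2 ≤ E.payN C (φ (φ τ)).symm :=
    fun h h' => payN_ge_fst k2 c2 (by rw [← hφ, inv]; exact not_needy_of_len c1) st2 h (by rwa [exb])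
  have Hx := lh _ k2
  have Hc := lh _ m2
  have He := lh _ m4
  have Ax := ask_ge_of_heavy (E := E) (C := C) (d := φ (φ τ))
  have Ac := ask_ge_of_heavy (E := E) (C := C) (d := φ (φ d))
  have Ae := ask_ge_of_heavy (E := E) (C := C) (d := φ (φ (φ (φ d))))
  -- the contributions around the three vertices off the common edge
  have Q1 : ¬ Heavy G C d.snd → 1 / 2 ≤ E.payN C (φ d).symm + 1 / 2 * E.ask C (φ (φ d)) := by
    intro h
    rcases Hc with h' | h'
    · have := P1 h h'; linarith
    · have := Ac h'; linarith
  have Q4 : ¬ Heavy G C d.fst →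
      1 / 2 ≤ E.payN C (φ (φ (φ (φ d)))).symm + 1 / 2 * E.ask C (φ (φ (φ (φ d)))) := by
    intro h
    rcases He with h' | h'
    · have := P4 h' h; linarith
    · have := Ae h'; linarith
  have Qt1 : ¬ Heavy G C d.fst → 1 / 2 ≤ E.payN C (φ τ).symm + 1 / 2 * E.ask C (φ (φ τ)) := by
    intro h
    rcases Hx with h' | h'
    · have := Pt1 h h'; linarith
    · have := Ax h'; linarith
  have Qt2 : ¬ Heavy G C d.snd → 1 / 2 ≤ E.payN C (φ (φ τ)).symm + 1 / 2 * E.ask C (φ (φ τ)) := by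
    intro h
    rcases Hx with h' | h'
    · have := Pt2 h' h; linarith
    · have := Ax h'; linarith
  have Ha : Heavy G C d.fst → 1 ≤ E.gift C d ∧ 1 ≤ E.gift C (φ τ) := fun h =>
    ⟨gift_ge_of_heavy m0 h, gift_ge_of_heavy k1 (by rwa [ea])⟩
  have Hb : Heavy G C d.snd → 1 ≤ E.gift C (φ d) ∧ 1 ≤ E.gift C τ := fun h =>
    ⟨gift_ge_of_heavy m1 (by rwa [eb]), gift_ge_of_heavy k0 h⟩
  push_cast
  -- Four units are needed. A heavy end of the common edge gives 1 to both faces. A light end lets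
  -- the two outer edges beside it bring one half each, counting half of what the far corners ask.
  -- The two possibly special edges bring 1 in total at weight one quarter, and 2 at weight one
  -- half, again counting gifts.
  by_cases ha : Heavy G C d.fst
  · obtain ⟨i1, i2⟩ := Ha ha
    have j2 := w2 (w := 1 / 4) (by norm_num) (Or.inl rfl)
    have j3 := w3 (w := 1 / 4) (by norm_num) (Or.inl rfl)
    by_cases hb : Heavy G C d.snd
    · obtain ⟨i3, i4⟩ := Hb hb
      linarith
    · have := Q1 hb; have := Qt2 hb
      linarith
  · by_cases hb : Heavy G C d.snd
    · obtain ⟨i3, i4⟩ := Hb hb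
      have j2 := w2 (w := 1 / 4) (by norm_num) (Or.inl rfl)
      have j3 := w3 (w := 1 / 4) (by norm_num) (Or.inl rfl)
      have := Q4 ha; have := Qt1 ha
      linarith
    · have n2 : ¬ E.Spec C (φ (φ d)) := fun h => (hspec 2 (by omega) (by omega) h).2.elim ha hb
      have n3 : ¬ E.Spec C (φ (φ (φ d))) := fun h => (hspec 3 (by omega) (by omega) h).2.elim ha hb
      have j2 := w2 (w := 1 / 2) (by norm_num) (Or.inr ⟨rfl, n2⟩)
      have j3 := w3 (w := 1 / 2) (by norm_num) (Or.inr ⟨rfl, n3⟩)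
      have := Q1 hb; have := Q4 ha; have := Qt1 ha; have := Qt2 hb
      linarith

end Setting

end DPG

/-! ### Final charge of the other pentagons, of faces through `C`, and of faces of lengths 6 to 8.
-/

namespace DPG

open Equiv Equiv.Perm

namespace RotationSystem

variable {V : Type u} {G : SimpleGraph V} {E : RotationSystem G} {C : Set V}

theorem Qe.light_fst {d : G.Dart} (h : E.Qe C d) : Light G C d.fst := by
  rcases h.2 with h | h
  · have := h _ (sameCycle_facePerm d.symm).symm
    rwa [E.fst_facePerm] at this
  · exact h.1

theorem Qe.light_snd {d : G.Dart} (h : E.Qe C d) : Light G C d.snd := by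
  rcases h.2 with h | h
  · exact h d.symm (SameCycle.refl _ _)
  · exact h.2.1

theorem payQ_le (d : G.Dart) : E.payQ C d ≤ 1 / 3 := by
  unfold payQ; split_ifs <;> norm_num

theorem payQ_eq_zero {d : G.Dart} (h : ¬ E.Qe C d) : E.payQ C d = 0 := by
  unfold payQ; rw [if_neg (fun h' => h h'.2)]

end RotationSystem

namespace Setting

open RotationSystem

variable {V : Type u} [Finite V] {G : SimpleGraph V} {E : RotationSystem G} {C : Set V}

/-- Consecutive edges of a pentagon at a light vertex. -/
theorem seven_le_len_or (X : Setting E C) {d : G.Dart} (hU : E.IsUQ C d) (hl : Light G C d.snd) :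
    7 ≤ E.len d.symm ∨ 7 ≤ E.len (E.facePerm d).symm := by
  have s := (sameCycle_facePerm (E := E) d).symm
  have hU' : E.IsUQ C (E.facePerm d) := (isUQ_congr s).1 hU
  have hlen : E.len (E.facePerm d) = 5 := hU'.1.1
  have hx : ∀ e, E.IsUQ C e → 3 ≤ deg G e.fst ∧ 3 ≤ deg G e.snd := fun e he =>
    ⟨X.three_le_deg he.1.2.fst_notMem, X.three_le_deg he.1.2.snd_notMem⟩
  have hne : d ≠ E.facePerm d := fun h => by
    have := congrArg (fun e : G.Dart => e.fst) h
    rw [E.fst_facePerm] at this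
    exact d.adj.ne this
  have k33 : E.len d.symm = 3 → E.len (E.facePerm d).symm = 3 → False := fun h h' =>
    hne (X.eq_of_five_three hU.1.1 s h h')
  have k35 : E.len d.symm = 3 → E.len (E.facePerm d).symm = 5 → False := fun h h' =>
    X.not_three_five_and_five_five (d := d.symm) h (by rw [SimpleGraph.Dart.symm_symm]; exact hU.1.1)
      (hx _ hU').1 (hx _ hU').2 hlen h'
  have k53 : E.len d.symm = 5 → E.len (E.facePerm d).symm = 3 → False := fun h h' =>
    X.not_three_five_and_five_five (d := (E.facePerm d).symm) h'
      (by rw [SimpleGraph.Dart.symm_symm]; exact hlen) (hx _ hU).1 (hx _ hU).2 hU.1.1 h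
  -- The three faces at the light vertex would be pentagons, which is impossible without cycles of
  -- lengths 4, 6 and 9.
  have k55 : E.len d.symm = 5 → E.len (E.facePerm d).symm = 5 → False := fun h h' => by
    obtain ⟨h6, -⟩ := X.no_six_seven_of_five_five (hx _ hU).1 (hx _ hU).2 hU.1.1 h
    have h3 : deg G (E.facePerm d).fst = 3 := by rw [E.fst_facePerm]; exact hl.2
    refine X.not_five_five_five h6 h3 hlen (by rw [len_rot, h']) ?_
    rw [← E.rot_inv_eq_of_deg_three h3, ← E.symm_facePerm_inv, Equiv.symm_apply_apply, h]
  have h1 := X.len_symm_of_isUQ hU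
  have h2 := X.len_symm_of_isUQ hU'
  grind

theorem payQ_ge {d : G.Dart} (hU : E.IsUQ C d) (hl : 7 ≤ E.len d.symm) (hx : Light G C d.fst)
    (hy : Light G C d.snd)
    (h5 : E.len (E.facePerm d).symm = 5 ∨ E.len (E.facePerm.symm d).symm = 5) :
    1 / 4 ≤ E.pay C d.symm := by
  refine le_trans ?_ (payQ_le_pay _)
  unfold RotationSystem.payQ
  have hq : E.Qe C d.symm := by
    refine ⟨by rwa [SimpleGraph.Dart.symm_symm], Or.inr ⟨hy, hx, ?_⟩⟩
    rw [len_congr (sameCycle_symm_of_fst hx.2), len_congr (sameCycle_symm_of_snd hy.2)]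
    exact h5.symm
  rw [if_pos ⟨hl, hq⟩]
  split_ifs <;> norm_num

/-- Pentagons without a triangle next to them. -/
theorem sum_loss_isUQ (X : Setting E C) {d : G.Dart} (hU : E.IsUQ C d) :
    ∑ i ∈ Finset.range (E.len d), E.loss C (E.facePerm^[i] d) ≤ E.len d - 6 := by
  have l0 : ∀ e, SameCycle E.facePerm d e → E.loss C e = - E.pay C e.symm - E.gift C e := by
    intro e he
    have heU := (isUQ_congr he).1 hU
    rw [loss_eq_of_small (Or.inr heU.1), payT_of_not_isT (fun h => by
      have := h.1; have := heU.1.1; omega), payT_of_not_isT (fun h => hU.2 ⟨e, he, h⟩)]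
    ring
  have gh : ∀ e, SameCycle E.facePerm d e → Heavy G C e.fst → 1 / 2 ≤ E.gift C e := by
    intro e he hh
    have heU := (isUQ_congr he).1 hU
    rw [gift_heavy hh, if_neg heU.not_needy, if_pos heU]
    split_ifs <;> norm_num
  have pn : ∀ e : G.Dart, 0 ≤ E.pay C e.symm := fun e => pay_nonneg _
  have gn : ∀ e : G.Dart, 0 ≤ E.gift C e := fun e => gift_nonneg _
  have expand : ∀ e, SameCycle E.facePerm d e →
      ∑ i ∈ Finset.range (E.len d), E.loss C (E.facePerm^[i] d) =
      ∑ i ∈ Finset.range 5, (- E.pay C (E.facePerm^[i] e).symm - E.gift C (E.facePerm^[i] e)) := by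
    intro e he
    rw [sum_face_congr he, ← len_congr he, hU.1.1]
    exact Finset.sum_congr rfl fun i _ => l0 _ (he.trans (sameCycle_iterate _ e i))
  by_cases hall : E.AllLight C d
  · have good : ∀ i, 7 ≤ E.len (E.facePerm^[i] d).symm → 1 / 3 ≤ E.pay C (E.facePerm^[i] d).symm := by
      intro i hi
      refine le_trans ?_ (payQ_le_pay _)
      have si := sameCycle_iterate E.facePerm d i
      have hA : E.AllLight C (E.facePerm^[i] d).symm.symm := by
        rw [SimpleGraph.Dart.symm_symm]; exact (allLight_congr si).1 hall
      unfold RotationSystem.payQ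
      rw [if_pos ⟨hi, by rw [SimpleGraph.Dart.symm_symm]; exact (isUQ_congr si).1 hU, Or.inl hA⟩,
        if_pos hA]
    -- No two consecutive edges border short faces, so at least three of the five edges bring one
    -- third.
    have cons : ∀ i, 7 ≤ E.len (E.facePerm^[i] d).symm ∨ 7 ≤ E.len (E.facePerm^[i + 1] d).symm := by
      intro i
      rw [Function.iterate_succ_apply']
      refine X.seven_le_len_or ((isUQ_congr (sameCycle_iterate _ d i)).1 hU) ?_
      rw [← E.fst_facePerm, ← Function.iterate_succ_apply' E.facePerm]
      exact hall _ (sameCycle_iterate _ d _)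
    rw [expand d (SameCycle.refl _ _), hU.1.1]
    have e5 : E.facePerm^[4 + 1] d = d := by
      have := E.iterate_len d; rwa [hU.1.1] at this
    have k0 := cons 0; have k1 := cons 1; have k2 := cons 2; have k3 := cons 3; have k4 := cons 4
    rw [e5] at k4
    have g0 := good 0; have g1 := good 1; have g2 := good 2; have g3 := good 3; have g4 := good 4
    have p0 := pn (E.facePerm^[0] d); have p1 := pn (E.facePerm^[1] d)
    have p2 := pn (E.facePerm^[2] d); have p3 := pn (E.facePerm^[3] d)
    have p4 := pn (E.facePerm^[4] d)
    have q0 := gn (E.facePerm^[0] d); have q1 := gn (E.facePerm^[1] d)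
    have q2 := gn (E.facePerm^[2] d); have q3 := gn (E.facePerm^[3] d)
    have q4 := gn (E.facePerm^[4] d)
    simp only [Finset.sum_range_succ, Finset.range_zero, Finset.sum_empty, Function.iterate_zero,
      id, zero_add, Nat.reduceAdd] at *
    push_cast
    clear good cons expand pn gn gh l0
    by_cases b0 : 7 ≤ E.len d.symm
    · have := g0 b0
      by_cases b1 : 7 ≤ E.len (E.facePerm^[1] d).symm
      · have := g1 b1
        rcases k2 with b | b
        · have := g2 b; linarith
        · have := g3 b; linarith
      · have := g2 (k1.resolve_left b1)
        rcases k3 with b | b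
        · have := g3 b; linarith
        · have := g4 b; linarith
    · have := g1 (k0.resolve_left b0)
      have := g4 (k4.resolve_right b0)
      rcases k2 with b | b
      · have := g2 b; linarith
      · have := g3 b; linarith
  · obtain ⟨e, he, hne⟩ : ∃ e, SameCycle E.facePerm d e ∧ ¬ Light G C e.fst := by
      unfold RotationSystem.AllLight at hall; push Not at hall; exact hall
    have heU := (isUQ_congr he).1 hU
    have h5 := heU.1.1
    have hh : Heavy G C e.fst := (X.light_or_heavy heU.1.2.fst_notMem).resolve_left hne
    have si : ∀ i, SameCycle E.facePerm d (E.facePerm^[i] e) := fun i =>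
      he.trans (sameCycle_iterate _ e i)
    rw [expand e he, hU.1.1]
    have hg := gh e he hh
    have p0 := pn (E.facePerm^[0] e); have p1 := pn (E.facePerm^[1] e)
    have p2 := pn (E.facePerm^[2] e); have p3 := pn (E.facePerm^[3] e)
    have p4 := pn (E.facePerm^[4] e)
    have q0 := gn (E.facePerm^[0] e); have q1 := gn (E.facePerm^[1] e)
    have q2 := gn (E.facePerm^[2] e); have q3 := gn (E.facePerm^[3] e)
    have q4 := gn (E.facePerm^[4] e)
    by_cases h2 : ∃ i, 0 < i ∧ i < 5 ∧ Heavy G C (E.facePerm^[i] e).fst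
    · obtain ⟨i, hi0, hi, hih⟩ := h2
      have := gh _ (si i) hih
      simp only [Finset.sum_range_succ, Finset.range_zero, Finset.sum_empty, Function.iterate_zero,
        id] at *
      push_cast
      interval_cases i <;> linarith
    · push Not at h2
      have li : ∀ i, 0 < i → i < 5 → Light G C (E.facePerm^[i] e).fst := fun i h0 hi =>
        (X.light_or_heavy ((isUQ_congr (si i)).1 hU).1.2.fst_notMem).resolve_right (h2 i h0 hi)
      have ls : ∀ i, i < 4 → Light G C (E.facePerm^[i] e).snd := fun i hi => by
        rw [← E.fst_facePerm, ← Function.iterate_succ_apply' E.facePerm]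
        exact li _ (by omega) (by omega)
      have inv : E.facePerm.symm e = E.facePerm^[4] e := (E.iterate_eq_inv h5).symm
      -- With a single heavy vertex, a pentagon across an edge at it reduces the gift by one
      -- quarter. The next edge of the face then borders a face of length at least 7, which pays the
      -- quarter back.
      have w1 : E.len e.symm = 5 → 1 / 4 ≤ E.pay C (E.facePerm^[1] e).symm := by
        intro h
        have := X.seven_le_len_or heU (ls 0 (by omega))
        refine payQ_ge ((isUQ_congr (si 1)).1 hU) (this.resolve_left (by omega))
          (li 1 (by omega) (by omega)) (ls 1 (by omega)) (Or.inr ?_)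
        rw [Function.iterate_one, Equiv.symm_apply_apply, h]
      have w3 : E.len (E.facePerm.symm e).symm = 5 → 1 / 4 ≤ E.pay C (E.facePerm^[3] e).symm := by
        intro h
        rw [inv, Function.iterate_succ_apply'] at h
        have := X.seven_le_len_or ((isUQ_congr (si 3)).1 hU) (ls 3 (by omega))
        exact payQ_ge ((isUQ_congr (si 3)).1 hU) (this.resolve_right (by omega))
          (li 3 (by omega) (by omega)) (ls 3 (by omega)) (Or.inl h)
      have hgift := gift_heavy (E := E) hh
      rw [if_neg heU.not_needy, if_pos heU, len_rot, len_congr (sameCycle_rot_inv e)] at hgift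
      simp only [Finset.sum_range_succ, Finset.range_zero, Finset.sum_empty, Function.iterate_zero,
        id] at *
      push_cast
      by_cases c1 : E.len e.symm = 5 <;> by_cases c3 : E.len (E.facePerm.symm e).symm = 5
      · have := w1 c1; have := w3 c3
        rw [if_pos c1, if_pos c3] at hgift; linarith
      · have := w1 c1
        rw [if_pos c1, if_neg c3] at hgift; linarith
      · have := w3 c3
        rw [if_neg c1, if_pos c3] at hgift; linarith
      · rw [if_neg c1, if_neg c3] at hgift; linarith

/-- A face through `C` leaves `C` somewhere. -/
theorem exists_leaving (X : Setting E C) {d : G.Dart} (h : ¬ E.Act C d) :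
    ∃ e, SameCycle E.facePerm d e ∧ e.fst ∈ C ∧ e.snd ∉ C := by
  unfold RotationSystem.Act at h
  push Not at h
  obtain ⟨e, he, heC⟩ := h
  by_cases h1 : e.snd ∈ C
  · refine ⟨E.facePerm e, he.trans (sameCycle_facePerm e).symm, by rwa [E.fst_facePerm], fun h2 => ?_⟩
    have hne : e.fst ≠ (E.facePerm e).snd := fun h => by
      rw [← E.fst_facePerm] at h
      have h3 := X.three_le_len e
      have := X.fst_iterate_inj e (i := 0) (j := 2) (by omega) (by omega) h
      omega
    have hne2 : e.snd ≠ (E.facePerm e).snd := by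
      rw [← E.fst_facePerm]; exact (E.facePerm e).adj.ne
    have : 2 < C.ncard := by
      rw [Set.two_lt_ncard_iff (Set.toFinite _)]
      exact ⟨_, _, _, heC, h1, h2, e.adj.ne, hne, hne2⟩
    have := X.crit.ncard_le
    omega
  · exact ⟨e, he, heC, h1⟩

/-- Triangles and pentagons through `C`. -/
theorem sum_loss_not_act (X : Setting E C) {d : G.Dart} (hl : E.len d = 3 ∨ E.len d = 5)
    (ha : ¬ E.Act C d) :
    ∑ i ∈ Finset.range (E.len d), E.loss C (E.facePerm^[i] d) ≤ E.len d - 6 := by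
  obtain ⟨e₀, he₀, hf, hs⟩ := X.exists_leaving ha
  have hsm : ∀ e, SameCycle E.facePerm d e → ¬ E.Small C e := fun e he h => ha
    ((act_congr he).2 (h.elim (·.2) (·.2)))
  have l0 : ∀ e, SameCycle E.facePerm d e → E.loss C e ≤ E.payF C e - E.gift C e := by
    intro e he
    have h1 := loss_le (hsm e he)
    rw [pay_of_len_lt (d := e) (by rw [← len_congr he]; omega)] at h1
    have h2 := pay_nonneg (E := E) (C := C) e.symm
    linarith
  have hsum : ∑ i ∈ Finset.range (E.len d), E.loss C (E.facePerm^[i] d) ≤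
      ∑ i ∈ Finset.range (E.len d), E.payF C (E.facePerm^[i] d) -
      ∑ i ∈ Finset.range (E.len d), E.gift C (E.facePerm^[i] d) := by
    rw [← Finset.sum_sub_distrib]
    exact Finset.sum_le_sum fun i _ => l0 _ (sameCycle_iterate _ d i)
  have hg : E.gift C e₀ ≤ ∑ i ∈ Finset.range (E.len d), E.gift C (E.facePerm^[i] d) := by
    obtain ⟨i, hi, rfl⟩ := (sameCycle_iff_exists_lt _ _ _).1 he₀
    exact Finset.single_le_sum (f := fun i => E.gift C (E.facePerm^[i] d))
      (fun i _ => gift_nonneg _) (Finset.mem_range.2 hi)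
  rw [gift_mem hf hs, ← len_congr he₀] at hg
  rcases hl with h | h
  · have hz : ∑ i ∈ Finset.range (E.len d), E.payF C (E.facePerm^[i] d) = 0 :=
      Finset.sum_eq_zero fun i _ => by
        unfold RotationSystem.payF
        rw [if_neg]
        rintro ⟨h5, -⟩
        rw [E.len_iterate] at h5
        omega
    rw [if_pos h] at hg
    rw [hz] at hsum
    rw [h] at hg hsum ⊢
    push_cast
    linarith
  · rw [if_neg (by omega), if_pos h] at hg
    -- A pentagon through `C` receives 2, needs 1, and pays 1 to at most one triangle.
    have h1 : ∑ i ∈ Finset.range (E.len d), E.payF C (E.facePerm^[i] d) ≤ 1 := by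
      by_cases hT : ∃ i < E.len d, E.IsT C (E.facePerm^[i] d).symm
      · obtain ⟨i, hi, hT⟩ := hT
        rw [Finset.sum_eq_single_of_mem i (Finset.mem_range.2 hi)]
        · unfold RotationSystem.payF; split_ifs <;> norm_num
        · intro j hj hji
          unfold RotationSystem.payF
          rw [if_neg]
          rintro ⟨-, -, hT'⟩
          apply hji
          refine iterate_inj_of_lt E.facePerm d (Finset.mem_range.1 hj) hi ?_
          refine X.eq_of_five_three (by rw [E.len_iterate, h]) ?_ hT'.1 hT.1
          exact (sameCycle_iterate _ d j).symm.trans (sameCycle_iterate _ d i)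
      · push Not at hT
        rw [Finset.sum_eq_zero]
        · norm_num
        · intro i hi
          unfold RotationSystem.payF
          rw [if_neg fun h' => hT i (Finset.mem_range.1 hi) h'.2.2]
    rw [h] at hg h1 hsum ⊢
    push_cast
    linarith

omit [Finite V] in
theorem loss_le_payQ {d : G.Dart} (h : 6 ≤ E.len d) (h' : E.len d < 10) :
    E.loss C d ≤ E.payQ C d := by
  have h1 := loss_le (E := E) (C := C) (d := d) (by rintro (k | k) <;> (have := k.1; omega))
  have h2 := pay_nonneg (E := E) (C := C) d.symm
  have h3 := gift_nonneg (E := E) (C := C) d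
  have h4 : E.pay C d = E.payQ C d := by
    unfold RotationSystem.pay RotationSystem.payN RotationSystem.payP RotationSystem.payF
    rw [if_neg (by omega), if_neg (by omega), if_neg (by omega)]; ring
  linarith

/-- Hexagons. -/
theorem sum_loss_six {d : G.Dart} (h : E.len d = 6) :
    ∑ i ∈ Finset.range (E.len d), E.loss C (E.facePerm^[i] d) ≤ E.len d - 6 := by
  have : ∀ i ∈ Finset.range (E.len d), E.loss C (E.facePerm^[i] d) ≤ 0 := fun i _ => by
    have hl := E.len_iterate d i
    refine (loss_le_payQ (by omega) (by omega)).trans (le_of_eq ?_)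
    unfold RotationSystem.payQ
    rw [if_neg (by omega)]
  refine (Finset.sum_nonpos this).trans ?_
  rw [h]; norm_num

/-- Heptagons. -/
theorem sum_loss_seven (X : Setting E C) {d : G.Dart} (h : E.len d = 7) :
    ∑ i ∈ Finset.range (E.len d), E.loss C (E.facePerm^[i] d) ≤ E.len d - 6 := by
  -- Payments across consecutive edges would go to two adjacent pentagons, and their presence
  -- excludes cycles of length 7. So at most three of the seven edges carry one third.
  have hq : ∀ e, E.len e = 7 → E.Qe C e → E.Qe C (E.facePerm e) → False := by
    intro e he h1 h2
    have h3 : deg G (E.facePerm e).fst = 3 := h2.light_fst.2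
    have s1 := sameCycle_rot (E := E) (E.facePerm e)
    have s2 := sameCycle_rot_symm (E := E) h3
    rw [Equiv.symm_apply_apply] at s2
    have hU : E.IsUQ C (E.rot (E.facePerm e)) := (isUQ_congr s1).2 h2.1
    have h7 := (X.no_six_seven_of_five_five (X.three_le_deg hU.1.2.fst_notMem)
      (X.three_le_deg hU.1.2.snd_notMem) hU.1.1 ((isUQ_congr s2).2 h1.1).1.1).2
    exact X.len_ne h7 e he
  have cons : ∀ i, E.payQ C (E.facePerm^[i] d) = 0 ∨ E.payQ C (E.facePerm^[i + 1] d) = 0 := by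
    intro i
    by_contra hc
    push Not at hc
    refine hq (E.facePerm^[i] d) (by rw [E.len_iterate, h]) ?_ ?_
    · by_contra h'; exact hc.1 (payQ_eq_zero h')
    · by_contra h'
      rw [← Function.iterate_succ_apply' E.facePerm] at h'
      exact hc.2 (payQ_eq_zero h')
  have hle : ∑ i ∈ Finset.range (E.len d), E.loss C (E.facePerm^[i] d) ≤
      ∑ i ∈ Finset.range (E.len d), E.payQ C (E.facePerm^[i] d) :=
    Finset.sum_le_sum fun i _ => by
      have hl := E.len_iterate d i
      exact loss_le_payQ (by omega) (by omega)
  refine hle.trans ?_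
  have b : ∀ i, E.payQ C (E.facePerm^[i] d) ≤ 1 / 3 := fun i => payQ_le _
  have e7 : E.facePerm^[6 + 1] d = d := by have := E.iterate_len d; rwa [h] at this
  have k0 := cons 0; have k1 := cons 1; have k2 := cons 2; have k3 := cons 3; have k4 := cons 4
  have k5 := cons 5; have k6 := cons 6
  rw [e7] at k6
  have b0 := b 0; have b1 := b 1; have b2 := b 2; have b3 := b 3; have b4 := b 4; have b5 := b 5
  have b6 := b 6
  rw [h]
  simp only [Finset.sum_range_succ, Finset.range_zero, Finset.sum_empty, Function.iterate_zero,
    id, zero_add, Nat.reduceAdd] at *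
  push_cast
  clear cons b hle hq
  by_cases z : E.payQ C d = 0
  · rw [z]
    rcases k1 with k1 | k1 <;> rcases k3 with k3 | k3 <;> rcases k5 with k5 | k5 <;>
      rw [k1, k3, k5] <;> linarith
  · rw [k0.resolve_left z, k6.resolve_right z]
    rcases k2 with k2 | k2 <;> rcases k4 with k4 | k4 <;> rw [k2, k4] <;> linarith

/-- Octagons. -/
theorem sum_loss_eight (X : Setting E C) {d : G.Dart} (h : E.len d = 8) :
    ∑ i ∈ Finset.range (E.len d), E.loss C (E.facePerm^[i] d) ≤ E.len d - 6 := by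
  have hle : ∀ e, SameCycle E.facePerm d e → E.loss C e ≤ E.payQ C e := fun e he => by
    have hl := len_congr he
    exact loss_le_payQ (by omega) (by omega)
  -- The charge is 2. If all vertices are light, no face across an edge is all light and eight
  -- quarters suffice; otherwise the two edges at a vertex that is not light carry nothing and six
  -- thirds suffice.
  by_cases hall : E.AllLight C d
  · have : ∀ i ∈ Finset.range (E.len d), E.loss C (E.facePerm^[i] d) ≤ 1 / 4 := fun i _ => by
      have si := sameCycle_iterate E.facePerm d i
      refine (hle _ si).trans ?_
      unfold RotationSystem.payQ
      rw [if_neg (c := E.AllLight C (E.facePerm^[i] d).symm)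
        (fun h' => X.not_allLight ((allLight_congr si).1 hall) h')]
      split_ifs <;> norm_num
    refine (Finset.sum_le_card_nsmul _ _ _ this).trans ?_
    rw [Finset.card_range, h]; norm_num
  · obtain ⟨e, he, hne⟩ : ∃ e, SameCycle E.facePerm d e ∧ ¬ Light G C e.fst := by
      unfold RotationSystem.AllLight at hall; push Not at hall; exact hall
    rw [sum_face_congr he, len_congr he]
    have h8 : E.len e = 8 := by rw [← len_congr he, h]
    have z0 : E.payQ C e = 0 := payQ_eq_zero fun h' => hne h'.light_fst
    have z7 : E.payQ C (E.facePerm^[7] e) = 0 := payQ_eq_zero fun h' => hne (by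
      have := h'.light_snd
      rwa [E.iterate_eq_inv h8, E.snd_facePerm_inv] at this)
    have b : ∀ i, E.loss C (E.facePerm^[i] e) ≤ 1 / 3 := fun i =>
      (hle _ (he.trans (sameCycle_iterate _ e i))).trans (payQ_le _)
    have l0 := hle _ he
    have l7 := hle _ (he.trans (sameCycle_iterate _ e 7))
    have b1 := b 1; have b2 := b 2; have b3 := b 3; have b4 := b 4; have b5 := b 5
    have b6 := b 6
    rw [h8]
    simp only [Finset.sum_range_succ, Finset.range_zero, Finset.sum_empty, Function.iterate_zero, id]
    push_cast
    linarith

end Setting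

end DPG

/-! ### Where a long face does not pay. -/

namespace DPG

open Equiv Equiv.Perm

namespace Setting

open RotationSystem

variable {V : Type u} [Finite V] {G : SimpleGraph V} {E : RotationSystem G} {C : Set V}

/-- The faces that pay for a poor face lie between needy faces. -/
theorem nd_of_pe {h : G.Dart} (hp : E.Pe C h) :
    ¬ E.ND C h ∧ E.ND C (E.facePerm h) ∧ E.ND C (E.facePerm.symm h) := by
  obtain ⟨hP, hn, -⟩ := hp
  have hl := hP.allLight
  have l0 : Light G C h.snd := hl h.symm (SameCycle.refl _ _)
  have l1 : Light G C h.fst := by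
    have := hl _ (sameCycle_facePerm h.symm).symm
    rwa [E.fst_facePerm] at this
  refine ⟨fun h' => ?_, ?_, ?_⟩
  · have h1 := h'.len_le
    have h2 := hP.1
    omega
  · have := (hP.2 h.symm (SameCycle.refl _ _)).nd_iff
    have h2 : E.ND C (E.facePerm.symm h.symm) := by grind
    exact (needy_congr (sameCycle_symm_of_snd l0.2)).1 h2
  · have h2 : E.ND C (E.facePerm h.symm) := (hP.nd_facePerm (SameCycle.refl _ _)).2 hn
    exact (needy_congr (sameCycle_symm_of_fst l1.2)).1 h2

/-- The ends of an edge next to a pentagon without triangle are not paid for. -/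
theorem not_nd_of_qe (X : Setting E C) {e : G.Dart} (h : E.Qe C e) :
    ¬ E.ND C (E.facePerm.symm e) ∧ ¬ E.ND C e ∧ ¬ E.ND C (E.facePerm e) := by
  refine ⟨fun h' => X.not_isUQ_needy h.light_fst h.1 h', h.1.not_needy, fun h' => ?_⟩
  refine X.not_needy_isUQ (d := E.facePerm e) (by rw [E.fst_facePerm]; exact h.light_snd) h' ?_
  rw [Equiv.symm_apply_apply]; exact h.1

/-- A vertex pays only if exactly one of the two faces across its edges of the long face is needy;
around an edge bordering such a pentagon none is. -/
theorem not_ee_of_qe (X : Setting E C) {e : G.Dart} (h : E.Qe C e) : ¬ E.Ee C e := fun h' => by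
  have := h'.nd_iff
  have := X.not_nd_of_qe h
  grind

theorem not_ee_facePerm_of_qe (X : Setting E C) {e : G.Dart} (h : E.Qe C e) :
    ¬ E.Ee C (E.facePerm e) := fun h' => by
  have h1 := h'.nd_iff
  rw [Equiv.symm_apply_apply] at h1
  have := X.not_nd_of_qe h
  grind

/-- Next to an edge of two adjacent pentagons. -/
theorem not_ee_of_five_five (X : Setting E C) {e : G.Dart} (h : E.Qe C e)
    (h5 : E.len (E.facePerm e).symm = 5) : ¬ E.Ee C (E.facePerm (E.facePerm e)) := fun h' => by
  have hs := sameCycle_symm_of_snd (E := E) (d := e) h.light_snd.2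
  have hU := h.1
  have s0 := sameCycle_facePerm_inv (E := E) e.symm
  have hU' : E.IsUQ C (E.facePerm.symm e.symm) := (isUQ_congr s0).2 hU
  have no := fun (t : G.Dart) (h3 : E.len t = 3) (k5 : E.len t.symm = 5) =>
    X.not_three_five_and_five_five h3 k5 (e := E.facePerm.symm e.symm)
      (X.three_le_deg hU'.1.2.fst_notMem) (X.three_le_deg hU'.1.2.snd_notMem) hU'.1.1
      (by rw [len_congr hs, h5])
  -- Two adjacent pentagons exclude every pair of a triangle and a pentagon at an edge. A needy face
  -- with a pentagon across an edge would contain or provide such a pair.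
  have key : ∀ t : G.Dart, E.Needy C t → E.len t.symm = 5 → False := by
    rintro t (ht | ht) h5
    · exact no t ht.1 h5
    · obtain ⟨s, hs, hT⟩ := ht.2
      refine no s.symm hT.1 ?_
      rw [SimpleGraph.Dart.symm_symm, ← len_congr hs, ht.1.1]
  have hl := h'.light
  have k := h'.nd_iff
  rw [Equiv.symm_apply_apply] at k
  by_cases hn : E.ND C (E.facePerm e)
  · exact (X.not_nd_of_qe h).2.2 hn
  · have hn' := k.2 hn
    have s1 := sameCycle_rot (E := E) (E.facePerm (E.facePerm e))
    have s2 := sameCycle_rot_symm (E := E) hl.2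
    rw [Equiv.symm_apply_apply] at s2
    exact key _ ((needy_congr s1).2 hn') (by rw [len_congr s2, h5])

theorem not_ee_of_five_five_inv (X : Setting E C) {e : G.Dart} (h : E.Qe C e)
    (h5 : E.len (E.facePerm.symm e).symm = 5) : ¬ E.Ee C (E.facePerm.symm e) := fun h' => by
  have hs := sameCycle_symm_of_fst (E := E) (d := e) h.light_fst.2
  have hU := h.1
  have s0 := sameCycle_facePerm (E := E) e.symm
  have hU' : E.IsUQ C (E.facePerm e.symm) := (isUQ_congr s0).2 hU
  have no := fun (t : G.Dart) (h3 : E.len t = 3) (k5 : E.len t.symm = 5) =>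
    X.not_three_five_and_five_five h3 k5 (e := E.facePerm e.symm)
      (X.three_le_deg hU'.1.2.fst_notMem) (X.three_le_deg hU'.1.2.snd_notMem) hU'.1.1
      (by rw [len_congr hs, h5])
  have key : ∀ t : G.Dart, E.Needy C t → E.len t.symm = 5 → False := by
    rintro t (ht | ht) h5
    · exact no t ht.1 h5
    · obtain ⟨s, hs, hT⟩ := ht.2
      refine no s.symm hT.1 ?_
      rw [SimpleGraph.Dart.symm_symm, ← len_congr hs, ht.1.1]
  have hl := h'.light
  have k := h'.nd_iff
  by_cases hn : E.ND C (E.facePerm.symm e)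
  · exact (X.not_nd_of_qe h).1 hn
  · have hn' : E.ND C (E.facePerm.symm (E.facePerm.symm e)) := by grind
    have s1 := sameCycle_rot (E := E) (E.facePerm.symm e)
    have s2 := sameCycle_rot_symm (E := E) hl.2
    refine key _ ((needy_congr s2).2 hn') ?_
    rw [SimpleGraph.Dart.symm_symm, len_congr s1, h5]

theorem not_qe_of_pe (X : Setting E C) {h : G.Dart} (hp : E.Pe C h) :
    ¬ E.Qe C (E.facePerm (E.facePerm h)) ∧ ¬ E.Qe C (E.facePerm h) ∧
    ¬ E.Qe C (E.facePerm.symm h) ∧ ¬ E.Qe C (E.facePerm.symm (E.facePerm.symm h)) := by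
  obtain ⟨h1, h2, h3⟩ := nd_of_pe hp
  refine ⟨fun k => (X.not_nd_of_qe k).1 ?_, fun k => (X.not_nd_of_qe k).2.1 h2,
    fun k => (X.not_nd_of_qe k).2.1 h3, fun k => (X.not_nd_of_qe k).2.2 ?_⟩
  · rwa [Equiv.symm_apply_apply]
  · rwa [Equiv.apply_symm_apply]

omit [Finite V] in
/-- The payments along a stretch of a face alternate. -/
theorem nd_iterate {x : G.Dart} {k : ℕ}
    (h : ∀ i, 0 < i → i ≤ k → E.Ee C (E.facePerm^[i] x)) :
    E.ND C (E.facePerm^[k] x) ↔ (Even k ↔ E.ND C x) := by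
  induction k with
  | zero => simp
  | succ k ih =>
    have h1 := (h (k + 1) (by omega) le_rfl).nd_iff
    rw [Function.iterate_succ_apply', Equiv.symm_apply_apply] at h1
    rw [Function.iterate_succ_apply', h1, ih fun i hi hk => h i hi (by omega), Nat.even_add_one]
    grind

/-- A face of length ten that pays at nine vertices pays at all. -/
theorem not_nine (X : Setting E C) {x : G.Dart} (hl : E.len x = 10) (hx : ¬ E.Ee C x)
    (h : ∀ i, 0 < i → i ≤ 9 → E.Ee C (E.facePerm^[i] x)) : False := by
  have e9 : E.facePerm^[9] x = E.facePerm.symm x := E.iterate_eq_inv hl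
  have hnd := nd_iterate h
  rw [e9] at hnd
  -- Sides that are needy and sides that are not alternate. Since 9 is odd, exactly one of the two
  -- sides at `x` is needy. A light `x` would then pay, so `x` is heavy.
  have h9 : ¬ Even 9 := by decide
  have E1 := h 1 (by omega) (by omega)
  have E9 := h 9 (by omega) (by omega)
  rw [Function.iterate_one] at E1
  rw [e9] at E9
  have n1 := E1.nd_iff
  have n9 := E9.nd_iff
  rw [Equiv.symm_apply_apply] at n1
  have l1 := E1.light
  rw [E.fst_facePerm] at l1
  have l9 := E9.light
  have hC : x.fst ∉ C := by
    by_cases k : E.ND C x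
    · exact Needy.act k |>.snd_notMem
    · have k' : E.ND C (E.facePerm.symm x) := by grind
      have := Needy.act k' |>.fst_notMem
      rwa [SimpleGraph.Dart.symm_toProd, Prod.fst_swap, E.snd_facePerm_inv] at this
  by_cases k : E.ND C x
  · have k' : ¬ E.ND C (E.facePerm.symm x) := by grind
    have hh : Heavy G C x.fst := (X.light_or_heavy hC).resolve_left fun hL =>
      hx (Or.inl ⟨hL, k, k', fun h => l1.not_heavy h.1⟩)
    rcases E1 with ⟨-, a, -⟩ | ⟨-, -, -, a⟩
    · grind
    rw [Equiv.symm_apply_apply] at a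
    -- The neighbour pays across the edge to the heavy `x`, so the corner is not strong: `x` has
    -- degree 4 and the face across its other edge on the long face is small. That face is not
    -- needy, hence a pentagon without triangle, but the next side is needy and meets it at a light
    -- vertex.
    have hs : ¬ E.Str C (E.rot x) := fun hs => a ⟨hh, hs⟩
    unfold RotationSystem.Str at hs
    push Not at hs
    obtain ⟨h4, hs⟩ := hs
    rw [E.fst_rot] at h4
    have e4 : E.rot^[4] x = x := by rw [← h4]; exact E.rot_iterate_deg x
    have e3 : E.rot (E.rot (E.rot x)) = E.rot.symm x := by
      rw [Equiv.eq_symm_apply]; exact e4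
    rw [e3, ← E.symm_facePerm_inv] at hs
    exact X.not_isUQ_needy l9 ((small_iff.1 hs).resolve_left k') (by
      have : E.ND C (E.facePerm.symm (E.facePerm.symm x)) := by grind
      exact this)
  · have k' : E.ND C (E.facePerm.symm x) := by grind
    have hh : Heavy G C x.fst := (X.light_or_heavy hC).resolve_left fun hL =>
      hx (Or.inr ⟨hL, k', k, fun h => l9.not_heavy h.1⟩)
    rcases E9 with ⟨-, -, -, a⟩ | ⟨-, -, a, -⟩
    · rw [E.snd_facePerm_inv] at a
      have hs : ¬ E.Str C (E.facePerm.symm x).symm := fun hs => a ⟨hh, hs⟩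
      unfold RotationSystem.Str at hs
      push Not at hs
      obtain ⟨h4, hs⟩ := hs
      rw [E.symm_facePerm_inv, Equiv.apply_symm_apply] at hs
      have hs' : E.Small C x.symm := (small_congr (sameCycle_rot x)).1 hs
      refine X.not_needy_isUQ (d := E.facePerm x) (by rwa [E.fst_facePerm]) (n1.2 k) ?_
      rw [Equiv.symm_apply_apply]
      exact (small_iff.1 hs').resolve_left k
    · exact (a k').elim

end Setting

end DPG

/-! ### Final charge of poor faces. -/

namespace DPG

open Equiv Equiv.Perm

namespace Setting

open RotationSystem

variable {V : Type u} [Finite V] {G : SimpleGraph V} {E : RotationSystem G} {C : Set V}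

/-- A poor face receives charge across an edge between two sides that are not special. -/
theorem pe_of_poor (X : Setting E C) {d : G.Dart} (hp : E.Poor C d) (hd : ¬ E.ND C d)
    (h1 : ¬ E.Spec C (E.facePerm d).symm) (h9 : ¬ E.Spec C (E.facePerm.symm d).symm)
    (h37 : ¬ (E.Spec C (E.facePerm^[3] d).symm ∧ E.Spec C (E.facePerm^[7] d).symm)) :
    10 ≤ E.len d.symm ∧ E.Pe C d.symm := by
  have hl := hp.allLight
  have s1 : SameCycle E.facePerm d (E.facePerm d) := (sameCycle_facePerm d).symm
  have s9 : SameCycle E.facePerm d (E.facePerm.symm d) := (sameCycle_facePerm_inv d).symm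
  have nd1 : E.ND C (E.facePerm d) := (hp.nd_facePerm (SameCycle.refl _ _)).2 hd
  have nd9 : E.ND C (E.facePerm.symm d) := by
    have := (hp.2 d (SameCycle.refl _ _)).nd_iff
    grind
  have l0 : deg G d.fst = 3 := (hl d (SameCycle.refl _ _)).2
  have l1 : deg G d.snd = 3 := by
    rw [← E.fst_facePerm]; exact (hl _ s1).2
  have c1 := X.poor_side ((poor_congr s1).1 hp) nd1 h1
  have c9 := X.poor_side ((poor_congr s9).1 hp) nd9 h9
  -- the darts that leave the poor face
  have e9 : E.facePerm (E.facePerm d.symm).symm = (E.facePerm.symm d).symm := by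
    have := facePerm_facePerm_symm (E := E) (d := d.symm) l0
    rwa [SimpleGraph.Dart.symm_symm] at this
  have e1 : (E.facePerm (E.facePerm d).symm).symm = E.facePerm.symm d.symm := by
    rw [facePerm_facePerm_symm l1, SimpleGraph.Dart.symm_symm]
  generalize hm : (E.facePerm.symm d).symm = m at *
  generalize hn : (E.facePerm d).symm = n at *
  have e9' : E.facePerm d.symm = (E.facePerm.symm m).symm := by
    rw [← e9, Equiv.symm_apply_apply, SimpleGraph.Dart.symm_symm]
  have nm : E.Needy C m := by rw [← hm]; exact nd9
  have nn : E.Needy C n := by rw [← hn]; exact nd1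
  -- The face across lies between two needy faces. Beside a pentagon with a triangle it must be
  -- long, since it is not needy. Between two triangles it could otherwise only be a pentagon, which
  -- would then have two triangles next to it.
  have hlen : 10 ≤ E.len d.symm := by
    have a9 : E.len (E.facePerm.symm m).symm = E.len d.symm := by rw [← e9', E.len_facePerm]
    have a1 : E.len (E.facePerm n).symm = E.len d.symm := by rw [e1, E.len_facePerm_inv]
    have sm := sameCycle_facePerm_inv (E := E) m
    have sn := sameCycle_facePerm (E := E) n
    have q9 : E.IsCQ C m → 10 ≤ E.len d.symm := fun h => by
      rcases X.len_symm_of_isCQ ((isCQ_congr sm).2 h) with h | h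
      · rw [← e9'] at h
        exact (hd ((needy_congr (sameCycle_facePerm d.symm)).1 h.needy)).elim
      · rwa [a9] at h
    have q1 : E.IsCQ C n → 10 ≤ E.len d.symm := fun h => by
      rcases X.len_symm_of_isCQ ((isCQ_congr sn).2 h) with h | h
      · rw [e1] at h
        exact (hd ((needy_congr (sameCycle_facePerm_inv d.symm)).1 h.needy)).elim
      · rwa [a1] at h
    rcases nm with tm | qm
    · rcases nn with tn | qn
      · have t9 := (isT_congr sm).2 tm
        have t1 := (isT_congr sn).2 tn
        have k := X.len_symm_of_isT t9
        rw [a9] at k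
        refine k.resolve_left fun k5 => ?_
        have he := X.eq_of_five_three (d := E.facePerm.symm d.symm) (e := E.facePerm d.symm)
          (by rw [E.len_facePerm_inv, k5])
          ((sameCycle_facePerm_inv d.symm).trans (sameCycle_facePerm d.symm).symm)
          (by rw [← e1, SimpleGraph.Dart.symm_symm]; exact t1.1)
          (by rw [e9', SimpleGraph.Dart.symm_symm]; exact t9.1)
        have h2 : E.facePerm^[2] d.symm = d.symm := by
          change E.facePerm (E.facePerm d.symm) = d.symm
          rw [← he, Equiv.apply_symm_apply]
        have := iterate_inj_of_lt E.facePerm d.symm (i := 2) (j := 0)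
          (by change 2 < E.len d.symm; omega) (by change 0 < E.len d.symm; omega) h2
        omega
      · exact q1 qn
    · exact q9 qm
  refine ⟨hlen, by rwa [SimpleGraph.Dart.symm_symm], by rwa [SimpleGraph.Dart.symm_symm], ?_, ?_, ?_⟩
  -- The next vertex of the face across is the far vertex of the needy side: it is either heavy or
  -- on two needy faces, so no payment is made there.
  · have ef : ∀ k, E.len m = k + 1 → (E.facePerm (E.facePerm d.symm)).fst = E.vx m k := by
      intro k hk
      rw [E.fst_facePerm, e9', SimpleGraph.Dart.symm_toProd, Prod.snd_swap, ← E.iterate_eq_inv hk]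
      rfl
    have hl2 : E.len (E.facePerm (E.facePerm d.symm)) = E.len d.symm := by
      rw [E.len_facePerm, E.len_facePerm]
    intro hE
    rcases c9 with ⟨hT, hh⟩ | ⟨hQ, -, -, -, hh⟩ | ⟨hQ, hT, -, hl4, -⟩
    · have := hE.light
      rw [ef 2 hT.1] at this
      exact this.not_heavy hh
    · have := hE.light
      rw [ef 4 hQ.1.1] at this
      exact this.not_heavy hh
    · have f4 : (E.facePerm^[3] m).snd = E.vx m 4 := by
        rw [← E.fst_facePerm, ← Function.iterate_succ_apply' E.facePerm]; rfl
      refine not_ee_of_needy_needy (k := (E.facePerm^[3] m).symm) (e := E.facePerm (E.facePerm d.symm))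
        ?_ hT.needy ?_ ?_ (by omega) hE
      · rw [SimpleGraph.Dart.symm_toProd, Prod.fst_swap, f4]; exact hl4
      · rw [SimpleGraph.Dart.symm_symm]
        exact (needy_congr (sameCycle_iterate _ m 3)).1 nm
      · rw [SimpleGraph.Dart.symm_toProd, Prod.fst_swap, f4, ef 4 hQ.1.1]
  · have ef : (E.facePerm.symm d.symm).fst = E.vx n 2 := by
      rw [← e1, SimpleGraph.Dart.symm_toProd, Prod.fst_swap, ← E.fst_facePerm]
      rfl
    have hl2 : E.len (E.facePerm.symm d.symm) = E.len d.symm := E.len_facePerm_inv _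
    intro hE
    rcases c1 with ⟨hT, hh⟩ | ⟨hQ, hT, hl4, -, -⟩ | ⟨hQ, -, -, -, hh⟩
    · have := hE.light
      rw [ef] at this
      exact this.not_heavy hh
    · exact not_ee_of_needy_needy (k := E.facePerm^[2] n) (e := E.facePerm.symm d.symm) hl4
        ((needy_congr (sameCycle_iterate _ n 2)).1 nn) hT.needy ef (by omega) hE
    · have := hE.light
      rw [ef] at this
      exact this.not_heavy hh
  · rw [SimpleGraph.Dart.symm_symm, hm, hn]
    exact ⟨h1, h9, h37⟩

open Classical in
/-- Poor faces. -/
theorem sum_loss_poor (X : Setting E C) {d : G.Dart} (hp : E.Poor C d) (hd : ¬ E.ND C d) :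
    ∑ i ∈ Finset.range (E.len d), E.loss C (E.facePerm^[i] d) ≤ E.len d - 6 := by
  have l10 := hp.1
  have sc : ∀ i, SameCycle E.facePerm d (E.facePerm^[i] d) := sameCycle_iterate _ d
  have hnd : ∀ i, E.ND C (E.facePerm^[i] d) ↔ ¬ Even i := fun i => by
    rw [nd_iterate fun i _ _ => hp.2 _ (sc i)]
    grind
  have hE : ∀ i, E.Ee C (E.facePerm^[i] d) := fun i => hp.2 _ (sc i)
  have hPe : ∀ e, SameCycle E.facePerm d e → ¬ E.Pe C e := fun e he h =>
    h.2.2.1 (hp.2 _ (he.trans ((sameCycle_facePerm _).trans (sameCycle_facePerm e)).symm))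
  have hQe : ∀ e, SameCycle E.facePerm d e → ¬ E.Qe C e := fun e he h =>
    X.not_ee_of_qe h (hp.2 _ he)
  have hbase : ∀ i, E.loss C (E.facePerm^[i] d) ≤
      E.payN C (E.facePerm^[i] d) - E.payP C (E.facePerm^[i] d).symm := fun i => by
    have hli := E.len_iterate d i
    have h1 := loss_le (E := E) (C := C) (d := E.facePerm^[i] d) (not_small_of_len (by omega))
    have h2 := gift_nonneg (E := E) (C := C) (E.facePerm^[i] d)
    have h3 : E.pay C (E.facePerm^[i] d) = E.payN C (E.facePerm^[i] d) := by
      unfold RotationSystem.pay RotationSystem.payF RotationSystem.payP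
      rw [payQ_eq_zero (hQe _ (sc i)), if_neg (fun h => hPe _ (sc i) h.2), if_neg (by omega)]
      ring
    have h4 : E.payP C (E.facePerm^[i] d).symm ≤ E.pay C (E.facePerm^[i] d).symm := by
      unfold RotationSystem.pay
      have := payN_nonneg (E := E) (C := C) (E.facePerm^[i] d).symm
      have := payQ_nonneg (E := E) (C := C) (E.facePerm^[i] d).symm
      have := payF_nonneg (E := E) (C := C) (E.facePerm^[i] d).symm
      linarith
    linarith
  -- Both ends of a needy side pay, one half each, or one quarter each if the side is special.
  have hodd : ∀ i, ¬ Even i → E.loss C (E.facePerm^[i] d) ≤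
      if E.Spec C (E.facePerm^[i] d).symm then 1 / 2 else 1 := fun i hi => by
    refine (hbase i).trans ?_
    have := payP_nonneg (E := E) (C := C) (E.facePerm^[i] d).symm
    have : E.payN C (E.facePerm^[i] d) ≤ if E.Spec C (E.facePerm^[i] d).symm then 1 / 2 else 1 := by
      unfold RotationSystem.payN
      split_ifs <;> norm_num
    linarith
  have heven : ∀ i, Even i → E.loss C (E.facePerm^[i] d) ≤
      if E.Spec C (E.facePerm^[i + 1] d).symm ∨ E.Spec C (E.facePerm^[i + 9] d).symm ∨
        (E.Spec C (E.facePerm^[i + 3] d).symm ∧ E.Spec C (E.facePerm^[i + 7] d).symm)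
      then 0 else - (1 / 5) := fun i hi => by
    refine (hbase i).trans ?_
    have hn : ¬ E.ND C (E.facePerm^[i] d) := fun h => (hnd i).1 h hi
    have h0 : E.payN C (E.facePerm^[i] d) = 0 := by
      unfold RotationSystem.payN
      have k1 : ¬ E.Eo C (E.facePerm^[i] d) := fun h => hn h.2.1
      have k2 : ¬ E.Ei C (E.facePerm (E.facePerm^[i] d)) := fun h => by
        have := h.2.1
        rw [Equiv.symm_apply_apply] at this
        exact hn this
      simp [k1, k2]
    have hnn := payP_nonneg (E := E) (C := C) (E.facePerm^[i] d).symm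
    rw [h0]
    split_ifs with hc
    · linarith
    · push Not at hc
      have hli := E.len_iterate d i
      have ei : ∀ j, E.facePerm^[i + j] d = E.facePerm^[j] (E.facePerm^[i] d) := fun j => by
        rw [add_comm, Function.iterate_add_apply]
      simp only [ei] at hc
      rw [E.iterate_eq_inv (n := 9) (by omega)] at hc
      have := X.pe_of_poor ((poor_congr (sc i)).1 hp) hn hc.1 hc.2.1 (fun h => hc.2.2 h.1 h.2)
      unfold RotationSystem.payP
      rw [if_pos this]
      norm_num
  have per : ∀ i, E.facePerm^[i + 10] d = E.facePerm^[i] d := fun i => by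
    rw [Function.iterate_add_apply, ← l10, E.iterate_len]
  have a0 := heven 0 (by decide)
  have a1 := hodd 1 (by decide)
  have a2 := heven 2 (by decide)
  have a3 := hodd 3 (by decide)
  have a4 := heven 4 (by decide)
  have a5 := hodd 5 (by decide)
  have a6 := heven 6 (by decide)
  have a7 := hodd 7 (by decide)
  have a8 := heven 8 (by decide)
  have a9 := hodd 9 (by decide)
  have p1 := per 1
  have p3 := per 3
  have p5 := per 5
  have p7 := per 7
  simp only [Nat.reduceAdd] at p1 p3 p5 p7 a0 a2 a4 a6 a8
  rw [p1] at a2 a4 a8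
  rw [p3] at a4 a6
  rw [p5] at a6 a8
  rw [p7] at a8
  clear hbase hodd heven per hE hnd sc
  rw [l10]
  simp only [Finset.sum_range_succ, Finset.range_zero, Finset.sum_empty, zero_add]
  push_cast
  -- The charge is 4 and the cost is 5 minus one half per special side. Two special sides are
  -- enough. With one, three of the even edges bring one fifth; with none, all five do.
  by_cases s1 : E.Spec C (E.facePerm^[1] d).symm <;>
  by_cases s3 : E.Spec C (E.facePerm^[3] d).symm <;>
  by_cases s5 : E.Spec C (E.facePerm^[5] d).symm <;>
  by_cases s7 : E.Spec C (E.facePerm^[7] d).symm <;>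
  by_cases s9 : E.Spec C (E.facePerm^[9] d).symm <;>
  simp only [s1, s3, s5, s7, s9, if_true, if_false, or_true, or_false, and_true,
    and_false] at a0 a1 a2 a3 a4 a5 a6 a7 a8 a9 <;> linarith

end Setting

end DPG

/-! ### Final charge of the faces of length at least ten. -/

namespace DPG

open Equiv Equiv.Perm

open Classical in
/-- A proper nonempty part of a cycle of a permutation together with its image is larger. -/
theorem card_lt_card_union_image {D : Type*} [Fintype D] (π : Perm D) {d : D} {S : Finset D}
    (hS : ∀ e ∈ S, SameCycle π d e) (hne : S.Nonempty) {x : D} (hx : SameCycle π d x) (hxS : x ∉ S) :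
    S.card < (S ∪ S.image π).card := by
  refine Finset.card_lt_card (Finset.ssubset_iff_subset_ne.2 ⟨Finset.subset_union_left, fun h => ?_⟩)
  have hcl : ∀ e ∈ S, π e ∈ S := fun e he => by
    rw [h]; exact Finset.mem_union_right _ (Finset.mem_image_of_mem _ he)
  obtain ⟨e, he⟩ := hne
  have hit : ∀ i, π^[i] e ∈ S := fun i => by
    induction i with
    | zero => exact he
    | succ i ih => rw [Function.iterate_succ_apply']; exact hcl _ ih
  obtain ⟨i, -, rfl⟩ := (sameCycle_iff_exists_lt π e x).1 ((hS e he).symm.trans hx)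
  exact hxS (hit i)

namespace Setting

open RotationSystem

variable {V : Type u} [Finite V] {G : SimpleGraph V} {E : RotationSystem G} {C : Set V}

omit [Finite V] in
open Classical in
/-- The payments of a large face to needy faces. -/
theorem sum_payN_le [Fintype G.Dart] (d : G.Dart) :
    ∑ e with SameCycle E.facePerm d e, E.payN C e ≤
      (1 / 2) * (Finset.univ.filter fun e => SameCycle E.facePerm d e ∧ E.Ee C e).card := by
  set F := Finset.univ.filter fun e => SameCycle E.facePerm d e with hF
  have h1 : ∀ e, E.payN C e ≤ (1 / 2) * ((if E.Eo C e then 1 else 0) +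
      (if E.Ei C (E.facePerm e) then 1 else 0)) := fun e => by
    unfold RotationSystem.payN
    split_ifs <;> norm_num
  -- A payment of the second kind is recorded at the dart before its vertex; shifting by one step
  -- assigns it to the vertex, which makes at most one payment.
  have h2 : ∑ e ∈ F, (if E.Ei C (E.facePerm e) then 1 else 0 : ℚ) =
      ∑ e ∈ F, (if E.Ei C e then 1 else 0) :=
    Finset.sum_equiv E.facePerm (fun e => by
      simp only [hF, Finset.mem_filter, Finset.mem_univ, true_and]
      exact ⟨fun h => h.trans (sameCycle_facePerm e).symm, fun h => h.trans (sameCycle_facePerm e)⟩)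
      (fun _ _ => rfl)
  calc ∑ e ∈ F, E.payN C e ≤ ∑ e ∈ F, (1 / 2) * ((if E.Eo C e then 1 else 0) +
      (if E.Ei C (E.facePerm e) then 1 else 0)) := Finset.sum_le_sum fun e _ => h1 e
    _ = (1 / 2) * ∑ e ∈ F, ((if E.Eo C e then 1 else 0) + (if E.Ei C e then 1 else 0)) := by
      rw [← Finset.mul_sum, Finset.sum_add_distrib, h2, Finset.sum_add_distrib]
    _ ≤ (1 / 2) * ∑ e ∈ F, (if E.Ee C e then 1 else 0) := by
      refine mul_le_mul_of_nonneg_left (Finset.sum_le_sum fun e _ => ?_) (by norm_num)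
      by_cases a : E.Eo C e
      · have b : ¬ E.Ei C e := fun h => h.2.2.1 a.2.1
        simp [RotationSystem.Ee, a, b]
      · simp [RotationSystem.Ee, a]
    _ = _ := by rw [Finset.sum_boole, hF, Finset.filter_filter]

set_option maxHeartbeats 1000000 in
open Classical in
/-- The faces of length at least ten. -/
theorem sum_loss_of_ten_le (X : Setting E C) {d : G.Dart} (hl : 10 ≤ E.len d) :
    ∑ i ∈ Finset.range (E.len d), E.loss C (E.facePerm^[i] d) ≤ E.len d - 6 := by
  have := Fintype.ofFinite G.Dart
  set F := Finset.univ.filter fun e => SameCycle E.facePerm d e with hF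
  have memF : ∀ e, e ∈ F ↔ SameCycle E.facePerm d e := fun e => by simp [hF]
  have memφ : ∀ e, e ∈ F → E.facePerm e ∈ F := fun e he =>
    (memF _).2 (((memF _).1 he).trans (sameCycle_facePerm e).symm)
  have memφ' : ∀ e, e ∈ F → E.facePerm.symm e ∈ F := fun e he =>
    (memF _).2 (((memF _).1 he).trans (sameCycle_facePerm_inv e).symm)
  have dF : d ∈ F := (memF _).2 (SameCycle.refl _ _)
  have lenF : ∀ e ∈ F, E.len e = E.len d := fun e he => (len_congr ((memF e).1 he)).symm
  have sumF : ∀ g : G.Dart → ℚ, ∑ i ∈ Finset.range (E.len d), g (E.facePerm^[i] d) =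
      ∑ e ∈ F, g e := fun g => by
    unfold RotationSystem.len
    rw [← sum_sameCycle]
    exact Finset.sum_congr (by ext e; simp [hF]) fun _ _ => rfl
  have cardF : F.card = E.len d := by
    have := sumF fun _ => 1
    simp only [Finset.sum_const, Finset.card_range, nsmul_eq_mul, mul_one] at this
    exact_mod_cast this.symm
  set M := F.filter fun e => E.Ee C e with hM
  set N := F.filter fun e => ¬ E.Ee C e with hN
  set Q := F.filter fun e => E.Qe C e with hQ
  set P := F.filter fun e => E.Pe C e with hP
  have cMN : M.card + N.card = E.len d := by
    rw [← cardF]; exact Finset.card_filter_add_card_filter_not _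
  have memN : ∀ e, e ∈ N ↔ e ∈ F ∧ ¬ E.Ee C e := fun e => by simp [hN]
  have memQ : ∀ e, e ∈ Q ↔ e ∈ F ∧ E.Qe C e := fun e => by simp [hQ]
  have memP : ∀ e, e ∈ P ↔ e ∈ F ∧ E.Pe C e := fun e => by simp [hP]
  have hloss : ∑ e ∈ F, E.loss C e ≤
      (1 / 2) * M.card + ∑ e ∈ F, E.payQ C e + (1 / 5) * P.card := by
    have h1 : ∑ e ∈ F, E.loss C e ≤ ∑ e ∈ F, (E.payN C e + E.payQ C e + E.payP C e) := by
      refine Finset.sum_le_sum fun e he => ?_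
      have hle := lenF e he
      have h1 := loss_le (E := E) (C := C) (d := e) (not_small_of_len (by omega))
      have h2 := gift_nonneg (E := E) (C := C) e
      have h3 := pay_nonneg (E := E) (C := C) e.symm
      have h4 : E.payF C e = 0 := by
        unfold RotationSystem.payF
        rw [if_neg (by omega)]
      unfold RotationSystem.pay at h1
      unfold RotationSystem.pay at h3
      linarith
    have h2 : ∑ e ∈ F, E.payN C e ≤ (1 / 2) * M.card := by
      have := sum_payN_le (E := E) (C := C) d
      rwa [← Finset.filter_filter] at this
    have h3 : ∑ e ∈ F, E.payP C e ≤ (1 / 5) * P.card := by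
      have : ∀ e ∈ F, E.payP C e ≤ (1 / 5) * (if E.Pe C e then 1 else 0) := fun e he => by
        unfold RotationSystem.payP
        split_ifs <;> grind
      refine (Finset.sum_le_sum this).trans (le_of_eq ?_)
      rw [← Finset.mul_sum, Finset.sum_boole]
    rw [Finset.sum_add_distrib, Finset.sum_add_distrib] at h1
    linarith
  have sumQ : ∀ c : ℚ, (∀ e ∈ Q, E.payQ C e ≤ c) → ∑ e ∈ F, E.payQ C e ≤ c * Q.card := by
    intro c hc
    have h1 : ∀ e ∈ F, E.payQ C e ≤ c * (if E.Qe C e then 1 else 0) := fun e he => by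
      split_ifs with h
      · rw [mul_one]; exact hc e ((memQ e).2 ⟨he, h⟩)
      · rw [mul_zero, payQ_eq_zero h]
    refine (Finset.sum_le_sum h1).trans (le_of_eq ?_)
    rw [← Finset.mul_sum, Finset.sum_boole]
  have sQ3 := sumQ (1 / 3) fun e _ => payQ_le e
  set Q' := Q ∪ Q.image E.facePerm with hQ'
  -- Neither end of an edge with payment to a pentagon without triangle pays to needy faces. Unless
  -- all edges are of this kind, there are more such ends than edges.
  have Q'N : ∀ e ∈ Q', e ∈ N := by
    intro e he
    rcases Finset.mem_union.1 he with h | h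
    · obtain ⟨h1, h2⟩ := (memQ e).1 h
      exact (memN e).2 ⟨h1, X.not_ee_of_qe h2⟩
    · obtain ⟨f, hf, rfl⟩ := Finset.mem_image.1 h
      obtain ⟨h1, h2⟩ := (memQ f).1 hf
      exact (memN _).2 ⟨memφ _ h1, X.not_ee_facePerm_of_qe h2⟩
  have Q'light : ∀ e ∈ Q', Light G C e.fst := by
    intro e he
    rcases Finset.mem_union.1 he with h | h
    · exact ((memQ e).1 h).2.light_fst
    · obtain ⟨f, hf, rfl⟩ := Finset.mem_image.1 h
      rw [E.fst_facePerm]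
      exact ((memQ f).1 hf).2.light_snd
  have QF : ∀ e ∈ Q, SameCycle E.facePerm d e := fun e he => (memF e).1 ((memQ e).1 he).1
  have cQ' : ∀ x ∈ F, x ∉ Q → Q.Nonempty → Q.card + 1 ≤ Q'.card := fun x hx hxQ hne => by
    have := card_lt_card_union_image E.facePerm QF hne ((memF x).1 hx) hxQ
    convert Nat.succ_le_of_lt this
  have P2N : ∀ h ∈ P, E.facePerm (E.facePerm h) ∈ N ∧ E.facePerm.symm h ∈ N := fun h hh => by
    obtain ⟨h1, h2⟩ := (memP h).1 hh
    exact ⟨(memN _).2 ⟨memφ _ (memφ _ h1), h2.2.2.1⟩, (memN _).2 ⟨memφ' _ h1, h2.2.2.2.1⟩⟩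
  have P2Q : ∀ h ∈ P, E.facePerm (E.facePerm h) ∉ Q' ∧ E.facePerm.symm h ∉ Q' := fun h hh => by
    obtain ⟨h1, h2⟩ := (memP h).1 hh
    obtain ⟨k1, k2, k3, k4⟩ := X.not_qe_of_pe h2
    constructor
    · intro hc
      rcases Finset.mem_union.1 hc with h | h
      · exact k1 ((memQ _).1 h).2
      · obtain ⟨f, hf, he⟩ := Finset.mem_image.1 h
        rw [E.facePerm.injective he] at hf
        exact k2 ((memQ _).1 hf).2
    · intro hc
      rcases Finset.mem_union.1 hc with h | h
      · exact k3 ((memQ _).1 h).2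
      · obtain ⟨f, hf, he⟩ := Finset.mem_image.1 h
        rw [(Equiv.eq_symm_apply _).2 he] at hf
        exact k4 ((memQ _).1 hf).2
  -- Each refunded edge supplies two distinct vertices without payment, disjoint from those in `Q'`.
  have neP : ∀ h ∈ P, E.facePerm (E.facePerm h) ≠ E.facePerm.symm h := fun h hh hc => by
    have hlh := lenF h ((memP h).1 hh).1
    have h3 : E.facePerm^[3] h = h := by
      change E.facePerm (E.facePerm (E.facePerm h)) = h
      rw [hc, Equiv.apply_symm_apply]
    have := iterate_inj_of_lt E.facePerm h (i := 3) (j := 0) (by change 3 < E.len h; omega)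
      (by change 0 < E.len h; omega) h3
    omega
  rw [sumF]
  have cMN' : (M.card : ℚ) + N.card = E.len d := by exact_mod_cast cMN
  have hl' : (10 : ℚ) ≤ E.len d := by exact_mod_cast hl
  rcases P.eq_empty_or_nonempty with hP0 | ⟨h, hh⟩
  · rw [hP0, Finset.card_empty] at hloss
    push_cast at hloss
    rcases Q.eq_empty_or_nonempty with hQ0 | hQne
    · rw [hQ0, Finset.card_empty] at sQ3
      push_cast at sQ3
      rcases Nat.lt_or_ge (E.len d + N.card) 12 with hlt | hge
      · rcases Nat.lt_or_ge N.card 1 with h0 | h0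
        · have hN0 : N = ∅ := Finset.card_eq_zero.1 (by omega)
          have hE : ∀ e ∈ F, E.Ee C e := fun e he => by
            by_contra hc
            have := (memN e).2 ⟨he, hc⟩
            rw [hN0] at this
            exact absurd this (Finset.notMem_empty _)
          rcases Nat.lt_or_ge (E.len d) 11 with h11 | h11
          · have hp : E.Poor C d := ⟨by omega, fun e he => hE e ((memF e).2 he)⟩
            rw [← sumF]
            by_cases hd : E.ND C d
            · have hc := sameCycle_facePerm (E := E) d
              have := X.sum_loss_poor ((poor_congr hc.symm).1 hp)
                (fun h => (hp.nd_facePerm (SameCycle.refl _ _)).1 h hd)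
              rwa [sum_face_congr hc, len_congr hc] at this
            · exact X.sum_loss_poor hp hd
          · have h11' : E.len d = 11 := by omega
            have := nd_iterate (E := E) (C := C) (x := d) (k := 11) fun i _ _ =>
              hE _ ((memF _).2 (sameCycle_iterate _ d i))
            rw [← h11', E.iterate_len, h11'] at this
            have h9 : ¬ Even 11 := by decide
            grind
        · have h10 : E.len d = 10 := by omega
          obtain ⟨x, hx⟩ := Finset.card_eq_one.1 (show N.card = 1 by omega)
          obtain ⟨hxF, hxE⟩ := (memN x).1 (by rw [hx]; exact Finset.mem_singleton_self x)
          refine (X.not_nine (x := x) (by rw [lenF x hxF, h10]) hxE fun i h0 h9 => ?_).elim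
          by_contra hc
          have hm : E.facePerm^[i] x ∈ N := (memN _).2
            ⟨(memF _).2 (((memF x).1 hxF).trans (sameCycle_iterate _ x i)), hc⟩
          rw [hx, Finset.mem_singleton] at hm
          have hlx := lenF x hxF
          have := iterate_inj_of_lt E.facePerm x (i := i) (j := 0) (by change i < E.len x; omega)
            (by change 0 < E.len x; omega) hm
          omega
      · have : (12 : ℚ) ≤ E.len d + N.card := by exact_mod_cast hge
        linarith
    · have q1 : 1 ≤ Q.card := hQne.card_pos
      have q1' : (1 : ℚ) ≤ Q.card := by exact_mod_cast q1
      by_cases hAL : ∃ e ∈ Q, E.AllLight C e.symm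
      · obtain ⟨e, he, hA⟩ := hAL
        obtain ⟨heF, -⟩ := (memQ e).1 he
        -- An all-light pentagon next to this face provides a vertex here that is not light. It lies
        -- in `N` but not in `Q'`, so `N` has at least two more elements than `Q`.
        obtain ⟨x, hx, hxl⟩ : ∃ x ∈ F, ¬ Light G C x.fst := by
          by_contra hc
          push Not at hc
          refine X.not_allLight (d := e) (fun f hf => hc f ((memF f).2 ?_)) hA
          exact ((memF e).1 heF).trans hf
        have hxQ' : x ∉ Q' := fun h => hxl (Q'light x h)
        have hc1 := cQ' x hx (fun h => hxQ' (Finset.mem_union_left _ h)) hQne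
        have hc2 : Q'.card + 1 ≤ N.card := by
          rw [← Finset.card_insert_of_notMem hxQ']
          refine Finset.card_le_card fun f hf => ?_
          rcases Finset.mem_insert.1 hf with rfl | hf
          · exact (memN _).2 ⟨hx, fun h => hxl h.light⟩
          · exact Q'N f hf
        have : (Q.card : ℚ) + 2 ≤ N.card := by exact_mod_cast (by omega : Q.card + 2 ≤ N.card)
        linarith
      · push Not at hAL
        have sQ4 := sumQ (1 / 4) fun e he => by
          unfold RotationSystem.payQ
          rw [if_neg (hAL e he)]
          split_ifs <;> norm_num
        by_cases hall : ∃ x ∈ F, x ∉ Q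
        · obtain ⟨x, hx, hxQ⟩ := hall
          have hc1 := cQ' x hx hxQ hQne
          have hc2 : Q'.card ≤ N.card := Finset.card_le_card Q'N
          have c1 : (Q.card : ℚ) + 1 ≤ N.card := by exact_mod_cast hc1.trans hc2
          rcases Nat.lt_or_ge 1 Q.card with h2 | h2
          · have : (2 : ℚ) ≤ Q.card := by exact_mod_cast h2
            linarith
          · obtain ⟨e, he⟩ := Finset.card_eq_one.1 (show Q.card = 1 by omega)
            obtain ⟨heF, heQ⟩ := (memQ e).1 (by rw [he]; exact Finset.mem_singleton_self e)
            have hle := lenF e heF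
            have inj : ∀ i j, i < 10 → j < 10 → E.facePerm^[i] e = E.facePerm^[j] e → i = j :=
              fun i j hi hj h => iterate_inj_of_lt E.facePerm e (by change i < E.len e; omega)
                (by change j < E.len e; omega) h
            have n01 : e ≠ E.facePerm e := fun h => by have := inj 0 1 (by omega) (by omega) h; omega
            have three : ∀ f ∈ N, f ≠ e → f ≠ E.facePerm e → 3 ≤ N.card := fun f hf h0 h1 => by
              have : ({f, e, E.facePerm e} : Finset G.Dart) ⊆ N := by
                intro g hg
                simp only [Finset.mem_insert, Finset.mem_singleton] at hg
                rcases hg with rfl | rfl | rfl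
                · exact hf
                · exact (memN _).2 ⟨heF, X.not_ee_of_qe heQ⟩
                · exact (memN _).2 ⟨memφ _ heF, X.not_ee_facePerm_of_qe heQ⟩
              have hcard := Finset.card_le_card this
              rwa [Finset.card_insert_of_notMem (by simp [h0, h1]),
                Finset.card_insert_of_notMem (by simpa using n01), Finset.card_singleton] at hcard
            -- With a single payment of one quarter, its two ends are not enough. The pentagon then
            -- has another pentagon beside it, and that provides a third vertex without payment.
            have h3 : 3 ≤ N.card := by
              rcases heQ.2 with hA | ⟨-, -, h5 | h5⟩
              · exact (hAL e (by rw [he]; exact Finset.mem_singleton_self e) hA).elim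
              · refine three _ ((memN _).2 ⟨memφ _ (memφ _ heF), X.not_ee_of_five_five heQ h5⟩) ?_ ?_
                · intro h; have := inj 2 0 (by omega) (by omega) h; omega
                · intro h; have := inj 2 1 (by omega) (by omega) h; omega
              · refine three _ ((memN _).2 ⟨memφ' _ heF, X.not_ee_of_five_five_inv heQ h5⟩) ?_ ?_
                · intro h
                  rw [Equiv.symm_apply_eq] at h
                  exact n01 h
                · intro h
                  rw [Equiv.symm_apply_eq] at h
                  have := inj 0 2 (by omega) (by omega) h
                  omega
            have : (3 : ℚ) ≤ N.card := by exact_mod_cast h3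
            have : (Q.card : ℚ) ≤ 1 := by exact_mod_cast h2
            linarith
        · push Not at hall
          have hMQ : M.card = 0 := by
            refine Finset.card_eq_zero.2 (Finset.eq_empty_of_forall_notMem fun e he => ?_)
            obtain ⟨h1, h2⟩ := Finset.mem_filter.1 he
            exact X.not_ee_of_qe ((memQ e).1 (hall e h1)).2 h2
          have hQc : (Q.card : ℚ) ≤ E.len d := by
            rw [← cardF]; exact_mod_cast Finset.card_le_card (Finset.filter_subset _ _)
          rw [hMQ] at hloss
          push_cast at hloss
          linarith
  -- Two steps forward from a refunded edge is a vertex without payment, and this map is injective.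
  · have hPN : P.card ≤ (N \ Q').card := by
      refine Finset.card_le_card_of_injOn (fun h => E.facePerm (E.facePerm h)) (fun f hf => ?_)
        (fun a _ b _ hab => E.facePerm.injective (E.facePerm.injective hab))
      exact Finset.mem_sdiff.2 ⟨(P2N f hf).1, (P2Q f hf).1⟩
    have h2N : 2 ≤ (N \ Q').card := by
      rw [← Finset.card_pair (neP h hh)]
      refine Finset.card_le_card fun f hf => ?_
      simp only [Finset.mem_insert, Finset.mem_singleton] at hf
      rcases hf with rfl | rfl
      · exact Finset.mem_sdiff.2 ⟨(P2N h hh).1, (P2Q h hh).1⟩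
      · exact Finset.mem_sdiff.2 ⟨(P2N h hh).2, (P2Q h hh).2⟩
    have hsd : (N \ Q').card + Q'.card = N.card := Finset.card_sdiff_add_card_eq_card Q'N
    have a1 : (P.card : ℚ) + Q'.card ≤ N.card := by exact_mod_cast (by omega)
    have a2 : (2 : ℚ) + Q'.card ≤ N.card := by exact_mod_cast (by omega)
    rcases Q.eq_empty_or_nonempty with hQ0 | hQne
    · rw [hQ0, Finset.card_empty] at sQ3
      push_cast at sQ3
      have a0 : (0 : ℚ) ≤ Q'.card := by positivity
      rcases Nat.lt_or_ge (E.len d) 11 with h11 | h11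
      · have h10 : E.len d = 10 := by omega
        obtain ⟨hhF, hpe⟩ := (memP h).1 hh
        obtain ⟨e, he, hne1, hne2, hE⟩ := X.exists_not_ee_of_pe hpe (by rw [lenF h hhF, h10])
        have h3 : 3 ≤ N.card := by
          have hsub : ({e, E.facePerm (E.facePerm h), E.facePerm.symm h} : Finset G.Dart) ⊆ N := by
            intro g hg
            simp only [Finset.mem_insert, Finset.mem_singleton] at hg
            rcases hg with rfl | rfl | rfl
            · exact (memN _).2 ⟨(memF _).2 (((memF h).1 hhF).trans he), hE⟩
            · exact (P2N h hh).1
            · exact (P2N h hh).2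
          have hcard := Finset.card_le_card hsub
          rwa [Finset.card_insert_of_notMem (by simp [hne1, hne2]),
            Finset.card_pair (neP h hh)] at hcard
        -- If every vertex without payment arose from refunded edges in both directions, `P` would
        -- be closed under three steps. As 21 is 1 modulo 10, it would contain two consecutive
        -- edges, but the edges next to a refunded one border needy faces and it does not.
        have hlt : P.card + 1 ≤ N.card := by
          by_contra hcon
          have i2 : P.image (fun h => E.facePerm (E.facePerm h)) = N := by
            refine Finset.eq_of_subset_of_card_le (fun f hf => ?_) ?_
            · obtain ⟨g, hg, rfl⟩ := Finset.mem_image.1 hf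
              exact (P2N g hg).1
            · rw [Finset.card_image_of_injective _ fun a b hab =>
                E.facePerm.injective (E.facePerm.injective hab)]
              omega
          have i1 : P.image E.facePerm.symm = N := by
            refine Finset.eq_of_subset_of_card_le (fun f hf => ?_) ?_
            · obtain ⟨g, hg, rfl⟩ := Finset.mem_image.1 hf
              exact (P2N g hg).2
            · rw [Finset.card_image_of_injective _ E.facePerm.symm.injective]
              omega
          have cl : ∀ g ∈ P, E.facePerm^[3] g ∈ P := fun g hg => by
            have := (P2N g hg).1
            rw [← i1] at this
            obtain ⟨f, hf, hfe⟩ := Finset.mem_image.1 this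
            rw [Equiv.symm_apply_eq] at hfe
            rw [hfe] at hf
            exact hf
          have cl7 : ∀ k, E.facePerm^[3 * k] h ∈ P := fun k => by
            induction k with
            | zero => exact hh
            | succ k ih =>
              rw [Nat.mul_succ, add_comm, Function.iterate_add_apply]
              exact cl _ ih
          have h21 := cl7 7
          have e10 : ∀ g ∈ F, E.facePerm^[10] g = g := fun g hg => by
            rw [← h10, ← lenF g hg, E.iterate_len]
          have e21 : E.facePerm^[3 * 7] h = E.facePerm h := by
            change E.facePerm^[10 + (10 + 1)] h = _
            rw [Function.iterate_add_apply, Function.iterate_add_apply, Function.iterate_one,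
              e10 _ (memφ _ hhF), e10 _ (memφ _ hhF)]
          rw [e21] at h21
          exact (nd_of_pe ((memP _).1 h21).2).1 (nd_of_pe hpe).2.1
        have b1 : (P.card : ℚ) + 1 ≤ N.card := by exact_mod_cast hlt
        have b2 : (3 : ℚ) ≤ N.card := by exact_mod_cast h3
        linarith
      · have : (11 : ℚ) ≤ E.len d := by exact_mod_cast h11
        linarith
    · have hxQ : E.facePerm (E.facePerm h) ∉ Q := fun hc =>
        (P2Q h hh).1 (Finset.mem_union_left _ hc)
      have hc1 := cQ' _ (memφ _ (memφ _ ((memP h).1 hh).1)) hxQ hQne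
      have q1' : (1 : ℚ) ≤ Q.card := by exact_mod_cast hQne.card_pos
      have c1 : (Q.card : ℚ) + 1 ≤ Q'.card := by exact_mod_cast hc1
      linarith

end Setting

end DPG

/-! ### Summation of the charges, and the theorem. -/

namespace DPG

open Equiv Equiv.Perm

namespace Setting

open RotationSystem

variable {V : Type u} [Finite V] {G : SimpleGraph V} {E : RotationSystem G} {C : Set V}

/-- No face loses more charge than it has. -/
theorem sum_loss_le (X : Setting E C) (d : G.Dart) :
    ∑ i ∈ Finset.range (E.len d), E.loss C (E.facePerm^[i] d) ≤ E.len d - 6 := by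
  by_cases ha : E.Act C d
  · rcases X.len_cases d with h | h | h | h | h | h
    · have hT : E.IsT C d := ⟨h, ha⟩
      by_cases hQ : ∃ e, SameCycle E.facePerm d e ∧ E.IsQ C e.symm
      · obtain ⟨e, he, hQ⟩ := hQ
        rw [sum_face_congr he, len_congr he]
        exact X.sum_loss_isT_isQ ((isT_congr he).1 hT) hQ
      · push Not at hQ
        exact X.sum_loss_plain hT hQ
    · have hQ : E.IsQ C d := ⟨h, ha⟩
      by_cases hT : E.NearT C d
      · obtain ⟨e, he, hT⟩ := hT
        rw [sum_face_congr he, len_congr he]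
        exact X.sum_loss_isCQ ((isQ_congr he).1 hQ) hT
      · exact X.sum_loss_isUQ ⟨hQ, hT⟩
    · exact sum_loss_six h
    · exact X.sum_loss_seven h
    · exact X.sum_loss_eight h
    · exact X.sum_loss_of_ten_le h
  · rcases X.len_cases d with h | h | h | h | h | h
    · exact X.sum_loss_not_act (Or.inl h) ha
    · exact X.sum_loss_not_act (Or.inr h) ha
    · exact sum_loss_six h
    · exact X.sum_loss_seven h
    · exact X.sum_loss_eight h
    · exact X.sum_loss_of_ten_le h

-- Reversal permutes the darts, so every payment across an edge cancels and only the gifts remain.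
omit [Finite V] in
theorem sum_loss [Fintype G.Dart] : ∑ d, E.loss C d = - ∑ d, E.gift C d := by
  have h : ∀ g : G.Dart → ℚ, ∑ d : G.Dart, g d.symm = ∑ d, g d := fun g =>
    Equiv.sum_comp (dartRev G) g
  unfold RotationSystem.loss
  simp only [Finset.sum_sub_distrib, Finset.sum_add_distrib, h (E.pay C), h (E.payT C)]
  ring

theorem exists_dart (X : Setting E C) (v : V) : ∃ d : G.Dart, d.fst = v := by
  have h := X.two_le_deg v
  obtain ⟨w, hw⟩ := Set.nonempty_of_ncard_ne_zero (s := G.neighborSet v)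
    (by change deg G v ≠ 0; omega)
  exact ⟨⟨(v, w), hw⟩, rfl⟩

open Classical in
theorem card_fst [Fintype G.Dart] (E : RotationSystem G) (d : G.Dart) :
    (∑ e : G.Dart with e.fst = d.fst, 1 : ℚ) = deg G d.fst := by
  rw [sum_fst_eq (E := E) d fun _ => 1]
  simp

open Classical in
/-- The gifts of all vertices. -/
theorem sum_gift_total [Fintype G.Dart] [Fintype V] (X : Setting E C) :
    ∑ d, E.gift C d ≤ 2 * Nat.card G.Dart - 6 * Nat.card V + 11 := by
  have hfib : ∀ g : G.Dart → ℚ, ∑ d, g d = ∑ v, ∑ e with e.fst = v, g e := fun g =>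
    (Finset.sum_fiberwise Finset.univ (fun d : G.Dart => d.fst) g).symm
  have hcard : (Nat.card G.Dart : ℚ) = ∑ v, ∑ e : G.Dart with e.fst = v, (1 : ℚ) := by
    rw [← hfib, Nat.card_eq_fintype_card]; simp
  -- The function `x` is the amount by which a vertex may exceed its charge `2 * deg - 6`: 11 for a
  -- single vertex of `C`, or 5 for each of two.
  have key : ∀ x : V → ℚ, ∑ v, x v ≤ 11 →
      (∀ d : G.Dart, ∑ i ∈ Finset.range (deg G d.fst), E.gift C (E.rot^[i] d) ≤
        2 * (deg G d.fst : ℚ) - 6 + x d.fst) →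
      ∑ d, E.gift C d ≤ 2 * Nat.card G.Dart - 6 * Nat.card V + 11 := by
    intro x hx h
    have h1 : ∀ v, ∑ e with e.fst = v, E.gift C e ≤
        2 * (∑ e : G.Dart with e.fst = v, (1 : ℚ)) - 6 + x v := fun v => by
      obtain ⟨d, rfl⟩ := X.exists_dart v
      rw [sum_fst_eq (E := E) d, card_fst E d]
      exact h d
    have h2 := Finset.sum_le_sum fun v (_ : v ∈ Finset.univ) => h1 v
    rw [← hfib, Finset.sum_add_distrib, Finset.sum_sub_distrib, ← Finset.mul_sum, ← hcard] at h2
    simp only [Finset.sum_const, Finset.card_univ, nsmul_eq_mul] at h2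
    rw [Nat.card_eq_fintype_card (α := V)]
    linarith
  have hpos := X.crit.nonempty.ncard_pos
  have hle := X.crit.ncard_le
  obtain h1 | h2 : C.ncard = 1 ∨ C.ncard = 2 := by omega
  · obtain ⟨c, rfl⟩ := Set.ncard_eq_one.1 h1
    refine key (fun v => if v = c then 11 else 0) (by simp) fun d => ?_
    by_cases hd : d.fst = c
    · have := X.sum_gift_le_of_singleton (d := d) hd fun v hv => by rw [hd]; exact hv
      rw [if_pos hd]
      linarith
    · have := X.sum_gift_le (d := d) hd
      rw [if_neg hd]
      linarith
  · obtain ⟨a, b, hab, rfl⟩ := Set.ncard_eq_two.1 h2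
    have hadj := X.crit.clique a (by simp) b (by simp) hab
    have hpair : ∀ d e : G.Dart, d.fst = e.fst → d.fst ∈ ({a, b} : Set V) → e.snd ∈ ({a, b} : Set V) →
        (∀ v ∈ ({a, b} : Set V), v = e.fst ∨ v = e.snd) →
        ∑ i ∈ Finset.range (deg G d.fst), E.gift {a, b} (E.rot^[i] d) ≤
          2 * (deg G d.fst : ℚ) - 1 := by
      intro d e he h1 h2 h3
      have := X.sum_gift_le_of_pair (d := e) (he ▸ h1) h2 h3
      rwa [← sum_fst_eq, ← he, sum_fst_eq] at this
    refine key (fun v => (if v = a then 5 else 0) + (if v = b then 5 else 0)) ?_ fun d => ?_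
    · rw [Finset.sum_add_distrib]; simp; norm_num
    · by_cases ha : d.fst = a
      · have := hpair d ⟨(a, b), hadj⟩ ha (by simp [ha]) (by simp) (by simp)
        rw [if_pos ha, if_neg (by rw [ha]; exact hab)]
        linarith
      · by_cases hb : d.fst = b
        · have := hpair d ⟨(b, a), hadj.symm⟩ hb (by simp [hb]) (by simp) (by simp [or_comm])
          rw [if_neg ha, if_pos hb]
          linarith
        · have := X.sum_gift_le (d := d) (by simp [ha, hb])
          rw [if_neg ha, if_neg hb]
          linarith

/-- The sphere carries no critical graph without the forbidden cycles. -/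
theorem false (X : Setting E C) : False := by
  have := Fintype.ofFinite G.Dart
  have := Fintype.ofFinite V
  have h1 := sum_le_of_cycles E.facePerm (E.loss C) 6 X.sum_loss_le
  rw [sum_loss] at h1
  have h2 := X.sum_gift_total
  obtain ⟨c, -⟩ := X.crit.nonempty
  obtain ⟨d, -⟩ := X.exists_dart c
  have : Nonempty G.Dart := ⟨d⟩
  -- Three times Euler's inequality gives `3 * |D| + 12 ≤ 6 * (|V| + |F|)`. The face and vertex
  -- bounds give `6 * (|V| + |F|) ≤ 3 * |D| + 11`.
  have h3 := euler_le E X.sph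
  have h3' : (Nat.card G.Dart : ℚ) + 4 ≤ 2 * (Nat.card V + numCycles E.facePerm) := by
    exact_mod_cast h3
  linarith

end Setting

theorem NoCycleOfLength.induce {V : Type u} {G : SimpleGraph V} {n : ℕ} (h : NoCycleOfLength G n)
    (T : Set V) : NoCycleOfLength (G.induce T) n := by
  intro v p hp hn
  refine h _ (p.map (SimpleGraph.Embedding.induce T).toHom)
    ((SimpleGraph.Walk.isCycle_map_iff_of_injective ?_).2 hp) ?_
  · exact Subtype.val_injective
  · rw [SimpleGraph.Walk.length_map, hn]

/-- The class of graphs for which the theorem is proved by induction. -/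
def Sparse {V : Type u} (G : SimpleGraph V) : Prop :=
  (∃ E : RotationSystem G, E.Spherical) ∧ NoCycleOfLength G 4 ∧ NoCycleOfLength G 9 ∧
    ((NoCycleOfLength G 7 ∧ NoCycleOfLength G 8) ∨
      (NoCycleOfLength G 6 ∧ NoCycleOfLength G 8) ∨ (NoCycleOfLength G 6 ∧ NoCycleOfLength G 7))

theorem Sparse.induce {V : Type u} [Finite V] {G : SimpleGraph V} (h : Sparse G) (T : Set V) :
    Sparse (G.induce T) := by
  obtain ⟨⟨E, hE⟩, h4, h9, hc⟩ := h
  refine ⟨exists_spherical_induce E hE T, h4.induce T, h9.induce T, ?_⟩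
  exact hc.imp (fun h => ⟨h.1.induce T, h.2.induce T⟩)
    (Or.imp (fun h => ⟨h.1.induce T, h.2.induce T⟩) (fun h => ⟨h.1.induce T, h.2.induce T⟩))

theorem Sparse.allColorable {V : Type u} [Finite V] {G : SimpleGraph V} (h : Sparse G) :
    AllColorable G := by
  refine allColorable_of_good fun s I b => ?_
  refine exists_good_of_hereditary (fun G => Sparse G) (fun G T hG => hG.induce T)
    (fun G C hG hC => ?_) (Nat.card V) G rfl h I [b] ?_
  · obtain ⟨⟨E, hE⟩, h4, h9, hc⟩ := hG
    exact Setting.false ⟨hE, hC, h4, h9, hc⟩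
  · exact ⟨by simp, by simp, by simp⟩

end DPG

theorem mainTheorem3 {V : Type u} [Finite V] (G : SimpleGraph V)
    (hplanar : DPG.IsPlanar G) (a b : ℕ)
    (ha : a ∈ ({6, 7, 8} : Set ℕ)) (hb : b ∈ ({6, 7, 8} : Set ℕ)) (hab : a ≠ b)
    (h4 : DPG.NoCycleOfLength G 4) (hGa : DPG.NoCycleOfLength G a)
    (hGb : DPG.NoCycleOfLength G b) (h9 : DPG.NoCycleOfLength G 9) :
    DPG.DPGColorable G 3 2 ∧
    DPG.DPColorable.{u, w} G 3 ∧
    DPG.DPVertexArborable.{u, w} G 2 ∧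
    (∀ (C : Type w) (L : V → Finset C), (∀ v, (L v).card = 2) → ∀ i : C,
      ∃ c : V → C, DPG.IsForestedColoring G L c ∧ G.IsIndepSet {v | c v = i}) ∧
    (∀ (s : ℕ) (f : Fin s → V → ℕ), (∀ v, 3 ≤ ∑ i, f i v) →
      (∀ v i, f i v ∈ ({0, 1, 2} : Set ℕ)) → DPG.Partitionable G f) := by
  obtain ⟨E, hE⟩ := hplanar
  have hc : DPG.Sparse G := by
    refine ⟨⟨E, hE.spherical⟩, h4, h9, ?_⟩
    simp only [Set.mem_insert_iff, Set.mem_singleton_iff] at ha hb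
    rcases ha with rfl | rfl | rfl <;> rcases hb with rfl | rfl | rfl <;> tauto
  have h := hc.allColorable
  exact ⟨h.dpg, h.dpColorable, h.dpVertexArborable, fun C L hL i => h.forested L hL i,
    fun s f h3 hf => h.partitionable f h3 hf⟩
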